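/- **Conventions.** Let $2\le k<n$, let $X^n$ and $Y^k$ be smooth manifolds, $g$ a Riemannian metric on $X$ and $i\colon Y^k\to (X^n,g)$ a smooth immersion. Abstract indices $a,b,c,\dots$ refer to $i^*TX=TY\oplus NY$, indices $\alpha,\beta,\dots$ to $TY$, and primed indices $\alpha',\beta',\dots$ to the normal bundle $NY$; using a Greek or primed index on an ambient tensor means projecting to $TY$ or $NY$. Indices are raised and lowered with $g$. $\nabla$ is the Levi-Civita connection of $g$, $\overline\nabla$ the induced connections on $TY$ and $NY$, $\overline\Delta=\overline\nabla^\alpha\overline\nabla_\alpha$. Curvature: $\nabla_a\nabla_b\tau_c-\nabla_b\nabla_a\tau_c=R_{abc}{}^d\tau_d$, $R_{ab}=R_{acb}{}^c$, $R=R_a{}^a$, and $$\mathsf P_{ab}=\tfrac1{n-2}\bigl(R_{ab}-\tfrac{R}{2(n-1)}g_{ab}\bigr),\quad W_{abcd}=R_{abcd}-\mathsf P_{ac}g_{bd}-\mathsf P_{bd}g_{ac}+\mathsf P_{ad}g_{bc}+\mathsf P_{bc}g_{ad},$$ $$C_{abc}=\nabla_a\mathsf P_{bc}-\nabla_b\mathsf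 P_{ac},\quad B_{ab}=\nabla^cC_{cab}+W_{acbd}\mathsf P^{cd}.$$ The second fundamental form is $L(U,V)=(\nabla_UV)^\perp$, $H^{\alpha'}=\frac1kL_\alpha{}^{\alpha\alpha'}$, $\mathring L_{\alpha\beta\alpha'}=L_{\alpha\beta\alpha'}-H_{\alpha'}g_{\alpha\beta}$, $\mathring L^2_{\alpha\beta}=\mathring L^\gamma{}_{\alpha\alpha'}\mathring L_{\gamma\beta}{}^{\alpha'}$, $\operatorname{tr}\mathring L^3_{\alpha'}=\mathring L_\alpha{}^\beta{}_{\beta'}\mathring L_\beta{}^{\gamma\beta'}\mathring L_\gamma{}^\alpha{}_{\alpha'}$. Put $$\mathsf D_{\alpha\alpha'}=\mathsf P_{\alpha\alpha'}-\overline\nabla_\alpha H_{\alpha'},\quad \mathsf G=\tfrac1{2(k-1)}\bigl(|\mathring L|^2-W_{\alpha\beta}{}^{\alpha\beta}\bigr),\quad \mathcal P_{\alpha\beta}=\mathsf P_{\alpha\beta}+H^{\alpha'}\mathring L_{\alpha\beta\alpha'}+\tfrac12|H|^2g_{\alpha\beta},$$ $$\mathcal C_{abc}=C_{abc}-H^{\alpha'}W_{abc\alpha'},\quad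 \mathcal C_\alpha=\mathcal C_{\beta\alpha}{}^\beta,$$ $$\mathcal B_{\alpha\beta}=B_{\alpha\beta}+(n-4)H^{\alpha'}(C_{\alpha'\alpha\beta}+C_{\alpha'\beta\alpha})+(n-4)H^{\alpha'}H^{\beta'}W_{\alpha\alpha'\beta\beta'},$$ $$\mathcal K_1=\overline\nabla^\alpha(\mathring L^{\beta\gamma\alpha'}W_{\alpha\beta\alpha'\gamma})+(k-4)\mathring L^{\alpha\beta\alpha'}\mathcal C_{\alpha\alpha'\beta},\quad \mathcal K_2=\overline\nabla^\alpha(\mathring L_\alpha{}^{\beta\alpha'}W_{\beta\gamma\alpha'}{}^\gamma)+(k-4)\mathsf D^{\alpha\alpha'}W_{\alpha\beta\alpha'}{}^\beta,$$ \begin{align*}\mathcal I&=(k-1)\bigl(-\overline\Delta\mathsf G+2\mathsf G\mathcal P_\alpha{}^\alpha\bigr)+(k-6)\Bigl[(\mathring L^2_{\alpha\beta}-W_{\alpha\gamma\beta}{}^\gamma)\mathcal P^{\alpha\beta}+\overline\nabla^\alpha(\mathcal C_\alpha-\mathsf D^{\beta\alpha'}\mathring L_{\alpha\beta\alpha'})+\tfrac{k-3}{n-4}\mathcal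 B_\alpha{}^\alpha-(k-3)|\mathsf D|^2\Bigr],\\ \mathcal J&=-\overline\Delta W_{\alpha\beta}{}^{\alpha\beta}+2W_{\alpha\beta}{}^{\alpha\beta}\mathcal P_\gamma{}^\gamma-2(k-6)\Bigl[\overline\nabla^\alpha\mathcal C_\alpha-\mathcal P^{\alpha\beta}W_{\alpha\gamma\beta}{}^\gamma+\mathsf D^{\alpha\alpha'}W_{\alpha\beta\alpha'}{}^\beta+\mathring L^{\alpha\beta\alpha'}\mathcal C_{\alpha\alpha'\beta}+\tfrac{k-3}{n-4}\mathcal B_\alpha{}^\alpha\Bigr].\end{align*} Below, $\mathcal I$ and $\mathcal J$ occur only in the combinations $2\mathcal I+\mathcal J$, in which the two terms containing $\frac1{n-4}\mathcal B_\alpha{}^\alpha$ cancel, and $(n-4)\mathcal J$, in which the denominator cancels; these are thereby defined for $n=4$ too. A scalar $T$ of $(i,g)$ that is a linear combination of complete contractions of the above tensors is *conformally invariant of weight $-4$* if $T^{e^{2\Upsilon}g}=e^{-4\,i^*\Upsilon}T^g$ for all $i$, $g$ and all $\Upsilon\in C^\infty(X)$. Define \begin{align*}\mathcal N_1&=\tfrac12(2\mathcal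 I+\mathcal J)-\tfrac{k-6}2(\mathcal K_1+\mathcal K_2)+\tfrac{k-6}2\Bigl(\mathring L^{\gamma\alpha\alpha'}\mathring L_\gamma{}^{\beta\beta'}W_{\alpha\beta\alpha'\beta'}-W_{\alpha\beta\alpha'}{}^\beta W^{\alpha\gamma\alpha'}{}_\gamma+\tfrac12W_{\alpha\beta\gamma\alpha'}W^{\alpha\beta\gamma\alpha'}-\mathring L^2_{\alpha\beta}W^{\alpha\gamma\beta}{}_\gamma\\&\quad-\mathring L^{\alpha\gamma\alpha'}\mathring L^{\beta\delta}{}_{\alpha'}W_{\alpha\beta\gamma\delta}+\mathring L^{\alpha\beta\alpha'}\mathring L_{\alpha\beta}{}^{\beta'}W_{\alpha'\gamma\beta'}{}^\gamma-2\mathring L^{\gamma\alpha\alpha'}\mathring L_\gamma{}^{\beta\beta'}W_{\alpha\alpha'\beta\beta'}\Bigr)\end{align*} and, for $k\notin\{3,6\}$ and with $q=(k-1)(k-3)$, \begin{align*}\mathcal N_2&=\tfrac{1}{(k-3)(k-6)}(n-4)\mathcal J-\tfrac2{k-1}\bigl(W_{\alpha\beta cd}W^{\alpha\beta cd}-W_{\alpha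 c\beta d}W^{\alpha c\beta d}+W_{c\alpha d}{}^\alpha W^{c\beta d}{}_\beta\bigr)-\tfrac{2(n-k-1)}q\mathcal K_1-\tfrac{2(n-5k+11)}q\mathcal K_2\\ &\quad-\tfrac{2(n-3k+5)}qW_{\alpha\beta\alpha'}{}^\beta W^{\alpha\gamma\alpha'}{}_\gamma+\tfrac{n-k-1}qW_{\alpha\beta\alpha'\gamma}W^{\alpha\beta\alpha'\gamma}-\tfrac{2(n-k-1)}q\mathring L^{\alpha\gamma\alpha'}\mathring L^{\beta\delta}{}_{\alpha'}W_{\alpha\beta\gamma\delta}-\tfrac{2(n-3k+5)}q\mathring L^2_{\alpha\beta}W^{\alpha\gamma\beta}{}_\gamma\\ &\quad+\tfrac{2(n-5k+11)}q\mathring L^{\gamma\alpha\alpha'}\mathring L_\gamma{}^{\beta\beta'}W_{\alpha\beta\alpha'\beta'}+\tfrac{2(n-3k+5)}q\mathring L^{\alpha\beta\alpha'}\mathring L_{\alpha\beta}{}^{\beta'}W_{\alpha'\gamma\beta'}{}^\gamma-\tfrac{4(n-2k+2)}q\mathring L^{\gamma\alpha\alpha'}\mathring L_\gamma{}^{\beta\beta'}W_{\alpha\alpha'\beta\beta'}.\end{align*}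 **Theorem.** (1) $\mathcal N_1$ is conformally invariant of weight $-4$ for all $2\le k<n$, and $\mathcal N_2$ is conformally invariant of weight $-4$ for all $2\le k<n$ with $k\notin\{3,6\}$. (2) If $k=4$, then $$\mathcal N_1=-\tfrac12\overline\Delta|\mathring L|^2+2\overline\nabla^\beta(\mathsf D^{\alpha\alpha'}\mathring L_{\alpha\beta\alpha'})+\mathcal J_1^{\mathrm{CHO}^+},\qquad \mathcal N_2=\tfrac{3n-10}6\overline\Delta W_{\alpha\beta}{}^{\alpha\beta}-\tfrac{4(n-5)}3\overline\nabla^\alpha\mathcal C_\alpha+\mathcal J_2^{\mathrm{CHO}^+},$$ where $\mathcal J_1^{\mathrm{CHO}^+}$, $\mathcal J_2^{\mathrm{CHO}^+}$ are the scalars of Chalabi, Herzog, O'Bannon, Robinson and Sisti, \begin{align*}\mathcal J_1^{\mathrm{CHO}^+}&=2|\mathsf D|^2+\mathring L^{\alpha\beta\alpha'}\nabla_{\alpha'}W_{\alpha\gamma\beta}{}^\gamma+\tfrac1{n-1}R|\mathring L|^2-\tfrac1{n-2}|\mathring L|^2R_{\alpha'}{}^{\alpha'}-\tfrac2{n-2}\mathring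 L^2_{\alpha\beta}R^{\alpha\beta}+|H|^2|\mathring L|^2\\&\quad-2H^{\alpha'}\operatorname{tr}\mathring L^3_{\alpha'}-2H^{\alpha'}\mathring L^{\alpha\beta}{}_{\alpha'}W_{\alpha\gamma\beta}{}^\gamma,\\ \mathcal J_2^{\mathrm{CHO}^+}&=\tfrac13\nabla^{\alpha'}\nabla_{\alpha'}W_{\alpha\beta}{}^{\alpha\beta}+\tfrac{n-10}3H^{\alpha'}\nabla_{\alpha'}W_{\alpha\beta}{}^{\alpha\beta}-\tfrac{n-4}{n-1}RW_{\alpha\beta}{}^{\alpha\beta}+\tfrac{n-4}{n-2}R_{\alpha'}{}^{\alpha'}W_{\alpha\beta}{}^{\alpha\beta}+\tfrac{4(n-5)}{3(n-2)}R^{\alpha\beta}W_{\alpha\gamma\beta}{}^\gamma\\&\quad-\tfrac43W_{\alpha\beta\alpha'}{}^\beta\overline\nabla^\alpha H^{\alpha'}-\tfrac{2(n-5)}3\mathring L^{\alpha\beta\alpha'}\nabla_{\alpha'}W_{\alpha\gamma\beta}{}^\gamma+\tfrac{8(n-5)}3H^{\alpha'}\mathring L^{\alpha\beta}{}_{\alpha'}W_{\alpha\gamma\beta}{}^\gamma-\tfrac{4(n+1)}3\mathsf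 D^{\alpha\alpha'}W_{\alpha\beta\alpha'}{}^\beta-\tfrac{5(n-4)}3|H|^2W_{\alpha\beta}{}^{\alpha\beta}.\end{align*} (3) Consequently, if $k=4$ and $Y$ is compact, then $\int_Y\mathcal J_1^{\mathrm{CHO}^+}\,dA$ and $\int_Y\mathcal J_2^{\mathrm{CHO}^+}\,dA$, where $dA$ is the area measure of $i^*g$, do not change when $g$ is replaced by $e^{2\Upsilon}g$ with $\Upsilon\in C^\infty(X)$. -/

import Mathlib

open scoped Manifold ContDiff

noncomputable section

namespace ConfSub

/-! ### Riemannian geometry in coordinates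

A covariant tensor field of rank `r` on (an open part of) `ℝᵐ` is given by its components: a
function of the point and of the multi-index `I : Fin r → Fin m`. -/

/-- Coordinate space `ℝᵐ`. -/
abbrev Coo (m : ℕ) : Type := EuclideanSpace ℝ (Fin m)

/-- Component functions of a covariant tensor field of rank `r`. -/
abbrev TensorField (m r : ℕ) : Type := Coo m → (Fin r → Fin m) → ℝ

/-- Component matrix of a metric. -/
abbrev MetricField (m : ℕ) : Type := Coo m → Matrix (Fin m) (Fin m) ℝ

/-- The partial derivative `∂ₐ F`. -/
def pd {m : ℕ} (a : Fin m) (F : Coo m → ℝ) (x : Coo m) : ℝ :=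
  fderiv ℝ F x (EuclideanSpace.single a 1)

/-- Christoffel symbols: `christoffel g x c a b` is `Γᶜₐᵦ` (upper index first). -/
def christoffel {m : ℕ} (g : MetricField m) (x : Coo m) (c a b : Fin m) : ℝ :=
  (1 / 2) * ∑ d, (g x)⁻¹ c d *
    (pd a (fun z => g z b d) x + pd b (fun z => g z a d) x - pd d (fun z => g z a b) x)

/-- The Levi-Civita covariant derivative of a covariant tensor field; the index of the derivative
comes first: `cov g T x ![a, b, …, c]` is `∇ₐ T_{b…c}`. -/
def cov {m r : ℕ} (g : MetricField m) (T : TensorField m r) : TensorField m (r + 1) := fun x I =>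
  pd (I 0) (fun z => T z (Fin.tail I)) x
    - ∑ j : Fin r, ∑ c, christoffel g x c (I 0) (I j.succ) * T x (Function.update (Fin.tail I) j c)

/-- `R_{abc}{}^d`, with the convention `∇ₐ∇ᵦτ_c - ∇ᵦ∇ₐτ_c = R_{abc}{}^d τ_d`. -/
def riemannUp {m : ℕ} (g : MetricField m) (x : Coo m) (a b c d : Fin m) : ℝ :=
  pd b (fun z => christoffel g z d a c) x - pd a (fun z => christoffel g z d b c) x
    + ∑ e, (christoffel g x e a c * christoffel g x d b e
        - christoffel g x e b c * christoffel g x d a e)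

/-- `R_{abcd}`. -/
def riemann {m : ℕ} (g : MetricField m) : TensorField m 4 := fun x I =>
  ∑ e, riemannUp g x (I 0) (I 1) (I 2) e * g x e (I 3)

/-- The Ricci tensor `R_{ab} = R_{acb}{}^c`. -/
def ricci {m : ℕ} (g : MetricField m) : TensorField m 2 := fun x I =>
  ∑ c, riemannUp g x (I 0) c (I 1) c

/-- The scalar curvature `R`. -/
def scalarCurv {m : ℕ} (g : MetricField m) (x : Coo m) : ℝ :=
  ∑ a, ∑ b, (g x)⁻¹ a b * ricci g x ![a, b]

/-- The Schouten tensor `P_{ab} = (R_{ab} - R g_{ab} / (2 (m - 1))) / (m - 2)`. -/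
def schouten {m : ℕ} (g : MetricField m) : TensorField m 2 := fun x I =>
  (1 / ((m : ℝ) - 2)) *
    (ricci g x I - 1 / (2 * ((m : ℝ) - 1)) * scalarCurv g x * g x (I 0) (I 1))

/-- The Weyl tensor `W_{abcd}`. -/
def weyl {m : ℕ} (g : MetricField m) : TensorField m 4 := fun x I =>
  riemann g x I
    - schouten g x ![I 0, I 2] * g x (I 1) (I 3) - schouten g x ![I 1, I 3] * g x (I 0) (I 2)
    + schouten g x ![I 0, I 3] * g x (I 1) (I 2) + schouten g x ![I 1, I 2] * g x (I 0) (I 3)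

/-- The Cotton tensor `C_{abc} = ∇ₐ P_{bc} - ∇ᵦ P_{ac}`. -/
def cotton {m : ℕ} (g : MetricField m) : TensorField m 3 := fun x I =>
  cov g (schouten g) x ![I 0, I 1, I 2] - cov g (schouten g) x ![I 1, I 0, I 2]

/-- The Bach tensor `B_{ab} = ∇ᶜ C_{cab} + W_{acbd} P^{cd}`. -/
def bach {m : ℕ} (g : MetricField m) : TensorField m 2 := fun x I =>
  (∑ c, ∑ d, (g x)⁻¹ c d * cov g (cotton g) x ![c, d, I 0, I 1])
    + ∑ c, ∑ c', ∑ d, ∑ d', (g x)⁻¹ c c' * (g x)⁻¹ d d' *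
        (weyl g x ![I 0, c, I 1, d] * schouten g x ![c', d'])

/-- Evaluation of a covariant tensor (given by components) on `r` vectors. -/
def evalTensor {m r : ℕ} (T : (Fin r → Fin m) → ℝ) (v : Fin r → Fin m → ℝ) : ℝ :=
  ∑ I : Fin r → Fin m, T I * ∏ j, v j (I j)

/-- The divergence `∇^a V_a` of a one-form. -/
def divergence {m : ℕ} (h : MetricField m) (V : Coo m → Fin m → ℝ) (x : Coo m) : ℝ :=
  ∑ a, ∑ b, (h x)⁻¹ a b * cov h (fun z (I : Fin 1 → Fin m) => V z (I 0)) x ![a, b]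

/-- The Laplacian `∇^a ∇_a φ` of a function. -/
def laplacian {m : ℕ} (h : MetricField m) (φ : Coo m → ℝ) (x : Coo m) : ℝ :=
  divergence h (fun z a => pd a φ z) x

/-! ### Immersions in coordinates -/

/-- Coordinate expressions of a metric on the ambient manifold and of a map into it. -/
structure CoordData (k n : ℕ) where
  /-- the components of the ambient metric -/
  g : MetricField n
  /-- the coordinate expression of the map -/
  f : Coo k → Coo n

namespace CoordData

variable {k n : ℕ} (D : CoordData k n)

/-- Components of the coordinate tangent vector `∂_α f`. -/
def tan (u : Coo k) (α : Fin k) : Fin n → ℝ := fun a => pd α (fun z => D.f z a) u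

/-- The induced metric `g_{αβ}` on the submanifold. -/
def h : MetricField k := fun u => Matrix.of fun α β =>
  ∑ a, ∑ b, D.g (D.f u) a b * D.tan u α a * D.tan u β b

/-- The projection of the coordinate vector `∂ₐ` to the normal space. A normal index `α'` is
represented throughout by an ambient index `a`: the slot is evaluated on `D.nor u a`, and two such
slots are contracted with the inverse `g^{ab}` of the ambient metric (`D.trA`). -/
def nor (u : Coo k) (a : Fin n) : Fin n → ℝ := fun b =>
  (if b = a then 1 else 0)
    - ∑ α, ∑ β, (D.h u)⁻¹ α β * D.tan u α b * ∑ c, D.g (D.f u) c a * D.tan u β c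

/-- The coordinate vector `∂ₐ`, used for ambient (Latin) indices. -/
def amb (a : Fin n) : Fin n → ℝ := Pi.single a 1

/-- Contraction of two lower tangential indices with `g^{αβ}`. -/
def trT (u : Coo k) (F : Fin k → Fin k → ℝ) : ℝ := ∑ α, ∑ β, (D.h u)⁻¹ α β * F α β

/-- Contraction of two lower normal (or ambient) indices with `g^{ab}`. -/
def trA (u : Coo k) (F : Fin n → Fin n → ℝ) : ℝ := ∑ a, ∑ b, (D.g (D.f u))⁻¹ a b * F a b

/-- The Weyl tensor of the ambient metric at `f(u)`, on four vectors. -/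
def W (u : Coo k) (v₀ v₁ v₂ v₃ : Fin n → ℝ) : ℝ :=
  evalTensor (weyl D.g (D.f u)) ![v₀, v₁, v₂, v₃]

/-- `∇W` at `f(u)`; the derivative direction is the first argument. -/
def dW (u : Coo k) (w v₀ v₁ v₂ v₃ : Fin n → ℝ) : ℝ :=
  evalTensor (cov D.g (weyl D.g) (D.f u)) ![w, v₀, v₁, v₂, v₃]

/-- `∇∇W` at `f(u)`; the derivative directions are the first two arguments. -/
def ddW (u : Coo k) (w w' v₀ v₁ v₂ v₃ : Fin n → ℝ) : ℝ :=
  evalTensor (cov D.g (cov D.g (weyl D.g)) (D.f u)) ![w, w', v₀, v₁, v₂, v₃]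

/-- The ambient Schouten tensor at `f(u)`. -/
def Sch (u : Coo k) (v₀ v₁ : Fin n → ℝ) : ℝ := evalTensor (schouten D.g (D.f u)) ![v₀, v₁]

/-- The ambient Ricci tensor at `f(u)`. -/
def Ric (u : Coo k) (v₀ v₁ : Fin n → ℝ) : ℝ := evalTensor (ricci D.g (D.f u)) ![v₀, v₁]

/-- The ambient Cotton tensor at `f(u)`. -/
def Cot (u : Coo k) (v₀ v₁ v₂ : Fin n → ℝ) : ℝ :=
  evalTensor (cotton D.g (D.f u)) ![v₀, v₁, v₂]

/-- The ambient Bach tensor at `f(u)`. -/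
def Bach (u : Coo k) (v₀ v₁ : Fin n → ℝ) : ℝ := evalTensor (bach D.g (D.f u)) ![v₀, v₁]

/-- The second fundamental form `L_{αβα'}`: the normal part of `∇_α ∂_β f`, paired with the normal
vector labelled by `a`. -/
def L (u : Coo k) (α β : Fin k) (a : Fin n) : ℝ :=
  ∑ b, ∑ c, D.g (D.f u) b c *
    (pd α (fun z => D.tan z β b) u
      + ∑ d, ∑ e, christoffel D.g (D.f u) b d e * D.tan u α d * D.tan u β e) * D.nor u a c

/-- The mean curvature `H_{α'} = (1/k) L_α{}^α{}_{α'}`. -/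
def H (u : Coo k) (a : Fin n) : ℝ := (1 / (k : ℝ)) * D.trT u fun α β => D.L u α β a

/-- The trace-free second fundamental form `L̊_{αβα'}`. -/
def Lo (u : Coo k) (α β : Fin k) (a : Fin n) : ℝ := D.L u α β a - D.H u a * D.h u α β

/-- `∇̄_α H_{α'}` for the normal connection: the normal part of the covariant derivative of `H`
along the map. -/
def dH (u : Coo k) (α : Fin k) (a : Fin n) : ℝ :=
  ∑ b, (pd α (fun z => D.H z b) u
    - ∑ c, ∑ d, christoffel D.g (D.f u) c d b * D.tan u α d * D.H u c) * D.nor u a b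

/-- `D_{αα'} = P_{αα'} - ∇̄_α H_{α'}`. -/
def Dt (u : Coo k) (α : Fin k) (a : Fin n) : ℝ :=
  D.Sch u (D.tan u α) (D.nor u a) - D.dH u α a

/-- `W_{αγβ}{}^γ`. -/
def Wtt (u : Coo k) (α β : Fin k) : ℝ :=
  D.trT u fun γ γ' => D.W u (D.tan u α) (D.tan u γ) (D.tan u β) (D.tan u γ')

/-- `W_{αβα'}{}^β`. -/
def Wtn (u : Coo k) (α : Fin k) (a : Fin n) : ℝ :=
  D.trT u fun β β' => D.W u (D.tan u α) (D.tan u β) (D.nor u a) (D.tan u β')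

/-- `W_{α'γβ'}{}^γ`. -/
def Wnn (u : Coo k) (a b : Fin n) : ℝ :=
  D.trT u fun γ γ' => D.W u (D.nor u a) (D.tan u γ) (D.nor u b) (D.tan u γ')

/-- `W_{αβ}{}^{αβ}`. -/
def Wtr (u : Coo k) : ℝ := D.trT u fun α α' => D.Wtt u α α'

/-- `L̊²_{αβ} = L̊^γ{}_{αα'} L̊_{γβ}{}^{α'}`. -/
def Lo2 (u : Coo k) (α β : Fin k) : ℝ :=
  D.trT u fun γ γ' => D.trA u fun a a' => D.Lo u γ α a * D.Lo u γ' β a'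

/-- `|L̊|²`. -/
def normLo (u : Coo k) : ℝ :=
  D.trT u fun α α' => D.trT u fun β β' => D.trA u fun a a' => D.Lo u α β a * D.Lo u α' β' a'

/-- `|H|²`. -/
def normH (u : Coo k) : ℝ := D.trA u fun a a' => D.H u a * D.H u a'

/-- `|D|²`. -/
def normD (u : Coo k) : ℝ :=
  D.trT u fun α α' => D.trA u fun a a' => D.Dt u α a * D.Dt u α' a'

/-- `tr L̊³_{α'} = L̊_α{}^β{}_{β'} L̊_β{}^{γβ'} L̊_γ{}^α{}_{α'}`. -/
def trLo3 (u : Coo k) (a : Fin n) : ℝ :=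
  D.trT u fun α α' => D.trT u fun β β' => D.trT u fun γ γ' => D.trA u fun b b' =>
    D.Lo u α β b * D.Lo u β' γ b' * D.Lo u γ' α' a

/-- The trace `G = (|L̊|² - W_{αβ}{}^{αβ}) / (2 (k - 1))` of the Fialkow tensor. -/
def G (u : Coo k) : ℝ := (1 / (2 * ((k : ℝ) - 1))) * (D.normLo u - D.Wtr u)

/-- `𝒫_{αβ} = P_{αβ} + H^{α'} L̊_{αβα'} + |H|² g_{αβ} / 2`. -/
def cP (u : Coo k) (α β : Fin k) : ℝ :=
  D.Sch u (D.tan u α) (D.tan u β) + (D.trA u fun a a' => D.H u a * D.Lo u α β a')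
    + (1 / 2) * D.normH u * D.h u α β

/-- `𝒫_α{}^α`. -/
def cPtr (u : Coo k) : ℝ := D.trT u fun α α' => D.cP u α α'

/-- `𝒞_{abc} = C_{abc} - H^{α'} W_{abcα'}`, on three vectors. -/
def cC (u : Coo k) (v₀ v₁ v₂ : Fin n → ℝ) : ℝ :=
  D.Cot u v₀ v₁ v₂ - D.trA u fun a a' => D.H u a * D.W u v₀ v₁ v₂ (D.nor u a')

/-- The tangential one-form `𝒞_α = 𝒞_{βα}{}^β`. -/
def cC1 (u : Coo k) (α : Fin k) : ℝ :=
  D.trT u fun β β' => D.cC u (D.tan u β) (D.tan u α) (D.tan u β')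

/-- `ℬ_{αβ} = B_{αβ} + 2 (n-4) H^{α'} C_{α'(αβ)} + (n-4) H^{α'} H^{β'} W_{αα'ββ'}`, with
`2 C_{α'(αβ)} = C_{α'αβ} + C_{α'βα}`. -/
def cB (u : Coo k) (α β : Fin k) : ℝ :=
  D.Bach u (D.tan u α) (D.tan u β)
    + ((n : ℝ) - 4) * (D.trA u fun a a' => D.H u a *
        (D.Cot u (D.nor u a') (D.tan u α) (D.tan u β)
          + D.Cot u (D.nor u a') (D.tan u β) (D.tan u α)))
    + ((n : ℝ) - 4) * (D.trA u fun a a' => D.trA u fun b b' => D.H u a * D.H u b *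
        D.W u (D.tan u α) (D.nor u a') (D.tan u β) (D.nor u b'))

/-- `ℬ_α{}^α`. -/
def cBtr (u : Coo k) : ℝ := D.trT u fun α α' => D.cB u α α'

/-! Tangential one-forms whose divergences occur. -/

/-- `L̊^{βγα'} W_{αβα'γ}`. -/
def formLW (u : Coo k) (α : Fin k) : ℝ :=
  D.trT u fun β β' => D.trT u fun γ γ' => D.trA u fun a a' =>
    D.Lo u β γ a * D.W u (D.tan u α) (D.tan u β') (D.nor u a') (D.tan u γ')

/-- `L̊_α{}^{βα'} W_{βγα'}{}^γ`. -/
def formLWtn (u : Coo k) (α : Fin k) : ℝ :=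
  D.trT u fun β β' => D.trA u fun a a' => D.Lo u α β a * D.Wtn u β' a'

/-- `D^{βα'} L̊_{αβα'}`. -/
def formDL (u : Coo k) (α : Fin k) : ℝ :=
  D.trT u fun β β' => D.trA u fun a a' => D.Dt u β a * D.Lo u α β' a'

/-! Scalar contractions. -/

/-- `L̊^{αβα'} 𝒞_{αα'β}`. -/
def sLC (u : Coo k) : ℝ :=
  D.trT u fun α α' => D.trT u fun β β' => D.trA u fun a a' =>
    D.Lo u α β a * D.cC u (D.tan u α') (D.nor u a') (D.tan u β')

/-- `D^{αα'} W_{αβα'}{}^β`. -/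
def sDW (u : Coo k) : ℝ :=
  D.trT u fun α α' => D.trA u fun a a' => D.Dt u α a * D.Wtn u α' a'

/-- `L̊²_{αβ} 𝒫^{αβ}`. -/
def sLo2P (u : Coo k) : ℝ :=
  D.trT u fun α α' => D.trT u fun β β' => D.Lo2 u α β * D.cP u α' β'

/-- `W_{αγβ}{}^γ 𝒫^{αβ}`. -/
def sWP (u : Coo k) : ℝ :=
  D.trT u fun α α' => D.trT u fun β β' => D.Wtt u α β * D.cP u α' β'

/-- `L̊^{γαα'} L̊_γ{}^{ββ'} W_{αβα'β'}`. -/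
def sLLWttnn (u : Coo k) : ℝ :=
  D.trT u fun γ γ' => D.trT u fun α α' => D.trT u fun β β' =>
    D.trA u fun a a' => D.trA u fun b b' => D.Lo u γ α a * D.Lo u γ' β b *
      D.W u (D.tan u α') (D.tan u β') (D.nor u a') (D.nor u b')

/-- `L̊^{γαα'} L̊_γ{}^{ββ'} W_{αα'ββ'}`. -/
def sLLWtntn (u : Coo k) : ℝ :=
  D.trT u fun γ γ' => D.trT u fun α α' => D.trT u fun β β' =>
    D.trA u fun a a' => D.trA u fun b b' => D.Lo u γ α a * D.Lo u γ' β b *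
      D.W u (D.tan u α') (D.nor u a') (D.tan u β') (D.nor u b')

/-- `L̊²_{αβ} W^{αγβ}{}_γ`. -/
def sLo2W (u : Coo k) : ℝ :=
  D.trT u fun α α' => D.trT u fun β β' => D.Lo2 u α β * D.Wtt u α' β'

/-- `L̊^{αγα'} L̊^{βδ}{}_{α'} W_{αβγδ}`. -/
def sLLWtttt (u : Coo k) : ℝ :=
  D.trT u fun α α' => D.trT u fun β β' => D.trT u fun γ γ' => D.trT u fun δ δ' =>
    D.trA u fun a a' => D.Lo u α γ a * D.Lo u β δ a' *
      D.W u (D.tan u α') (D.tan u β') (D.tan u γ') (D.tan u δ')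

/-- `L̊^{αβα'} L̊_{αβ}{}^{β'} W_{α'γβ'}{}^γ`. -/
def sLLWnn (u : Coo k) : ℝ :=
  D.trT u fun α α' => D.trT u fun β β' => D.trA u fun a a' => D.trA u fun b b' =>
    D.Lo u α β a * D.Lo u α' β' b * D.Wnn u a' b'

/-- `W_{αβα'}{}^β W^{αγα'}{}_γ`. -/
def sWtnWtn (u : Coo k) : ℝ :=
  D.trT u fun α α' => D.trA u fun a a' => D.Wtn u α a * D.Wtn u α' a'

/-- `W_{αβα'γ} W^{αβα'γ}`. -/
def sWttnt (u : Coo k) : ℝ :=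
  D.trT u fun α α' => D.trT u fun β β' => D.trA u fun a a' => D.trT u fun γ γ' =>
    D.W u (D.tan u α) (D.tan u β) (D.nor u a) (D.tan u γ) *
      D.W u (D.tan u α') (D.tan u β') (D.nor u a') (D.tan u γ')

/-- `W_{αβγα'} W^{αβγα'}`. -/
def sWtttn (u : Coo k) : ℝ :=
  D.trT u fun α α' => D.trT u fun β β' => D.trT u fun γ γ' => D.trA u fun a a' =>
    D.W u (D.tan u α) (D.tan u β) (D.tan u γ) (D.nor u a) *
      D.W u (D.tan u α') (D.tan u β') (D.tan u γ') (D.nor u a')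

/-- `W_{αβcd} W^{αβcd}` (`c`, `d` ambient). -/
def sWttaa (u : Coo k) : ℝ :=
  D.trT u fun α α' => D.trT u fun β β' => D.trA u fun c c' => D.trA u fun d d' =>
    D.W u (D.tan u α) (D.tan u β) (amb c) (amb d) *
      D.W u (D.tan u α') (D.tan u β') (amb c') (amb d')

/-- `W_{αcβd} W^{αcβd}` (`c`, `d` ambient). -/
def sWtata (u : Coo k) : ℝ :=
  D.trT u fun α α' => D.trA u fun c c' => D.trT u fun β β' => D.trA u fun d d' =>
    D.W u (D.tan u α) (amb c) (D.tan u β) (amb d) *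
      D.W u (D.tan u α') (amb c') (D.tan u β') (amb d')

/-- `W_{cαd}{}^α W^{cβd}{}_β` (`c`, `d` ambient). -/
def sWaa (u : Coo k) : ℝ :=
  D.trA u fun c c' => D.trA u fun d d' =>
    (D.trT u fun α α' => D.W u (amb c) (D.tan u α) (amb d) (D.tan u α')) *
      (D.trT u fun β β' => D.W u (amb c') (D.tan u β) (amb d') (D.tan u β'))

/-- `L̊^{αβα'} ∇_{α'} W_{αγβ}{}^γ`. -/
def sLdW (u : Coo k) : ℝ :=
  D.trT u fun α α' => D.trT u fun β β' => D.trA u fun a a' => D.Lo u α β a *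
    D.trT u fun γ γ' =>
      D.dW u (D.nor u a') (D.tan u α') (D.tan u γ) (D.tan u β') (D.tan u γ')

/-- `H^{α'} ∇_{α'} W_{αβ}{}^{αβ}`. -/
def sHdW (u : Coo k) : ℝ :=
  D.trA u fun a a' => D.H u a * D.trT u fun α α' => D.trT u fun β β' =>
    D.dW u (D.nor u a') (D.tan u α) (D.tan u β) (D.tan u α') (D.tan u β')

/-- `∇^{α'} ∇_{α'} W_{αβ}{}^{αβ}`. -/
def sddW (u : Coo k) : ℝ :=
  D.trA u fun a a' => D.trT u fun α α' => D.trT u fun β β' =>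
    D.ddW u (D.nor u a) (D.nor u a') (D.tan u α) (D.tan u β) (D.tan u α') (D.tan u β')

/-- The normal trace `R_{α'}{}^{α'}` of the ambient Ricci tensor. -/
def sRicN (u : Coo k) : ℝ := D.trA u fun a a' => D.Ric u (D.nor u a) (D.nor u a')

/-- `L̊²_{αβ} R^{αβ}`. -/
def sLo2Ric (u : Coo k) : ℝ :=
  D.trT u fun α α' => D.trT u fun β β' => D.Lo2 u α β * D.Ric u (D.tan u α') (D.tan u β')

/-- `R^{αβ} W_{αγβ}{}^γ`. -/
def sRicW (u : Coo k) : ℝ :=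
  D.trT u fun α α' => D.trT u fun β β' => D.Ric u (D.tan u α) (D.tan u β) * D.Wtt u α' β'

/-- `H^{α'} tr L̊³_{α'}`. -/
def sHLo3 (u : Coo k) : ℝ := D.trA u fun a a' => D.H u a * D.trLo3 u a'

/-- `H^{α'} L̊^{αβ}{}_{α'} W_{αγβ}{}^γ`. -/
def sHLW (u : Coo k) : ℝ :=
  D.trA u fun a a' => D.trT u fun α α' => D.trT u fun β β' =>
    D.H u a * D.Lo u α β a' * D.Wtt u α' β'

/-- `W_{αβα'}{}^β ∇̄^α H^{α'}`. -/
def sWdH (u : Coo k) : ℝ :=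
  D.trT u fun α α' => D.trA u fun a a' => D.Wtn u α a * D.dH u α' a'

/-! The invariants. -/

/-- `𝒦₁`. -/
def K1 (u : Coo k) : ℝ := divergence D.h D.formLW u + ((k : ℝ) - 4) * D.sLC u

/-- `𝒦₂`. -/
def K2 (u : Coo k) : ℝ := divergence D.h D.formLWtn u + ((k : ℝ) - 4) * D.sDW u

/-- `ℐ` (for `n ≠ 4`). -/
def cI (u : Coo k) : ℝ :=
  ((k : ℝ) - 1) * (-laplacian D.h D.G u + 2 * D.G u * D.cPtr u)
    + ((k : ℝ) - 6) * (D.sLo2P u - D.sWP u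
        + divergence D.h (fun z α => D.cC1 z α - D.formDL z α) u
        + ((k : ℝ) - 3) / ((n : ℝ) - 4) * D.cBtr u - ((k : ℝ) - 3) * D.normD u)

/-- `𝒥` (for `n ≠ 4`). -/
def cJ (u : Coo k) : ℝ :=
  -laplacian D.h D.Wtr u + 2 * D.Wtr u * D.cPtr u
    - 2 * ((k : ℝ) - 6) * (divergence D.h D.cC1 u - D.sWP u + D.sDW u + D.sLC u
        + ((k : ℝ) - 3) / ((n : ℝ) - 4) * D.cBtr u)

/-- `(n - 4) 𝒥` with the denominator cleared, so that it is meaningful for `n = 4` too. -/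
def clearedJ (u : Coo k) : ℝ :=
  ((n : ℝ) - 4) * (-laplacian D.h D.Wtr u + 2 * D.Wtr u * D.cPtr u
    - 2 * ((k : ℝ) - 6) * (divergence D.h D.cC1 u - D.sWP u + D.sDW u + D.sLC u))
    - 2 * ((k : ℝ) - 6) * ((k : ℝ) - 3) * D.cBtr u

theorem clearedJ_eq (hn : n ≠ 4) (u : Coo k) : D.clearedJ u = ((n : ℝ) - 4) * D.cJ u := by
  have h4 : (n : ℝ) - 4 ≠ 0 := sub_ne_zero.mpr (by exact_mod_cast hn)
  simp only [clearedJ, cJ]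
  field_simp
  ring

/-- `2ℐ + 𝒥`. The terms with `ℬ_α{}^α / (n - 4)` cancel, so this is meaningful for `n = 4` too
(where Lean's `x / 0 = 0` just drops both of them). -/
def twoIJ (u : Coo k) : ℝ := 2 * D.cI u + D.cJ u

/-- The invariant `𝒩₁`. -/
def N1 (u : Coo k) : ℝ :=
  (1 / 2) * D.twoIJ u - ((k : ℝ) - 6) / 2 * (D.K1 u + D.K2 u)
    + ((k : ℝ) - 6) / 2 * (D.sLLWttnn u - D.sWtnWtn u + (1 / 2) * D.sWtttn u - D.sLo2W u
        - D.sLLWtttt u + D.sLLWnn u - 2 * D.sLLWtntn u)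

/-- The invariant `𝒩₂` (for `k ∉ {1, 3, 6}`). -/
def N2 (u : Coo k) : ℝ :=
  1 / (((k : ℝ) - 3) * ((k : ℝ) - 6)) * D.clearedJ u
    - 2 / ((k : ℝ) - 1) * (D.sWttaa u - D.sWtata u + D.sWaa u)
    - 2 * ((n : ℝ) - k - 1) / (((k : ℝ) - 1) * ((k : ℝ) - 3)) * D.K1 u
    - 2 * ((n : ℝ) - 5 * k + 11) / (((k : ℝ) - 1) * ((k : ℝ) - 3)) * D.K2 u
    - 2 * ((n : ℝ) - 3 * k + 5) / (((k : ℝ) - 1) * ((k : ℝ) - 3)) * D.sWtnWtn u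
    + ((n : ℝ) - k - 1) / (((k : ℝ) - 1) * ((k : ℝ) - 3)) * D.sWttnt u
    - 2 * ((n : ℝ) - k - 1) / (((k : ℝ) - 1) * ((k : ℝ) - 3)) * D.sLLWtttt u
    - 2 * ((n : ℝ) - 3 * k + 5) / (((k : ℝ) - 1) * ((k : ℝ) - 3)) * D.sLo2W u
    + 2 * ((n : ℝ) - 5 * k + 11) / (((k : ℝ) - 1) * ((k : ℝ) - 3)) * D.sLLWttnn u
    + 2 * ((n : ℝ) - 3 * k + 5) / (((k : ℝ) - 1) * ((k : ℝ) - 3)) * D.sLLWnn u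
    - 4 * ((n : ℝ) - 2 * k + 2) / (((k : ℝ) - 1) * ((k : ℝ) - 3)) * D.sLLWtntn u

/-- The scalar `𝒥₁` of Chalabi, Herzog, O'Bannon, Robinson and Sisti (for `k = 4`). -/
def J1CHO (u : Coo k) : ℝ :=
  2 * D.normD u + D.sLdW u + 1 / ((n : ℝ) - 1) * scalarCurv D.g (D.f u) * D.normLo u
    - 1 / ((n : ℝ) - 2) * D.normLo u * D.sRicN u - 2 / ((n : ℝ) - 2) * D.sLo2Ric u
    + D.normH u * D.normLo u - 2 * D.sHLo3 u - 2 * D.sHLW u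

/-- The scalar `𝒥₂` of Chalabi, Herzog, O'Bannon, Robinson and Sisti (for `k = 4`). -/
def J2CHO (u : Coo k) : ℝ :=
  1 / 3 * D.sddW u + ((n : ℝ) - 10) / 3 * D.sHdW u
    - ((n : ℝ) - 4) / ((n : ℝ) - 1) * scalarCurv D.g (D.f u) * D.Wtr u
    + ((n : ℝ) - 4) / ((n : ℝ) - 2) * D.sRicN u * D.Wtr u
    + 4 * ((n : ℝ) - 5) / (3 * ((n : ℝ) - 2)) * D.sRicW u
    - 4 / 3 * D.sWdH u - 2 * ((n : ℝ) - 5) / 3 * D.sLdW u + 8 * ((n : ℝ) - 5) / 3 * D.sHLW u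
    - 4 * ((n : ℝ) + 1) / 3 * D.sDW u - 5 * ((n : ℝ) - 4) / 3 * D.normH u * D.Wtr u

end CoordData

/-! ### Immersions of manifolds -/

/-- Smooth Riemannian metrics on an `n`-manifold `X`. -/
abbrev RiemMetric (n : ℕ) (X : Type*) [TopologicalSpace X] [ChartedSpace (Coo n) X]
    [IsManifold (𝓡 n) ∞ X] : Type _ :=
  Bundle.ContMDiffRiemannianMetric (𝓡 n) ∞ (Coo n) (fun x : X => TangentSpace (𝓡 n) x)

section Manifold

variable {k n : ℕ} {X Y : Type*} [TopologicalSpace X] [ChartedSpace (Coo n) X]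
  [IsManifold (𝓡 n) ∞ X] [TopologicalSpace Y] [ChartedSpace (Coo k) Y]

/-- `ghat = e^{2Υ} g`. -/
def IsConformalRescaling (g : RiemMetric n X) (Υ : X → ℝ) (ghat : RiemMetric n X) : Prop :=
  ∀ (x : X) (v w : TangentSpace (𝓡 n) x),
    ghat.inner x v w = Real.exp (2 * Υ x) * g.inner x v w

/-- Components of `g` in the preferred chart at `x₀`. -/
def coordMetric (g : RiemMetric n X) (x₀ : X) : MetricField n := fun z => Matrix.of fun a b =>
  g.inner ((extChartAt (𝓡 n) x₀).symm z)
    (mfderiv (𝓡 n) (𝓡 n) (extChartAt (𝓡 n) x₀).symm z (EuclideanSpace.single a (1 : ℝ)))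
    (mfderiv (𝓡 n) (𝓡 n) (extChartAt (𝓡 n) x₀).symm z (EuclideanSpace.single b (1 : ℝ)))

/-- The metric and the map in the preferred charts around `i y` and `y`. -/
def coords (g : RiemMetric n X) (i : Y → X) (y : Y) : CoordData k n where
  g := coordMetric g (i y)
  f := writtenInExtChartAt (𝓡 k) (𝓡 n) y i

/-- The function on `Y` whose value at `y` is the given scalar of the coordinate data, computed in
charts around `y` and `i y`. -/
def onManifold (S : CoordData k n → Coo k → ℝ) (g : RiemMetric n X) (i : Y → X) (y : Y) : ℝ :=
  S (coords g i y) (extChartAt (𝓡 k) y y)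

/-- `𝒩₁` of the map `i : Y → (X, g)`. -/
def scalarN1 (g : RiemMetric n X) (i : Y → X) : Y → ℝ := onManifold (k := k) CoordData.N1 g i

/-- `𝒩₂` of the map `i : Y → (X, g)`. -/
def scalarN2 (g : RiemMetric n X) (i : Y → X) : Y → ℝ := onManifold (k := k) CoordData.N2 g i

/-- `𝒥₁` of Chalabi et al. -/
def scalarJ1 (g : RiemMetric n X) (i : Y → X) : Y → ℝ := onManifold (k := k) CoordData.J1CHO g i

/-- `𝒥₂` of Chalabi et al. -/
def scalarJ2 (g : RiemMetric n X) (i : Y → X) : Y → ℝ := onManifold (k := k) CoordData.J2CHO g i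

/-- `Δ̄ |L̊|²`. -/
def lapNormLo (g : RiemMetric n X) (i : Y → X) : Y → ℝ :=
  onManifold (k := k) (fun D => laplacian D.h D.normLo) g i

/-- `∇̄^β (D^{αα'} L̊_{αβα'})`. -/
def divDL (g : RiemMetric n X) (i : Y → X) : Y → ℝ :=
  onManifold (k := k) (fun D => divergence D.h D.formDL) g i

/-- `Δ̄ W_{αβ}{}^{αβ}`. -/
def lapWtr (g : RiemMetric n X) (i : Y → X) : Y → ℝ :=
  onManifold (k := k) (fun D => laplacian D.h D.Wtr) g i

/-- `∇̄^α 𝒞_α`. -/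
def divC (g : RiemMetric n X) (i : Y → X) : Y → ℝ :=
  onManifold (k := k) (fun D => divergence D.h D.cC1) g i

/-- The density `√(det g_{αβ})` of the area measure of `i^* g` in the preferred chart at `y₀`. -/
def areaDensity (g : RiemMetric n X) (i : Y → X) (y₀ : Y) (u : Coo k) : ℝ :=
  Real.sqrt (Matrix.det (Matrix.of fun α β : Fin k =>
    g.inner (i ((extChartAt (𝓡 k) y₀).symm u))
      (mfderiv (𝓡 k) (𝓡 n) (i ∘ (extChartAt (𝓡 k) y₀).symm) u
        (EuclideanSpace.single α (1 : ℝ)))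
      (mfderiv (𝓡 k) (𝓡 n) (i ∘ (extChartAt (𝓡 k) y₀).symm) u
        (EuclideanSpace.single β (1 : ℝ)))))

/-- The integral `∫_Y F dA` over a compact manifold with respect to the area measure of `i^* g`,
by means of a partition of unity subordinate to the domains of the preferred charts. -/
def areaIntegral (ρ : SmoothPartitionOfUnity Y (𝓡 k) Y Set.univ) (g : RiemMetric n X) (i : Y → X)
    (F : Y → ℝ) : ℝ :=
  ∑ᶠ y₀ : Y, ∫ u in (extChartAt (𝓡 k) y₀).target,
    ρ y₀ ((extChartAt (𝓡 k) y₀).symm u) * F ((extChartAt (𝓡 k) y₀).symm u)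
      * areaDensity g i y₀ u

end Manifold

end ConfSub

end

noncomputable section

namespace ConfSub

open Finset (sum_comm sum_congr mul_sum sum_mul sum_const_zero sum_eq_zero sum_ite_eq mem_univ univ
  sum_singleton univ_unique sum_ite_eq')
open Real (exp)
open Matrix (cons_val cons_val_zero cons_val_one of_apply)
open Function (update)
open EuclideanSpace (single)
local notation "Γ" => christoffel
local notation "ev" => evalTensor

section Sums
variable {ι κ μ : Type*} [Fintype ι] [Fintype κ] [Fintype μ]

lemma sum_ext {F G : ι → ℝ} (h : ∀ a, F a = G a) : ∑ a, F a = ∑ a, G a := sum_congr rfl fun a _ => h a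

lemma sum_ext2 {F G : ι → κ → ℝ} (h : ∀ a b, F a b = G a b) :
    ∑ a, ∑ b, F a b = ∑ a, ∑ b, G a b := sum_ext fun a => sum_ext (h a)

lemma sum_ext3 {F G : ι → κ → μ → ℝ} (h : ∀ a b c, F a b c = G a b c) :
    ∑ a, ∑ b, ∑ c, F a b c = ∑ a, ∑ b, ∑ c, G a b c := sum_ext fun a => sum_ext2 (h a)

lemma sum_add (F G : ι → ℝ) : ∑ a, (F a + G a) = ∑ a, F a + ∑ a, G a := Finset.sum_add_distrib

lemma sum_sub (F G : ι → ℝ) : ∑ a, (F a - G a) = ∑ a, F a - ∑ a, G a := Finset.sum_sub_distrib F G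

lemma sum_neg (F : ι → ℝ) : ∑ a, -F a = -∑ a, F a := Finset.sum_neg_distrib F

lemma sum_const {n : ℕ} (c : ℝ) : ∑ _i : Fin n, c = n * c := by simp

end Sums

/-! ### Partial derivatives -/

section Partial
variable {m : ℕ} {V : Set (Coo m)} {x : Coo m} {F G : Coo m → ℝ} {a b : Fin m}

lemma pd_add (hF : DifferentiableAt ℝ F x) (hG : DifferentiableAt ℝ G x) :
    pd a (fun z => F z + G z) x = pd a F x + pd a G x := by
  simp only [pd]; rw [fderiv_fun_add hF hG]; rfl

lemma pd_sub (hF : DifferentiableAt ℝ F x) (hG : DifferentiableAt ℝ G x) :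
    pd a (fun z => F z - G z) x = pd a F x - pd a G x := by
  simp only [pd]; rw [fderiv_fun_sub hF hG]; rfl

lemma pd_neg : pd a (fun z => -F z) x = -pd a F x := by simp only [pd]; rw [fderiv_fun_neg]; rfl

lemma pd_mul (hF : DifferentiableAt ℝ F x) (hG : DifferentiableAt ℝ G x) :
    pd a (fun z => F z * G z) x = F x * pd a G x + G x * pd a F x := by
  simp only [pd]; rw [fderiv_fun_mul hF hG]; simp

lemma pd_const (c : ℝ) : pd a (fun _ => c) x = 0 := by simp [pd]

lemma pd_const_mul (c : ℝ) (hF : DifferentiableAt ℝ F x) :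
    pd a (fun z => c * F z) x = c * pd a F x := by rw [pd_mul (by fun_prop) hF, pd_const]; ring

lemma pd_sum {ι : Type*} {s : Finset ι} {F : ι → Coo m → ℝ}
    (hF : ∀ i ∈ s, DifferentiableAt ℝ (F i) x) :
    pd a (fun z => ∑ i ∈ s, F i z) x = ∑ i ∈ s, pd a (F i) x := by
  simp only [pd]; rw [fderiv_fun_sum hF]; simp

lemma pd_exp (hF : DifferentiableAt ℝ F x) :
    pd a (fun z => exp (F z)) x = exp (F x) * pd a F x := by
  simp only [pd]; rw [fderiv_exp hF]; simp

lemma pd_congr_ev (h : F =ᶠ[nhds x] G) : pd a F x = pd a G x := by simp only [pd]; rw [h.fderiv_eq]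

lemma pd_congr (hV : IsOpen V) (hx : x ∈ V) (h : ∀ z ∈ V, F z = G z) :
    pd a F x = pd a G x := pd_congr_ev (Filter.eventually_of_mem (hV.mem_nhds hx) h)

lemma fderiv_eq_sum_pd {F : Coo m → ℝ} {x} (v) : fderiv ℝ F x v = ∑ c, v c * pd c F x := by
  conv_lhs => rw [← (EuclideanSpace.basisFun (Fin m) ℝ).sum_repr v]
  simp [pd, map_sum]

lemma hasFDerivAt_apply_coo {l : ℕ} {ψ : Coo l → Coo m} {y : Coo l}
    (hψ : DifferentiableAt ℝ ψ y) (c) (v : Coo l) :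
    fderiv ℝ (fun z => ψ z c) y v = fderiv ℝ ψ y v c := by
  have h := (EuclideanSpace.proj (𝕜 := ℝ) c).hasFDerivAt.comp y hψ.hasFDerivAt
  have h2 : HasFDerivAt (fun z => ψ z c)
    ((EuclideanSpace.proj (𝕜 := ℝ) c).comp (fderiv ℝ ψ y)) y := h
  rw [h2.fderiv]; rfl

lemma pd_comp {l : ℕ} {ψ : Coo l → Coo m} {y : Coo l} {a : Fin l}
    (hF : DifferentiableAt ℝ F (ψ y)) (hψ : DifferentiableAt ℝ ψ y) :
    pd a (fun z => F (ψ z)) y = ∑ c, pd a (fun z => ψ z c) y * pd c F (ψ y) := by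
  have : fderiv ℝ (fun z => F (ψ z)) y = (fderiv ℝ F (ψ y)).comp (fderiv ℝ ψ y) :=
    fderiv_comp y hF hψ
  simp only [pd, this, ContinuousLinearMap.comp_apply]; rw [fderiv_eq_sum_pd]
  refine sum_ext fun c => ?_; rw [hasFDerivAt_apply_coo hψ]; rfl

/-- Smooth real functions on `V`. -/
def Sm {m : ℕ} (V : Set (Coo m)) (F : Coo m → ℝ) : Prop := ContDiffOn ℝ ∞ F V

namespace Sm

lemma add (hF : Sm V F) (hG : Sm V G) : Sm V fun z => F z + G z := ContDiffOn.add hF hG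
lemma sub (hF : Sm V F) (hG : Sm V G) : Sm V fun z => F z - G z := ContDiffOn.sub hF hG
lemma neg (hF : Sm V F) : Sm V fun z => -F z := ContDiffOn.neg hF
lemma mul (hF : Sm V F) (hG : Sm V G) : Sm V fun z => F z * G z := ContDiffOn.mul hF hG
lemma const (c : ℝ) : Sm V fun _ => c := contDiffOn_const
lemma exp (hF : Sm V F) : Sm V fun z => exp (F z) := ContDiffOn.exp hF

lemma sum {ι : Type*} {s : Finset ι} {F : ι → Coo m → ℝ} (hF : ∀ i ∈ s, Sm V (F i)) :
    Sm V fun z => ∑ i ∈ s, F i z := ContDiffOn.sum hF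

lemma prod {ι : Type*} {s : Finset ι} {F : ι → Coo m → ℝ} (hF : ∀ i ∈ s, Sm V (F i)) :
    Sm V fun z => ∏ i ∈ s, F i z := contDiffOn_prod hF

lemma congr (hF : Sm V F) (h : ∀ z ∈ V, G z = F z) : Sm V G := ContDiffOn.congr hF h

lemma mono {V' : Set (Coo m)} (hF : Sm V F) (h : V' ⊆ V) : Sm V' F := ContDiffOn.mono hF h

lemma contDiffAt (hF : Sm V F) (hV : IsOpen V) (hx : x ∈ V) : ContDiffAt ℝ ∞ F x :=
  ContDiffOn.contDiffAt hF (hV.mem_nhds hx)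

lemma diffAt (hF : Sm V F) (hV : IsOpen V) (hx : x ∈ V) : DifferentiableAt ℝ F x :=
  (hF.contDiffAt hV hx).differentiableAt (by simp)

lemma pd (hV : IsOpen V) (hF : Sm V F) (a) : Sm V (pd a F) := by
  have h : ContDiffOn ℝ ∞ (fderiv ℝ F) V := ContDiffOn.fderiv_of_isOpen hF hV (by simp)
  exact h.clm_apply contDiffOn_const

lemma comp {l : ℕ} {U : Set (Coo l)} {ψ : Coo l → Coo m} (hF : Sm V F)
    (hψ : ContDiffOn ℝ ∞ ψ U) (hm : ∀ u ∈ U, ψ u ∈ V) : Sm U fun z => F (ψ z) :=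
  ContDiffOn.comp (t := V) hF hψ hm

lemma coord {l : ℕ} {U : Set (Coo l)} {ψ : Coo l → Coo m} (hψ : ContDiffOn ℝ ∞ ψ U)
    (c) : Sm U fun z => ψ z c := by
  have : ContDiffOn ℝ ∞ (fun z => (EuclideanSpace.proj (𝕜 := ℝ) c) (ψ z)) U :=
    (EuclideanSpace.proj (𝕜 := ℝ) c).contDiff.comp_contDiffOn hψ
  exact this

lemma det {ι : Type*} [Fintype ι] [DecidableEq ι] {A : Coo m → Matrix ι ι ℝ}
    (hA : ∀ i j, Sm V fun z => A z i j) : Sm V fun z => (A z).det := by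
  simp only [Matrix.det_apply']; exact sum fun σ _ => mul (const _) (prod fun i _ => hA _ _)

lemma inv_matrix {ι : Type*} [Fintype ι] [DecidableEq ι] {A : Coo m → Matrix ι ι ℝ}
    (hA : ∀ i j, Sm V fun z => A z i j) (hd : ∀ z ∈ V, (A z).det ≠ 0) (i j : ι) :
    Sm V fun z => (A z)⁻¹ i j := by
  have h1 : Sm V fun z => ((A z).det)⁻¹ := ContDiffOn.inv (det hA) hd
  have h2 : Sm V fun z => (A z).adjugate i j := by
    simp only [Matrix.adjugate_apply]; refine det fun p q => ?_
    by_cases hp : p = j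
    · subst hp; simp only [Matrix.updateRow_self]; exact const _
    · simp only [Matrix.updateRow_ne hp]; exact hA _ _
  refine (h1.mul h2).congr fun z _ => ?_; simp [Matrix.inv_def]

end Sm

lemma pd_comm (hV : IsOpen V) (hx : x ∈ V) (hF : Sm V F) (a b) :
    pd a (pd b F) x = pd b (pd a F) x := by
  have hc : ContDiffAt ℝ ∞ F x := hF.contDiffAt hV hx
  have hs : IsSymmSndFDerivAt ℝ F x := hc.isSymmSndFDerivAt (by simp; exact WithTop.coe_le_coe.2 le_top)
  have hd : DifferentiableAt ℝ (fderiv ℝ F) x :=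
    (hc.fderiv_right (m := ∞) (by simp)).differentiableAt (by simp)
  have key c d : pd c (pd d F) x = fderiv ℝ (fderiv ℝ F) x (single c 1) (single d 1) := by
    have : HasFDerivAt (pd d F) ((fderiv ℝ (fderiv ℝ F) x).flip (single d 1)) x := by
      have := hd.hasFDerivAt.clm_apply (hasFDerivAt_const (single d (1:ℝ)) x)
      simp only [ContinuousLinearMap.comp_zero, zero_add] at this; exact this
    simp only [pd]; change fderiv ℝ (pd d F) x _ = _; rw [this.fderiv]; rfl
  rw [key, key]; exact hs _ _

end Partial

/-! ### Linear substitutions in an index slot -/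

/-- The substitution `F ↦ ∑_c M_a^c F_c` in an index slot. -/
def ap {ι κ : Type*} [Fintype κ] (M : ι → κ → ℝ) (a : ι) (F : κ → ℝ) : ℝ := ∑ c, M a c * F c

/-- The contraction `∑ G^{ab} F_{ab}` with the inverse of a matrix. -/
def mtr {ι : Type*} [Fintype ι] [DecidableEq ι] (G : Matrix ι ι ℝ) (F : ι → ι → ℝ) : ℝ :=
  ∑ a, ∑ b, G⁻¹ a b * F a b

section Ap
variable {ι κ ι' κ' : Type*} [Fintype κ] [Fintype κ'] (M : ι → κ → ℝ) (a : ι)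

lemma ap_mul (F : κ → ℝ) (c : ℝ) : ap M a F * c = ap M a fun b => F b * c := by
  simp only [ap, sum_mul, mul_assoc]

lemma mul_ap (F : κ → ℝ) (c : ℝ) : c * ap M a F = ap M a fun b => c * F b := by
  simp only [ap, mul_sum]; exact sum_ext fun _ => by ring

lemma ap_add (F G : κ → ℝ) : ap M a (fun b => F b + G b) = ap M a F + ap M a G := by
  simp only [ap, mul_add, sum_add]

lemma ap_sub (F G : κ → ℝ) : ap M a (fun b => F b - G b) = ap M a F - ap M a G := by
  simp only [ap, mul_sub, sum_sub]

lemma ap_zero : ap M a (fun _ => 0) = 0 := by simp [ap]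

lemma ap_sum {σ : Type*} {s : Finset σ} (F : σ → κ → ℝ) :
    ap M a (fun b => ∑ i ∈ s, F i b) = ∑ i ∈ s, ap M a (F i) := by
  simp only [ap, mul_sum]; exact sum_comm

lemma ap_comm (N : ι' → κ' → ℝ) (a' : ι') (F : κ → κ' → ℝ) :
    (ap M a fun b => ap N a' fun b' => F b b') = ap N a' fun b' => ap M a fun b => F b b' := by
  simp only [ap, mul_sum]; rw [sum_comm]; exact sum_ext2 fun _ _ => by ring

variable [Fintype ι] [DecidableEq ι]

lemma mtr_add (G : Matrix ι ι ℝ) (F F' : ι → ι → ℝ) :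
    mtr G (fun a b => F a b + F' a b) = mtr G F + mtr G F' := by simp only [mtr, mul_add, sum_add]

lemma mtr_sub (G : Matrix ι ι ℝ) (F F' : ι → ι → ℝ) :
    mtr G (fun a b => F a b - F' a b) = mtr G F - mtr G F' := by simp only [mtr, mul_sub, sum_sub]

lemma mtr_const_mul (G : Matrix ι ι ℝ) (c : ℝ) (F : ι → ι → ℝ) :
    mtr G (fun a b => c * F a b) = c * mtr G F := by
  simp only [mtr, mul_sum]; exact sum_ext2 fun _ _ => by ring

lemma mtr_mul_const (G : Matrix ι ι ℝ) (c : ℝ) (F : ι → ι → ℝ) :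
    mtr G (fun a b => F a b * c) = mtr G F * c := by simp only [mtr, sum_mul, mul_assoc]

lemma mtr_one (F : ι → ι → ℝ) : mtr (1 : Matrix ι ι ℝ) F = ∑ a, F a a := by
  simp [mtr, Matrix.one_apply]

lemma mtr_smul (G : Matrix ι ι ℝ) (c : ℝ) (F : ι → ι → ℝ) : mtr (c • G) F = c⁻¹ * mtr G F := by
  by_cases hc : c = 0
  · subst hc
    simp [mtr]
  · simp only [mtr, mul_sum]
    have : (c • G)⁻¹ = c⁻¹ • G⁻¹ := by
      by_cases hG : IsUnit G.det
      · rw [show c • G = (Units.mk0 c hc) • G from rfl, Matrix.inv_smul' G (Units.mk0 c hc) hG]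
        rfl
      · rw [Matrix.nonsing_inv_apply_not_isUnit G hG, Matrix.nonsing_inv_apply_not_isUnit]
        · simp
        · rw [Matrix.det_smul, isUnit_iff_ne_zero]
          simpa [isUnit_iff_ne_zero, hc] using hG
    rw [this]; simp [mul_assoc]

lemma mtr_ap (G : Matrix ι ι ℝ) (N : ι' → κ' → ℝ) (i : ι') (F : ι → ι → κ' → ℝ) :
    (mtr G fun a b => ap N i fun c => F a b c) = ap N i fun c => mtr G fun a b => F a b c := by
  simp only [mtr, ap, mul_sum]; rw [sum_ext fun a => sum_comm, sum_comm]
  exact sum_ext3 fun _ _ _ => by ring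

lemma mtr_ap_left_ap (G : Matrix ι ι ℝ) (M : ι → κ → ℝ) (N : ι' → κ' → ℝ) (i : ι')
    (F : ι → ι → κ → κ' → ℝ) : (mtr G fun a b => ap M a fun e => ap N i fun c => F a b e c)
    = ap N i fun c => mtr G fun a b => ap M a fun e => F a b e c := by
  simp only [ap_comm M _ N i]; rw [mtr_ap]

lemma mtr_ap_right_ap (G : Matrix ι ι ℝ) (M : ι → κ → ℝ) (N : ι' → κ' → ℝ) (i : ι')
    (F : ι → ι → κ → κ' → ℝ) : (mtr G fun a b => ap M b fun e => ap N i fun c => F a b e c)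
    = ap N i fun c => mtr G fun a b => ap M b fun e => F a b e c := by
  simp only [ap_comm M _ N i]; rw [mtr_ap]

lemma mtr_ap_ap [DecidableEq κ] {G' : Matrix ι ι ℝ} {G : Matrix κ κ ℝ} {M : ι → κ → ℝ}
    (hG : ∀ c d, mtr G' (fun a b => M a c * M b d) = G⁻¹ c d) (F : κ → κ → ℝ) :
    (mtr G' fun a b => ap M a fun c => ap M b fun d => F c d) = mtr G F := by
  simp only [mtr] at hG ⊢; simp only [← hG, ap, mul_sum, sum_mul]
  rw [sum_ext fun a => sum_comm, sum_comm]; refine sum_ext fun c => ?_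
  rw [sum_ext fun a => sum_comm, sum_comm]; refine sum_ext fun d => ?_
  exact sum_ext2 fun _ _ => by ring

lemma mtr_symm {G : Matrix ι ι ℝ} (hG : G.IsSymm) (F : ι → ι → ℝ) :
    (mtr G fun a b => F b a) = mtr G F := by
  simp only [mtr]; rw [sum_comm]
  have : G⁻¹.IsSymm := by unfold Matrix.IsSymm; rw [Matrix.transpose_nonsing_inv, hG]
  exact sum_ext2 fun a b => by rw [this.apply]

end Ap

/-! ### Evaluation of tensors on vectors -/

section Eval
variable {m r : ℕ}

lemma prod_update_apply (v : Fin r → Fin m → ℝ) (j : Fin r) (w : Fin m → ℝ) (K : Fin r → Fin m) :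
    ∏ i, update v j w i (K i) = w (K j) * ∏ i ∈ univ \ {j}, v i (K i) := by
  have : (fun i => update v j w i (K i)) = update (fun i => v i (K i)) j (w (K j)) := by
    funext i
    by_cases h : i = j
    · subst h; simp
    · simp [h]
  rw [this, Finset.prod_update_of_mem (mem_univ j)]

lemma evalTensor_update (T : (Fin r → Fin m) → ℝ) (v : Fin r → Fin m → ℝ) (j : Fin r)
    (w : Fin m → ℝ) : ev T (update v j w) = ∑ K, T K * (w (K j) * ∏ i ∈ univ \ {j}, v i (K i)) := by
  simp only [evalTensor, prod_update_apply]

lemma evalTensor_update_ap {ι κ : Type*} [Fintype κ] (T : (Fin r → Fin m) → ℝ)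
    (v : Fin r → Fin m → ℝ) (j : Fin r) (A : ι → κ → ℝ) (i : ι) (w : κ → Fin m → ℝ) :
    ev T (update v j fun b => ap A i fun c => w c b) = ap A i fun c => ev T (update v j (w c)) := by
  simp only [evalTensor_update, ap, sum_mul, mul_sum]; rw [sum_comm]
  exact sum_ext2 fun _ _ => by ring

lemma evalTensor_update_add (T : (Fin r → Fin m) → ℝ)
    (v : Fin r → Fin m → ℝ) (j : Fin r) (w w' : Fin m → ℝ) : ev T (update v j fun b => w b + w' b)
    = ev T (update v j w) + ev T (update v j w') := by
  simp only [evalTensor_update, ← sum_add]; exact sum_ext fun _ => by ring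

lemma evalTensor_cons (T : (Fin (r + 1) → Fin m) → ℝ) (v : Fin (r + 1) → Fin m → ℝ) :
    ev T v = ∑ a, v 0 a * ev (fun I => T (Fin.cons a I)) (Fin.tail v) := by
  simp only [evalTensor]
  rw [← (Fin.consEquiv fun _ : Fin (r + 1) => Fin m).sum_comp, Fintype.sum_prod_type]
  refine sum_ext fun a => ?_; rw [mul_sum]; refine sum_ext fun K => ?_
  simp only [Fin.consEquiv, Equiv.coe_fn_mk, Fin.prod_univ_succ, Fin.cons_zero, Fin.cons_succ,
    Fin.tail]
  ring

lemma evalTensor_zero' (T : (Fin 0 → Fin m) → ℝ) (v : Fin 0 → Fin m → ℝ) : ev T v = T ![] := by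
  simp only [evalTensor, Finset.univ_eq_empty, Finset.prod_empty, mul_one]
  rw [Fintype.sum_unique]; congr 1

lemma evalTensor_single (T : (Fin r → Fin m) → ℝ) (I : Fin r → Fin m) :
    ev T (fun j => Pi.single (I j) 1) = T I := by
  simp only [evalTensor]; rw [Finset.sum_eq_single I]
  · simp
  · intro K _ hK
    obtain ⟨j, hj⟩ := Function.ne_iff.1 hK; rw [Finset.prod_eq_zero (mem_univ j), mul_zero]
    simp [hj]
  · simp

lemma evalTensor_one (T : (Fin 1 → Fin m) → ℝ) (v : Fin 1 → Fin m → ℝ) :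
    ev T v = ∑ a, v 0 a * T ![a] := by rw [evalTensor_cons]; simp only [evalTensor_zero']; rfl

lemma evalTensor_two (T : (Fin 2 → Fin m) → ℝ) (v : Fin 2 → Fin m → ℝ) :
    ev T v = ∑ a, v 0 a * ∑ b, v 1 b * T ![a, b] := by
  rw [evalTensor_cons]; simp only [evalTensor_one]; rfl

lemma evalTensor_three (T : (Fin 3 → Fin m) → ℝ) (v : Fin 3 → Fin m → ℝ) :
    ev T v = ∑ a, v 0 a * ∑ b, v 1 b * ∑ c, v 2 c * T ![a, b, c] := by
  rw [evalTensor_cons]; simp only [evalTensor_two]; rfl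

lemma evalTensor_four (T : (Fin 4 → Fin m) → ℝ) (v : Fin 4 → Fin m → ℝ) : ev T v
    = ∑ a, v 0 a * ∑ b, v 1 b * ∑ c, v 2 c * ∑ d, v 3 d * T ![a, b, c, d] := by
  rw [evalTensor_cons]; simp only [evalTensor_three]; rfl

lemma sum_slot_evalTensor (T : (Fin r → Fin m) → ℝ) (v : Fin r → Fin m → ℝ) (j : Fin r)
    (A : Fin m → Fin m → ℝ) :
    ∑ K : Fin r → Fin m, (∑ e, A e (K j) * T (update K j e)) * ∏ i, v i (K i)
    = ev T (update v j fun e => ∑ d, A e d * v j d) := by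
  rw [evalTensor_update]; simp only [sum_mul, mul_sum]
  rw [← Fintype.sum_prod_type', ← Fintype.sum_prod_type']
  refine Fintype.sum_equiv
    ⟨fun p => (update p.1 j p.2, p.1 j), fun p => (update p.1 j p.2, p.1 j),
      fun p => by simp, fun p => by simp⟩ _ _ fun p => ?_
  simp only [Equiv.coe_fn_mk, Function.update_self]
  rw [← Finset.mul_prod_erase univ (fun i => v i (p.1 i)) (mem_univ j)]
  have : ∏ i ∈ univ \ {j}, v i (update p.1 j p.2 i) = ∏ i ∈ univ.erase j, v i (p.1 i) := by
    rw [Finset.sdiff_singleton_eq_erase]; refine Finset.prod_congr rfl fun i hi => ?_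
    rw [Function.update_of_ne (Finset.ne_of_mem_erase hi)]
  rw [this]; ring

end Eval

/-! ### Metrics -/

/-- A smooth Riemannian metric on the open set `V`, given by its components. -/
structure MReg {m : ℕ} (g : MetricField m) (V : Set (Coo m)) : Prop where
  isOpen : IsOpen V
  smooth : ∀ a b, Sm V fun x => g x a b
  posDef : ∀ x ∈ V, (g x).PosDef

instance {m : ℕ} {g : MetricField m} {V} : CoeOut (MReg g V) (IsOpen V) := ⟨MReg.isOpen⟩

namespace MReg
variable {m : ℕ} {g : MetricField m} {V : Set (Coo m)} {x : Coo m}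

lemma mono (hg : MReg g V) {V' : Set (Coo m)} (h : V' ⊆ V) (ho : IsOpen V') : MReg g V' :=
  ⟨ho, fun a b => (hg.smooth a b).mono h, fun x hx => hg.posDef x (h hx)⟩

lemma symm (hg : MReg g V) (hx : x ∈ V) (a b) : g x a b = g x b a := by
  have := (hg.posDef x hx).isHermitian.apply a b; simpa using this.symm

lemma isSymm (hg : MReg g V) (hx : x ∈ V) : (g x).IsSymm :=
  Matrix.IsSymm.ext fun a b => hg.symm hx b a

lemma det_ne (hg : MReg g V) (hx : x ∈ V) : (g x).det ≠ 0 := (hg.posDef x hx).det_pos.ne'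

lemma isUnit_det (hg : MReg g V) (hx : x ∈ V) : IsUnit (g x).det := (hg.det_ne hx).isUnit

lemma inv_mul (hg : MReg g V) (hx : x ∈ V) (a c) :
    ∑ b, (g x)⁻¹ a b * g x b c = if a = c then 1 else 0 := by
  have := congrFun (congrFun (Matrix.nonsing_inv_mul (g x) (hg.isUnit_det hx)) a) c
  rwa [Matrix.mul_apply, Matrix.one_apply] at this

lemma mul_inv (hg : MReg g V) (hx : x ∈ V) (a c) :
    ∑ b, g x a b * (g x)⁻¹ b c = if a = c then 1 else 0 := by
  have := congrFun (congrFun (Matrix.mul_nonsing_inv (g x) (hg.isUnit_det hx)) a) c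
  rwa [Matrix.mul_apply, Matrix.one_apply] at this

lemma smooth_inv (hg : MReg g V) (a b) : Sm V fun x => (g x)⁻¹ a b :=
  Sm.inv_matrix hg.smooth (fun _ hx => hg.det_ne hx) a b

lemma mtr_swap (hg : MReg g V) (hx : x ∈ V) (F : Fin m → Fin m → ℝ) :
    (mtr (g x) fun a b => F b a) = mtr (g x) F := mtr_symm (hg.isSymm hx) F

lemma smooth_christoffel (hg : MReg g V) (c a b) : Sm V fun x => Γ g x c a b := by
  unfold christoffel
  exact (Sm.const _).mul (Sm.sum fun d _ => (hg.smooth_inv c d).mul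
    ((((hg.smooth b d).pd hg a).add ((hg.smooth a d).pd hg b)).sub ((hg.smooth a b).pd hg d)))

lemma pd_symm (hg : MReg g V) (hx : x ∈ V) (c a b) :
    pd c (fun z => g z a b) x = pd c (fun z => g z b a) x :=
  pd_congr hg hx fun _ hz => hg.symm hz a b

lemma christoffel_symm (hg : MReg g V) (hx : x ∈ V) (c a b) : Γ g x c a b = Γ g x c b a := by
  unfold christoffel; congr 1; refine sum_ext fun d => ?_; rw [hg.pd_symm hx d a b]; ring

lemma sum_mul_christoffel (hg : MReg g V) (hx : x ∈ V) (e a b) : ∑ c, g x e c * Γ g x c a b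
    = (1 / 2) * (pd a (fun z => g z b e) x + pd b (fun z => g z a e) x
    - pd e (fun z => g z a b) x) := by
  unfold christoffel
  have : ∀ c, g x e c * ((1 / 2) * ∑ d, (g x)⁻¹ c d *
    (pd a (fun z => g z b d) x + pd b (fun z => g z a d) x - pd d (fun z => g z a b) x))
    = (1 / 2) * ∑ d, (g x e c * (g x)⁻¹ c d) *
    (pd a (fun z => g z b d) x + pd b (fun z => g z a d) x - pd d (fun z => g z a b) x) := by
    intro c; rw [mul_sum, mul_sum, mul_sum]; exact sum_ext fun _ => by ring
  simp only [this, ← mul_sum]; rw [sum_comm]; simp only [← sum_mul, hg.mul_inv hx]; simp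

lemma pd_metric (hg : MReg g V) (hx : x ∈ V) (a b c) : pd a (fun z => g z b c) x
    = ∑ d, (Γ g x d a b * g x d c + Γ g x d a c * g x b d) := by
  have h1 := hg.sum_mul_christoffel hx c a b; have h2 := hg.sum_mul_christoffel hx b a c
  rw [sum_add]
  have e1 : ∑ d, Γ g x d a b * g x d c = ∑ d, g x c d * Γ g x d a b :=
    sum_ext fun d => by rw [hg.symm hx d c]; ring
  have e2 : ∑ d, Γ g x d a c * g x b d = ∑ d, g x b d * Γ g x d a c := sum_ext fun d => by ring
  rw [e1, e2, h1, h2, hg.pd_symm hx a c b, hg.pd_symm hx b a c, hg.pd_symm hx c a b,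
    hg.pd_symm hx b c a, hg.pd_symm hx c b a]
  ring

/-- The Levi-Civita connection is the only symmetric metric connection. -/
lemma christoffel_unique (hg : MReg g V) (hx : x ∈ V) {S : Fin m → Fin m → Fin m → ℝ}
    (hS : ∀ c a b, S c a b = S c b a)
    (hm : ∀ a b c, pd a (fun z => g z b c) x = ∑ d, (S d a b * g x d c + S d a c * g x b d))
    (c a b) : Γ g x c a b = S c a b := by
  have low e : ∑ c, g x e c * Γ g x c a b = ∑ c, g x e c * S c a b := by
    rw [hg.sum_mul_christoffel hx, hm, hm, hm]; simp only [sum_add]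
    have e1 : ∑ d, S d a b * g x d e = ∑ c, g x e c * S c a b :=
      sum_ext fun d => by rw [hg.symm hx d e]; ring
    have e2 : ∑ d, S d b a * g x d e = ∑ c, g x e c * S c a b :=
      sum_ext fun d => by rw [hg.symm hx d e, hS]; ring
    have e3 : ∑ d, S d a e * g x b d = ∑ d, S d e a * g x b d := sum_ext fun d => by rw [hS]
    have e4 : ∑ d, S d b e * g x a d = ∑ d, S d e b * g x a d := sum_ext fun d => by rw [hS]
    have e5 : ∑ d, S d e a * g x d b = ∑ d, S d e a * g x b d :=
      sum_ext fun d => by rw [hg.symm hx d b]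
    rw [e1, e2, e3, e4, e5]; ring
  have : ∀ (F : Fin m → ℝ) c, F c = ∑ e, (g x)⁻¹ c e * ∑ c', g x e c' * F c' := by
    intro F c; simp only [mul_sum]; rw [sum_comm]; simp only [← mul_assoc, ← sum_mul, hg.inv_mul hx]
    simp
  rw [this (fun c => Γ g x c a b) c, this (fun c => S c a b) c]
  exact sum_ext fun e => by rw [low e]

lemma smooth_cov (hg : MReg g V) {r : ℕ} {T : TensorField m r} (hT : ∀ I, Sm V fun x => T x I)
    (I : Fin (r + 1) → Fin m) : Sm V fun x => cov g T x I := by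
  unfold cov
  exact ((hT _).pd hg _).sub (Sm.sum fun j _ => Sm.sum fun c _ =>
    (hg.smooth_christoffel _ _ _).mul (hT _))

lemma smooth_riemannUp (hg : MReg g V) (a b c d) : Sm V fun x => riemannUp g x a b c d := by
  unfold riemannUp
  exact (((hg.smooth_christoffel _ _ _).pd hg _).sub
    ((hg.smooth_christoffel _ _ _).pd hg _)).add (Sm.sum fun e _ =>
      ((hg.smooth_christoffel _ _ _).mul (hg.smooth_christoffel _ _ _)).sub
      ((hg.smooth_christoffel _ _ _).mul (hg.smooth_christoffel _ _ _)))

lemma smooth_riemann (hg : MReg g V) (I) : Sm V fun x => riemann g x I := by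
  unfold riemann; exact Sm.sum fun e _ => (hg.smooth_riemannUp _ _ _ _).mul (hg.smooth _ _)

lemma smooth_ricci (hg : MReg g V) (I) : Sm V fun x => ricci g x I := by
  unfold ricci; exact Sm.sum fun e _ => hg.smooth_riemannUp _ _ _ _

lemma smooth_scalarCurv (hg : MReg g V) : Sm V (scalarCurv g) := by
  unfold scalarCurv
  exact Sm.sum fun a _ => Sm.sum fun b _ => (hg.smooth_inv _ _).mul (hg.smooth_ricci _)

lemma smooth_schouten (hg : MReg g V) (I) : Sm V fun x => schouten g x I := by
  unfold schouten
  exact (Sm.const _).mul ((hg.smooth_ricci _).sub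
    (((Sm.const _).mul hg.smooth_scalarCurv).mul (hg.smooth _ _)))

lemma smooth_weyl (hg : MReg g V) (I) : Sm V fun x => weyl g x I := by
  unfold weyl
  exact ((((hg.smooth_riemann _).sub ((hg.smooth_schouten _).mul (hg.smooth _ _))).sub
    ((hg.smooth_schouten _).mul (hg.smooth _ _))).add
    ((hg.smooth_schouten _).mul (hg.smooth _ _))).add ((hg.smooth_schouten _).mul (hg.smooth _ _))

lemma smooth_cotton (hg : MReg g V) (I) : Sm V fun x => cotton g x I := by
  unfold cotton; exact (hg.smooth_cov hg.smooth_schouten _).sub (hg.smooth_cov hg.smooth_schouten _)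

end MReg

/-! ### Covariant differentiation along maps -/

/-- The covariant derivative along `f`, in the coordinate direction `α`, of the vector field `v`. -/
def covAlong {l m : ℕ} (g : MetricField m) (f : Coo l → Coo m) (α : Fin l)
    (v : Coo l → Fin m → ℝ) (u : Coo l) (b : Fin m) : ℝ := pd α (fun z => v z b) u
    + ∑ c, ∑ d, Γ g (f u) b c d * pd α (fun z => f z c) u * v u d

section Along
variable {l m r : ℕ} {g : MetricField m} {V : Set (Coo m)} {U : Set (Coo l)} {f : Coo l → Coo m}

lemma evalTensor_cov (T : TensorField m r) (x) (w : Fin m → ℝ)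
    (v : Fin r → Fin m → ℝ) : ev (cov g T x) (Fin.cons w v)
      = (∑ c, w c * ev (fun K => pd c (fun z => T z K) x) v) - ∑ j, ev (T x) (update v j fun e =>
            ∑ c, ∑ d, Γ g x e c d * w c * v j d) := by
  rw [evalTensor_cons]; simp only [Fin.cons_zero, Fin.tail_cons]
  have h a : ev (fun I => cov g T x (Fin.cons a I)) v = ev (fun K => pd a (fun z => T z K) x) v
    - ∑ j, ev (T x) (update v j fun e => ∑ d, Γ g x e a d * v j d) := by
    simp only [← sum_slot_evalTensor (T x) v _ (fun e d => Γ g x e a d)]; rw [sum_comm]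
    simp only [evalTensor, cov, Fin.cons_zero, Fin.tail_cons, Fin.cons_succ, sub_mul,
      sum_sub, sum_mul]
  simp only [h, mul_sub, sum_sub, mul_sum]; congr 1; rw [sum_comm]; refine sum_ext fun j => ?_
  have := evalTensor_update_ap (T x) v j (fun (_ : Unit) c => w c) ()
    (fun a e => ∑ d, Γ g x e a d * v j d)
  simp only [ap] at this; rw [← this]; congr 2; funext e; refine sum_ext fun c => ?_; rw [mul_sum]
  exact sum_ext fun _ => by ring

lemma pd_prod {ι : Type*} [Fintype ι] [DecidableEq ι] {F : ι → Coo l → ℝ} {u : Coo l}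
    {a : Fin l} (hF : ∀ i, DifferentiableAt ℝ (F i) u) :
    pd a (fun z => ∏ i, F i z) u = ∑ j, pd a (F j) u * ∏ i ∈ univ \ {j}, F i u := by
  simp only [pd]; rw [fderiv_finsetProd (fun i _ => hF i)]
  simp only [sum_apply, smul_apply, smul_eq_mul, Finset.sdiff_singleton_eq_erase]
  exact sum_ext fun _ => by ring

lemma pd_evalTensor (hV : IsOpen V) {T : TensorField m r}
    (hT : ∀ I, Sm V fun x => T x I) {v : Coo l → Fin r → Fin m → ℝ} {u : Coo l}
    (hu : f u ∈ V) (hf : DifferentiableAt ℝ f u)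
    (hv : ∀ j b, DifferentiableAt ℝ (fun z => v z j b) u) (a : Fin l) :
    pd a (fun z => ev (T (f z)) (v z)) u
    = ev (cov g T (f u)) (Fin.cons (fun c => pd a (fun z => f z c) u) (v u)) + ∑ j, ev (T (f u))
    (update (v u) j (covAlong g f a (fun z => v z j) u)) := by
  have hTf I : DifferentiableAt ℝ (fun z => T (f z) I) u := ((hT I).diffAt hV hu).comp (f := f) u hf
  have h1 : pd a (fun z => ev (T (f z)) (v z)) u
    = (∑ c, pd a (fun z => f z c) u * ev (fun K => pd c (fun z => T z K) (f u)) (v u))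
    + ∑ j, ev (T (f u)) (update (v u) j fun b => pd a (fun z => v z j b) u) := by
    have hp : ∀ K : Fin r → Fin m, DifferentiableAt ℝ (fun z => ∏ i, v z i (K i)) u := fun K =>
      (HasFDerivAt.finsetProd (u := univ) (g := fun i z => v z i (K i))
        fun i _ => (hv i (K i)).hasFDerivAt).differentiableAt
    simp only [evalTensor]; rw [pd_sum fun K _ => (hTf K).fun_mul (hp K)]
    simp only [prod_update_apply, mul_sum]
    rw [sum_comm, sum_comm (s := (univ : Finset (Fin r))), ← sum_add]; refine sum_ext fun K => ?_
    rw [pd_mul (hTf K) (hp K), pd_prod (fun i => hv i (K i)),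
      pd_comp ((hT K).diffAt hV hu) hf, mul_sum, mul_sum, add_comm]
    congr 1
    · exact sum_ext fun _ => by ring
  rw [h1, evalTensor_cov, sub_add]; congr 1; simp only [sub_eq_add_neg, neg_add, neg_neg]
  rw [← sum_neg, ← sum_add]; refine sum_ext fun j => ?_
  have : covAlong g f a (fun z => v z j) u = fun b => pd a (fun z => v z j b) u
    + ∑ c, ∑ d, Γ g (f u) b c d * pd a (fun z => f z c) u * v u j d := rfl
  rw [this, evalTensor_update_add]; ring

end Along

/-! ### Changes of coordinates -/

/-- The rows of the Jacobian matrix: the components of `∂ₐ ψ`. -/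
def jac {l m : ℕ} (ψ : Coo l → Coo m) (x : Coo l) (a : Fin l) : Fin m → ℝ :=
  fun c => pd a (fun z => ψ z c) x

lemma matrix_congr_inv {ι : Type*} [Fintype ι] [DecidableEq ι] {G' G J : Matrix ι ι ℝ}
    (h : G' = J * G * J.transpose) (hd : IsUnit G'.det) :
    J.transpose * G'⁻¹ * J = G⁻¹ ∧ IsUnit J.det := by
  have hdet : G'.det = J.det * G.det * J.det := by
    rw [h, Matrix.det_mul, Matrix.det_mul, Matrix.det_transpose]
  rw [isUnit_iff_ne_zero, hdet] at hd
  have hJ : IsUnit J.det := isUnit_iff_ne_zero.2 fun h0 => hd (by simp [h0])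
  have hJt : IsUnit J.transpose.det := by rwa [Matrix.det_transpose]
  refine ⟨?_, hJ⟩
  rw [h, Matrix.mul_inv_rev, Matrix.mul_inv_rev, ← mul_assoc, ← mul_assoc,
    Matrix.mul_nonsing_inv _ hJt, one_mul, mul_assoc, Matrix.nonsing_inv_mul _ hJ, mul_one]

lemma ap_ap_eq_matrix {ι : Type*} [Fintype ι] [DecidableEq ι] (M : ι → ι → ℝ) (G : Matrix ι ι ℝ)
    (a b : ι) : (ap M a fun c => ap M b fun d => G c d)
    = (Matrix.of M * G * (Matrix.of M).transpose) a b := by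
  simp only [ap, Matrix.mul_apply, Matrix.transpose_apply, of_apply, mul_sum, sum_mul]
  rw [sum_comm]; exact sum_ext2 fun _ _ => by ring

lemma mtr_congr_metric {ι : Type*} [Fintype ι] [DecidableEq ι] {G' G : Matrix ι ι ℝ}
    {M : ι → ι → ℝ} (h : ∀ a b, G' a b = ap M a fun c => ap M b fun d => G c d)
    (hd : IsUnit G'.det) (c d : ι) : mtr G' (fun a b => M a c * M b d) = G⁻¹ c d := by
  have h' : G' = Matrix.of M * G * (Matrix.of M).transpose := by ext a b; rw [h, ap_ap_eq_matrix]
  rw [← (matrix_congr_inv h' hd).1]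
  simp only [mtr, Matrix.mul_apply, Matrix.transpose_apply, of_apply, sum_mul]; rw [sum_comm]
  exact sum_ext2 fun _ _ => by ring

lemma exists_inverse_of_metric {ι : Type*} [Fintype ι] [DecidableEq ι] {G' G : Matrix ι ι ℝ}
    {M : ι → ι → ℝ} (h : ∀ a b, G' a b = ap M a fun c => ap M b fun d => G c d)
    (hd : IsUnit G'.det) : ∃ N : ι → ι → ℝ, (∀ a c, ∑ b, N a b * M b c = if a = c then 1 else 0) ∧
    (∀ a c, ∑ b, M a b * N b c = if a = c then 1 else 0) := by
  have h' : G' = Matrix.of M * G * (Matrix.of M).transpose := by ext a b; rw [h, ap_ap_eq_matrix]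
  have hJ := (matrix_congr_inv h' hd).2
  refine ⟨fun a b => (Matrix.of M)⁻¹ a b, fun a c => ?_, fun a c => ?_⟩
  · have := congrFun (congrFun (Matrix.nonsing_inv_mul _ hJ) a) c
    rw [Matrix.mul_apply, Matrix.one_apply] at this; exact this
  · have := congrFun (congrFun (Matrix.mul_nonsing_inv _ hJ) a) c
    rw [Matrix.mul_apply, Matrix.one_apply] at this; exact this

section ApPairs
variable {ι κ : Type*} [Fintype κ] (J : ι → κ → ℝ) (a b c d : ι) (P Q : κ → κ → ℝ)

lemma ap_mul_ap_02_13 :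
    (ap J a fun a' => ap J c fun c' => P a' c') * (ap J b fun b' => ap J d fun d' => Q b' d')
    = ap J a fun a' => ap J b fun b' => ap J c fun c' => ap J d fun d' => P a' c' * Q b' d' := by
  simp only [ap_mul]; simp only [mul_ap]; congr 1; funext a'; rw [ap_comm]

lemma ap_mul_ap_13_02 :
    (ap J b fun b' => ap J d fun d' => P b' d') * (ap J a fun a' => ap J c fun c' => Q a' c')
    = ap J a fun a' => ap J b fun b' => ap J c fun c' => ap J d fun d' => P b' d' * Q a' c' := by
  rw [mul_comm, ap_mul_ap_02_13]; simp only [mul_comm]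

lemma ap_mul_ap_03_12 :
    (ap J a fun a' => ap J d fun d' => P a' d') * (ap J b fun b' => ap J c fun c' => Q b' c')
    = ap J a fun a' => ap J b fun b' => ap J c fun c' => ap J d fun d' => P a' d' * Q b' c' := by
  rw [ap_mul_ap_02_13]; congr 1; funext a'; congr 1; funext b'; rw [ap_comm]

lemma ap_mul_ap_12_03 :
    (ap J b fun b' => ap J c fun c' => P b' c') * (ap J a fun a' => ap J d fun d' => Q a' d')
    = ap J a fun a' => ap J b fun b' => ap J c fun c' => ap J d fun d' => P b' c' * Q a' d' := by
  rw [mul_comm, ap_mul_ap_03_12]; simp only [mul_comm]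

end ApPairs

/-- `g'` is the pull-back of `g` by `ψ`. -/
structure IsPull {m : ℕ} (g' g : MetricField m) (ψ : Coo m → Coo m) (V' V : Set (Coo m)) :
    Prop where
  reg' : MReg g' V'
  reg : MReg g V
  smooth : ContDiffOn ℝ ∞ ψ V'
  maps : ∀ x ∈ V', ψ x ∈ V
  eq : ∀ x ∈ V', ∀ a b, g' x a b = ap (jac ψ x) a fun c => ap (jac ψ x) b fun d => g (ψ x) c d

namespace IsPull
variable {m r : ℕ} {g' g : MetricField m} {ψ : Coo m → Coo m} {V' V : Set (Coo m)} {x : Coo m}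

lemma isOpen (h : IsPull g' g ψ V' V) : IsOpen V' := h.reg'

lemma diffAt (h : IsPull g' g ψ V' V) (hx : x ∈ V') : DifferentiableAt ℝ ψ x :=
  (h.smooth.contDiffAt (h.isOpen.mem_nhds hx)).differentiableAt (by simp)

lemma smooth_jac (h : IsPull g' g ψ V' V) (a c) : Sm V' fun z => jac ψ z a c :=
  (Sm.coord h.smooth c).pd h.isOpen a

lemma mtr_eq (h : IsPull g' g ψ V' V) (hx : x ∈ V') (F : Fin m → Fin m → ℝ) :
    (mtr (g' x) fun a b => ap (jac ψ x) a fun c => ap (jac ψ x) b fun d => F c d)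
    = mtr (g (ψ x)) F := mtr_ap_ap (mtr_congr_metric (h.eq x hx) (h.reg'.isUnit_det hx)) F

lemma mtr_eq' (h : IsPull g' g ψ V' V) (hx : x ∈ V') (F : Fin m → Fin m → ℝ) :
    (mtr (g' x) fun a b => ap (jac ψ x) b fun d => ap (jac ψ x) a fun c => F c d)
    = mtr (g (ψ x)) F := by
  rw [← h.mtr_eq hx]; simp only [mtr]; exact sum_ext2 fun _ _ => by rw [ap_comm]

lemma exists_inverse (h : IsPull g' g ψ V' V) (hx : x ∈ V') : ∃ N : Fin m → Fin m → ℝ,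
    (∀ a c, ∑ b, N a b * jac ψ x b c = if a = c then 1 else 0) ∧
    (∀ a c, ∑ b, jac ψ x a b * N b c = if a = c then 1 else 0) :=
  exists_inverse_of_metric (h.eq x hx) (h.reg'.isUnit_det hx)

lemma ap_injective (h : IsPull g' g ψ V' V) (hx : x ∈ V') {F : Fin m → ℝ}
    (hF : ∀ a, ap (jac ψ x) a F = 0) (c) : F c = 0 := by
  obtain ⟨N, hN, -⟩ := h.exists_inverse hx
  have : F c = ∑ b, N c b * ap (jac ψ x) b F := by
    simp only [ap, mul_sum, ← mul_assoc]; rw [sum_comm]; simp only [← sum_mul, hN]; simp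
  rw [this]; simp [hF]

end IsPull

/-- The metric as a tensor field. -/
def metricTensor {m : ℕ} (g : MetricField m) : TensorField m 2 := fun x I => g x (I 0) (I 1)

lemma MReg.cov_metricTensor {m : ℕ} {g : MetricField m} {V : Set (Coo m)} {x}
    (hg : MReg g V) (hx : x ∈ V) (I : Fin 3 → Fin m) : cov g (metricTensor g) x I = 0 := by
  simp only [cov, metricTensor, Fin.sum_univ_two, Fin.tail]; rw [hg.pd_metric hx, sum_add]
  simp only [Function.update_self, Function.update_of_ne (show (1 : Fin 2) ≠ 0 by decide),
    Function.update_of_ne (show (0 : Fin 2) ≠ 1 by decide), Fin.tail]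
  ring

namespace IsPull
variable {m r : ℕ} {g' g : MetricField m} {ψ : Coo m → Coo m} {V' V : Set (Coo m)} {x : Coo m}

lemma covAlong_jac_symm (h : IsPull g' g ψ V' V) (hx : x ∈ V') (a b e) :
    covAlong g ψ a (fun z => jac ψ z b) x e = covAlong g ψ b (fun z => jac ψ z a) x e := by
  simp only [covAlong]; congr 1
  · exact pd_comm h.isOpen hx (Sm.coord h.smooth e) a b
  · rw [sum_comm]
    refine sum_ext2 fun c d => ?_; rw [h.reg.christoffel_symm (h.maps x hx)]; simp only [jac]; ring

lemma covAlong_jac (h : IsPull g' g ψ V' V) (hx : x ∈ V') (a b e) :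
    covAlong g ψ a (fun z => jac ψ z b) x e = ∑ c, Γ g' x c a b * jac ψ x c e := by
  obtain ⟨N, hN, hN'⟩ := h.exists_inverse hx
  set S : Fin m → Fin m → Fin m → ℝ := fun c a b =>
    ∑ e, N e c * covAlong g ψ a (fun z => jac ψ z b) x e with hS
  have hSJ a b e : covAlong g ψ a (fun z => jac ψ z b) x e = ∑ c, S c a b * jac ψ x c e := by
    simp only [hS, sum_mul]; rw [sum_comm]
    have : ∀ e', ∑ c, N e' c * covAlong g ψ a (fun z => jac ψ z b) x e' * jac ψ x c e
      = (∑ c, N e' c * jac ψ x c e) * covAlong g ψ a (fun z => jac ψ z b) x e' := by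
      intro e'; rw [sum_mul]; exact sum_ext fun _ => by ring
    simp only [this, hN]; simp
  have hSs c a b : S c a b = S c b a := by simp only [hS, h.covAlong_jac_symm hx a b]
  have hm a b c : pd a (fun z => g' z b c) x = ∑ d, (S d a b * g' x d c + S d a c * g' x b d) := by
    have e1 : pd a (fun z => g' z b c) x
      = pd a (fun z => ev (metricTensor g (ψ z)) ![jac ψ z b, jac ψ z c]) x := by
      refine pd_congr h.isOpen hx fun z hz => ?_; rw [h.eq z hz, evalTensor_two]; rfl
    have hs I : Sm V fun x => metricTensor g x I := h.reg.smooth _ _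
    rw [e1, pd_evalTensor (g := g) h.reg.isOpen hs (h.maps x hx) (h.diffAt hx)]
    · have z0 : ∀ v, ev (cov g (metricTensor g) (ψ x)) v = 0 := by
        intro v; simp [evalTensor, h.reg.cov_metricTensor (h.maps x hx)]
      rw [z0, zero_add, Fin.sum_univ_two, sum_add]; congr 1
      · have : covAlong g ψ a (fun z => (![jac ψ z b, jac ψ z c] : Fin 2 → Fin m → ℝ) 0) x
            = fun e => ap (fun (_ : Unit) d => S d a b) () fun d => jac ψ x d e := by
          funext e; exact hSJ a b e
        rw [this, evalTensor_update_ap]; refine sum_ext fun d => ?_; dsimp only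
        rw [h.eq x hx, evalTensor_two]; rfl
      · have : covAlong g ψ a (fun z => (![jac ψ z b, jac ψ z c] : Fin 2 → Fin m → ℝ) 1) x
            = fun e => ap (fun (_ : Unit) d => S d a c) () fun d => jac ψ x d e := by
          funext e; exact hSJ a c e
        rw [this, evalTensor_update_ap]; refine sum_ext fun d => ?_; dsimp only
        rw [h.eq x hx, evalTensor_two]; rfl
    · intro j e
      fin_cases j
      · exact (h.smooth_jac b e).diffAt h.isOpen hx
      · exact (h.smooth_jac c e).diffAt h.isOpen hx
  rw [hSJ]; exact sum_ext fun c => by rw [h.reg'.christoffel_unique hx hSs hm]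

lemma cov_eq (h : IsPull g' g ψ V' V) {T' T : TensorField m r} (hT : ∀ I, Sm V fun x => T x I)
    (hTT : ∀ x ∈ V', ∀ I, T' x I = ev (T (ψ x)) fun j => jac ψ x (I j))
    (hx : x ∈ V') (I : Fin (r + 1) → Fin m) :
    cov g' T' x I = ev (cov g T (ψ x)) fun j => jac ψ x (I j) := by
  have e1 : pd (I 0) (fun z => T' z (Fin.tail I)) x
    = pd (I 0) (fun z => ev (T (ψ z)) fun j => jac ψ z (Fin.tail I j)) x :=
    pd_congr h.isOpen hx fun z hz => hTT z hz _
  rw [cov, e1, pd_evalTensor (g := g) h.reg.isOpen hT (h.maps x hx) (h.diffAt hx)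
    (fun j b => (h.smooth_jac _ b).diffAt h.isOpen hx)]
  have e2 : (Fin.cons (fun c => pd (I 0) (fun z => ψ z c) x)
    (fun j => jac ψ x (Fin.tail I j)) : Fin (r + 1) → Fin m → ℝ) = fun j => jac ψ x (I j) := by
    funext j; refine Fin.cases ?_ (fun i => ?_) j
    · rfl
    · rfl
  rw [e2, add_sub_assoc, ← sum_sub, sum_eq_zero, add_zero]; intro j _
  have e3 : covAlong g ψ (I 0) (fun z => jac ψ z (Fin.tail I j)) x = fun e =>
      ap (fun (_ : Unit) c => Γ g' x c (I 0) (I j.succ)) () fun c => jac ψ x c e := by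
    funext e; exact h.covAlong_jac hx _ _ _
  rw [e3, evalTensor_update_ap, sub_eq_zero]; refine sum_ext fun c => ?_; rw [hTT x hx]; dsimp only
  congr 2; funext i
  by_cases hi : i = j
  · subst hi; simp
  · simp [hi]

end IsPull

lemma MReg.cov_cov_one {m : ℕ} {g : MetricField m} {V : Set (Coo m)} {x} (hg : MReg g V)
    (hx : x ∈ V) {T : TensorField m 1} (hT : ∀ I, Sm V fun x => T x I) (a b c) :
    cov g (cov g T) x ![a, b, c] - cov g (cov g T) x ![b, a, c]
    = ∑ d, riemannUp g x a b c d * T x ![d] := by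
  have key a b : cov g (cov g T) x ![a, b, c] = pd a (pd b fun z => T z ![c]) x
    - (∑ e, (Γ g x e b c * pd a (fun z => T z ![e]) x + T x ![e] * pd a (fun z => Γ g z e b c) x))
    - (∑ e, Γ g x e a b * cov g T x ![e, c]) - ∑ e, Γ g x e a c * (pd b (fun z => T z ![e]) x
    - ∑ d, Γ g x d b e * T x ![d]) := by
    have e1 z b c : cov g T z ![b, c]
      = pd b (fun z => T z ![c]) z - ∑ e, Γ g z e b c * T z ![e] := by
      have t : Fin.tail ![b, c] = ![c] := by ext i; fin_cases i; rfl
      have t2 : ∀ e, update ![c] (0 : Fin 1) e = ![e] := by intro e; ext i; fin_cases i; rfl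
      simp only [cov]; rw [t, Fin.sum_univ_one]
      exact congrArg₂ (· - ·) rfl (sum_ext fun e => congrArg (fun q => Γ g z e b c * T z q) (t2 e))
    have h2 : cov g (cov g T) x ![a, b, c] = pd a (fun z => cov g T z ![b, c]) x
      - (∑ e, Γ g x e a b * cov g T x ![e, c]) - ∑ e, Γ g x e a c * cov g T x ![b, e] := by
      have t : Fin.tail ![a, b, c] = ![b, c] := by ext i; fin_cases i <;> rfl
      have t2 : ∀ e, update ![b, c] (0 : Fin 2) e = ![e, c] := by
        intro e; ext i; fin_cases i <;> rfl
      have t3 : ∀ e, update ![b, c] (1 : Fin 2) e = ![b, e] := by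
        intro e; ext i; fin_cases i <;> rfl
      simp only [cov]; rw [t, Fin.sum_univ_two, sub_sub]
      exact congrArg₂ (· - ·) rfl (congrArg₂ (· + ·)
        (sum_ext fun e => congrArg (fun q => Γ g x e a b * cov g T x q) (t2 e))
        (sum_ext fun e => congrArg (fun q => Γ g x e a c * cov g T x q) (t3 e)))
    rw [h2]; simp only [e1]
    rw [pd_sub (((hT _).pd hg _).diffAt hg hx)
      ((Sm.sum fun e _ => (hg.smooth_christoffel _ _ _).mul (hT _)).diffAt hg hx),
      pd_sum fun e _ => ((hg.smooth_christoffel _ _ _).mul (hT _)).diffAt hg hx]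
    congr 3; refine sum_ext fun e => ?_
    rw [pd_mul ((hg.smooth_christoffel _ _ _).diffAt hg hx) ((hT _).diffAt hg hx)]
  rw [key a b, key b a, pd_comm hg hx (hT _) a b]
  simp only [hg.christoffel_symm hx _ b a, riemannUp, mul_sub, sum_sub,
    sum_add, add_mul, sub_mul, mul_sum, sum_mul]
  rw [sum_comm (f := fun e i => Γ g x e a c * (Γ g x i b e * T x ![i])),
    sum_comm (f := fun e i => Γ g x e b c * (Γ g x i a e * T x ![i]))]
  simp only [mul_assoc, mul_comm (T x _)]; ring

namespace IsPull
variable {m r : ℕ} {g' g : MetricField m} {ψ : Coo m → Coo m} {V' V : Set (Coo m)} {x : Coo m}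

lemma riemannUp_eq (h : IsPull g' g ψ V' V) (hx : x ∈ V') (a b c e) :
    ∑ d, riemannUp g' x a b c d * jac ψ x d e
      = ap (jac ψ x) a fun a' => ap (jac ψ x) b fun b' => ap (jac ψ x) c fun c' =>
          riemannUp g (ψ x) a' b' c' e := by
  set T : TensorField m 1 := fun _ I => if I 0 = e then 1 else 0 with hTd
  set T' : TensorField m 1 := fun z I => jac ψ z (I 0) e with hTd'
  have hT I : Sm V fun x => T x I := Sm.const _
  have hT' I : Sm V' fun x => T' x I := h.smooth_jac _ _
  have h0 : ∀ x ∈ V', ∀ I, T' x I = ev (T (ψ x)) fun j => jac ψ x (I j) := by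
    intro x _ I; rw [evalTensor_one]; simp [hTd, hTd']
  have h1 : ∀ x ∈ V', ∀ I, cov g' T' x I = ev (cov g T (ψ x)) fun j => jac ψ x (I j) :=
    fun x hx I => h.cov_eq hT h0 hx I
  have h2 := h.cov_eq (h.reg.smooth_cov hT) h1 hx; have r' := h.reg'.cov_cov_one hx hT' a b c
  have r := fun a b c => h.reg.cov_cov_one (h.maps x hx) hT a b c
  rw [h2, h2, evalTensor_three, evalTensor_three] at r'; simp only [hTd', cons_val_zero] at r'
  rw [← r']
  have r2 a b c : riemannUp g (ψ x) a b c e = cov g (cov g T) (ψ x) ![a, b, c]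
      - cov g (cov g T) (ψ x) ![b, a, c] := by rw [r]; simp [hTd]
  simp only [r2, ap_sub]; congr 1; rw [ap_comm]; rfl

lemma riemann_eq (h : IsPull g' g ψ V' V) (hx : x ∈ V') (a b c d) : riemann g' x ![a, b, c, d]
      = ap (jac ψ x) a fun a' => ap (jac ψ x) b fun b' => ap (jac ψ x) c fun c' =>
          ap (jac ψ x) d fun d' => riemann g (ψ x) ![a', b', c', d'] := by
  have e1 : riemann g' x ![a, b, c, d] = ∑ p, (∑ e, riemannUp g' x a b c e * jac ψ x e p) *
    ap (jac ψ x) d fun q => g (ψ x) p q := by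
    simp only [riemann, cons_val, h.eq x hx, sum_mul]; rw [sum_comm]; refine sum_ext fun e => ?_
    simp only [ap, mul_sum]; exact sum_ext2 fun _ _ => by ring
  rw [e1]; simp only [h.riemannUp_eq hx, ap_mul]; simp only [mul_ap]; simp only [← ap_sum]; rfl

lemma ricci_eq_mtr {g : MetricField m} {V : Set (Coo m)} (hg : MReg g V) (hx : x ∈ V)
    (I : Fin 2 → Fin m) : ricci g x I = mtr (g x) fun c d => riemann g x ![I 0, c, I 1, d] := by
  simp only [ricci, mtr, riemann, cons_val]; refine sum_ext fun c => ?_; simp only [mul_sum]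
  rw [sum_comm]
  have : ∀ e, ∑ d, (g x)⁻¹ c d * (riemannUp g x (I 0) c (I 1) e * g x e d)
    = (∑ d, (g x)⁻¹ c d * g x d e) * riemannUp g x (I 0) c (I 1) e := by
    intro e; rw [sum_mul]; exact sum_ext fun d => by rw [hg.symm hx e d]; ring
  simp only [this, hg.inv_mul hx]; simp

lemma ricci_eq (h : IsPull g' g ψ V' V) (hx : x ∈ V') (I : Fin 2 → Fin m) :
    ricci g' x I = ap (jac ψ x) (I 0) fun a => ap (jac ψ x) (I 1) fun b =>
      ricci g (ψ x) ![a, b] := by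
  rw [ricci_eq_mtr h.reg' hx]
  simp only [ricci_eq_mtr h.reg (h.maps x hx), h.riemann_eq hx, mtr_ap, mtr_ap_left_ap,
    h.mtr_eq hx, cons_val]

lemma scalarCurv_eq (h : IsPull g' g ψ V' V) (hx : x ∈ V') :
    scalarCurv g' x = scalarCurv g (ψ x) := by
  have := h.mtr_eq hx fun a b => ricci g (ψ x) ![a, b]; rw [scalarCurv]; simp only [h.ricci_eq hx]
  exact this

lemma schouten_eq (h : IsPull g' g ψ V' V) (hx : x ∈ V') (I : Fin 2 → Fin m) :
    schouten g' x I = ap (jac ψ x) (I 0) fun a => ap (jac ψ x) (I 1) fun b =>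
      schouten g (ψ x) ![a, b] := by
  simp only [schouten, h.ricci_eq hx, h.scalarCurv_eq hx, h.eq x hx, mul_ap, ap_sub,
    cons_val, mul_sub]

lemma weyl_eq (h : IsPull g' g ψ V' V) (hx : x ∈ V') (I : Fin 4 → Fin m) : weyl g' x I
      = ap (jac ψ x) (I 0) fun a' => ap (jac ψ x) (I 1) fun b' => ap (jac ψ x) (I 2) fun c' =>
          ap (jac ψ x) (I 3) fun d' => weyl g (ψ x) ![a', b', c', d'] := by
  have hI : I = ![I 0, I 1, I 2, I 3] := by ext i; fin_cases i <;> rfl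
  rw [hI]; set P : Fin m → Fin m → ℝ := fun p q => schouten g (ψ x) ![p, q]
  set Q : Fin m → Fin m → ℝ := fun p q => g (ψ x) p q
  have e1 := ap_mul_ap_02_13 (jac ψ x) (I 0) (I 1) (I 2) (I 3) P Q
  have e2 := ap_mul_ap_13_02 (jac ψ x) (I 0) (I 1) (I 2) (I 3) P Q
  have e3 := ap_mul_ap_03_12 (jac ψ x) (I 0) (I 1) (I 2) (I 3) P Q
  have e4 := ap_mul_ap_12_03 (jac ψ x) (I 0) (I 1) (I 2) (I 3) P Q; simp only [P, Q] at e1 e2 e3 e4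
  simp only [weyl, h.riemann_eq hx, h.schouten_eq hx, h.eq x hx, ap_sub, ap_add,
    cons_val, e1, e2, e3, e4]

lemma cov_weyl_eq (h : IsPull g' g ψ V' V) (hx : x ∈ V') (I : Fin 5 → Fin m) :
    cov g' (weyl g') x I = ev (cov g (weyl g) (ψ x)) fun j => jac ψ x (I j) :=
  h.cov_eq h.reg.smooth_weyl
    (fun x hx I => by rw [h.weyl_eq hx, evalTensor_four]; rfl) hx I

lemma cov_cov_weyl_eq (h : IsPull g' g ψ V' V) (hx : x ∈ V') (I : Fin 6 → Fin m) :
    cov g' (cov g' (weyl g')) x I = ev (cov g (cov g (weyl g)) (ψ x)) fun j => jac ψ x (I j) :=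
    h.cov_eq (h.reg.smooth_cov h.reg.smooth_weyl) (fun _ hx I => h.cov_weyl_eq hx I) hx I

lemma cov_schouten_eq (h : IsPull g' g ψ V' V) (hx : x ∈ V') (I : Fin 3 → Fin m) :
    cov g' (schouten g') x I = ev (cov g (schouten g) (ψ x)) fun j => jac ψ x (I j) :=
  h.cov_eq h.reg.smooth_schouten
    (fun x hx I => by rw [h.schouten_eq hx, evalTensor_two]; rfl) hx I

lemma cotton_eq (h : IsPull g' g ψ V' V) (hx : x ∈ V') (I : Fin 3 → Fin m) :
    cotton g' x I = ap (jac ψ x) (I 0) fun a => ap (jac ψ x) (I 1) fun b =>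
      ap (jac ψ x) (I 2) fun c => cotton g (ψ x) ![a, b, c] := by
  simp only [cotton, h.cov_schouten_eq hx, evalTensor_three, cons_val, ap_sub]; congr 1
  rw [ap_comm]; rfl

lemma cov_cotton_eq (h : IsPull g' g ψ V' V) (hx : x ∈ V') (I : Fin 4 → Fin m) :
    cov g' (cotton g') x I
      = ap (jac ψ x) (I 0) fun a' => ap (jac ψ x) (I 1) fun b' => ap (jac ψ x) (I 2) fun c' =>
          ap (jac ψ x) (I 3) fun d' => cov g (cotton g) (ψ x) ![a', b', c', d'] := by
  rw [h.cov_eq h.reg.smooth_cotton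
    (fun x hx I => by rw [h.cotton_eq hx, evalTensor_three]; rfl) hx I, evalTensor_four]
  rfl

lemma bach_eq_mtr (g : MetricField m) (x) (I : Fin 2 → Fin m) :
    bach g x I = (mtr (g x) fun c d => cov g (cotton g) x ![c, d, I 0, I 1])
      + mtr (g x) fun c c' => mtr (g x) fun d d' =>
          weyl g x ![I 0, c, I 1, d] * schouten g x ![c', d'] := by
  simp only [bach, mtr, mul_sum, mul_assoc]

lemma bach_eq (h : IsPull g' g ψ V' V) (hx : x ∈ V') (I : Fin 2 → Fin m) :
    bach g' x I = ap (jac ψ x) (I 0) fun a => ap (jac ψ x) (I 1) fun b => bach g (ψ x) ![a, b] := by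
  simp only [bach_eq_mtr, h.cov_cotton_eq hx, h.weyl_eq hx, h.schouten_eq hx, ap_add,
    cons_val, h.mtr_eq hx, mtr_ap, ap_mul, mul_ap, mtr_ap_right_ap, h.mtr_eq' hx]

end IsPull

/-! ### Normal coordinates -/

lemma pd_coord {m : ℕ} (a b : Fin m) (x : Coo m) :
    pd a (fun z : Coo m => z b) x = if b = a then 1 else 0 := by
  have : HasFDerivAt (fun z : Coo m => z b) (EuclideanSpace.proj (𝕜 := ℝ) b) x :=
    (EuclideanSpace.proj (𝕜 := ℝ) b).hasFDerivAt
  rw [pd, this.fderiv]; simp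

lemma sm_coord {m : ℕ} (b) (V : Set (Coo m)) : Sm V fun z => z b :=
  (EuclideanSpace.proj (𝕜 := ℝ) b).contDiff.contDiffOn

lemma contDiffOn_coo {l m : ℕ} {U : Set (Coo l)} {f : Coo l → Coo m}
    (h : ∀ c, Sm U fun z => f z c) : ContDiffOn ℝ ∞ f U := contDiffOn_euclidean.2 h

/-- A point at which the metric is the identity and the Christoffel symbols vanish. -/
structure IsNormalAt {m : ℕ} (g : MetricField m) (p : Coo m) : Prop where
  one : g p = 1
  conn : ∀ c a b, Γ g p c a b = 0

/-- The quadratic coordinate change with prescribed differential `E` and second derivatives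
`-2 S` at the origin. -/
def quadMap {m : ℕ} (p : Coo m) (E : Fin m → Fin m → ℝ) (S : Fin m → Fin m → Fin m → ℝ)
    (x : Coo m) : Coo m :=
  WithLp.toLp 2 fun e => p e + (∑ a, x a * E a e) - (1 / 2) * ∑ a, ∑ b, x a * x b * S e a b

section Quad
variable {m : ℕ} (p : Coo m) (E : Fin m → Fin m → ℝ) (S : Fin m → Fin m → Fin m → ℝ)

lemma quadMap_zero : quadMap p E S 0 = p := by ext e; simp [quadMap]

lemma sm_quadMap (V : Set (Coo m)) (e) : Sm V fun z => quadMap p E S z e := by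
  simp only [quadMap]
  exact ((Sm.const _).add (Sm.sum fun a _ => (sm_coord a V).mul (Sm.const _))).sub
    ((Sm.const _).mul (Sm.sum fun a _ => Sm.sum fun b _ =>
      ((sm_coord a V).mul (sm_coord b V)).mul (Sm.const _)))

lemma contDiffOn_quadMap (V : Set (Coo m)) : ContDiffOn ℝ ∞ (quadMap p E S) V :=
  contDiffOn_coo fun c => sm_quadMap p E S V c

lemma jac_quadMap (hS : ∀ e a b, S e a b = S e b a) (x) (a e) :
    jac (quadMap p E S) x a e = E a e - ∑ b, x b * S e a b := by
  have hd : ∀ {F : Coo m → ℝ}, Sm Set.univ F → DifferentiableAt ℝ F x :=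
    fun h => h.diffAt isOpen_univ trivial
  have hc := fun b => sm_coord (m := m) b Set.univ; simp only [jac, quadMap]
  rw [pd_sub (hd ((Sm.const _).add (Sm.sum fun a _ => (hc a).mul (Sm.const _))))
      (hd ((Sm.const _).mul (Sm.sum fun a _ => Sm.sum fun b _ =>
        ((hc a).mul (hc b)).mul (Sm.const _)))),
    pd_add (hd (Sm.const _)) (hd (Sm.sum fun a _ => (hc a).mul (Sm.const _))), pd_const,
    pd_sum (fun a _ => hd ((hc a).mul (Sm.const _))),
    pd_const_mul _ (hd (Sm.sum fun a _ => Sm.sum fun b _ => ((hc a).mul (hc b)).mul (Sm.const _))),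
    pd_sum (fun a _ => hd (Sm.sum fun b _ => ((hc a).mul (hc b)).mul (Sm.const _)))]
  have e1 : ∀ i, pd a (fun z => z i * E i e) x = if i = a then E i e else 0 := by
    intro i; rw [pd_mul (hd (hc i)) (hd (Sm.const _)), pd_const, pd_coord]; split_ifs <;> ring
  have e2 : ∀ i, pd a (fun z => ∑ j, z i * z j * S e i j) x
    = ∑ j, ((if j = a then x i * S e i j else 0) + if i = a then x j * S e i j else 0) := by
    intro i; rw [pd_sum (fun j _ => hd (((hc i).mul (hc j)).mul (Sm.const _)))]
    refine sum_ext fun j => ?_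
    rw [pd_mul (hd ((hc i).mul (hc j))) (hd (Sm.const _)), pd_const,
      pd_mul (hd (hc i)) (hd (hc j)), pd_coord, pd_coord]
    split_ifs <;> ring
  simp only [e1, e2, sum_add, sum_ite_eq', mem_univ, if_true]
  have e3 : ∀ i, (∑ j, if i = a then x j * S e i j else 0)
      = if i = a then ∑ j, x j * S e i j else 0 := by intro i; split_ifs <;> simp
  simp only [e3, sum_ite_eq', mem_univ, if_true]
  have e4 : ∑ j, x j * S e j a = ∑ j, x j * S e a j := sum_ext fun j => by rw [hS]
  rw [e4]; ring

end Quad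

/-- The pull-back of a metric. -/
def pullMetric {m : ℕ} (g : MetricField m) (ψ : Coo m → Coo m) : MetricField m := fun x =>
  Matrix.of fun a b => ap (jac ψ x) a fun c => ap (jac ψ x) b fun d => g (ψ x) c d

lemma pullMetric_eq {m : ℕ} (g : MetricField m) (ψ : Coo m → Coo m) (x) :
    pullMetric g ψ x = Matrix.of (jac ψ x) * g (ψ x) * (Matrix.of (jac ψ x)).transpose := by
  ext a b; rw [← ap_ap_eq_matrix]; rfl

lemma IsPull.of_pullMetric {m : ℕ} {g : MetricField m} {V : Set (Coo m)} (hg : MReg g V)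
    {ψ : Coo m → Coo m} (hψ : ContDiff ℝ ∞ ψ) :
    IsPull (pullMetric g ψ) g ψ {x | ψ x ∈ V ∧ (Matrix.of (jac ψ x)).det ≠ 0} V := by
  have hj a c : Sm Set.univ fun z => jac ψ z a c := (Sm.coord hψ.contDiffOn c).pd isOpen_univ a
  have hdet : Continuous fun x => (Matrix.of (jac ψ x)).det := by
    have : Sm Set.univ fun x => (Matrix.of (jac ψ x)).det := Sm.det hj
    exact (contDiffOn_univ.1 this).continuous
  have hopen : IsOpen {x | ψ x ∈ V ∧ (Matrix.of (jac ψ x)).det ≠ 0} :=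
    (hg.isOpen.preimage hψ.continuous).inter (isOpen_ne.preimage hdet)
  refine ⟨⟨hopen, fun a b => ?_, fun x hx => ?_⟩, hg, hψ.contDiffOn, fun x hx => hx.1,
    fun x _ a b => rfl⟩
  · simp only [pullMetric, of_apply, ap]
    exact Sm.sum fun c _ => ((hj a c).mono (Set.subset_univ _)).mul (Sm.sum fun d _ =>
      ((hj b d).mono (Set.subset_univ _)).mul
        ((hg.smooth c d).comp hψ.contDiffOn fun x hx => hx.1))
  · have hp := hg.posDef _ hx.1
    rw [pullMetric_eq]
    have hu : IsUnit (Matrix.of (jac ψ x)) :=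
      (Matrix.isUnit_iff_isUnit_det _).2 (isUnit_iff_ne_zero.2 hx.2)
    have := hp.mul_mul_conjTranspose_same (B := Matrix.of (jac ψ x))
      (Matrix.vecMul_injective_iff_isUnit.2 hu)
    rwa [Matrix.conjTranspose_eq_transpose_of_trivial] at this

/-- Normal coordinates with a prescribed orthonormal frame at the centre. -/
lemma MReg.exists_normal {m : ℕ} {g : MetricField m} {V : Set (Coo m)} (hg : MReg g V)
    {p} (hp : p ∈ V) {E : Fin m → Fin m → ℝ}
    (hE : ∀ a b, (ap E a fun c => ap E b fun d => g p c d) = if a = b then 1 else 0) :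
    ∃ (g' : MetricField m) (ψ : Coo m → Coo m) (V' : Set (Coo m)), ContDiff ℝ ∞ ψ ∧
    IsPull g' g ψ V' V ∧ (0 : Coo m) ∈ V' ∧ ψ 0 = p ∧ (∀ a, jac ψ 0 a = E a) ∧ IsNormalAt g' 0 := by
  set S : Fin m → Fin m → Fin m → ℝ := fun e a b => ∑ c, ∑ d, Γ g p e c d * E a c * E b d with hSdef
  have hS : ∀ e a b, S e a b = S e b a := by
    intro e a b; simp only [hSdef]; rw [sum_comm]; refine sum_ext2 fun c d => ?_
    rw [hg.christoffel_symm hp]; ring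
  set ψ := quadMap p E S with hψd
  have hψ : ContDiff ℝ ∞ ψ := contDiffOn_univ.1 (contDiffOn_quadMap p E S Set.univ)
  have h0 : ψ 0 = p := quadMap_zero p E S
  have hJ : ∀ a, jac ψ 0 a = E a := by intro a; funext e; rw [hψd, jac_quadMap p E S hS]; simp
  have hJ' : jac ψ 0 = E := funext hJ; have hP := IsPull.of_pullMetric hg hψ
  have hone : pullMetric g ψ 0 = 1 := by
    ext a b; simp only [pullMetric, of_apply, hJ', h0, Matrix.one_apply]; exact hE a b
  have hmem : (0 : Coo m) ∈ {x | ψ x ∈ V ∧ (Matrix.of (jac ψ x)).det ≠ 0} := by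
    refine ⟨by rw [h0]; exact hp, fun hdet => ?_⟩
    have := congrArg Matrix.det (pullMetric_eq g ψ 0)
    rw [hone, Matrix.det_one, Matrix.det_mul, Matrix.det_mul, hdet] at this; simp at this
  refine ⟨pullMetric g ψ, ψ, _, hψ, hP, hmem, h0, hJ, hone, fun c a b => ?_⟩
  have hz : ∀ e, ∑ c, Γ (pullMetric g ψ) 0 c a b * jac ψ 0 c e = 0 := by
    intro e; rw [← hP.covAlong_jac hmem, covAlong]
    have e1 : pd a (fun z => jac ψ z b e) 0 = -S e a b := by
      have : (fun z => jac ψ z b e) = fun z => E b e - ∑ c, z c * S e b c := by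
        funext z; exact jac_quadMap p E S hS z b e
      have hd : ∀ {F : Coo m → ℝ}, Sm Set.univ F → DifferentiableAt ℝ F 0 :=
        fun h => h.diffAt isOpen_univ trivial
      have hc := fun b => sm_coord (m := m) b Set.univ
      rw [this, pd_sub (hd (Sm.const _)) (hd (Sm.sum fun c _ => (hc c).mul (Sm.const _))),
        pd_const, pd_sum fun c _ => hd ((hc c).mul (Sm.const _))]
      have e2 : ∀ i, pd a (fun z => z i * S e b i) 0 = if i = a then S e b i else 0 := by
        intro i; rw [pd_mul (hd (hc i)) (hd (Sm.const _)), pd_const, pd_coord]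
        split_ifs <;> simp
      simp [e2, hS e b a]
    have e3 : ∀ c, pd a (fun z => ψ z c) 0 = E a c := fun c => congrFun (hJ a) c; rw [e1, h0]
    simp only [e3, hJ, hSdef]; ring
  obtain ⟨N, -, hN⟩ := hP.exists_inverse hmem
  have : Γ (pullMetric g ψ) 0 c a b
    = ∑ e, (∑ c', Γ (pullMetric g ψ) 0 c' a b * jac ψ 0 c' e) * N e c := by
    simp only [sum_mul]; rw [sum_comm]; simp only [mul_assoc, ← mul_sum, hN]; simp
  rw [this]; simp [hz]

open scoped MatrixOrder Matrix.Norms.L2Operator in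
lemma exists_orthonormal_frame {m : ℕ} {G : Matrix (Fin m) (Fin m) ℝ} (hG : G.PosDef) :
    ∃ E : Fin m → Fin m → ℝ,
    ∀ a b, (ap E a fun c => ap E b fun d => G c d) = if a = b then 1 else 0 := by
  obtain ⟨B, hB⟩ := CStarAlgebra.nonneg_iff_eq_star_mul_self.mp hG.posSemidef.nonneg
  rw [Matrix.star_eq_conjTranspose, Matrix.conjTranspose_eq_transpose_of_trivial] at hB
  have hd : IsUnit B.det := by
    have := hG.det_pos.ne'; rw [hB, Matrix.det_mul, Matrix.det_transpose] at this
    exact isUnit_iff_ne_zero.2 fun h => this (by simp [h])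
  have hdt : IsUnit B.transpose.det := by rwa [Matrix.det_transpose]
  refine ⟨fun a b => (B.transpose)⁻¹ a b, fun a b => ?_⟩
  have e := ap_ap_eq_matrix (fun a b => (B.transpose)⁻¹ a b) G a b
  rw [show Matrix.of (fun a b => (B.transpose)⁻¹ a b) = (B.transpose)⁻¹ from rfl, hB,
    ← mul_assoc, Matrix.nonsing_inv_mul _ hdt, one_mul, Matrix.transpose_nonsing_inv,
    Matrix.transpose_transpose, Matrix.mul_nonsing_inv _ hd, Matrix.one_apply, ← hB] at e
  exact e

lemma MReg.exists_normal' {m : ℕ} {g : MetricField m} {V : Set (Coo m)} (hg : MReg g V)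
    {p} (hp : p ∈ V) : ∃ (g' : MetricField m) (ψ : Coo m → Coo m) (V' : Set (Coo m)),
    IsPull g' g ψ V' V ∧ (0 : Coo m) ∈ V' ∧ ψ 0 = p ∧ IsNormalAt g' 0 := by
  obtain ⟨E, hE⟩ := exists_orthonormal_frame (hg.posDef p hp)
  obtain ⟨g', ψ, V', -, h1, h2, h3, -, h4⟩ := hg.exists_normal hp hE
  exact ⟨g', ψ, V', h1, h2, h3, h4⟩

/-! ### Transfer of tensor identities -/

lemma evalTensor_perm {m r : ℕ} (σ : Equiv.Perm (Fin r)) (T : (Fin r → Fin m) → ℝ)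
    (v : Fin r → Fin m → ℝ) : ev (fun K => T fun j => K (σ j)) v = ev T fun j => v (σ j) := by
  simp only [evalTensor]
  refine Fintype.sum_equiv (Equiv.arrowCongr σ.symm (Equiv.refl _)) _ _ fun K => ?_
  simp only [Equiv.arrowCongr_apply, Equiv.coe_refl, Function.comp_def, Equiv.symm_symm, id]
  congr 1; exact (Equiv.prod_comp σ fun j => v j (K j)).symm

lemma evalTensor_mul {m p q r : ℕ} (e : Fin p ⊕ Fin q ≃ Fin r) (A : (Fin p → Fin m) → ℝ)
    (B : (Fin q → Fin m) → ℝ) (v : Fin r → Fin m → ℝ) :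
    ev (fun K => A (fun i => K (e (.inl i))) * B fun i => K (e (.inr i))) v
    = ev A (fun i => v (e (.inl i))) * ev B fun i => v (e (.inr i)) := by
  simp only [evalTensor, Finset.sum_mul_sum]; rw [← Fintype.sum_prod_type']
  refine Fintype.sum_equiv ((Equiv.arrowCongr e.symm (Equiv.refl (Fin m))).trans
    (Equiv.sumArrowEquivProdArrow _ _ _)) _ _ fun K => ?_
  have : ∏ j, v j (K j) = (∏ i, v (e (.inl i)) (K (e (.inl i))))
    * ∏ i, v (e (.inr i)) (K (e (.inr i))) := by
    rw [← Equiv.prod_comp e fun j => v j (K j), Fintype.prod_sum_type]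
  calc _ = (A (fun i => K (e (.inl i))) * ∏ i, v (e (.inl i)) (K (e (.inl i))))
        * (B (fun i => K (e (.inr i))) * ∏ i, v (e (.inr i)) (K (e (.inr i)))) := by rw [this]; ring
    _ = _ := rfl

lemma evalTensor_add {m r : ℕ} (S T : (Fin r → Fin m) → ℝ) (v : Fin r → Fin m → ℝ) :
    ev (fun K => S K + T K) v = ev S v + ev T v := by simp only [evalTensor, add_mul, sum_add]

lemma evalTensor_sub {m r : ℕ} (S T : (Fin r → Fin m) → ℝ) (v : Fin r → Fin m → ℝ) :
    ev (fun K => S K - T K) v = ev S v - ev T v := by simp only [evalTensor, sub_mul, sum_sub]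

lemma evalTensor_smul {m r : ℕ} (c : ℝ) (T : (Fin r → Fin m) → ℝ) (v : Fin r → Fin m → ℝ) :
    ev (fun K => c * T K) v = c * ev T v := by simp only [evalTensor, mul_sum, mul_assoc]

namespace IsPull
variable {m r : ℕ} {g' g : MetricField m} {ψ : Coo m → Coo m} {V' V : Set (Coo m)} {x : Coo m}

lemma evalTensor_injective (h : IsPull g' g ψ V' V) (hx : x ∈ V') {T : (Fin r → Fin m) → ℝ}
    (hT : ∀ I : Fin r → Fin m, ev T (fun j => jac ψ x (I j)) = 0) (I : Fin r → Fin m) : T I = 0 := by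
  induction r with
  | zero =>
    have := hT I; rw [evalTensor_zero'] at this; rw [← this]; congr 1; exact Subsingleton.elim _ _
  | succ r ih =>
    rw [← Fin.cons_self_tail I]; refine ih (T := fun K => T (Fin.cons (I 0) K)) (fun K => ?_) _
    refine h.ap_injective hx (F := fun a => ev (fun K' => T (Fin.cons a K'))
      fun j => jac ψ x (K j)) (fun a => ?_) (I 0)
    have := hT (Fin.cons a K); rw [evalTensor_cons] at this; exact this

end IsPull

/-! ### Curvature at normal points -/

namespace IsNormalAt
variable {m r : ℕ} {g : MetricField m} {V : Set (Coo m)} {p : Coo m}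

lemma apply (hn : IsNormalAt g p) (a b) : g p a b = if a = b then 1 else 0 := by
  rw [hn.one, Matrix.one_apply]

lemma inv_apply (hn : IsNormalAt g p) (a b) : (g p)⁻¹ a b = if a = b then 1 else 0 := by
  rw [hn.one, inv_one, Matrix.one_apply]

lemma mtr (hn : IsNormalAt g p) (F : Fin m → Fin m → ℝ) : mtr (g p) F = ∑ a, F a a := by
  rw [hn.one, mtr_one]

lemma pd_metric (hn : IsNormalAt g p) (hg : MReg g V) (hp : p ∈ V) (a b c) :
    pd a (fun z => g z b c) p = 0 := by rw [hg.pd_metric hp]; simp [hn.conn]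

lemma pd_inv (hn : IsNormalAt g p) (hg : MReg g V) (hp : p ∈ V) (a b c) :
    pd a (fun z => (g z)⁻¹ b c) p = 0 := by
  have h1 : pd a (fun z => ∑ d, (g z)⁻¹ b d * g z d c) p = 0 := by
    rw [pd_congr hg hp (G := fun _ => if b = c then 1 else 0)
      (fun z hz => hg.inv_mul hz b c), pd_const]
  rw [pd_sum fun d _ => ((hg.smooth_inv b d).mul (hg.smooth d c)).diffAt hg hp] at h1
  have h2 d : pd a (fun z => (g z)⁻¹ b d * g z d c) p
    = if d = c then pd a (fun z => (g z)⁻¹ b d) p else 0 := by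
    rw [pd_mul ((hg.smooth_inv b d).diffAt hg hp) ((hg.smooth d c).diffAt hg hp),
      hn.pd_metric hg hp, hn.apply]
    split_ifs <;> simp
  simpa [h2] using h1

lemma cov_eq (hn : IsNormalAt g p) (T : TensorField m r) (I : Fin (r + 1) → Fin m) :
    cov g T p I = pd (I 0) (fun z => T z (Fin.tail I)) p := by simp [cov, hn.conn]

lemma pd_mtr (hn : IsNormalAt g p) (hg : MReg g V) (hp : p ∈ V)
    {F : Coo m → Fin m → Fin m → ℝ} (hF : ∀ a b, Sm V fun z => F z a b) (c) :
    pd c (fun z => ConfSub.mtr (g z) (F z)) p = ∑ a, pd c (fun z => F z a a) p := by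
  simp only [ConfSub.mtr]
  have hd a b : Sm V fun z => (g z)⁻¹ a b * F z a b := (hg.smooth_inv a b).mul (hF a b)
  rw [pd_sum fun a _ => (Sm.sum fun b _ => hd a b).diffAt hg hp]; refine sum_ext fun a => ?_
  rw [pd_sum fun b _ => (hd a b).diffAt hg hp]
  have h2 b : pd c (fun z => (g z)⁻¹ a b * F z a b) p
    = if a = b then pd c (fun z => F z a b) p else 0 := by
    rw [pd_mul ((hg.smooth_inv a b).diffAt hg hp) ((hF a b).diffAt hg hp),
      hn.pd_inv hg hp, hn.inv_apply]
    split_ifs <;> simp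
  simp [h2]

lemma pd_christoffel (hn : IsNormalAt g p) (hg : MReg g V) (hp : p ∈ V) (e c a b) :
    pd e (fun z => Γ g z c a b) p
    = (1 / 2) * (pd e (pd a fun z => g z b c) p + pd e (pd b fun z => g z a c) p
    - pd e (pd c fun z => g z a b) p) := by
  have hs d : Sm V fun z => (pd a (fun z => g z b d) z + pd b (fun z => g z a d) z
    - pd d (fun z => g z a b) z) := (((hg.smooth b d).pd hg a).add ((hg.smooth a d).pd hg b)).sub
    ((hg.smooth a b).pd hg d)
  simp only [christoffel]
  rw [pd_const_mul _ ((Sm.sum fun d _ => (hg.smooth_inv c d).mul (hs d)).diffAt hg hp),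
    pd_sum fun d _ => ((hg.smooth_inv c d).mul (hs d)).diffAt hg hp]
  have h2 d : pd e (fun z => (g z)⁻¹ c d * (pd a (fun z => g z b d) z
    + pd b (fun z => g z a d) z - pd d (fun z => g z a b) z)) p
    = if c = d then pd e (fun z => pd a (fun z => g z b d) z
    + pd b (fun z => g z a d) z - pd d (fun z => g z a b) z) p else 0 := by
    rw [pd_mul ((hg.smooth_inv c d).diffAt hg hp) ((hs d).diffAt hg hp),
      hn.pd_inv hg hp, hn.inv_apply]
    split_ifs <;> simp
  simp only [h2, sum_ite_eq, mem_univ, if_true]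
  rw [pd_sub ((((hg.smooth b c).pd hg a).add ((hg.smooth a c).pd hg b)).diffAt hg hp)
    (((hg.smooth a b).pd hg c).diffAt hg hp), pd_add (((hg.smooth b c).pd hg a).diffAt hg hp)
    (((hg.smooth a c).pd hg b).diffAt hg hp)]

lemma riemannUp_eq (hn : IsNormalAt g p) (a b c d) : riemannUp g p a b c d
    = pd b (fun z => Γ g z d a c) p - pd a (fun z => Γ g z d b c) p := by simp [riemannUp, hn.conn]

lemma riemann_eq_up (hn : IsNormalAt g p) (I : Fin 4 → Fin m) :
    riemann g p I = riemannUp g p (I 0) (I 1) (I 2) (I 3) := by simp [riemann, hn.apply]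

lemma riemann_eq (hn : IsNormalAt g p) (hg : MReg g V) (hp : p ∈ V) (I : Fin 4 → Fin m) :
    riemann g p I = (1 / 2) * (pd (I 1) (pd (I 2) fun z => g z (I 0) (I 3)) p
    - pd (I 1) (pd (I 3) fun z => g z (I 0) (I 2)) p
    - pd (I 0) (pd (I 2) fun z => g z (I 1) (I 3)) p
    + pd (I 0) (pd (I 3) fun z => g z (I 1) (I 2)) p) := by
  rw [hn.riemann_eq_up, hn.riemannUp_eq, hn.pd_christoffel hg hp, hn.pd_christoffel hg hp,
    pd_comm hg hp (hg.smooth _ _) (I 1) (I 0)]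
  ring

lemma pd_riemannUp (hn : IsNormalAt g p) (hg : MReg g V) (hp : p ∈ V) (e a b c d) :
    pd e (fun z => riemannUp g z a b c d) p = pd e (pd b fun z => Γ g z d a c) p
    - pd e (pd a fun z => Γ g z d b c) p := by
  have hs := hg.smooth_christoffel
  have hΓ : ∀ a b c a' b' c', pd e (fun z => Γ g z a b c * Γ g z a' b' c') p = 0 := by
    intro a b c a' b' c'
    rw [pd_mul ((hs _ _ _).diffAt hg hp) ((hs _ _ _).diffAt hg hp)]; simp [hn.conn]
  simp only [riemannUp]
  rw [pd_add ((((hs _ _ _).pd hg _).sub ((hs _ _ _).pd hg _)).diffAt hg hp) ((Sm.sum fun f _ =>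
    ((hs _ _ _).mul (hs _ _ _)).sub ((hs _ _ _).mul (hs _ _ _))).diffAt hg hp), pd_sub
    (((hs _ _ _).pd hg _).diffAt hg hp) (((hs _ _ _).pd hg _).diffAt hg hp), pd_sum fun f _ =>
    (((hs _ _ _).mul (hs _ _ _)).sub ((hs _ _ _).mul (hs _ _ _))).diffAt hg hp]
  have this f : pd e (fun z => Γ g z f a c * Γ g z d b f - Γ g z f b c * Γ g z d a f) p = 0 := by
        rw [pd_sub (((hs _ _ _).mul (hs _ _ _)).diffAt hg hp)
      (((hs _ _ _).mul (hs _ _ _)).diffAt hg hp), hΓ, hΓ, sub_zero]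
  simp [this]

lemma pd_riemann (hn : IsNormalAt g p) (hg : MReg g V) (hp : p ∈ V) (e)
    (I : Fin 4 → Fin m) : pd e (fun z => riemann g z I) p
    = pd e (fun z => riemannUp g z (I 0) (I 1) (I 2) (I 3)) p := by
  simp only [riemann]; have hs := hg.smooth_riemannUp
  rw [pd_sum fun f _ => ((hs _ _ _ _).mul (hg.smooth _ _)).diffAt hg hp]
  have this f : pd e (fun z => riemannUp g z (I 0) (I 1) (I 2) f * g z f (I 3)) p
    = if f = I 3 then pd e (fun z => riemannUp g z (I 0) (I 1) (I 2) f) p else 0 := by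
    rw [pd_mul ((hs _ _ _ _).diffAt hg hp) ((hg.smooth _ _).diffAt hg hp),
      hn.pd_metric hg hp, hn.apply]
    split_ifs <;> simp
  simp [this]

lemma pd_riemann_cyclic (hn : IsNormalAt g p) (hg : MReg g V) (hp : p ∈ V) (a b c d e) :
    pd a (fun z => riemann g z ![b, c, d, e]) p + pd b (fun z => riemann g z ![c, a, d, e]) p
    + pd c (fun z => riemann g z ![a, b, d, e]) p = 0 := by
  simp only [hn.pd_riemann hg hp, hn.pd_riemannUp hg hp, cons_val, cons_val]
  have hs := hg.smooth_christoffel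
  rw [pd_comm hg hp (hs e b d) a c, pd_comm hg hp (hs e c d) a b, pd_comm hg hp (hs e a d) b c]
  ring

end IsNormalAt

/-! ### Symmetries of the curvature tensor -/

namespace MReg
variable {m r : ℕ} {g : MetricField m} {V : Set (Coo m)} {x : Coo m}

lemma riemann_natural {g' : MetricField m} {ψ : Coo m → Coo m} {V' : Set (Coo m)}
    (h : IsPull g' g ψ V' V) (hx : x ∈ V') (I : Fin 4 → Fin m) :
    riemann g' x I = ev (riemann g (ψ x)) fun j => jac ψ x (I j) := by
  have hI : I = ![I 0, I 1, I 2, I 3] := by ext i; fin_cases i <;> rfl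
  rw [evalTensor_four]
  conv_lhs => rw [hI, h.riemann_eq hx]
  rfl

lemma riemann_swap (g : MetricField m) (x) (a b c d) :
    riemann g x ![a, b, c, d] = -riemann g x ![b, a, c, d] := by
  simp only [riemann, riemannUp, cons_val, ← sum_neg]; refine sum_ext fun e => ?_
  simp only [sum_sub]; ring

lemma riemann_pair (hg : MReg g V) (hx : x ∈ V) (a b c d) :
    riemann g x ![a, b, c, d] = riemann g x ![c, d, a, b] := by
  obtain ⟨g', ψ, V', hP, h0, rfl, hn⟩ := hg.exists_normal' hx
  have key := hP.evalTensor_injective h0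
    (T := fun K => riemann g (ψ 0) K - riemann g (ψ 0) fun j =>
      K (((finRotate 4).trans (finRotate 4)) j))
    (fun I => by
      rw [evalTensor_sub, evalTensor_perm ((finRotate 4).trans (finRotate 4)), ← riemann_natural hP
        h0, ← riemann_natural hP h0 (fun j => I (((finRotate 4).trans (finRotate 4)) j)),
        hn.riemann_eq hP.reg' h0, hn.riemann_eq hP.reg' h0]
      have e0 : ((finRotate 4).trans (finRotate 4)) 0 = 2 := rfl
      have e1 : ((finRotate 4).trans (finRotate 4)) 1 = 3 := rfl
      have e2 : ((finRotate 4).trans (finRotate 4)) 2 = 0 := rfl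
      have e3 : ((finRotate 4).trans (finRotate 4)) 3 = 1 := rfl; simp only [e0, e1, e2, e3]
      have hs := hP.reg'.smooth; have ho := hP.isOpen
      have hsy a b c d : pd a (pd b fun z => g' z c d) 0 = pd a (pd b fun z => g' z d c) 0 :=
        pd_congr ho h0 fun z hz => hP.reg'.pd_symm hz b c d
      rw [hsy (I 3) (I 0), hsy (I 3) (I 1), hsy (I 2) (I 0), hsy (I 2) (I 1),
        pd_comm ho h0 (hs (I 1) (I 2)) (I 3) (I 0), pd_comm ho h0 (hs (I 0) (I 2)) (I 3) (I 1),
        pd_comm ho h0 (hs (I 1) (I 3)) (I 2) (I 0), pd_comm ho h0 (hs (I 0) (I 3)) (I 2) (I 1)]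
      ring) ![a, b, c, d]
  have e : (fun j => (![a, b, c, d] : Fin 4 → Fin m) (((finRotate 4).trans (finRotate 4)) j))
      = ![c, d, a, b] := by ext i; fin_cases i <;> rfl
  rw [e] at key; linarith

lemma riemann_cyclic (hg : MReg g V) (hx : x ∈ V) (a b c d) :
    riemann g x ![a, b, c, d] + riemann g x ![b, c, a, d] + riemann g x ![c, a, b, d] = 0 := by
  simp only [riemann, cons_val, ← sum_add, ← add_mul]
  refine sum_eq_zero fun e _ => mul_eq_zero_of_left ?_ _
  have hs q a b : pd q (fun z => Γ g z e a b) x = pd q (fun z => Γ g z e b a) x :=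
    pd_congr hg hx fun z hz => hg.christoffel_symm hz e a b
  simp only [riemannUp, sum_sub]
  simp only [hg.christoffel_symm hx _ b a, hg.christoffel_symm hx _ c a,
    hg.christoffel_symm hx _ c b, hs _ b a, hs _ c a, hs _ c b]
  ring

lemma ricci_symm (hg : MReg g V) (hx : x ∈ V) (a b) : ricci g x ![a, b] = ricci g x ![b, a] := by
  rw [IsPull.ricci_eq_mtr hg hx, IsPull.ricci_eq_mtr hg hx, ← hg.mtr_swap hx]; simp only [cons_val]
  simp only [hg.riemann_pair hx a]

lemma schouten_symm (hg : MReg g V) (hx : x ∈ V) (a b) :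
    schouten g x ![a, b] = schouten g x ![b, a] := by
  simp only [schouten, hg.ricci_symm hx a b, cons_val, hg.symm hx a b]

lemma weyl_swap (g : MetricField m) (x) (a b c d) :
    weyl g x ![a, b, c, d] = -weyl g x ![b, a, c, d] := by
  simp only [weyl, cons_val, riemann_swap g x a b]; ring

lemma weyl_pair (hg : MReg g V) (hx : x ∈ V) (a b c d) :
    weyl g x ![a, b, c, d] = weyl g x ![c, d, a, b] := by
  simp only [weyl, cons_val, hg.riemann_pair hx a b, hg.schouten_symm hx c a, hg.schouten_symm hx d
    b, hg.schouten_symm hx c b, hg.schouten_symm hx d a, hg.symm hx c a, hg.symm hx d b, hg.symm hx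
    c b, hg.symm hx d a]
  ring

lemma weyl_swap' (hg : MReg g V) (hx : x ∈ V) (a b c d) :
    weyl g x ![a, b, c, d] = -weyl g x ![a, b, d, c] := by
  rw [hg.weyl_pair hx, weyl_swap g x, hg.weyl_pair hx]

lemma weyl_cyclic (hg : MReg g V) (hx : x ∈ V) (a b c d) :
    weyl g x ![a, b, c, d] + weyl g x ![b, c, a, d] + weyl g x ![c, a, b, d] = 0 := by
  have := hg.riemann_cyclic hx a b c d; simp only [weyl, cons_val]
  rw [hg.schouten_symm hx c a, hg.schouten_symm hx c b, hg.schouten_symm hx b a, hg.symm hx c a,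
    hg.symm hx b a, hg.symm hx c b]
  linarith

lemma cotton_swap (g : MetricField m) (x) (a b c) :
    cotton g x ![a, b, c] = -cotton g x ![b, a, c] := by simp only [cotton, cons_val]; ring

lemma mtr_metric (hg : MReg g V) (hx : x ∈ V) : mtr (g x) (fun c d => g x c d) = m := by
  simp only [mtr]
  have this a : ∑ b, (g x)⁻¹ a b * g x a b = 1 := by
    have := hg.inv_mul hx a a; simp only [if_true] at this; rw [← this]
    exact sum_ext fun b => by rw [hg.symm hx a b]
  simp [this]

lemma mtr_mul_metric (hg : MReg g V) (hx : x ∈ V) (F : Fin m → ℝ) (b) :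
    mtr (g x) (fun c d => F d * g x b c) = F b := by
  simp only [mtr]; rw [sum_comm]
  have : ∀ d, ∑ c, (g x)⁻¹ c d * (F d * g x b c) = (∑ c, g x b c * (g x)⁻¹ c d) * F d := by
    intro d; rw [sum_mul]; exact sum_ext fun _ => by ring
  simp only [this, hg.mul_inv hx]; simp

lemma mtr_schouten (hg : MReg g V) (hx : x ∈ V) (hm : 3 ≤ m) :
    mtr (g x) (fun c d => schouten g x ![c, d]) = 1 / (2 * ((m : ℝ) - 1)) * scalarCurv g x := by
  have h1 : mtr (g x) (fun c d => ricci g x ![c, d]) = scalarCurv g x := rfl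
  have hm' : (3 : ℝ) ≤ m := by exact_mod_cast hm
  have h2 : (m : ℝ) - 2 ≠ 0 := by linarith
  have h3 : (m : ℝ) - 1 ≠ 0 := by linarith
  have e : (fun c d => schouten g x ![c, d]) = fun c d => 1 / ((m : ℝ) - 2) *
    (ricci g x ![c, d] - 1 / (2 * ((m : ℝ) - 1)) * scalarCurv g x * g x c d) := rfl
  rw [e, mtr_const_mul, mtr_sub, h1, mtr_const_mul (g x) _ fun c d => g x c d, hg.mtr_metric hx]
  field_simp; ring

lemma ricci_eq_schouten {g : MetricField m} {x} (hm : 3 ≤ m) (I : Fin 2 → Fin m) :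
    ricci g x I = ((m : ℝ) - 2) * schouten g x I
    + 1 / (2 * ((m : ℝ) - 1)) * scalarCurv g x * g x (I 0) (I 1) := by
  have hm' : (3 : ℝ) ≤ m := by exact_mod_cast hm
  have h2 : (m : ℝ) - 2 ≠ 0 := by linarith
  simp only [schouten]; field_simp; ring

lemma weyl_trace (hg : MReg g V) (hx : x ∈ V) (hm : 3 ≤ m) (a b) :
    mtr (g x) (fun c d => weyl g x ![a, c, b, d]) = 0 := by
  have e : (fun c d => weyl g x ![a, c, b, d]) = fun c d =>
      (riemann g x ![a, c, b, d] - schouten g x ![a, b] * g x c d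
        - schouten g x ![c, d] * g x a b) + schouten g x ![a, d] * g x b c
        + schouten g x ![b, c] * g x a d := by
    funext c d; simp only [weyl, cons_val]; rw [hg.symm hx c b, hg.schouten_symm hx c b]
  have h1 : mtr (g x) (fun c d => riemann g x ![a, c, b, d]) = ricci g x ![a, b] := by
    rw [IsPull.ricci_eq_mtr hg hx]; rfl
  rw [e, mtr_add, mtr_add, mtr_sub, mtr_sub, h1, mtr_const_mul (g x) _ fun c d => g x c d,
    hg.mtr_metric hx, mtr_mul_const, hg.mtr_schouten hx hm, hg.mtr_mul_metric hx (fun d => schouten g x ![a, d]),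
    ← hg.mtr_swap hx, hg.mtr_mul_metric hx (fun d => schouten g x ![b, d]),
    ricci_eq_schouten hm, hg.schouten_symm hx b a]
  simp only [cons_val]; ring

end MReg

/-! ### The Kronecker delta -/

/-- The Kronecker delta. -/
def kd {ι : Type*} [DecidableEq ι] (a b : ι) : ℝ := if a = b then 1 else 0

section Kd
variable {ι : Type*} [Fintype ι] [DecidableEq ι]

lemma kd_comm {ι : Type*} [DecidableEq ι] (a b : ι) : kd a b = kd b a := by simp only [kd, eq_comm]

lemma kd_self {ι : Type*} [DecidableEq ι] (a : ι) : kd a a = 1 := by simp [kd]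

lemma sum_kd_mul (F : ι → ℝ) (a : ι) : ∑ e, kd e a * F e = F a := by simp [kd]

lemma sum_kd_mul' (F : ι → ℝ) (a : ι) : ∑ e, kd a e * F e = F a := by simp [kd]

lemma sum_mul_kd (F : ι → ℝ) (a : ι) : ∑ e, F e * kd e a = F a := by simp [kd]

lemma sum_mul_kd' (F : ι → ℝ) (a : ι) : ∑ e, F e * kd a e = F a := by simp [kd]

end Kd

/-! ### Bianchi identities for the Weyl tensor -/

section Bianchi
variable {m : ℕ} {g : MetricField m} {V : Set (Coo m)} {p x : Coo m}

lemma IsNormalAt.kd_apply (hn : IsNormalAt g p) (a b) : g p a b = kd a b := hn.apply a b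

lemma IsNormalAt.cov_vecCons {r : ℕ} (hn : IsNormalAt g p) (T : TensorField m r) (a)
    (K : Fin r → Fin m) : cov g T p (Matrix.vecCons a K) = pd a (fun z => T z K) p := hn.cov_eq T _

lemma cov_vecCons {r : ℕ} (g : MetricField m) (T : TensorField m r) (x a)
    (K : Fin r → Fin m) : cov g T x (Matrix.vecCons a K) = pd a (fun z => T z K) x
    - ∑ j, ∑ c, Γ g x c a (K j) * T x (update K j c) := rfl

lemma IsNormalAt.cotton_eq (hn : IsNormalAt g p) (a b c) :
    cotton g p ![a, b, c] = pd a (fun z => schouten g z ![b, c]) p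
    - pd b (fun z => schouten g z ![a, c]) p := by
  simp only [cotton]; rw [hn.cov_vecCons, hn.cov_vecCons]; rfl

lemma IsNormalAt.pd_mul_metric (hn : IsNormalAt g p) (hg : MReg g V) (hp : p ∈ V)
    {F : Coo m → ℝ} (hF : Sm V F) (c a b) :
    pd c (fun z => F z * g z a b) p = pd c F p * kd a b := by
  rw [pd_mul (hF.diffAt hg hp) ((hg.smooth a b).diffAt hg hp),
    hn.pd_metric hg hp, hn.kd_apply]; ring

lemma IsNormalAt.pd_weyl (hn : IsNormalAt g p) (hg : MReg g V) (hp : p ∈ V) (a b c d e) :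
    pd a (fun z => weyl g z ![b, c, d, e]) p = pd a (fun z => riemann g z ![b, c, d, e]) p
    - pd a (fun z => schouten g z ![b, d]) p * kd c e
    - pd a (fun z => schouten g z ![c, e]) p * kd b d
    + pd a (fun z => schouten g z ![b, e]) p * kd c d
    + pd a (fun z => schouten g z ![c, d]) p * kd b e := by
  have hR := hg.smooth_riemann
  have hP I i j : Sm V fun z => schouten g z I * g z i j :=
    (hg.smooth_schouten I).mul (hg.smooth i j)
  have hd {F} (h : Sm V F) := h.diffAt hg hp; simp only [weyl, cons_val]
  rw [pd_add (hd ((((hR _).sub (hP _ _ _)).sub (hP _ _ _)).add (hP _ _ _))) (hd (hP _ _ _)),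
    pd_add (hd (((hR _).sub (hP _ _ _)).sub (hP _ _ _))) (hd (hP _ _ _)),
    pd_sub (hd ((hR _).sub (hP _ _ _))) (hd (hP _ _ _)), pd_sub (hd (hR _)) (hd (hP _ _ _))]
  simp only [hn.pd_mul_metric hg hp (hg.smooth_schouten _)]

/-- The difference of the two sides of the Bianchi identity for the Weyl tensor, before cyclic
summation. -/
def weylBianchi (g : MetricField m) : TensorField m 5 := fun x I =>
  cov g (weyl g) x I - (metricTensor g x ![I 2, I 3] * cotton g x ![I 0, I 1, I 4]
    - metricTensor g x ![I 2, I 4] * cotton g x ![I 0, I 1, I 3])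

lemma weylBianchi_natural {g' : MetricField m} {ψ : Coo m → Coo m} {V' : Set (Coo m)}
    (h : IsPull g' g ψ V' V) (hx : x ∈ V') (I : Fin 5 → Fin m) :
    weylBianchi g' x I = ev (weylBianchi g (ψ x)) fun j => jac ψ x (I j) := by
  have e1 := evalTensor_mul (⟨Sum.elim ![2, 3] ![0, 1, 4],
    ![.inr 0, .inr 1, .inl 0, .inl 1, .inr 2], by decide, by decide⟩ : Fin 2 ⊕ Fin 3 ≃ Fin 5)
    (metricTensor g (ψ x)) (cotton g (ψ x)) (fun j => jac ψ x (I j))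
  have e2 := evalTensor_mul (⟨Sum.elim ![2, 4] ![0, 1, 3],
    ![.inr 0, .inr 1, .inl 0, .inr 2, .inl 1], by decide, by decide⟩ : Fin 2 ⊕ Fin 3 ≃ Fin 5)
    (metricTensor g (ψ x)) (cotton g (ψ x)) (fun j => jac ψ x (I j))
  have c2 : ∀ (K : Fin 5 → Fin m) (i j : Fin 5), (fun l => K (![i, j] l)) = ![K i, K j] := by
    intro K i j; ext l; fin_cases l <;> rfl
  have c3 : ∀ (K : Fin 5 → Fin m) (i j l : Fin 5),
      (fun q => K (![i, j, l] q)) = ![K i, K j, K l] := by intro K i j l; ext q; fin_cases q <;> rfl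
  simp only [Equiv.coe_fn_mk, Sum.elim_inl, Sum.elim_inr, c2, c3] at e1 e2
  have hm : ∀ i j, metricTensor g' x ![i, j]
    = ev (metricTensor g (ψ x)) fun l => jac ψ x (![i, j] l) := by
    intro i j; rw [evalTensor_two]; exact h.eq x hx i j
  have hc : ∀ i j l, cotton g' x ![i, j, l]
    = ev (cotton g (ψ x)) fun q => jac ψ x (![i, j, l] q) := by
    intro i j l; rw [evalTensor_three, h.cotton_eq hx]; rfl
  have t2 : ∀ i j : Fin 5, (fun l => jac ψ x (![I i, I j] l)) = fun l => jac ψ x (I (![i, j] l)) := by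
    intro i j; funext l; fin_cases l <;> rfl
  have t3 : ∀ i j k : Fin 5, (fun l => jac ψ x (![I i, I j, I k] l))
      = fun l => jac ψ x (I (![i, j, k] l)) := by intro i j k; funext l; fin_cases l <;> rfl
  unfold weylBianchi; rw [evalTensor_sub, evalTensor_sub, e1, e2, h.cov_weyl_eq hx]
  simp only [hm, hc, t2, t3]

lemma MReg.weyl_bianchi (hg : MReg g V) (hx : x ∈ V) (a b c d e) :
    cov g (weyl g) x ![a, b, c, d, e] + cov g (weyl g) x ![b, c, a, d, e]
    + cov g (weyl g) x ![c, a, b, d, e]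
    = (g x c d * cotton g x ![a, b, e] - g x c e * cotton g x ![a, b, d])
    + (g x a d * cotton g x ![b, c, e] - g x a e * cotton g x ![b, c, d])
    + (g x b d * cotton g x ![c, a, e] - g x b e * cotton g x ![c, a, d]) := by
  obtain ⟨g', ψ, V', hP, h0, rfl, hn⟩ := hg.exists_normal' hx
  let σ : Equiv.Perm (Fin 5) := ⟨![1, 2, 0, 3, 4], ![2, 0, 1, 3, 4], by decide, by decide⟩
  have key := hP.evalTensor_injective h0
    (T := fun K => (weylBianchi g (ψ 0) K + weylBianchi g (ψ 0) fun j => K (σ j))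
      + weylBianchi g (ψ 0) fun j => K ((σ.trans σ) j)) (fun I => by
      rw [evalTensor_add, evalTensor_add, evalTensor_perm, evalTensor_perm,
        ← weylBianchi_natural hP h0, ← weylBianchi_natural hP h0 (fun j => I (σ j)),
        ← weylBianchi_natural hP h0 (fun j => I ((σ.trans σ) j))]
      have f0 : I = ![I 0, I 1, I 2, I 3, I 4] := by ext i; fin_cases i <;> rfl
      have f1 : (fun j => I (σ j)) = ![I 1, I 2, I 0, I 3, I 4] := by ext i; fin_cases i <;> rfl
      have f2 : (fun j => I ((σ.trans σ) j)) = ![I 2, I 0, I 1, I 3, I 4] := by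
        ext i; fin_cases i <;> rfl
      rw [f1, f2]
      conv_lhs => rw [f0]
      have hB := hn.pd_riemann_cyclic hP.reg' h0 (I 0) (I 1) (I 2) (I 3) (I 4)
      simp only [weylBianchi, hn.cov_vecCons, hn.pd_weyl hP.reg' h0, hn.cotton_eq, metricTensor,
        cons_val, hn.kd_apply]
      linear_combination hB) ![a, b, c, d, e]
  have f1 : (fun j => (![a, b, c, d, e] : Fin 5 → Fin m) (σ j)) = ![b, c, a, d, e] := by
    ext i; fin_cases i <;> rfl
  have f2 : (fun j => (![a, b, c, d, e] : Fin 5 → Fin m) ((σ.trans σ) j)) = ![c, a, b, d, e] := by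
    ext i; fin_cases i <;> rfl
  rw [f1, f2] at key; simp only [weylBianchi, metricTensor, cons_val] at key; linear_combination key

lemma IsNormalAt.cotton_cyclic (hn : IsNormalAt g p) (hg : MReg g V) (hp : p ∈ V)
    (a b c) : cotton g p ![a, b, c] + cotton g p ![b, c, a] + cotton g p ![c, a, b] = 0 := by
  have hs e a b : pd e (fun z => schouten g z ![a, b]) p = pd e (fun z => schouten g z ![b, a]) p :=
    pd_congr hg hp fun z hz => hg.schouten_symm hz a b
  simp only [hn.cotton_eq]; rw [hs b c a, hs c b a, hs a c b]; ring

lemma IsNormalAt.pd_weyl_trace (hn : IsNormalAt g p) (hg : MReg g V) (hp : p ∈ V) (hm : 3 ≤ m)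
    (e a b) : ∑ c, pd e (fun z => weyl g z ![a, c, b, c]) p = 0 := by
  rw [← hn.pd_mtr hg hp (F := fun z c d => weyl g z ![a, c, b, d]) (fun _ _ => hg.smooth_weyl _),
    pd_congr hg hp (G := fun _ => 0) (fun z hz => hg.weyl_trace hz hm a b), pd_const]

lemma IsNormalAt.weyl_trace (hn : IsNormalAt g p) (hg : MReg g V) (hp : p ∈ V) (hm : 3 ≤ m)
    (a b) : ∑ c, weyl g p ![a, c, b, c] = 0 := by
  have := hg.weyl_trace hp hm a b
  rwa [hn.mtr] at this

lemma MReg.pd_weyl_swap (g : MetricField m) (e a b c d) :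
    pd e (fun z => weyl g z ![a, b, c, d]) x = -pd e (fun z => weyl g z ![b, a, c, d]) x := by
  rw [← pd_neg]; congr 1; funext z; exact MReg.weyl_swap g z a b c d

lemma MReg.pd_weyl_pair (hg : MReg g V) (hx : x ∈ V) (e a b c d) :
    pd e (fun z => weyl g z ![a, b, c, d]) x = pd e (fun z => weyl g z ![c, d, a, b]) x :=
  pd_congr hg hx fun z hz => hg.weyl_pair hz a b c d

lemma MReg.pd_weyl_swap' (hg : MReg g V) (hx : x ∈ V) (e a b c d) :
    pd e (fun z => weyl g z ![a, b, c, d]) x = -pd e (fun z => weyl g z ![a, b, d, c]) x := by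
  rw [hg.pd_weyl_pair hx, MReg.pd_weyl_swap g, hg.pd_weyl_pair hx]

lemma IsNormalAt.div_weyl_aux (hn : IsNormalAt g p) (hg : MReg g V) (hp : p ∈ V) (hm : 3 ≤ m)
    (a b d : Fin m) : ∑ c, pd c (fun z => weyl g z ![a, b, d, c]) p
    = (3 - (m : ℝ)) * cotton g p ![a, b, d] + kd a d * ∑ c, cotton g p ![b, c, c]
    - kd b d * ∑ c, cotton g p ![a, c, c] := by
  have hB := fun c => hg.weyl_bianchi hp a b c d c; simp only [hn.cov_vecCons] at hB
  have s1 : ∑ c, pd a (fun z => weyl g z ![b, c, d, c]) p = 0 := hn.pd_weyl_trace hg hp hm a b d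
  have s2 : ∑ c, pd b (fun z => weyl g z ![c, a, d, c]) p = 0 := by
    have := hn.pd_weyl_trace hg hp hm b a d; rw [← neg_eq_zero, ← sum_neg, ← this]
    exact sum_ext fun c => by rw [MReg.pd_weyl_swap g]; ring
  have hS := sum_congr (rfl : (univ : Finset (Fin m)) = _) fun c _ => hB c
  simp only [sum_add, sum_sub, hn.kd_apply, s1, s2] at hS
  have t1 : ∑ c, kd c d * cotton g p ![a, b, c] = cotton g p ![a, b, d] :=
    sum_kd_mul (fun c => cotton g p ![a, b, c]) d
  have t2 : ∑ c : Fin m, kd c c * cotton g p ![a, b, d] = m * cotton g p ![a, b, d] := by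
    simp [kd_self]
  have t3 : ∑ c, kd a c * cotton g p ![b, c, d] = cotton g p ![b, a, d] :=
    sum_kd_mul' (fun c => cotton g p ![b, c, d]) a
  have t4 : ∑ c, kd b c * cotton g p ![c, a, d] = cotton g p ![b, a, d] :=
    sum_kd_mul' (fun c => cotton g p ![c, a, d]) b
  have t5 : ∑ c, kd a d * cotton g p ![b, c, c] = kd a d * ∑ c, cotton g p ![b, c, c] := by
    rw [mul_sum]
  have t6 : ∑ c, kd b d * cotton g p ![c, a, c] = -(kd b d * ∑ c, cotton g p ![a, c, c]) := by
    rw [mul_sum, ← sum_neg]; exact sum_ext fun c => by rw [MReg.cotton_swap g p c a c]; ring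
  rw [t1, t2, t3, t4, t5, t6, MReg.cotton_swap g p b a d] at hS; linarith

lemma IsNormalAt.cotton_trace (hn : IsNormalAt g p) (hg : MReg g V) (hp : p ∈ V) (hm : 3 ≤ m)
    (b : Fin m) : ∑ c, cotton g p ![b, c, c] = 0 := by
  have h := fun a => hn.div_weyl_aux hg hp hm a b a
  have hS := sum_congr (rfl : (univ : Finset (Fin m)) = _) fun a _ => h a
  have e0 : ∑ a, ∑ c, pd c (fun z => weyl g z ![a, b, a, c]) p = 0 := by
    rw [sum_comm]; refine sum_eq_zero fun c _ => ?_; rw [← hn.pd_weyl_trace hg hp hm c b c]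
    exact sum_ext fun a => by rw [MReg.pd_weyl_swap g, hg.pd_weyl_swap' hp]; ring
  simp only [sum_add, sum_sub, ← mul_sum, e0] at hS
  have e1 : ∑ a, cotton g p ![a, b, a] = -∑ c, cotton g p ![b, c, c] := by
    rw [← sum_neg]; exact sum_ext fun a => MReg.cotton_swap g p a b a
  have e2 : ∑ a : Fin m, kd a a * ∑ c, cotton g p ![b, c, c] = m * ∑ c, cotton g p ![b, c, c] := by
    simp [kd_self]
  have e3 : ∑ a, kd b a * ∑ c, cotton g p ![a, c, c] = ∑ c, cotton g p ![b, c, c] :=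
    sum_kd_mul' (fun a => ∑ c, cotton g p ![a, c, c]) b
  rw [e1, e2, e3] at hS; have hm' : (3 : ℝ) ≤ m := by exact_mod_cast hm
  have : (2 * (m : ℝ) - 4) * ∑ c, cotton g p ![b, c, c] = 0 := by linarith
  rcases mul_eq_zero.1 this with h | h
  · linarith
  · exact h

lemma IsNormalAt.div_weyl (hn : IsNormalAt g p) (hg : MReg g V) (hp : p ∈ V) (hm : 3 ≤ m) (a b d) :
    ∑ c, pd c (fun z => weyl g z ![a, b, c, d]) p = ((m : ℝ) - 3) * cotton g p ![a, b, d] := by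
  have h := hn.div_weyl_aux hg hp hm a b d
  rw [hn.cotton_trace hg hp hm, hn.cotton_trace hg hp hm] at h
  have : ∑ c, pd c (fun z => weyl g z ![a, b, c, d]) p
    = -∑ c, pd c (fun z => weyl g z ![a, b, d, c]) p := by
    rw [← sum_neg]; exact sum_ext fun c => hg.pd_weyl_swap' hp c a b c d
  rw [this, h]; ring

lemma evalTensor_five {m : ℕ} (T : (Fin 5 → Fin m) → ℝ) (v : Fin 5 → Fin m → ℝ) :
    ev T v = ∑ a, v 0 a * ∑ b, v 1 b * ∑ c, v 2 c * ∑ d, v 3 d * ∑ e, v 4 e *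
      T ![a, b, c, d, e] := by rw [evalTensor_cons]; simp only [evalTensor_four]; rfl

lemma IsPull.cov_weyl_ap {g' : MetricField m} {ψ : Coo m → Coo m} {V' : Set (Coo m)}
    (h : IsPull g' g ψ V' V) (hx : x ∈ V') (a b c d e) : cov g' (weyl g') x ![a, b, c, d, e]
      = ap (jac ψ x) a fun a' => ap (jac ψ x) b fun b' => ap (jac ψ x) c fun c' =>
          ap (jac ψ x) d fun d' => ap (jac ψ x) e fun e' =>
          cov g (weyl g) (ψ x) ![a', b', c', d', e'] := by
  rw [h.cov_weyl_eq hx, evalTensor_five]; rfl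

lemma MReg.div_weyl (hg : MReg g V) (hx : x ∈ V) (hm : 3 ≤ m) (a b d) :
    (mtr (g x) fun c e => cov g (weyl g) x ![c, a, b, e, d])
    = ((m : ℝ) - 3) * cotton g x ![a, b, d] := by
  obtain ⟨g', ψ, V', hP, h0, rfl, hn⟩ := hg.exists_normal' hx
  have key := hP.evalTensor_injective h0
    (T := fun K => (mtr (g (ψ 0)) fun c e => cov g (weyl g) (ψ 0) ![c, K 0, K 1, e, K 2])
      - ((m : ℝ) - 3) * cotton g (ψ 0) ![K 0, K 1, K 2]) (fun I => by
      have e1 := hn.div_weyl hP.reg' h0 hm (I 0) (I 1) (I 2); rw [← sub_eq_zero] at e1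
      rw [← e1, evalTensor_three, hP.cotton_eq h0]; simp only [← hn.cov_vecCons]
      rw [← hn.mtr (fun c e => cov g' (weyl g') 0 ![c, I 0, I 1, e, I 2])]
      simp only [hP.cov_weyl_ap h0, mtr_ap, mtr_ap_left_ap, hP.mtr_eq h0, cons_val]
      rw [mul_ap]; simp only [mul_ap, ← ap_sub]
      rfl) ![a, b, d]
  simp only [cons_val] at key; linarith

lemma IsNormalAt.ricci_identity {r : ℕ} (hn : IsNormalAt g p) (hg : MReg g V) (hp : p ∈ V)
    {T : TensorField m r} (hT : ∀ I, Sm V fun x => T x I) (a b) (K : Fin r → Fin m) :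
    cov g (cov g T) p (Matrix.vecCons a (Matrix.vecCons b K))
    - cov g (cov g T) p (Matrix.vecCons b (Matrix.vecCons a K))
    = ∑ j, ∑ c, riemannUp g p a b (K j) c * T p (update K j c) := by
  have key a b : cov g (cov g T) p (Matrix.vecCons a (Matrix.vecCons b K))
    = pd a (pd b fun z => T z K) p
    - ∑ j, ∑ c, pd a (fun z => Γ g z c b (K j)) p * T p (update K j c) := by
    rw [hn.cov_vecCons]; simp only [ConfSub.cov_vecCons]
    have hs j c : Sm V fun z => Γ g z c b (K j) * T z (update K j c) := (hg.smooth_christoffel _ _ _).mul (hT _)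
    rw [pd_sub (((hT _).pd hg _).diffAt hg hp) ((Sm.sum fun j _ => Sm.sum fun c _ => hs j c).diffAt
      hg hp), pd_sum fun j _ => (Sm.sum fun c _ => hs j c).diffAt hg hp]
    congr 1; refine sum_ext fun j => ?_; rw [pd_sum fun c _ => (hs j c).diffAt hg hp]
    refine sum_ext fun c => ?_
    rw [pd_mul ((hg.smooth_christoffel _ _ _).diffAt hg hp) ((hT _).diffAt hg hp), hn.conn]; ring
  rw [key, key, pd_comm hg hp (hT K) a b]; simp only [hn.riemannUp_eq, sub_mul, sum_sub]; ring

end Bianchi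

/-! ### Conformal changes of a metric -/

/-- The metric `exp (2 v) g`. -/
def confMetric {m : ℕ} (v : Coo m → ℝ) (g : MetricField m) : MetricField m := fun x =>
  exp (2 * v x) • g x

/-- The differential of a function as a tensor field of rank one. -/
def dform {m : ℕ} (v : Coo m → ℝ) : TensorField m 1 := fun x I => pd (I 0) v x

/-- The squared length of the differential of `v`. -/
def gradSq {m : ℕ} (v : Coo m → ℝ) (g : MetricField m) (x : Coo m) : ℝ :=
  mtr (g x) fun a b => pd a v x * pd b v x

/-- The tensor `∇ₐ∇ᵦv - ∇ₐv ∇ᵦv + |dv|² g_{ab} / 2`, by which the Schouten tensor changes. -/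
def confSchouten {m : ℕ} (v : Coo m → ℝ) (g : MetricField m) : TensorField m 2 := fun x I =>
  cov g (dform v) x I - pd (I 0) v x * pd (I 1) v x + 1 / 2 * gradSq v g x * g x (I 0) (I 1)

lemma exp_mul_exp_neg (x : ℝ) : exp (2 * x) * exp (-2 * x) = 1 := by rw [← Real.exp_add]; simp

lemma exp_neg_four_mul (x : ℝ) : exp (-4 * x) = exp (-2 * x) * exp (-2 * x) := by
  rw [← Real.exp_add]; ring_nf

section Conf
variable {m : ℕ} {g : MetricField m} {V : Set (Coo m)} {x p : Coo m} {v : Coo m → ℝ}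

local notation "g⋆" => confMetric v g
local notation "Λ" => confSchouten v g p
local notation:max "∂" a:max => pd a v p

lemma confMetric_apply (a b) : g⋆ x a b = exp (2 * v x) * g x a b := rfl

lemma mtr_confMetric (F : Fin m → Fin m → ℝ) : mtr (g⋆ x) F = exp (-2 * v x) * mtr (g x) F := by
  rw [confMetric, mtr_smul, ← Real.exp_neg]; ring_nf

lemma MReg.conf (hg : MReg g V) (hv : Sm V v) : MReg g⋆ V where
  isOpen := hg
  smooth a b := ((Sm.const 2).mul hv).exp.mul (hg.smooth a b)
  posDef x hx := (hg.posDef x hx).smul (Real.exp_pos _)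

lemma pd_confMetric (hg : MReg g V) (hv : Sm V v) (hx : x ∈ V) (a b c) : pd a (fun z => g⋆ z b c) x
    = exp (2 * v x) * (pd a (fun z => g z b c) x + 2 * pd a v x * g x b c) := by
  have hd := hv.diffAt hg hx; simp only [confMetric_apply]
  rw [pd_mul (((Sm.const 2).mul hv).exp.diffAt hg hx) ((hg.smooth b c).diffAt hg hx),
    pd_exp (((Sm.const 2).mul hv).diffAt hg hx), pd_const_mul 2 hd]
  ring

lemma christoffel_conf (hg : MReg g V) (hv : Sm V v) (hx : x ∈ V) (c a b) :
    Γ g⋆ x c a b = Γ g x c a b + kd c a * pd b v x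
    + kd c b * pd a v x - g x a b * ∑ d, (g x)⁻¹ c d * pd d v x := by
  refine (hg.conf hv).christoffel_unique hx (S := fun c a b => Γ g x c a b
    + kd c a * pd b v x + kd c b * pd a v x - g x a b * ∑ d, (g x)⁻¹ c d * pd d v x) ?_ ?_ c a b
  · intro c a b
    rw [hg.christoffel_symm hx, hg.symm hx a b]; ring
  · intro a b c
    have key b : ∑ d, g x b d * ∑ e, (g x)⁻¹ d e * pd e v x = pd b v x := by
      simp only [mul_sum, ← mul_assoc]; rw [sum_comm]; simp only [← sum_mul, hg.mul_inv hx]; simp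
    have k1 := key b
    have k2 : ∑ d, g x d c * ∑ e, (g x)⁻¹ d e * pd e v x = pd c v x := by
      rw [← key c]; exact sum_ext fun d => by rw [hg.symm hx]
    rw [pd_confMetric hg hv hx, hg.pd_metric hx]; simp only [confMetric_apply]
    have e d : (Γ g x d a b + kd d a * pd b v x + kd d b * pd a v x
          - g x a b * ∑ e, (g x)⁻¹ d e * pd e v x) * (exp (2 * v x) * g x d c)
        + (Γ g x d a c + kd d a * pd c v x + kd d c * pd a v x
          - g x a c * ∑ e, (g x)⁻¹ d e * pd e v x) * (exp (2 * v x) * g x b d)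
        = exp (2 * v x) * ((Γ g x d a b * g x d c + Γ g x d a c * g x b d)
          + pd b v x * (kd d a * g x d c) + pd a v x * (kd d b * g x d c)
          - g x a b * (g x d c * ∑ e, (g x)⁻¹ d e * pd e v x)
          + pd c v x * (kd d a * g x b d) + pd a v x * (kd d c * g x b d)
          - g x a c * (g x b d * ∑ e, (g x)⁻¹ d e * pd e v x)) := by ring
    simp only [e, ← mul_sum, sum_add, sum_sub, sum_kd_mul, k1, k2]; rw [hg.symm hx b a]; ring

lemma IsPull.conf {g' : MetricField m} {ψ : Coo m → Coo m} {V' : Set (Coo m)}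
    (h : IsPull g' g ψ V' V) (hv : Sm V v) :
    IsPull (confMetric (fun z => v (ψ z)) g') g⋆ ψ V' V where
  reg' := h.reg'.conf (hv.comp h.smooth h.maps)
  reg := h.reg.conf hv
  smooth := h.smooth
  maps := h.maps
  eq x hx a b := by simp only [confMetric_apply, h.eq x hx, mul_ap]

lemma IsPull.pd_comp {g' : MetricField m} {ψ : Coo m → Coo m} {V' : Set (Coo m)}
    (h : IsPull g' g ψ V' V) (hv : Sm V v) (hx : x ∈ V') (a) :
    pd a (fun z => v (ψ z)) x = ap (jac ψ x) a fun c => pd c v (ψ x) :=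
  ConfSub.pd_comp (hv.diffAt h.reg (h.maps x hx)) (h.diffAt hx)

lemma smooth_dform (hg : MReg g V) (hv : Sm V v) (I : Fin 1 → Fin m) :
    Sm V fun x => dform v x I := hv.pd hg _

lemma smooth_gradSq (hg : MReg g V) (hv : Sm V v) : Sm V (gradSq v g) := by
  unfold gradSq mtr
  exact Sm.sum fun a _ => Sm.sum fun b _ => (hg.smooth_inv a b).mul ((hv.pd hg a).mul (hv.pd hg b))

lemma smooth_confSchouten (hg : MReg g V) (hv : Sm V v) (I : Fin 2 → Fin m) :
    Sm V fun x => confSchouten v g x I :=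
  ((hg.smooth_cov (smooth_dform hg hv) I).sub ((hv.pd hg _).mul (hv.pd hg _))).add
    (((Sm.const _).mul (smooth_gradSq hg hv)).mul (hg.smooth _ _))

lemma IsPull.confSchouten_eq {g' : MetricField m} {ψ : Coo m → Coo m} {V' : Set (Coo m)}
    (h : IsPull g' g ψ V' V) (hv : Sm V v) (hx : x ∈ V') (I : Fin 2 → Fin m) :
    confSchouten (fun z => v (ψ z)) g' x I
    = ap (jac ψ x) (I 0) fun a => ap (jac ψ x) (I 1) fun b => confSchouten v g (ψ x) ![a, b] := by
  have e1 := h.cov_eq (smooth_dform h.reg hv) (T' := dform fun z => v (ψ z))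
    (fun x hx I => by rw [evalTensor_one]; exact h.pd_comp hv hx (I 0)) hx I
  rw [evalTensor_two] at e1
  simp only [confSchouten, e1, gradSq, h.pd_comp hv hx, h.eq x hx, ap_mul, mul_ap, ap_sub, ap_add,
    h.mtr_eq' hx, cons_val]
  rw [ap_comm (jac ψ x) (I 1)]; rfl

namespace IsNormalAt

lemma gradSq_eq (hn : IsNormalAt g p) : gradSq v g p = ∑ a, ∂a * ∂a := by rw [gradSq, hn.mtr]

lemma confSchouten_eq (hn : IsNormalAt g p) (a b) : Λ ![a, b] = pd a (pd b v) p - ∂a * ∂b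
    + 1 / 2 * gradSq v g p * kd a b := by
  simp only [confSchouten, cons_val, hn.kd_apply]; rw [hn.cov_vecCons]; rfl

lemma christoffel_conf (hn : IsNormalAt g p) (hg : MReg g V) (hv : Sm V v) (hp : p ∈ V)
    (c a b) : Γ g⋆ p c a b = kd c a * ∂b + kd c b * ∂a - kd a b * ∂c := by
  rw [ConfSub.christoffel_conf hg hv hp, hn.conn, hn.kd_apply]; simp only [hn.inv_apply]; simp

lemma pd_christoffel_conf (hn : IsNormalAt g p) (hg : MReg g V) (hv : Sm V v) (hp : p ∈ V)
    (e c a b) : pd e (fun z => Γ g⋆ z c a b) p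
    = pd e (fun z => Γ g z c a b) p + kd c a * pd e (pd b v) p
    + kd c b * pd e (pd a v) p - kd a b * pd e (pd c v) p := by
  have hd {F} (h : Sm V F) := h.diffAt hg hp; have hy := fun a => hv.pd hg a
  have hi := fun d => (hg.smooth_inv c d).mul (hy d)
  have hs : Sm V fun z => ∑ d, (g z)⁻¹ c d * pd d v z := Sm.sum fun d _ => hi d
  rw [pd_congr hg hp fun z hz => ConfSub.christoffel_conf hg hv hz c a b, pd_sub
    (hd (((hg.smooth_christoffel c a b).add ((Sm.const _).mul (hy b))).add ((Sm.const _).mul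
    (hy a)))) (hd ((hg.smooth a b).mul hs)), pd_add (hd ((hg.smooth_christoffel c a b).add
    ((Sm.const _).mul (hy b)))) (hd ((Sm.const _).mul (hy a))), pd_add (hd (hg.smooth_christoffel c
    a b)) (hd ((Sm.const _).mul (hy b))), pd_const_mul _ (hd (hy _)), pd_const_mul _ (hd (hy _)),
    pd_mul (hd (hg.smooth a b)) (hd hs), pd_sum fun d _ => hd (hi d), hn.pd_metric hg hp,
    hn.kd_apply]
  have this d : pd e (fun z => (g z)⁻¹ c d * pd d v z) p = kd c d * pd e (pd d v) p := by
    rw [pd_mul (hd (hg.smooth_inv c d)) (hd (hy d)), hn.pd_inv hg hp, hn.inv_apply]; simp [kd]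
  simp only [this, sum_kd_mul']; ring

lemma riemannUp_conf (hn : IsNormalAt g p) (hg : MReg g V) (hv : Sm V v) (hp : p ∈ V)
    (a b c d) : riemannUp g⋆ p a b c d = riemannUp g p a b c d
    - (Λ ![a, c] * kd b d + Λ ![b, d] * kd a c - Λ ![a, d] * kd b c - Λ ![b, c] * kd a d) := by
  rw [hn.riemannUp_eq]
  simp only [riemannUp, hn.pd_christoffel_conf hg hv hp, hn.christoffel_conf hg hv hp,
    hn.confSchouten_eq]
  have e e : (kd e a * ∂c + kd e c * ∂a - kd a c * ∂e) * (kd d b * ∂e + kd d e * ∂b - kd b e * ∂d)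
      - (kd e b * ∂c + kd e c * ∂b - kd b c * ∂e) * (kd d a * ∂e + kd d e * ∂a - kd a e * ∂d)
      = kd e a * (∂c * (kd d b * ∂e + kd d e * ∂b - kd b e * ∂d))
      + kd e c * (∂a * (kd d b * ∂e + kd d e * ∂b - kd b e * ∂d))
      - kd e b * (∂c * (kd d a * ∂e + kd d e * ∂a - kd a e * ∂d))
      - kd e c * (∂b * (kd d a * ∂e + kd d e * ∂a - kd a e * ∂d))
      - kd a c * kd d b * (∂e * ∂e) - kd a c * ∂b * (kd d e * ∂e) + kd a c * ∂d * (kd b e * ∂e)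
      + kd b c * kd d a * (∂e * ∂e) + kd b c * ∂a * (kd d e * ∂e)
      - kd b c * ∂d * (kd a e * ∂e) := by ring
  simp only [e, sum_add, sum_sub, ← mul_sum, sum_kd_mul, sum_kd_mul', ← hn.gradSq_eq]
  rw [kd_comm d a, kd_comm d b, kd_comm d c, kd_comm b a]; rw [pd_comm hg hp hv b a]; ring

lemma ricci_conf (hn : IsNormalAt g p) (hg : MReg g V) (hv : Sm V v) (hp : p ∈ V)
    (a b) : ricci g⋆ p ![a, b] = ricci g p ![a, b] - (((m : ℝ) - 2) * Λ ![a, b]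
    + kd a b * ∑ c, Λ ![c, c]) := by
  simp only [ricci, cons_val, hn.riemannUp_conf hg hv hp, kd_self, sum_add, sum_sub, ← sum_mul,
    sum_mul_kd, sum_mul_kd', mul_one, sum_const]
  ring

lemma scalarCurv_eq (hn : IsNormalAt g p) : scalarCurv g p = ∑ a, ricci g p ![a, a] := hn.mtr _

lemma schouten_conf (hn : IsNormalAt g p) (hg : MReg g V) (hv : Sm V v) (hp : p ∈ V)
    (hm : 3 ≤ m) (a b) : schouten g⋆ p ![a, b] = schouten g p ![a, b] - Λ ![a, b] := by
  have hm' : (3 : ℝ) ≤ m := by exact_mod_cast hm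
  have h2 : (m : ℝ) - 2 ≠ 0 := by linarith
  have h3 : (m : ℝ) - 1 ≠ 0 := by linarith
  have hs : scalarCurv g⋆ p = exp (-2 * v p) *
    (scalarCurv g p - 2 * ((m : ℝ) - 1) * ∑ c, Λ ![c, c]) := by
    have : scalarCurv g⋆ p = ConfSub.mtr (g⋆ p) fun a b => ricci g⋆ p ![a, b] := rfl
    rw [this, mtr_confMetric, hn.mtr, hn.scalarCurv_eq]
    simp only [hn.ricci_conf hg hv hp, kd_self, one_mul, sum_add, sum_sub, ← mul_sum, sum_const]
    ring
  have he := exp_mul_exp_neg (v p); rw [mul_comm] at he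
  simp only [schouten, hs, hn.ricci_conf hg hv hp, confMetric_apply, hn.kd_apply, cons_val]
  have : 1 / (2 * ((m : ℝ) - 1)) * (exp (-2 * v p) *
      (scalarCurv g p - 2 * ((m : ℝ) - 1) * ∑ c, Λ ![c, c])) *
        (exp (2 * v p) * kd a b) = 1 / (2 * ((m : ℝ) - 1)) * (exp (-2 * v p) * exp (2 * v p)) *
      (scalarCurv g p - 2 * ((m : ℝ) - 1) * ∑ c, Λ ![c, c]) * kd a b := by ring
  rw [this, he]; field_simp; ring

lemma weyl_eq (hn : IsNormalAt g p) (a b c d) :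
    weyl g p ![a, b, c, d] = riemannUp g p a b c d - schouten g p ![a, c] * kd b d
    - schouten g p ![b, d] * kd a c + schouten g p ![a, d] * kd b c
    + schouten g p ![b, c] * kd a d := by simp only [weyl, hn.riemann_eq_up, hn.kd_apply, cons_val]

lemma weyl_conf (hn : IsNormalAt g p) (hg : MReg g V) (hv : Sm V v) (hp : p ∈ V)
    (hm : 3 ≤ m) (a b c d) : weyl g⋆ p ![a, b, c, d] = exp (2 * v p) * weyl g p ![a, b, c, d] := by
  have : riemann g⋆ p ![a, b, c, d] = exp (2 * v p) * riemannUp g⋆ p a b c d := by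
    simp only [riemann, confMetric_apply, hn.kd_apply, cons_val, mul_left_comm _ (exp _), ← mul_sum, sum_mul_kd]
  rw [hn.weyl_eq]
  simp only [weyl, cons_val,
    hn.schouten_conf hg hv hp hm, confMetric_apply, hn.kd_apply, this, hn.riemannUp_conf hg hv hp]
  ring

end IsNormalAt

lemma schouten_conf (hg : MReg g V) (hv : Sm V v) (hx : x ∈ V) (hm : 3 ≤ m) (I : Fin 2 → Fin m) :
    schouten g⋆ x I = schouten g x I - confSchouten v g x I := by
  obtain ⟨g', ψ, V', hP, h0, rfl, hn⟩ := hg.exists_normal' hx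
  have key := hP.evalTensor_injective h0 (T := fun K => schouten g⋆ (ψ 0) K
      - (schouten g (ψ 0) K - confSchouten v g (ψ 0) K)) (fun I => by
    have e := hn.schouten_conf hP.reg' (hv.comp hP.smooth hP.maps) h0 hm (I 0) (I 1)
    rw [(hP.conf hv).schouten_eq h0, hP.schouten_eq h0, hP.confSchouten_eq hv h0] at e
    rw [evalTensor_sub, evalTensor_sub, evalTensor_two, evalTensor_two, evalTensor_two, sub_eq_zero]
    exact e) I
  linarith

lemma weyl_conf (hg : MReg g V) (hv : Sm V v) (hx : x ∈ V) (hm : 3 ≤ m) (I : Fin 4 → Fin m) :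
    weyl g⋆ x I = exp (2 * v x) * weyl g x I := by
  obtain ⟨g', ψ, V', hP, h0, rfl, hn⟩ := hg.exists_normal' hx
  have key := hP.evalTensor_injective h0 (T := fun K => weyl g⋆ (ψ 0) K
      - exp (2 * v (ψ 0)) * weyl g (ψ 0) K) (fun I => by
    have e := hn.weyl_conf hP.reg' (hv.comp hP.smooth hP.maps) h0 hm (I 0) (I 1) (I 2) (I 3)
    rw [(hP.conf hv).weyl_eq h0, hP.weyl_eq h0] at e
    rw [evalTensor_sub, evalTensor_smul, evalTensor_four, evalTensor_four, sub_eq_zero]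
    exact e) I
  linarith

lemma sum_kd_christoffel_mul (a b) (X : Fin m → ℝ) :
    ∑ d, (kd d a * ∂b + kd d b * ∂a - kd a b * ∂d) * X d
    = ∂b * X a + ∂a * X b - kd a b * ∑ d, X d * ∂d := by
  simp only [sub_mul, add_mul, mul_assoc, sum_add, sum_sub, ← mul_sum, sum_kd_mul, mul_comm (X _)]

lemma IsNormalAt.cotton_conf (hn : IsNormalAt g p) (hg : MReg g V) (hv : Sm V v) (hp : p ∈ V)
    (hm : 3 ≤ m) (a b c : Fin m) : cotton g⋆ p ![a, b, c]
    = cotton g p ![a, b, c] - ∑ d, weyl g p ![a, b, c, d] * ∂d := by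
  have hd {F} (h : Sm V F) := h.diffAt hg hp; have hy := fun a => hv.pd hg a
  have hcov a b c : cov g⋆ (schouten g⋆) p ![a, b, c]
    = pd a (fun z => schouten g z ![b, c]) p - pd a (fun z => confSchouten v g z ![b, c]) p
    - (∑ d, (kd d a * ∂b + kd d b * ∂a - kd a b * ∂d) * (schouten g p ![d, c] - Λ ![d, c])
    + ∑ d, (kd d a * ∂c + kd d c * ∂a - kd a c * ∂d) * (schouten g p ![b, d] - Λ ![b, d])) := by
    rw [ConfSub.cov_vecCons, pd_congr hg hp fun z hz => ConfSub.schouten_conf hg hv hz hm _,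
      pd_sub (hd (hg.smooth_schouten _)) (hd (smooth_confSchouten hg hv _))]
    simp only [hn.christoffel_conf hg hv hp, Fin.sum_univ_two, ConfSub.schouten_conf hg hv hp hm]
    congr 2
  have hgs a : pd a (gradSq v g) p = 2 * ∑ d, ∂d * pd a (pd d v) p := by
    rw [show gradSq v g = fun z => ConfSub.mtr (g z) fun a b => pd a v z * pd b v z from rfl,
      hn.pd_mtr hg hp (fun a b => (hy a).mul (hy b)), mul_sum]
    refine sum_ext fun d => ?_; rw [pd_mul (hd (hy d)) (hd (hy d))]; ring
  have hLam a b c : pd a (fun z => confSchouten v g z ![b, c]) p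
    = cov g (cov g (dform v)) p ![a, b, c] - (∂b * pd a (pd c v) p + ∂c * pd a (pd b v) p)
    + (∑ d, ∂d * pd a (pd d v) p) * kd b c := by
    simp only [confSchouten, cons_val]; have h1 := hg.smooth_cov (smooth_dform hg hv) ![b, c]
    have h2 : Sm V fun z => 1 / 2 * gradSq v g z := (Sm.const _).mul (smooth_gradSq hg hv)
    rw [pd_add (hd (h1.sub ((hy b).mul (hy c)))) (hd (h2.mul (hg.smooth b c))),
      pd_sub (hd h1) (hd ((hy b).mul (hy c))), pd_mul (hd (hy b)) (hd (hy c)),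
      hn.pd_mul_metric hg hp h2, pd_const_mul _ (hd (smooth_gradSq hg hv)), hgs, hn.cov_vecCons]
    ring
  have hR := hg.cov_cov_one hp (smooth_dform hg hv) a b c
  have hW d : riemannUp g p a b c d = weyl g p ![a, b, c, d] + schouten g p ![a, c] * kd b d
      + schouten g p ![b, d] * kd a c - schouten g p ![a, d] * kd b c
      - schouten g p ![b, c] * kd a d := by rw [hn.weyl_eq]; ring
  rw [hn.cotton_eq]; simp only [cotton, cons_val, hcov, hLam]
  have hRR : cov g (cov g (dform v)) p ![a, b, c] = cov g (cov g (dform v)) p ![b, a, c]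
    + (∑ d, weyl g p ![a, b, c, d] * ∂d + schouten g p ![a, c] * ∂b
    + kd a c * (∑ d, schouten g p ![b, d] * ∂d)
    - kd b c * (∑ d, schouten g p ![a, d] * ∂d) - schouten g p ![b, c] * ∂a) := by
    rw [← sub_eq_iff_eq_add', hR]
    have this d : riemannUp g p a b c d * dform v p ![d] = weyl g p ![a, b, c, d] * ∂d
      + schouten g p ![a, c] * (kd b d * ∂d) + kd a c * (schouten g p ![b, d] * ∂d)
      - kd b c * (schouten g p ![a, d] * ∂d) - schouten g p ![b, c] * (kd a d * ∂d) := by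
        rw [hW, show dform v p ![d] = ∂d from rfl]; ring
    simp only [this, sum_add, sum_sub, ← mul_sum, sum_kd_mul']
  rw [hRR]
  have hL2 b : ∑ d, (schouten g p ![b, d] - Λ ![b, d]) * ∂d
    = ∑ d, schouten g p ![b, d] * ∂d - (∑ d, ∂d * pd b (pd d v) p
    - ∂b * gradSq v g p + 1 / 2 * gradSq v g p * ∂b) := by
    have this d : (schouten g p ![b, d] - Λ ![b, d]) * ∂d
      = schouten g p ![b, d] * ∂d - (∂d * pd b (pd d v) p - ∂b * (∂d * ∂d)
        + 1 / 2 * gradSq v g p * (kd b d * ∂d)) := by rw [hn.confSchouten_eq]; ring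
    simp only [this, sum_add, sum_sub, ← mul_sum, sum_kd_mul', ← hn.gradSq_eq]
  simp only [sum_kd_christoffel_mul]; rw [hL2 a, hL2 b]
  simp only [hn.confSchouten_eq, hg.schouten_symm hp b a, pd_comm hg hp hv b a, kd_comm b a]; ring

lemma cotton_conf (hg : MReg g V) (hv : Sm V v) (hx : x ∈ V) (hm : 3 ≤ m) (I : Fin 3 → Fin m) :
    cotton g⋆ x I = cotton g x I
    - mtr (g x) fun d e => weyl g x ![I 0, I 1, I 2, d] * pd e v x := by
  obtain ⟨g', ψ, V', hP, h0, rfl, hn⟩ := hg.exists_normal' hx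
  have key := hP.evalTensor_injective h0 (T := fun K => cotton g⋆ (ψ 0) K
      - (cotton g (ψ 0) K - mtr (g (ψ 0)) fun d e =>
        weyl g (ψ 0) ![K 0, K 1, K 2, d] * pd e v (ψ 0))) (fun I => by
    have e := hn.cotton_conf hP.reg' (hv.comp hP.smooth hP.maps) h0 hm (I 0) (I 1) (I 2)
    rw [← hn.mtr fun d e => weyl g' 0 ![I 0, I 1, I 2, d] * pd e (fun z => v (ψ z)) 0,
      (hP.conf hv).cotton_eq h0, hP.cotton_eq h0] at e
    simp only [hP.weyl_eq h0, hP.pd_comp hv h0, ap_mul, mul_ap, cons_val, mtr_ap_right_ap, hP.mtr_eq' h0] at e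
    rw [evalTensor_sub, evalTensor_sub, evalTensor_three, evalTensor_three, evalTensor_three,
      sub_eq_zero]
    exact e) I
  linarith

lemma IsNormalAt.bach_eq (hn : IsNormalAt g p) (a b) : bach g p ![a, b]
    = ∑ c, pd c (fun z => cotton g z ![c, a, b]) p
    + ∑ c, ∑ d, weyl g p ![a, c, b, d] * schouten g p ![c, d] := by
  rw [IsPull.bach_eq_mtr, hn.mtr, hn.mtr]; simp only [hn.mtr, hn.cov_vecCons, cons_val]

lemma IsNormalAt.bach_conf (hn : IsNormalAt g p) (hg : MReg g V) (hv : Sm V v) (hp : p ∈ V)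
    (hm : 3 ≤ m) (a b : Fin m) : bach g⋆ p ![a, b] = exp (-2 * v p) * (bach g p ![a, b]
    + ((m : ℝ) - 4) * ∑ c, ∂c * (cotton g p ![c, a, b] + cotton g p ![c, b, a])
    + ((m : ℝ) - 4) * ∑ c, ∑ d, weyl g p ![a, c, b, d] * (∂c * ∂d)) := by
  have hd {F} (h : Sm V F) := h.diffAt hg hp; have hy := fun a => hv.pd hg a
  set C : Fin m → Fin m → Fin m → ℝ := fun a b c => cotton g p ![a, b, c] with hC
  set W : Fin m → Fin m → Fin m → Fin m → ℝ := fun a b c d => weyl g p ![a, b, c, d] with hW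
  set Ch : Fin m → Fin m → Fin m → ℝ := fun a b c => C a b c - ∑ d, W a b c d * ∂d with hCh
  have hChv a b c : cotton g⋆ p ![a, b, c] = Ch a b c := hn.cotton_conf hg hv hp hm a b c
  have Csw a b c : C a b c = -C b a c := MReg.cotton_swap g p a b c
  have Wsw a b c d : W a b c d = -W b a c d := MReg.weyl_swap g p a b c d
  have Wsw' a b c d : W a b c d = -W a b d c := hg.weyl_swap' hp a b c d
  have Wp a b c d : W a b c d = W c d a b := hg.weyl_pair hp a b c d
  have Wt a b : ∑ c, W a c b c = 0 := hn.weyl_trace hg hp hm a b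
  have Chsw a b c : Ch a b c = -Ch b a c := by
    simp only [hCh]; rw [Csw a b c, sum_ext fun d => by rw [Wsw a b c d]]
    simp only [neg_mul, sum_neg]; ring
  have Chtr a : ∑ c, Ch c a c = 0 := by
    have h1 : ∑ c, C c a c = 0 := by
      simp only [Csw _ a, sum_neg]; have := hn.cotton_trace hg hp hm a
      simp only [hC]; rw [this, neg_zero]
    have h2 : ∑ c, ∑ d, W c a c d * ∂d = 0 := by
      rw [sum_comm]; refine sum_eq_zero fun d _ => ?_; rw [← sum_mul]
      have this c : W c a c d = W a c d c := by rw [Wsw c a, Wsw' a c c d, neg_neg]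
      simp only [this, Wt, zero_mul]
    simp only [hCh, sum_sub, h1, h2, sub_zero]
  have hpd c : pd c (fun z => cotton g⋆ z ![c, a, b]) p
    = pd c (fun z => cotton g z ![c, a, b]) p - ∑ d, (W c a b d * pd c (pd d v) p
    + ∂d * pd c (fun z => weyl g z ![c, a, b, d]) p) := by
    have hs d e : Sm V fun z => weyl g z ![c, a, b, d] * pd e v z := (hg.smooth_weyl _).mul (hy e)
    have hsm : Sm V fun z => ConfSub.mtr (g z) fun d e => weyl g z ![c, a, b, d] * pd e v z :=
      Sm.sum fun d _ => Sm.sum fun e _ => (hg.smooth_inv d e).mul (hs d e)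
    rw [pd_congr hg hp fun z hz => ConfSub.cotton_conf hg hv hz hm _]
    simp only [cons_val]; rw [pd_sub (hd (hg.smooth_cotton _)) (hd hsm), hn.pd_mtr hg hp hs]
    refine congrArg _ (sum_ext fun d => ?_); rw [pd_mul (hd (hg.smooth_weyl _)) (hd (hy d))]
  have hdiv d : ∑ c, pd c (fun z => weyl g z ![c, a, b, d]) p = ((m : ℝ) - 3) * C b d a := by
    rw [sum_ext fun c => hg.pd_weyl_pair hp c c a b d]; exact hn.div_weyl hg hp hm b d a
  have hcov c : cov g⋆ (cotton g⋆) p ![c, c, a, b] = pd c (fun z => cotton g⋆ z ![c, a, b]) p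
    - (∑ e, (kd e c * ∂c + kd e c * ∂c - kd c c * ∂e) * Ch e a b
    + ∑ e, (kd e c * ∂a + kd e a * ∂c - kd c a * ∂e) * Ch c e b
    + ∑ e, (kd e c * ∂b + kd e b * ∂c - kd c b * ∂e) * Ch c a e) := by
    rw [ConfSub.cov_vecCons]; simp only [hn.christoffel_conf hg hv hp, Fin.sum_univ_three, ← hChv]
    congr 2
  have Cz c b : Ch c c b = 0 := by have := Chsw c c b; linarith
  set S := ∑ c, Ch c a b * ∂c with hS
  have hdivC : ∑ c, cov g⋆ (cotton g⋆) p ![c, c, a, b]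
    = ∑ c, pd c (fun z => cotton g⋆ z ![c, a, b]) p + ((m : ℝ) - 5) * S + ∑ e, Ch b a e * ∂e := by
    simp only [hcov, sum_kd_christoffel_mul]; simp only [Cz, kd_self]
    have this c : pd c (fun z => cotton g⋆ z ![c, a, b]) p
        - (∂c * Ch c a b + ∂c * Ch c a b - 1 * ∑ d, Ch d a b * ∂d
          + (∂a * 0 + ∂c * Ch c a b - kd c a * ∑ d, Ch c d b * ∂d)
          + (∂b * Ch c a c + ∂c * Ch c a b - kd c b * ∑ d, Ch c a d * ∂d))
        = pd c (fun z => cotton g⋆ z ![c, a, b]) p - 4 * (Ch c a b * ∂c)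
          + S + kd c a * (∑ d, Ch c d b * ∂d) - ∂b * Ch c a c
          + kd c b * ∑ d, Ch c a d * ∂d := by rw [hS]; ring
    simp only [this, sum_add, sum_sub, ← mul_sum, sum_kd_mul, Chtr, sum_const]
    have : ∑ d, Ch a d b * ∂d = -S := by
      rw [hS, ← sum_neg]; exact sum_ext fun d => by rw [Chsw a d]; ring
    rw [this]; ring
  have hWP : ∑ c, ∑ d, W a c b d * (schouten g p ![c, d] - Λ ![c, d])
    = ∑ c, ∑ d, W a c b d * schouten g p ![c, d] - ∑ c, ∑ d, W a c b d * pd c (pd d v) p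
    + ∑ c, ∑ d, W a c b d * (∂c * ∂d) := by
    have this c d : W a c b d * (schouten g p ![c, d] - Λ ![c, d])
      = W a c b d * schouten g p ![c, d] - W a c b d * pd c (pd d v) p
        + W a c b d * (∂c * ∂d) - 1 / 2 * gradSq v g p * (W a c b d * kd c d) := by rw [hn.confSchouten_eq]; ring
    simp only [this, sum_add, sum_sub, ← mul_sum, sum_mul_kd', Wt]; ring
  have hS' : S = ∑ c, ∂c * C c a b + ∑ c, ∑ d, W a c b d * (∂c * ∂d) := by
    have this c : Ch c a b * ∂c = ∂c * C c a b + ∑ d, W a c b d * (∂c * ∂d) := by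
      have h1 : ∑ d, W a c b d * (∂c * ∂d) = -(∑ d, W c a b d * ∂d) * ∂c := by
        rw [neg_mul, sum_mul, ← sum_neg]; exact sum_ext fun d => by rw [Wsw c a]; ring
      rw [h1]; simp only [hCh]; ring
    simp only [hS, this, sum_add]
  have hcyc e : C b a e = C e a b - C e b a := by
    have h1 := hn.cotton_cyclic hg hp b a e; have h2 := Csw a e b; simp only [hC] at h1 h2 ⊢
    linarith
  have hb : ∑ e, Ch b a e * ∂e = ∑ c, ∂c * C c a b - ∑ c, ∂c * C c b a := by
    have h0 : ∑ e, ∑ d, W b a e d * ∂d * ∂e = 0 := by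
      have h1 : ∑ e, ∑ d, W b a e d * ∂d * ∂e = ∑ e, ∑ d, -(W b a e d * ∂d * ∂e) := by
        rw [sum_comm]; exact sum_ext2 fun c d => by rw [Wsw' b a]; ring
      simp only [sum_neg] at h1; linarith
    simp only [hCh, sub_mul, sum_sub, sum_mul, h0, sub_zero, hcyc, mul_comm (pd _ _ _)]
  have hpds : ∑ c, pd c (fun z => cotton g⋆ z ![c, a, b]) p
    = ∑ c, pd c (fun z => cotton g z ![c, a, b]) p + ∑ c, ∑ d, W a c b d * pd c (pd d v) p
    + ((m : ℝ) - 3) * ∑ c, ∂c * C c b a := by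
    simp only [hpd, sum_sub, sum_add]
    have h1 : ∑ c, ∑ d, W c a b d * pd c (pd d v) p = -∑ c, ∑ d, W a c b d * pd c (pd d v) p := by
      simp only [← sum_neg]; exact sum_ext2 fun c d => by rw [Wsw c a]; ring
    have h2 : ∑ c, ∑ d, ∂d * pd c (fun z => weyl g z ![c, a, b, d]) p
      = -(((m : ℝ) - 3) * ∑ c, ∂c * C c b a) := by
      rw [sum_comm]; simp only [← mul_sum, hdiv]; rw [mul_sum, ← sum_neg]
      exact sum_ext fun d => by rw [Csw b d]; ring
    rw [h1, h2]; ring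
  have he := exp_mul_exp_neg (v p); rw [mul_comm] at he
  rw [IsPull.bach_eq_mtr]; simp only [mtr_confMetric, hn.mtr]; simp only [cons_val]
  have hW2 c d : weyl g⋆ p ![a, c, b, d] * schouten g⋆ p ![c, d]
      = exp (2 * v p) * (W a c b d * (schouten g p ![c, d] - Λ ![c, d])) := by rw [hn.weyl_conf hg hv hp hm, hn.schouten_conf hg hv hp hm]; ring
  simp only [hW2, ← mul_sum]
  rw [hdivC, hpds, hWP, hS', hb, hn.bach_eq, ← mul_assoc (exp (-2 * v p)) (exp (2 * v p)),
    he, one_mul, ← mul_add]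
  congr 1; simp only [mul_add, sum_add, hW, hC]; ring

end Conf

/-! ### Immersions in coordinates: regularity -/

lemma evalTensor_six {m : ℕ} (T : (Fin 6 → Fin m) → ℝ) (v : Fin 6 → Fin m → ℝ) :
    ev T v = ∑ a, v 0 a * ∑ b, v 1 b * ∑ c, v 2 c * ∑ d, v 3 d * ∑ e, v 4 e *
    ∑ f, v 5 f * T ![a, b, c, d, e, f] := by rw [evalTensor_cons]; simp only [evalTensor_five]; rfl

namespace CoordData
variable {k n : ℕ}

/-- Coordinate data of an immersion of the open set `U` into the open set `V`, which carries a
Riemannian metric. -/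
structure Reg (D : CoordData k n) (U : Set (Coo k)) (V : Set (Coo n)) : Prop where
  isOpen : IsOpen U
  smooth : ContDiffOn ℝ ∞ D.f U
  maps : ∀ u ∈ U, D.f u ∈ V
  metric : MReg D.g V
  imm : ∀ u ∈ U, LinearIndependent ℝ (D.tan u)

instance {D : CoordData k n} {U V} : CoeOut (D.Reg U V) (IsOpen U) := ⟨Reg.isOpen⟩

lemma trT_eq_mtr (D : CoordData k n) (u F) : D.trT u F = mtr (D.h u) F := rfl

lemma trA_eq_mtr (D : CoordData k n) (u F) : D.trA u F = mtr (D.g (D.f u)) F := rfl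

lemma h_eq_ap (D : CoordData k n) (u) (p q) :
    D.h u p q = ap (D.tan u) p fun a => ap (D.tan u) q fun b => D.g (D.f u) a b := by
  simp only [h, ap, of_apply, mul_sum]; exact sum_ext2 fun _ _ => by ring

lemma h_eq_matrix (D : CoordData k n) (u) :
    D.h u = Matrix.of (D.tan u) * D.g (D.f u) * (Matrix.of (D.tan u)).transpose := by
  ext a b
  simp only [h_eq_ap, ap, Matrix.mul_apply, Matrix.transpose_apply, of_apply, mul_sum, sum_mul]
  rw [sum_comm]; exact sum_ext2 fun _ _ => by ring

namespace Reg
variable {D : CoordData k n} {U : Set (Coo k)} {V : Set (Coo n)} {u : Coo k}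

lemma diffAt (hD : D.Reg U V) (hu : u ∈ U) : DifferentiableAt ℝ D.f u :=
  (hD.smooth.contDiffAt (hD.isOpen.mem_nhds hu)).differentiableAt (by simp)

lemma mono (hD : D.Reg U V) {U' : Set (Coo k)} {V' : Set (Coo n)} (hU : U' ⊆ U)
    (ho : IsOpen U') (hV : V' ⊆ V) (ho' : IsOpen V') (hm : ∀ u ∈ U', D.f u ∈ V') : D.Reg U' V' :=
  ⟨ho, hD.smooth.mono hU, hm, hD.metric.mono hV ho', fun u hu => hD.imm u (hU hu)⟩

lemma sm_tan (hD : D.Reg U V) (p a) : Sm U fun z => D.tan z p a := (Sm.coord hD.smooth a).pd hD p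

lemma sm_g (hD : D.Reg U V) (a b) : Sm U fun z => D.g (D.f z) a b :=
  (hD.metric.smooth a b).comp hD.smooth hD.maps

lemma posDef_h (hD : D.Reg U V) (hu : u ∈ U) : (D.h u).PosDef := by
  rw [h_eq_matrix, ← Matrix.conjTranspose_eq_transpose_of_trivial]
  refine (hD.metric.posDef _ (hD.maps u hu)).mul_mul_conjTranspose_same ?_
  exact Matrix.vecMul_injective_iff.2 (hD.imm u hu)

lemma reg_h (hD : D.Reg U V) : MReg D.h U where
  isOpen := hD
  smooth p q := by
    simp only [CoordData.h, of_apply]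
    exact Sm.sum fun a _ => Sm.sum fun b _ =>
      ((hD.sm_g a b).mul (hD.sm_tan p a)).mul (hD.sm_tan q b)
  posDef _ hu := hD.posDef_h hu

lemma sm_trT (hD : D.Reg U V) {F : Coo k → Fin k → Fin k → ℝ}
    (hF : ∀ p q, Sm U fun z => F z p q) : Sm U fun z => D.trT z (F z) :=
  Sm.sum fun a _ => Sm.sum fun b _ => (hD.reg_h.smooth_inv a b).mul (hF a b)

lemma sm_trA (hD : D.Reg U V) {F : Coo k → Fin n → Fin n → ℝ}
    (hF : ∀ a b, Sm U fun z => F z a b) : Sm U fun z => D.trA z (F z) :=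
  Sm.sum fun a _ => Sm.sum fun b _ =>
    ((hD.metric.smooth_inv a b).comp hD.smooth hD.maps).mul (hF a b)

lemma sm_nor (hD : D.Reg U V) (a b) : Sm U fun z => D.nor z a b :=
  (Sm.const _).sub (Sm.sum fun p _ => Sm.sum fun q _ =>
    ((hD.reg_h.smooth_inv p q).mul (hD.sm_tan p b)).mul
      (Sm.sum fun c _ => (hD.sm_g c a).mul (hD.sm_tan q c)))

lemma sm_comp (hD : D.Reg U V) {F : Coo n → ℝ} (hF : Sm V F) : Sm U fun z => F (D.f z) :=
  hF.comp hD.smooth hD.maps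

section Eval
variable {v0 v1 v2 v3 v4 v5 : Coo k → Fin n → ℝ}

lemma sm_W (hD : D.Reg U V) (h0 : ∀ a, Sm U fun z => v0 z a) (h1 : ∀ a, Sm U fun z => v1 z a)
    (h2 : ∀ a, Sm U fun z => v2 z a) (h3 : ∀ a, Sm U fun z => v3 z a) :
    Sm U fun z => D.W z (v0 z) (v1 z) (v2 z) (v3 z) := by
  simp only [W, evalTensor_four]
  exact Sm.sum fun a _ => (h0 a).mul <| Sm.sum fun b _ => (h1 b).mul <| Sm.sum fun c _ =>
    (h2 c).mul <| Sm.sum fun d _ => (h3 d).mul <| hD.sm_comp (hD.metric.smooth_weyl _)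

lemma sm_dW (hD : D.Reg U V) (h0 : ∀ a, Sm U fun z => v0 z a) (h1 : ∀ a, Sm U fun z => v1 z a)
    (h2 : ∀ a, Sm U fun z => v2 z a) (h3 : ∀ a, Sm U fun z => v3 z a)
    (h4 : ∀ a, Sm U fun z => v4 z a) : Sm U fun z => D.dW z (v0 z) (v1 z) (v2 z) (v3 z) (v4 z) := by
  simp only [dW, evalTensor_five]
  exact Sm.sum fun a _ => (h0 a).mul <| Sm.sum fun b _ => (h1 b).mul <| Sm.sum fun c _ =>
    (h2 c).mul <| Sm.sum fun d _ => (h3 d).mul <| Sm.sum fun e _ => (h4 e).mul <|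
      hD.sm_comp (hD.metric.smooth_cov hD.metric.smooth_weyl _)

lemma sm_ddW (hD : D.Reg U V) (h0 : ∀ a, Sm U fun z => v0 z a) (h1 : ∀ a, Sm U fun z => v1 z a)
    (h2 : ∀ a, Sm U fun z => v2 z a) (h3 : ∀ a, Sm U fun z => v3 z a)
    (h4 : ∀ a, Sm U fun z => v4 z a) (h5 : ∀ a, Sm U fun z => v5 z a) :
    Sm U fun z => D.ddW z (v0 z) (v1 z) (v2 z) (v3 z) (v4 z) (v5 z) := by
  simp only [ddW, evalTensor_six]
  exact Sm.sum fun a _ => (h0 a).mul <| Sm.sum fun b _ => (h1 b).mul <| Sm.sum fun c _ =>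
    (h2 c).mul <| Sm.sum fun d _ => (h3 d).mul <| Sm.sum fun e _ => (h4 e).mul <|
    Sm.sum fun f _ => (h5 f).mul <|
      hD.sm_comp (hD.metric.smooth_cov (hD.metric.smooth_cov hD.metric.smooth_weyl) _)

lemma sm_Sch (hD : D.Reg U V) (h0 : ∀ a, Sm U fun z => v0 z a) (h1 : ∀ a, Sm U fun z => v1 z a) :
    Sm U fun z => D.Sch z (v0 z) (v1 z) := by
  simp only [Sch, evalTensor_two]
  exact Sm.sum fun a _ => (h0 a).mul <| Sm.sum fun b _ => (h1 b).mul <|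
    hD.sm_comp (hD.metric.smooth_schouten _)

lemma sm_Ric (hD : D.Reg U V) (h0 : ∀ a, Sm U fun z => v0 z a) (h1 : ∀ a, Sm U fun z => v1 z a) :
    Sm U fun z => D.Ric z (v0 z) (v1 z) := by
  simp only [Ric, evalTensor_two]
  exact Sm.sum fun a _ => (h0 a).mul <| Sm.sum fun b _ => (h1 b).mul <|
    hD.sm_comp (hD.metric.smooth_ricci _)

lemma sm_Cot (hD : D.Reg U V) (h0 : ∀ a, Sm U fun z => v0 z a) (h1 : ∀ a, Sm U fun z => v1 z a)
    (h2 : ∀ a, Sm U fun z => v2 z a) : Sm U fun z => D.Cot z (v0 z) (v1 z) (v2 z) := by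
  simp only [Cot, evalTensor_three]
  exact Sm.sum fun a _ => (h0 a).mul <| Sm.sum fun b _ => (h1 b).mul <| Sm.sum fun c _ =>
    (h2 c).mul <| hD.sm_comp (hD.metric.smooth_cotton _)

end Eval

lemma sm_L (hD : D.Reg U V) (p q) (a) : Sm U fun z => D.L z p q a :=
  Sm.sum fun b _ => Sm.sum fun c _ => ((hD.sm_g b c).mul
    (((hD.sm_tan q b).pd hD p).add (Sm.sum fun d _ => Sm.sum fun e _ =>
      ((hD.sm_comp (hD.metric.smooth_christoffel b d e)).mul (hD.sm_tan p d)).mul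
        (hD.sm_tan q e)))).mul (hD.sm_nor a c)

lemma sm_h (hD : D.Reg U V) (a b) : Sm U fun z => D.h z a b := hD.reg_h.smooth a b

lemma sm_H (hD : D.Reg U V) (a) : Sm U fun z => D.H z a :=
  (Sm.const _).mul (hD.sm_trT fun p b => hD.sm_L p b a)

lemma sm_Lo (hD : D.Reg U V) (p b) (a) : Sm U fun z => D.Lo z p b a :=
  (hD.sm_L p b a).sub ((hD.sm_H a).mul (hD.sm_h p b))

lemma sm_dH (hD : D.Reg U V) (p a) : Sm U fun z => D.dH z p a :=
  Sm.sum fun b _ => (((hD.sm_H b).pd hD p).sub (Sm.sum fun c _ => Sm.sum fun d _ =>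
    ((hD.sm_comp (hD.metric.smooth_christoffel c d b)).mul (hD.sm_tan p d)).mul
      (hD.sm_H c))).mul (hD.sm_nor a b)

lemma sm_Dt (hD : D.Reg U V) (p a) : Sm U fun z => D.Dt z p a :=
  (hD.sm_Sch (hD.sm_tan p) (hD.sm_nor a)).sub (hD.sm_dH p a)

lemma sm_Wtt (hD : D.Reg U V) (a b) : Sm U fun z => D.Wtt z a b :=
  hD.sm_trT fun c c' => hD.sm_W (hD.sm_tan a) (hD.sm_tan c) (hD.sm_tan b) (hD.sm_tan c')

lemma sm_Wtn (hD : D.Reg U V) (p a) : Sm U fun z => D.Wtn z p a :=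
  hD.sm_trT fun c c' => hD.sm_W (hD.sm_tan p) (hD.sm_tan c) (hD.sm_nor a) (hD.sm_tan c')

lemma sm_Wtr (hD : D.Reg U V) : Sm U D.Wtr := hD.sm_trT fun a a' => hD.sm_Wtt a a'

lemma sm_Lo2 (hD : D.Reg U V) (p b) : Sm U fun z => D.Lo2 z p b :=
  hD.sm_trT fun c c' => hD.sm_trA fun a a' => (hD.sm_Lo c p a).mul (hD.sm_Lo c' b a')

lemma sm_normLo (hD : D.Reg U V) : Sm U D.normLo :=
  hD.sm_trT fun p p' => hD.sm_trT fun b b' => hD.sm_trA fun a a' =>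
    (hD.sm_Lo p b a).mul (hD.sm_Lo p' b' a')

lemma sm_normH (hD : D.Reg U V) : Sm U D.normH := hD.sm_trA fun a a' => (hD.sm_H a).mul (hD.sm_H a')

lemma sm_normD (hD : D.Reg U V) : Sm U D.normD :=
  hD.sm_trT fun p p' => hD.sm_trA fun a a' => (hD.sm_Dt p a).mul (hD.sm_Dt p' a')

lemma sm_cC1 (hD : D.Reg U V) (p) : Sm U fun z => D.cC1 z p :=
  hD.sm_trT fun b b' => (hD.sm_Cot (hD.sm_tan b) (hD.sm_tan p) (hD.sm_tan b')).sub
    (hD.sm_trA fun a a' => (hD.sm_H a).mul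
      (hD.sm_W (hD.sm_tan b) (hD.sm_tan p) (hD.sm_tan b') (hD.sm_nor a')))

lemma sm_formLW (hD : D.Reg U V) (p) : Sm U fun z => D.formLW z p :=
  hD.sm_trT fun b b' => hD.sm_trT fun c c' => hD.sm_trA fun a a' => (hD.sm_Lo b c a).mul
    (hD.sm_W (hD.sm_tan p) (hD.sm_tan b') (hD.sm_nor a') (hD.sm_tan c'))

lemma sm_formLWtn (hD : D.Reg U V) (p) : Sm U fun z => D.formLWtn z p :=
  hD.sm_trT fun b b' => hD.sm_trA fun a a' => (hD.sm_Lo p b a).mul (hD.sm_Wtn b' a')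

lemma sm_formDL (hD : D.Reg U V) (p) : Sm U fun z => D.formDL z p :=
  hD.sm_trT fun b b' => hD.sm_trA fun a a' => (hD.sm_Dt b a).mul (hD.sm_Lo p b' a')

lemma sm_G (hD : D.Reg U V) : Sm U D.G := (Sm.const _).mul (hD.sm_normLo.sub hD.sm_Wtr)

lemma sm_scalarCurv (hD : D.Reg U V) : Sm U fun z => scalarCurv D.g (D.f z) :=
  hD.sm_comp hD.metric.smooth_scalarCurv

lemma sm_sRicN (hD : D.Reg U V) : Sm U D.sRicN :=
  hD.sm_trA fun a a' => hD.sm_Ric (hD.sm_nor a) (hD.sm_nor a')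

lemma sm_sHLW (hD : D.Reg U V) : Sm U D.sHLW :=
  hD.sm_trA fun a a' => hD.sm_trT fun p p' => hD.sm_trT fun b b' =>
    ((hD.sm_H a).mul (hD.sm_Lo p b a')).mul (hD.sm_Wtt p' b')

lemma sm_sLdW (hD : D.Reg U V) : Sm U D.sLdW :=
  hD.sm_trT fun p p' => hD.sm_trT fun b b' => hD.sm_trA fun a a' => (hD.sm_Lo p b a).mul <|
    hD.sm_trT fun c c' => hD.sm_dW (hD.sm_nor a') (hD.sm_tan p') (hD.sm_tan c) (hD.sm_tan b')
      (hD.sm_tan c')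

lemma sm_J1CHO (hD : D.Reg U V) : Sm U D.J1CHO := by
  have h1 : Sm U D.sLo2Ric := hD.sm_trT fun p p' => hD.sm_trT fun q q' =>
    (hD.sm_Lo2 p q).mul (hD.sm_Ric (hD.sm_tan p') (hD.sm_tan q'))
  have h2 : Sm U D.sHLo3 := hD.sm_trA fun a a' => (hD.sm_H a).mul <|
    hD.sm_trT fun p p' => hD.sm_trT fun q q' => hD.sm_trT fun c c' => hD.sm_trA fun b b' =>
      ((hD.sm_Lo p q b).mul (hD.sm_Lo q' c b')).mul (hD.sm_Lo c' p' a')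
  exact ((((((((Sm.const _).mul hD.sm_normD).add hD.sm_sLdW).add (((Sm.const _).mul
    hD.sm_scalarCurv).mul hD.sm_normLo)).sub (((Sm.const _).mul hD.sm_normLo).mul
    hD.sm_sRicN)).sub ((Sm.const _).mul h1)).add (hD.sm_normH.mul hD.sm_normLo)).sub
    ((Sm.const _).mul h2)).sub ((Sm.const _).mul hD.sm_sHLW)

lemma sm_J2CHO (hD : D.Reg U V) : Sm U D.J2CHO := by
  have h1 : Sm U D.sddW := hD.sm_trA fun a a' => hD.sm_trT fun p p' => hD.sm_trT fun b b' =>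
    hD.sm_ddW (hD.sm_nor a) (hD.sm_nor a') (hD.sm_tan p) (hD.sm_tan b) (hD.sm_tan p')
      (hD.sm_tan b')
  have h2 : Sm U D.sHdW := hD.sm_trA fun a a' => (hD.sm_H a).mul <|
    hD.sm_trT fun p p' => hD.sm_trT fun b b' => hD.sm_dW (hD.sm_nor a') (hD.sm_tan p)
    (hD.sm_tan b) (hD.sm_tan p') (hD.sm_tan b')
  have h3 : Sm U D.sRicW := hD.sm_trT fun p p' => hD.sm_trT fun b b' =>
    (hD.sm_Ric (hD.sm_tan p) (hD.sm_tan b)).mul (hD.sm_Wtt p' b')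
  have h4 : Sm U D.sWdH := hD.sm_trT fun p p' => hD.sm_trA fun a a' =>
    (hD.sm_Wtn p a).mul (hD.sm_dH p' a')
  have h5 : Sm U D.sDW := hD.sm_trT fun p p' => hD.sm_trA fun a a' =>
    (hD.sm_Dt p a).mul (hD.sm_Wtn p' a')
  have c : ∀ c : ℝ, Sm U fun _ => c := Sm.const
  exact ((((((((((c _).mul h1).add ((c _).mul h2)).sub (((c _).mul hD.sm_scalarCurv).mul
    hD.sm_Wtr)).add (((c _).mul hD.sm_sRicN).mul hD.sm_Wtr)).add ((c _).mul h3)).sub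
    ((c _).mul h4)).sub ((c _).mul hD.sm_sLdW)).add ((c _).mul hD.sm_sHLW)).sub
    ((c _).mul h5)).sub (((c _).mul hD.sm_normH).mul hD.sm_Wtr)

end Reg
end CoordData

/-! ### Immersions in coordinates: changes of coordinates -/

/-- The image of a vector under the differential of a coordinate change. -/
def push {l m : ℕ} (J : Fin l → Fin m → ℝ) (v : Fin l → ℝ) : Fin m → ℝ := fun c => ∑ a, v a * J a c

lemma sum_ap_mul {ι κ μ : Type*} [Fintype κ] [Fintype μ] (M : ι → κ → ℝ) (i : ι)
    (v : κ → μ → ℝ) (X : μ → ℝ) :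
    ∑ a, (ap M i fun c => v c a) * X a = ap M i fun c => ∑ a, v c a * X a := by
  simp only [ap, sum_mul, mul_sum]; rw [sum_comm]; exact sum_ext2 fun _ _ => by ring

lemma sum_mul_ap {ι κ μ : Type*} [Fintype κ] [Fintype μ] (M : ι → κ → ℝ) (i : ι)
    (v : μ → ℝ) (X : κ → μ → ℝ) :
    ∑ a, v a * (ap M i fun c => X c a) = ap M i fun c => ∑ a, v a * X c a := by
  simp only [ap, mul_sum]; rw [sum_comm]; exact sum_ext2 fun _ _ => by ring

lemma evalTensor_push {l m r : ℕ} (J : Fin l → Fin m → ℝ) (T : (Fin r → Fin m) → ℝ)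
    (v : Fin r → Fin l → ℝ) :
    ev (fun I => ev T fun j => J (I j)) v = ev T fun j => push J (v j) := by
  simp only [evalTensor, push, sum_mul]; rw [sum_comm]; refine sum_ext fun K => ?_
  rw [Finset.prod_univ_sum, mul_sum]; rw [Fintype.piFinset_univ]; refine sum_ext fun I => ?_
  rw [Finset.prod_mul_distrib]; ring

namespace CoordData
variable {k n : ℕ}

section Slots
variable {ι κ : Type*} [Fintype κ] (D : CoordData k n) (u : Coo k) (M : ι → κ → ℝ) (i : ι)
  (w : κ → Fin n → ℝ)

local notation "wM" => fun b => ap M i fun c => w c b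

lemma W_ap : (∀ x y z, D.W u (wM) x y z = ap M i fun c => D.W u (w c) x y z) ∧ (∀ x y z, D.W u x
    (wM) y z = ap M i fun c => D.W u x (w c) y z) ∧ (∀ x y z, D.W u x y (wM) z = ap M i fun c => D.W
    u x y (w c) z) ∧ (∀ x y z, D.W u x y z (wM) = ap M i fun c => D.W u x y z (w c)) := by
  and_intros <;> simp only [W, evalTensor_four, cons_val, sum_ap_mul, sum_mul_ap, implies_true]

lemma dW_ap : (∀ x y z s, D.dW u (wM) x y z s = ap M i fun c => D.dW u (w c) x y z s) ∧ (∀ x y z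
    s, D.dW u x (wM) y z s = ap M i fun c => D.dW u x (w c) y z s) ∧ (∀ x y z s, D.dW u x y (wM) z s
    = ap M i fun c => D.dW u x y (w c) z s) ∧ (∀ x y z s, D.dW u x y z (wM) s = ap M i fun c => D.dW
    u x y z (w c) s) ∧ (∀ x y z s, D.dW u x y z s (wM) = ap M i fun c => D.dW u x y z s (w c)) := by
  and_intros <;> simp only [dW, evalTensor_five, cons_val, sum_ap_mul, sum_mul_ap, implies_true]

lemma ddW_ap : (∀ x y z s t, D.ddW u (wM) x y z s t = ap M i fun c => D.ddW u (w c) x y z s t) ∧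
    (∀ x y z s t, D.ddW u x (wM) y z s t = ap M i fun c => D.ddW u x (w c) y z s t) ∧ (∀ x y z s t,
    D.ddW u x y (wM) z s t = ap M i fun c => D.ddW u x y (w c) z s t) ∧ (∀ x y z s t, D.ddW u x y z
    (wM) s t = ap M i fun c => D.ddW u x y z (w c) s t) ∧ (∀ x y z s t, D.ddW u x y z s (wM) t = ap
    M i fun c => D.ddW u x y z s (w c) t) ∧ (∀ x y z s t, D.ddW u x y z s t (wM) = ap M i fun c =>
    D.ddW u x y z s t (w c)) := by
  and_intros <;> simp only [ddW, evalTensor_six, cons_val, sum_ap_mul, sum_mul_ap, implies_true]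

lemma Sch_ap : (∀ x, D.Sch u (wM) x = ap M i fun c => D.Sch u (w c) x) ∧ (∀ x, D.Sch u x (wM) =
    ap M i fun c => D.Sch u x (w c)) := by
  and_intros <;> simp only [Sch, evalTensor_two, cons_val, sum_ap_mul, sum_mul_ap, implies_true]

lemma Ric_ap : (∀ x, D.Ric u (wM) x = ap M i fun c => D.Ric u (w c) x) ∧ (∀ x, D.Ric u x (wM) =
    ap M i fun c => D.Ric u x (w c)) := by
  and_intros <;> simp only [Ric, evalTensor_two, cons_val, sum_ap_mul, sum_mul_ap, implies_true]

lemma Bach_ap : (∀ x, D.Bach u (wM) x = ap M i fun c => D.Bach u (w c) x) ∧ (∀ x, D.Bach u x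
    (wM) = ap M i fun c => D.Bach u x (w c)) := by
  and_intros <;> simp only [Bach, evalTensor_two, cons_val, sum_ap_mul, sum_mul_ap, implies_true]

lemma Cot_ap : (∀ x y, D.Cot u (wM) x y = ap M i fun c => D.Cot u (w c) x y) ∧ (∀ x y, D.Cot u x
    (wM) y = ap M i fun c => D.Cot u x (w c) y) ∧ (∀ x y, D.Cot u x y (wM) = ap M i fun c => D.Cot u
    x y (w c)) := by
  and_intros <;> simp only [Cot, evalTensor_three, cons_val, sum_ap_mul, sum_mul_ap, implies_true]

end Slots

/-- A change of coordinates on the submanifold (`φ`) and on the ambient manifold (`ψ`). -/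
structure Change (D' D : CoordData k n) (φ : Coo k → Coo k) (ψ : Coo n → Coo n)
    (U' U : Set (Coo k)) (V' V : Set (Coo n)) : Prop where
  reg' : D'.Reg U' V'
  reg : D.Reg U V
  pull : IsPull D'.g D.g ψ V' V
  smooth : ContDiffOn ℝ ∞ φ U'
  maps : ∀ u ∈ U', φ u ∈ U
  comm : ∀ u ∈ U', ψ (D'.f u) = D.f (φ u)

namespace Change
variable {D' D : CoordData k n} {φ : Coo k → Coo k} {ψ : Coo n → Coo n}
  {U' U : Set (Coo k)} {V' V : Set (Coo n)} {u : Coo k}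

local notation "Chg" => Change D' D φ ψ U' U V' V
local notation "Jφ" => jac φ u
local notation "Jψ" => jac ψ (D'.f u)

lemma diffAt (h : Chg) (hu : u ∈ U') : DifferentiableAt ℝ φ u :=
  (h.smooth.contDiffAt (h.reg'.isOpen.mem_nhds hu)).differentiableAt (by simp)

lemma push_tan (h : Chg) (hu : u ∈ U') (a) :
    push Jψ (D'.tan u a) = fun c => ap Jφ a fun b => D.tan (φ u) b c := by
  funext c
  have e1 : pd a (fun z => ψ (D'.f z) c) u = push Jψ (D'.tan u a) c :=
    pd_comp ((Sm.coord h.pull.smooth c).diffAt h.pull.isOpen (h.reg'.maps u hu)) (h.reg'.diffAt hu)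
  have e2 : pd a (fun z => D.f (φ z) c) u = ap Jφ a fun b => D.tan (φ u) b c :=
    pd_comp ((Sm.coord h.reg.smooth c).diffAt h.reg.isOpen (h.maps u hu)) (h.diffAt hu)
  rw [← e1, ← e2]; exact pd_congr h.reg'.isOpen hu fun z hz => by rw [h.comm z hz]

lemma metric_eq (h : Chg) (hu : u ∈ U') (a b) :
    D'.g (D'.f u) a b = ap Jψ a fun c => ap Jψ b fun d =>
      D.g (D.f (φ u)) c d := by rw [h.pull.eq _ (h.reg'.maps u hu), h.comm u hu]

lemma ap_metric_eq (h : Chg) (hu : u ∈ U') (b a) :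
    ∑ c, D'.g (D'.f u) c a * D'.tan u b c = ap Jψ a fun d => ap Jφ b fun t =>
      ∑ c, D.g (D.f (φ u)) c d * D.tan (φ u) t c := by
  have this d : (ap Jφ b fun t => ∑ c, D.g (D.f (φ u)) c d * D.tan (φ u) t c)
    = ∑ c, D.g (D.f (φ u)) c d * push Jψ (D'.tan u b) c := by rw [h.push_tan hu, sum_mul_ap]
  simp only [this]; simp only [h.metric_eq hu, push]; simp only [ap, mul_sum, sum_mul]
  rw [sum_ext fun _ => sum_comm, sum_comm]; refine sum_ext fun _ => ?_; rw [sum_comm]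
  exact sum_ext2 fun _ _ => by ring

lemma h_eq (h : Chg) (hu : u ∈ U') (p q) :
    D'.h u p q = ap Jφ p fun t => ap Jφ q fun d => D.h (φ u) t d := by
  have e1 : D'.h u p q = ∑ b, D'.tan u p b * ∑ a, D'.g (D'.f u) a b * D'.tan u q a := by
    simp only [CoordData.h, of_apply, mul_sum]
    exact sum_ext2 fun _ _ => by rw [h.reg'.metric.symm (h.reg'.maps u hu)]; ring
  have e2 t d : D.h (φ u) t d
    = ∑ b, D.tan (φ u) t b * ∑ a, D.g (D.f (φ u)) a b * D.tan (φ u) d a := by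
    simp only [CoordData.h, of_apply, mul_sum]
    exact sum_ext2 fun _ _ => by rw [h.reg.metric.symm (h.reg.maps _ (h.maps u hu))]; ring
  have e3 : ∀ F : Fin n → ℝ, ∑ b, D'.tan u p b * ap Jψ b F = ∑ c, push Jψ (D'.tan u p) c * F c := by
    intro F; simp only [ap, push, mul_sum, sum_mul]; rw [sum_comm]
    exact sum_ext2 fun _ _ => by ring
  simp only [e1, h.ap_metric_eq hu, e3, h.push_tan hu, e2, sum_ap_mul, sum_mul_ap]

lemma pull_h (h : Chg) : IsPull D'.h D.h φ U' U where
  reg' := h.reg'.reg_h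
  reg := h.reg.reg_h
  smooth := h.smooth
  maps := h.maps
  eq _ hu a b := h.h_eq hu a b

lemma trT_eq (h : Chg) (hu : u ∈ U') (F : Fin k → Fin k → ℝ) :
    (mtr (D'.h u) fun a b => ap Jφ a fun c => ap Jφ b fun d => F c d)
    = mtr (D.h (φ u)) F := h.pull_h.mtr_eq hu F

lemma trT_eq' (h : Chg) (hu : u ∈ U') (F : Fin k → Fin k → ℝ) :
    (mtr (D'.h u) fun a b => ap Jφ b fun d => ap Jφ a fun c => F c d)
    = mtr (D.h (φ u)) F := h.pull_h.mtr_eq' hu F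

lemma trA_eq' (h : Chg) (hu : u ∈ U') (F : Fin n → Fin n → ℝ) :
    (mtr (D'.g (D'.f u)) fun a b => ap Jψ b fun d => ap Jψ a fun c =>
      F c d) = mtr (D.g (D.f (φ u))) F := by rw [h.pull.mtr_eq' (h.reg'.maps u hu), h.comm u hu]

lemma push_amb (J : Fin n → Fin n → ℝ) (a) : push J (amb a) = fun c => ap J a fun b => amb b c := by
  funext c; simp [push, ap, amb, Pi.single_apply]

lemma nor_eq_mtr (D : CoordData k n) (u) (a b) : D.nor u a b = amb a b - mtr (D.h u) fun p q =>
      D.tan u p b * ∑ c, D.g (D.f u) c a * D.tan u q c := by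
  simp only [nor, mtr, amb, Pi.single_apply, mul_assoc]

lemma push_nor (h : Chg) (hu : u ∈ U') (a) : push Jψ (D'.nor u a)
    = fun c => ap Jψ a fun b => D.nor (φ u) b c := by
  funext c
  have e0 : push Jψ (D'.nor u a) c = push Jψ (amb a) c
    - mtr (D'.h u) fun p q => push Jψ (D'.tan u p) c * ∑ d, D'.g (D'.f u) d a * D'.tan u q d := by
    simp only [push, nor_eq_mtr, sub_mul, sum_sub]; congr 1
    simp only [mtr, sum_mul, mul_sum]; rw [sum_comm]; refine sum_ext fun _ => ?_; rw [sum_comm]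
    refine sum_ext fun _ => ?_; rw [sum_comm]; exact sum_ext2 fun _ _ => by ring
  rw [e0, push_amb]
  simp only [h.push_tan hu, h.ap_metric_eq hu, nor_eq_mtr, ap_sub, ap_mul, mul_ap, mtr_ap, mtr_ap_left_ap,
    mtr_ap_right_ap, h.trT_eq' hu]

lemma eval_eq {r : ℕ} (h : Chg) (hu : u ∈ U') {T' T : TensorField n r}
    (hT : ∀ x ∈ V', ∀ I, T' x I = ev (T (ψ x)) fun j => jac ψ x (I j))
    (v w : Fin r → Fin n → ℝ) (hw : ∀ j, push Jψ (v j) = w j) :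
    ev (T' (D'.f u)) v = ev (T (D.f (φ u))) w := by
  rw [show T' (D'.f u) = fun I => ev (T (ψ (D'.f u))) fun j => Jψ (I j) from
    funext fun I => hT _ (h.reg'.maps u hu) I, evalTensor_push, h.comm u hu]
  congr 1; funext j; exact hw j

lemma W_eq (h : Chg) (hu : u ∈ U') (v0 v1 v2 v3 : Fin n → ℝ) : D'.W u v0 v1 v2 v3 = D.W (φ u)
      (push Jψ v0) (push Jψ v1) (push Jψ v2) (push Jψ v3) :=
  eval_eq h hu (fun x hx I => by rw [h.pull.weyl_eq hx, evalTensor_four]; rfl) _ _ fun j => by fin_cases j <;> rfl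

lemma dW_eq (h : Chg) (hu : u ∈ U') (v0 v1 v2 v3 v4 : Fin n → ℝ) :
    D'.dW u v0 v1 v2 v3 v4 = D.dW (φ u)
      (push Jψ v0) (push Jψ v1) (push Jψ v2) (push Jψ v3) (push Jψ v4) :=
  eval_eq h hu (fun x hx I => h.pull.cov_weyl_eq hx I) _ _ fun j => by fin_cases j <;> rfl

lemma ddW_eq (h : Chg) (hu : u ∈ U') (v0 v1 v2 v3 v4 v5 : Fin n → ℝ) :
    D'.ddW u v0 v1 v2 v3 v4 v5 = D.ddW (φ u)
      (push Jψ v0) (push Jψ v1) (push Jψ v2) (push Jψ v3) (push Jψ v4) (push Jψ v5) :=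
  eval_eq h hu (fun x hx I => h.pull.cov_cov_weyl_eq hx I) _ _ fun j => by fin_cases j <;> rfl

lemma Sch_eq (h : Chg) (hu : u ∈ U') (v0 v1 : Fin n → ℝ) : D'.Sch u v0 v1 = D.Sch (φ u)
      (push Jψ v0) (push Jψ v1) :=
  eval_eq h hu (fun x hx I => by rw [h.pull.schouten_eq hx, evalTensor_two]; rfl) _ _ fun j => by fin_cases j <;> rfl

lemma Ric_eq (h : Chg) (hu : u ∈ U') (v0 v1 : Fin n → ℝ) : D'.Ric u v0 v1 = D.Ric (φ u)
      (push Jψ v0) (push Jψ v1) :=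
  eval_eq h hu (fun x hx I => by rw [h.pull.ricci_eq hx, evalTensor_two]; rfl) _ _ fun j => by fin_cases j <;> rfl

lemma Bach_eq (h : Chg) (hu : u ∈ U') (v0 v1 : Fin n → ℝ) : D'.Bach u v0 v1 = D.Bach (φ u)
      (push Jψ v0) (push Jψ v1) :=
  eval_eq h hu (fun x hx I => by rw [h.pull.bach_eq hx, evalTensor_two]; rfl) _ _ fun j => by fin_cases j <;> rfl

lemma Cot_eq (h : Chg) (hu : u ∈ U') (v0 v1 v2 : Fin n → ℝ) : D'.Cot u v0 v1 v2 = D.Cot (φ u)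
      (push Jψ v0) (push Jψ v1) (push Jψ v2) :=
  eval_eq h hu (fun x hx I => by rw [h.pull.cotton_eq hx, evalTensor_three]; rfl) _ _ fun j => by fin_cases j <;> rfl

lemma push_covAlong (h : Chg) (hu : u ∈ U') {v : Coo k → Fin n → ℝ}
    (hv : ∀ a, DifferentiableAt ℝ (fun z => v z a) u) (p c) :
    push Jψ (fun b => covAlong D'.g D'.f p v u b) c
    = pd p (fun z => push (jac ψ (D'.f z)) (v z) c) u
    + ∑ d, ∑ e, Γ D.g (D.f (φ u)) c d e * push Jψ (D'.tan u p) d * push Jψ (v u) e := by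
  have hx := h.reg'.maps u hu
  have hJ a : DifferentiableAt ℝ (fun z => jac ψ (D'.f z) a c) u :=
    ((h.pull.smooth_jac a c).comp h.reg'.smooth h.reg'.maps).diffAt h.reg'.isOpen hu
  have e1 : pd p (fun z => push (jac ψ (D'.f z)) (v z) c) u
    = ∑ a, (v u a * (∑ b, D'.tan u p b * pd b (fun x => jac ψ x a c) (D'.f u))
    + Jψ a c * pd p (fun z => v z a) u) := by
    simp only [push]; rw [pd_sum fun a _ => (hv a).fun_mul (hJ a)]; refine sum_ext fun a => ?_
    rw [pd_mul (hv a) (hJ a), pd_comp (F := fun x => jac ψ x a c)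
      ((h.pull.smooth_jac a c).diffAt h.pull.isOpen hx) (h.reg'.diffAt hu)]
    rfl
  have e2 a b : pd b (fun x => jac ψ x a c) (D'.f u) = ∑ e, Γ D'.g (D'.f u) e b a * Jψ e c
    - ∑ d, ∑ e, Γ D.g (D.f (φ u)) c d e * Jψ b d * Jψ a e := by
    have := h.pull.covAlong_jac hx b a c; rw [covAlong, h.comm u hu] at this; rw [← this]
    simp only [jac]; ring
  have e3 : ∑ d, ∑ e, Γ D.g (D.f (φ u)) c d e * push Jψ (D'.tan u p) d *
    push Jψ (v u) e = ∑ a, v u a * ∑ b, D'.tan u p b * ∑ d, ∑ e,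
    Γ D.g (D.f (φ u)) c d e * Jψ b d * Jψ a e := by
    simp only [push, mul_sum, sum_mul]; rw [sum_ext fun d => sum_comm, sum_comm]
    refine sum_ext fun a => ?_; rw [sum_ext fun d => sum_comm, sum_comm]
    exact sum_ext3 fun b d e => by ring
  rw [e1, e3, ← sum_add]
  have e4 : push Jψ (fun b => covAlong D'.g D'.f p v u b) c
      = ∑ a, (v u a * (∑ b, D'.tan u p b * ∑ e, Γ D'.g (D'.f u) e b a *
          Jψ e c) + Jψ a c * pd p (fun z => v z a) u) := by
    simp only [push, covAlong, add_mul, sum_add, mul_sum, sum_mul]; rw [add_comm]; congr 1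
    · rw [sum_ext fun d => sum_comm, sum_comm]
      refine sum_ext fun a => ?_; rw [sum_comm]
      exact sum_ext2 fun b d => by
        rw [show D'.tan u p b = pd p (fun z => D'.f z b) u from rfl]; ring
    · exact sum_ext fun d => by ring
  rw [e4]; refine sum_ext fun a => ?_; simp only [e2, mul_sub, sum_sub]; ring

end Change

lemma L_eq_covAlong (D : CoordData k n) (u) (p q) (a) :
    D.L u p q a = ∑ b, ∑ c, D.g (D.f u) b c * covAlong D.g D.f p (fun z => D.tan z q) u b *
    D.nor u a c := rfl

namespace Reg
variable {D : CoordData k n} {U : Set (Coo k)} {V : Set (Coo n)} {u : Coo k}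

lemma inner_tan (u) (a q) :
    ∑ c, (∑ b, D.g (D.f u) b c * D.tan u a b) * D.tan u q c = D.h u a q := by
  simp only [CoordData.h, of_apply, sum_mul]; rw [sum_comm]

lemma inner_tan_nor (hD : D.Reg U V) (hu : u ∈ U) (γ a) :
    ∑ b, ∑ c, D.g (D.f u) b c * D.tan u γ b * D.nor u a c = 0 := by
  rw [sum_comm]; simp only [← sum_mul]
  set t : Fin k → Fin n → ℝ := fun γ c => ∑ b, D.g (D.f u) b c * D.tan u γ b with ht
  have hnor c : D.nor u a c = (if c = a then 1 else 0)
    - ∑ p, ∑ q, (D.h u)⁻¹ p q * D.tan u p c * t q a := rfl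
  have e1 p : ∑ c, t γ c * D.tan u p c = D.h u γ p := inner_tan u γ p
  change ∑ c, t γ c * D.nor u a c = 0; clear_value t
  have e : ∑ c, t γ c * D.nor u a c
    = t γ a - ∑ p, ∑ q, (D.h u)⁻¹ p q * (∑ c, t γ c * D.tan u p c) * t q a := by
    have e0 c : t γ c * D.nor u a c = (if c = a then t γ c else 0)
      - ∑ p, ∑ q, (D.h u)⁻¹ p q * (t γ c * D.tan u p c) * t q a := by
      simp only [hnor, mul_sub, mul_sum, mul_ite, mul_one, mul_zero]; congr 1
      exact sum_ext2 fun _ _ => by ring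
    simp only [e0, sum_sub, sum_ite_eq', mem_univ, if_true]; congr 1; rw [sum_comm]
    refine sum_ext fun _ => ?_; rw [sum_comm]; refine sum_ext fun _ => ?_; rw [mul_sum, sum_mul]
  rw [e]; simp only [e1]; rw [sum_comm]
  have this q : ∑ p, (D.h u)⁻¹ p q * D.h u γ p * t q a = (if γ = q then 1 else 0) * t q a := by
    rw [← hD.reg_h.mul_inv hu γ q, sum_mul]; exact sum_ext fun _ => by ring
  simp [this]

end Reg

namespace Change
variable {D' D : CoordData k n} {φ : Coo k → Coo k} {ψ : Coo n → Coo n}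
  {U' U : Set (Coo k)} {V' V : Set (Coo n)} {u : Coo k}

local notation "Chg" => Change D' D φ ψ U' U V' V
local notation "Jφ" => jac φ u
local notation "Jψ" => jac ψ (D'.f u)

lemma inner_push (h : Chg) (hu : u ∈ U') (v w : Fin n → ℝ) : ∑ b, ∑ c, D'.g (D'.f u) b c * v b * w c
    = ∑ b, ∑ c, D.g (D.f (φ u)) b c * push Jψ v b * push Jψ w c := by
  simp only [h.metric_eq hu, push, ap, mul_sum, sum_mul]; rw [sum_ext fun b => sum_comm, sum_comm]
  refine sum_ext fun p => ?_; rw [sum_ext2 fun b c => rfl]; rw [sum_ext fun b => sum_comm, sum_comm]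
  refine sum_ext fun q => ?_; rw [sum_comm]; exact sum_ext2 fun b c => by ring

lemma sm_jac (h : Chg) (a b) : Sm U' fun z => jac φ z a b := h.pull_h.smooth_jac a b

lemma pd_comp (h : Chg) (hu : u ∈ U') {F : Coo k → ℝ} (hF : Sm U F)
    (a) : pd a (fun z => F (φ z)) u = ap Jφ a fun c => pd c F (φ u) :=
  ConfSub.pd_comp (hF.diffAt h.reg (h.maps u hu)) (h.diffAt hu)

lemma push_covAlong_tan (h : Chg) (hu : u ∈ U') (α β) (p) :
    push Jψ (fun b => covAlong D'.g D'.f α (fun z => D'.tan z β) u b) p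
      = ∑ γ, pd α (fun z => jac φ z β γ) u * D.tan (φ u) γ p + ap Jφ α fun δ => ap Jφ β fun γ =>
          covAlong D.g D.f δ (fun z => D.tan z γ) (φ u) p := by
  have ho := h.reg'
  rw [h.push_covAlong hu (fun a => (h.reg'.sm_tan β a).diffAt ho hu),
    pd_congr ho hu fun z hz => congrFun (h.push_tan hz β) p]
  have hs γ : Sm U' fun z => D.tan (φ z) γ p := (h.reg.sm_tan γ p).comp h.smooth h.maps
  simp only [h.push_tan hu]
  have e1 : pd α (fun z => ap (jac φ z) β fun γ => D.tan (φ z) γ p) u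
    = ∑ γ, pd α (fun z => jac φ z β γ) u * D.tan (φ u) γ p
    + ap Jφ α fun δ => ap Jφ β fun γ => pd δ (fun z => D.tan z γ p) (φ u) := by
    simp only [ap]; rw [pd_sum fun γ _ => ((h.sm_jac β γ).mul (hs γ)).diffAt ho hu]
    have this γ : pd α (fun z => jac φ z β γ * D.tan (φ z) γ p) u
      = pd α (fun z => jac φ z β γ) u * D.tan (φ u) γ p
      + ∑ δ, Jφ α δ * (Jφ β γ * pd δ (fun z => D.tan z γ p) (φ u)) := by
      rw [pd_mul ((h.sm_jac β γ).diffAt ho hu) ((hs γ).diffAt ho hu),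
        h.pd_comp hu (h.reg.sm_tan γ p), ap, mul_sum, add_comm, mul_comm]
      congr 1; exact sum_ext fun _ => by ring
    simp only [this, sum_add, mul_sum]
    rw [sum_comm (γ := Fin k) (f := fun γ δ => Jφ α δ * (Jφ β γ * _))]
  rw [e1, add_assoc]; congr 1; simp only [covAlong, ap_add]; congr 1
  simp only [mul_ap, ap_mul, ← ap_sum]; rw [ap_comm]; rfl

lemma L_eq (h : Chg) (hu : u ∈ U') (p q) (a) : D'.L u p q a = ap Jφ p fun p' => ap Jφ q fun q' =>
      ap Jψ a fun a' => D.L (φ u) p' q' a' := by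
  rw [L_eq_covAlong, h.inner_push hu]
  simp only [h.push_nor hu, h.push_covAlong_tan hu, L_eq_covAlong, mul_add, add_mul, sum_add]
  have e1 : ∑ b, ∑ c, D.g (D.f (φ u)) b c * (∑ t, pd p (fun z => jac φ z q t) u * D.tan (φ u) t b) *
    (ap Jψ a fun b => D.nor (φ u) b c) = 0 := by
    have e2 b c : D.g (D.f (φ u)) b c * (∑ t, pd p (fun z => jac φ z q t) u * D.tan (φ u) t b) *
      (ap Jψ a fun b => D.nor (φ u) b c) = ap Jψ a fun a' => ∑ t, pd p (fun z => jac φ z q t) u *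
      (D.g (D.f (φ u)) b c * D.tan (φ u) t b * D.nor (φ u) a' c) := by
      rw [mul_ap]; congr 1; funext a'; rw [mul_sum, sum_mul]; exact sum_ext fun _ => by ring
    simp only [e2, ← ap_sum]
    have e3 a' : ∑ b, ∑ c, ∑ t, pd p (fun z => jac φ z q t) u *
      (D.g (D.f (φ u)) b c * D.tan (φ u) t b * D.nor (φ u) a' c) = 0 := by
      rw [sum_ext fun b => sum_comm, sum_comm]; refine sum_eq_zero fun t _ => ?_
      simp only [← mul_sum]; rw [h.reg.inner_tan_nor (h.maps u hu), mul_zero]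
    simp only [e3, ap_zero]
  rw [e1, zero_add]; simp only [mul_ap, ap_mul, ← ap_sum]; simp only [ap_comm Jψ a]

lemma H_eq (h : Chg) (hu : u ∈ U') (a) : D'.H u a = ap Jψ a fun a' => D.H (φ u) a' := by
  simp only [H, trT_eq_mtr, h.L_eq hu, mtr_ap, mtr_ap_left_ap, mtr_ap_right_ap, mul_ap, h.trT_eq hu]

lemma Lo_eq (h : Chg) (hu : u ∈ U') (p b) (a) : D'.Lo u p b a = ap Jφ p fun p' => ap Jφ b fun b' =>
      ap Jψ a fun a' => D.Lo (φ u) p' b' a' := by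
  simp only [Lo, h.L_eq hu, h.H_eq hu, h.h_eq hu, ap_sub, ap_mul, mul_ap]

lemma dH_eq (h : Chg) (hu : u ∈ U') (p a) :
    D'.dH u p a = ap Jφ p fun p' => ap Jψ a fun a' => D.dH (φ u) p' a' := by
  have ho := h.reg'.isOpen; have hx := h.reg'.maps u hu
  have hJ b c : Sm U' fun z => jac ψ (D'.f z) b c :=
    (h.pull.smooth_jac b c).comp h.reg'.smooth h.reg'.maps
  have hH c : Sm U' fun z => D.H (φ z) c := (h.reg.sm_H c).comp h.smooth h.maps
  have e1 b : pd p (fun z => D'.H z b) u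
    = ∑ c, (D.H (φ u) c * (∑ d, D'.tan u p d * pd d (fun x => jac ψ x b c) (D'.f u))
    + Jψ b c * ap Jφ p fun t => pd t (fun z => D.H z c) (φ u)) := by
    rw [pd_congr ho hu fun z hz => h.H_eq hz b]; simp only [ap]
    rw [pd_sum fun c _ => ((hJ b c).mul (hH c)).diffAt ho hu]; refine sum_ext fun c => ?_
    rw [pd_mul ((hJ b c).diffAt ho hu) ((hH c).diffAt ho hu), h.pd_comp hu (h.reg.sm_H c),
      ConfSub.pd_comp (F := fun x => jac ψ x b c)
      ((h.pull.smooth_jac b c).diffAt h.pull.isOpen hx) (h.reg'.diffAt hu), add_comm]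
    rfl
  have e2 a b c : pd b (fun x => jac ψ x a c) (D'.f u) = ∑ e, Γ D'.g (D'.f u) e b a * Jψ e c
    - ∑ d, ∑ e, Γ D.g (D.f (φ u)) c d e * Jψ b d * Jψ a e := by
    have := h.pull.covAlong_jac hx b a c; rw [covAlong, h.comm u hu] at this; rw [← this]
    simp only [jac]; ring
  have e3 b : ∑ c, ∑ d, Γ D'.g (D'.f u) c d b * D'.tan u p d * D'.H u c
    = ∑ c, D.H (φ u) c * ∑ d, D'.tan u p d * ∑ e, Γ D'.g (D'.f u) e d b * Jψ e c := by
    simp only [h.H_eq hu, ap, mul_sum]; rw [sum_ext fun c => sum_comm, sum_comm]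
    refine sum_ext fun c => ?_; rw [sum_comm]; exact sum_ext2 fun d e => by ring
  have e4 b : pd p (fun z => D'.H z b) u - ∑ c, ∑ d, Γ D'.g (D'.f u) c d b * D'.tan u p d * D'.H u c
    = ∑ e, Jψ b e * ap Jφ p fun t => (pd t (fun z => D.H z e) (φ u)
    - ∑ c, ∑ d, Γ D.g (D.f (φ u)) c d e * D.tan (φ u) t d * D.H (φ u) c) := by
    rw [e1, e3, sum_add, add_sub_right_comm, ← sum_sub]
    simp only [ap_sub, mul_sub, sum_sub]; rw [add_comm, sub_eq_add_neg (∑ e, _)]; congr 1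
    have e5 e : (ap Jφ p fun t => ∑ c, ∑ d, Γ D.g (D.f (φ u)) c d e *
        D.tan (φ u) t d * D.H (φ u) c) = ∑ c, ∑ d, Γ D.g (D.f (φ u)) c d e *
          push Jψ (D'.tan u p) d * D.H (φ u) c := by
      simp only [h.push_tan hu, mul_ap, ap_mul, ← ap_sum]
    simp only [e5, e2, mul_sub, sum_sub, push]
    rw [← sub_eq_add_neg, sub_sub_cancel_left, neg_inj]; simp only [mul_sum, sum_mul]; symm
    rw [sum_comm]; refine sum_ext fun c => ?_; rw [sum_comm]; symm; rw [sum_comm]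
    refine sum_ext fun d => ?_; rw [sum_comm]; exact sum_ext2 fun _ _ => by ring
  have e6 : ∀ X : Fin n → ℝ, ∑ b, (∑ e, Jψ b e * X e) * D'.nor u a b
    = ap Jψ a fun a' => ∑ e, X e * D.nor (φ u) a' e := by
    intro X
    have e7 : (ap Jψ a fun a' => ∑ e, X e * D.nor (φ u) a' e)
      = ∑ e, X e * push Jψ (D'.nor u a) e := by simp only [h.push_nor hu, mul_ap, ← ap_sum]
    rw [e7]; simp only [push, mul_sum, sum_mul]; rw [sum_comm]; exact sum_ext2 fun _ _ => by ring
  simp only [dH, e4, e6, ap_mul, ← ap_sum]; rw [ap_comm]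

lemma Dt_eq (h : Chg) (hu : u ∈ U') (p a) :
    D'.Dt u p a = ap Jφ p fun p' => ap Jψ a fun a' => D.Dt (φ u) p' a' := by
  simp only [Dt, h.Sch_eq hu, h.push_tan hu, h.push_nor hu, Sch_ap, h.dH_eq hu, ap_sub]
  rw [ap_comm]

end Change

section Slots
variable {ι κ : Type*} [Fintype κ] (D : CoordData k n) (u : Coo k) (M : ι → κ → ℝ) (i : ι)
  (w : κ → Fin n → ℝ)

local notation "wM" => fun b => ap M i fun c => w c b

lemma cC_ap : (∀ x y, D.cC u (wM) x y = ap M i fun c => D.cC u (w c) x y) ∧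
    (∀ x y, D.cC u x (wM) y = ap M i fun c => D.cC u x (w c) y) ∧
    (∀ x y, D.cC u x y (wM) = ap M i fun c => D.cC u x y (w c)) := by
  and_intros <;> simp only [cC, Cot_ap, W_ap, mul_ap, trA_eq_mtr, mtr_ap, ap_sub, implies_true]

end Slots

namespace Change
variable {D' D : CoordData k n} {φ : Coo k → Coo k} {ψ : Coo n → Coo n}
  {U' U : Set (Coo k)} {V' V : Set (Coo n)} {u : Coo k}

local notation "Chg" => Change D' D φ ψ U' U V' V
local notation "Jφ" => jac φ u
local notation "Jψ" => jac ψ (D'.f u)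

lemma Wtt_eq (h : Chg) (hu : u ∈ U') (a b) : D'.Wtt u a b
    = ap Jφ a fun a' => ap Jφ b fun b' => D.Wtt (φ u) a' b' := by
  simp only [Wtt, h.W_eq hu, h.push_tan hu, W_ap, trT_eq_mtr, mtr_ap, mtr_ap_right_ap, h.trT_eq' hu]
  simp only [ap_comm Jφ b Jφ a]

lemma Wtn_eq (h : Chg) (hu : u ∈ U') (p a) : D'.Wtn u p a
    = ap Jφ p fun p' => ap Jψ a fun a' => D.Wtn (φ u) p' a' := by
  simp only [Wtn, h.W_eq hu, h.push_tan hu, h.push_nor hu, W_ap,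
    trT_eq_mtr, mtr_ap, mtr_ap_right_ap, h.trT_eq' hu]
  simp only [ap_comm Jψ a Jφ p]

lemma Wnn_eq (h : Chg) (hu : u ∈ U') (a b) : D'.Wnn u a b
    = ap Jψ a fun a' => ap Jψ b fun b' => D.Wnn (φ u) a' b' := by
  simp only [Wnn, h.W_eq hu, h.push_tan hu, h.push_nor hu, W_ap,
    trT_eq_mtr, mtr_ap, mtr_ap_right_ap, h.trT_eq' hu]
  simp only [ap_comm Jψ b Jψ a]

lemma Wtr_eq (h : Chg) (hu : u ∈ U') : D'.Wtr u = D.Wtr (φ u) := by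
  simp only [Wtr, h.Wtt_eq hu, trT_eq_mtr, h.trT_eq hu]

lemma Lo2_eq (h : Chg) (hu : u ∈ U') (a b) : D'.Lo2 u a b
    = ap Jφ a fun a' => ap Jφ b fun b' => D.Lo2 (φ u) a' b' := by
  simp only [Lo2, h.Lo_eq hu, trT_eq_mtr, trA_eq_mtr, ap_mul, mul_ap, mtr_ap, mtr_ap_right_ap,
    h.trT_eq' hu, h.trA_eq' hu]
  simp only [ap_comm Jφ b Jφ a]

lemma normLo_eq (h : Chg) (hu : u ∈ U') : D'.normLo u = D.normLo (φ u) := by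
  simp only [normLo, h.Lo_eq hu, trT_eq_mtr, trA_eq_mtr, ap_mul, mul_ap, mtr_ap, mtr_ap_right_ap,
    h.trT_eq' hu, h.trA_eq' hu]

lemma normH_eq (h : Chg) (hu : u ∈ U') : D'.normH u = D.normH (φ u) := by
  simp only [normH, h.H_eq hu, trA_eq_mtr, ap_mul, mul_ap, h.trA_eq' hu]

lemma trLo3_eq (h : Chg) (hu : u ∈ U') (a) : D'.trLo3 u a = ap Jψ a fun a' => D.trLo3 (φ u) a' := by
  simp only [trLo3, h.Lo_eq hu, trT_eq_mtr, trA_eq_mtr, ap_mul, mul_ap, mtr_ap, mtr_ap_right_ap,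
    h.trT_eq' hu, h.trA_eq' hu]

lemma cP_eq (h : Chg) (hu : u ∈ U') (a b) : D'.cP u a b
    = ap Jφ a fun a' => ap Jφ b fun b' => D.cP (φ u) a' b' := by
  simp only [cP, h.Sch_eq hu, h.push_tan hu, Sch_ap, h.H_eq hu, h.Lo_eq hu, h.normH_eq hu, h.h_eq hu, ap_add,
    trA_eq_mtr, ap_mul, mul_ap, mtr_ap, h.trA_eq' hu]
  simp only [ap_comm Jφ b Jφ a]

lemma cC_eq (h : Chg) (hu : u ∈ U') (v0 v1 v2 : Fin n → ℝ) :
    D'.cC u v0 v1 v2 = D.cC (φ u) (push Jψ v0) (push Jψ v1) (push Jψ v2) := by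
  simp only [cC, h.Cot_eq hu, h.H_eq hu, h.W_eq hu, h.push_nor hu, W_ap,
    trA_eq_mtr, ap_mul, mul_ap, h.trA_eq' hu]

lemma cC1_eq (h : Chg) (hu : u ∈ U') (a) : D'.cC1 u a = ap Jφ a fun a' => D.cC1 (φ u) a' := by
  simp only [cC1, h.cC_eq hu, h.push_tan hu, cC_ap, trT_eq_mtr, mtr_ap_right_ap, h.trT_eq' hu]

lemma cB_eq (h : Chg) (hu : u ∈ U') (a b) : D'.cB u a b
    = ap Jφ a fun a' => ap Jφ b fun b' => D.cB (φ u) a' b' := by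
  simp only [cB, h.Bach_eq hu, h.Cot_eq hu, h.W_eq hu, h.push_tan hu, h.push_nor hu, Bach_ap,
    Cot_ap, W_ap, h.H_eq hu, mul_add, ap_add, mtr_add,
    trA_eq_mtr, ap_mul, mul_ap, mtr_ap, mtr_ap_right_ap, h.trA_eq' hu]
  simp only [ap_comm Jφ b Jφ a]

lemma formLW_eq (h : Chg) (hu : u ∈ U') (a) : D'.formLW u a
    = ap Jφ a fun a' => D.formLW (φ u) a' := by
  simp only [formLW, h.W_eq hu, h.push_tan hu, h.push_nor hu, W_ap, h.Lo_eq hu,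
    trT_eq_mtr, trA_eq_mtr, ap_mul, mul_ap, mtr_ap, mtr_ap_right_ap, h.trT_eq' hu, h.trA_eq' hu]

lemma formLWtn_eq (h : Chg) (hu : u ∈ U') (a) : D'.formLWtn u a
    = ap Jφ a fun a' => D.formLWtn (φ u) a' := by
  simp only [formLWtn, h.Wtn_eq hu, h.Lo_eq hu,
    trT_eq_mtr, trA_eq_mtr, ap_mul, mul_ap, mtr_ap, mtr_ap_right_ap, h.trT_eq' hu, h.trA_eq' hu]

lemma formDL_eq (h : Chg) (hu : u ∈ U') (a) : D'.formDL u a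
    = ap Jφ a fun a' => D.formDL (φ u) a' := by
  simp only [formDL, h.Dt_eq hu, h.Lo_eq hu,
    trT_eq_mtr, trA_eq_mtr, ap_mul, mul_ap, mtr_ap, mtr_ap_right_ap, h.trT_eq' hu, h.trA_eq' hu]

/-- The scalars that occur in the invariants do not depend on the coordinates. -/
lemma scalars_eq (h : Chg) (hu : u ∈ U') :
    D'.normD u = D.normD (φ u) ∧ D'.cPtr u = D.cPtr (φ u) ∧ D'.cBtr u = D.cBtr (φ u) ∧ D'.sLC u =
    D.sLC (φ u) ∧ D'.sDW u = D.sDW (φ u) ∧ D'.sLo2P u = D.sLo2P (φ u) ∧ D'.sWP u = D.sWP (φ u) ∧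
    D'.sLLWttnn u = D.sLLWttnn (φ u) ∧ D'.sLLWtntn u = D.sLLWtntn (φ u) ∧ D'.sLLWtttt u = D.sLLWtttt
    (φ u) ∧ D'.sLo2W u = D.sLo2W (φ u) ∧ D'.sLLWnn u = D.sLLWnn (φ u) ∧ D'.sWtnWtn u = D.sWtnWtn (φ
    u) ∧ D'.sWttnt u = D.sWttnt (φ u) ∧ D'.sWtttn u = D.sWtttn (φ u) ∧ D'.sWttaa u = D.sWttaa (φ u)
    ∧ D'.sWtata u = D.sWtata (φ u) ∧ D'.sWaa u = D.sWaa (φ u) ∧ D'.sLdW u = D.sLdW (φ u) ∧ D'.sHdW u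
    = D.sHdW (φ u) ∧ D'.sddW u = D.sddW (φ u) ∧ D'.sRicN u = D.sRicN (φ u) ∧ D'.sLo2Ric u =
    D.sLo2Ric (φ u) ∧ D'.sRicW u = D.sRicW (φ u) ∧ D'.sHLo3 u = D.sHLo3 (φ u) ∧ D'.sHLW u = D.sHLW
    (φ u) ∧ D'.sWdH u = D.sWdH (φ u) := by
  and_intros <;> simp only [
    normD, cPtr, cBtr, sLC, sDW, sLo2P, sWP, sLLWttnn, sLLWtntn, sLLWtttt, sLo2W, sLLWnn, sWtnWtn,
    sWttnt, sWtttn, sWttaa, sWtata, sWaa, sLdW, sHdW, sddW, sRicN, sLo2Ric, sRicW, sHLo3, sHLW,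
    sWdH, h.W_eq hu, h.dW_eq hu, h.ddW_eq hu, h.Ric_eq hu, h.cC_eq hu, h.Lo_eq hu, h.H_eq hu,
    h.Dt_eq hu, h.dH_eq hu, h.Lo2_eq hu, h.Wtt_eq hu, h.Wtn_eq hu, h.Wnn_eq hu, h.cP_eq hu, h.cB_eq
    hu, h.trLo3_eq hu, h.push_tan hu, h.push_nor hu, push_amb, W_ap, dW_ap, ddW_ap, Ric_ap, cC_ap, trT_eq_mtr, trA_eq_mtr, ap_mul, mul_ap, mtr_ap,
    mtr_ap_right_ap, h.trT_eq hu, h.trT_eq' hu, h.trA_eq' hu]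

lemma divergence_eq (h : Chg) (hu : u ∈ U') {θ' θ : Coo k → Fin k → ℝ}
    (hθ : ∀ p, Sm U fun z => θ z p)
    (he : ∀ z ∈ U', ∀ p, θ' z p = ap (jac φ z) p fun q => θ (φ z) q) :
    divergence D'.h θ' u = divergence D.h θ (φ u) := by
  have e := h.pull_h.cov_eq (T := fun z (I : Fin 1 → Fin k) => θ z (I 0))
    (T' := fun z (I : Fin 1 → Fin k) => θ' z (I 0)) (fun I => hθ _)
    (fun z hz I => by rw [evalTensor_one, he z hz]; rfl) hu
  have e2 := h.trT_eq hu fun a b => cov D.h (fun z (I : Fin 1 → Fin k) => θ z (I 0)) (φ u) ![a, b]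
  simp only [divergence, e, evalTensor_two]; exact e2

lemma laplacian_eq (h : Chg) (hu : u ∈ U') {F' F : Coo k → ℝ}
    (hF : Sm U F) (he : ∀ z ∈ U', F' z = F (φ z)) : laplacian D'.h F' u = laplacian D.h F (φ u) :=
  h.divergence_eq hu (fun a => hF.pd h.reg a) fun z hz a => by
    rw [← h.pd_comp hz hF]; exact pd_congr h.reg' hz he

lemma K1_eq (h : Chg) (hu : u ∈ U') : D'.K1 u = D.K1 (φ u) := by
  simp only [K1, h.scalars_eq hu, h.divergence_eq hu h.reg.sm_formLW fun z hz a => h.formLW_eq hz a]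

lemma K2_eq (h : Chg) (hu : u ∈ U') : D'.K2 u = D.K2 (φ u) := by
  simp only [K2, h.scalars_eq hu, h.divergence_eq hu h.reg.sm_formLWtn fun z hz a => h.formLWtn_eq hz a]

lemma lapWtr_eq (h : Chg) (hu : u ∈ U') : laplacian D'.h D'.Wtr u = laplacian D.h D.Wtr (φ u) :=
    h.laplacian_eq hu h.reg.sm_Wtr fun _ hz => h.Wtr_eq hz

lemma lapNormLo_eq (h : Chg) (hu : u ∈ U') :
    laplacian D'.h D'.normLo u = laplacian D.h D.normLo (φ u) :=
  h.laplacian_eq hu h.reg.sm_normLo fun _ hz => h.normLo_eq hz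

lemma divC_eq (h : Chg) (hu : u ∈ U') : divergence D'.h D'.cC1 u = divergence D.h D.cC1 (φ u) :=
    h.divergence_eq hu h.reg.sm_cC1 fun _ hz a => h.cC1_eq hz a

lemma divDL_eq (h : Chg) (hu : u ∈ U') :
    divergence D'.h D'.formDL u = divergence D.h D.formDL (φ u) :=
  h.divergence_eq hu h.reg.sm_formDL fun _ hz a => h.formDL_eq hz a

lemma clearedJ_eq (h : Chg) (hu : u ∈ U') : D'.clearedJ u = D.clearedJ (φ u) := by
  simp only [clearedJ, h.lapWtr_eq hu, h.Wtr_eq hu, h.scalars_eq hu, h.divC_eq hu]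

lemma twoIJ_eq (h : Chg) (hu : u ∈ U') : D'.twoIJ u = D.twoIJ (φ u) := by
  have h1 : ∀ {z}, z ∈ U' → D'.G z = D.G (φ z) := fun hz => by
    simp only [G, h.normLo_eq hz, h.Wtr_eq hz]
  have h2 := h.laplacian_eq hu h.reg.sm_G fun _ hz => h1 hz
  have h3 := h.divergence_eq hu (fun a => (h.reg.sm_cC1 a).sub (h.reg.sm_formDL a))
    (θ' := fun z a => D'.cC1 z a - D'.formDL z a) fun z hz a => by
      rw [h.cC1_eq hz, h.formDL_eq hz, ap_sub]
  simp only [twoIJ, cI, cJ, h1 hu, h2, h3, h.scalars_eq hu, h.lapWtr_eq hu, h.Wtr_eq hu, h.divC_eq hu]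

lemma N1_eq (h : Chg) (hu : u ∈ U') : D'.N1 u = D.N1 (φ u) := by
  simp only [N1, h.twoIJ_eq hu, h.K1_eq hu, h.K2_eq hu, h.scalars_eq hu]

lemma N2_eq (h : Chg) (hu : u ∈ U') : D'.N2 u = D.N2 (φ u) := by
  simp only [N2, h.clearedJ_eq hu, h.K1_eq hu, h.K2_eq hu, h.scalars_eq hu]

lemma scalarCurv_eq (h : Chg) (hu : u ∈ U') :
    scalarCurv D'.g (D'.f u) = scalarCurv D.g (D.f (φ u)) := by
  rw [h.pull.scalarCurv_eq (h.reg'.maps u hu), h.comm u hu]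

lemma J1CHO_eq (h : Chg) (hu : u ∈ U') : D'.J1CHO u = D.J1CHO (φ u) := by
  simp only [J1CHO, h.scalarCurv_eq hu, h.scalars_eq hu, h.normLo_eq hu, h.normH_eq hu]

lemma J2CHO_eq (h : Chg) (hu : u ∈ U') : D'.J2CHO u = D.J2CHO (φ u) := by
  simp only [J2CHO, h.scalarCurv_eq hu, h.scalars_eq hu, h.Wtr_eq hu, h.normH_eq hu]

end Change
end CoordData

/-! ### Adapted coordinates at a point of the submanifold -/

lemma push_injective_of_inverse {m : ℕ} {J N : Fin m → Fin m → ℝ}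
    (hN : ∀ a c, ∑ b, J a b * N b c = if a = c then 1 else 0) {v w : Fin m → ℝ}
    (h : push J v = push J w) : v = w := by
  have key : ∀ v : Fin m → ℝ, ∀ d, ∑ c, push J v c * N c d = v d := by
    intro v d; simp only [push, sum_mul, mul_assoc]; rw [sum_comm]; simp only [← mul_sum, hN]; simp
  funext d; rw [← key v d, ← key w d, h]

namespace IsPull
variable {m : ℕ} {g' g : MetricField m} {ψ : Coo m → Coo m} {V' V : Set (Coo m)} {x : Coo m}

lemma push_injective (h : IsPull g' g ψ V' V) (hx : x ∈ V') {v w : Fin m → ℝ}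
    (he : push (jac ψ x) v = push (jac ψ x) w) : v = w := by
  obtain ⟨N, -, hN⟩ := h.exists_inverse hx; exact push_injective_of_inverse hN he

lemma fderiv_apply (h : IsPull g' g ψ V' V) (hx : x ∈ V') (v c) :
    fderiv ℝ ψ x v c = push (jac ψ x) v c := by
  rw [← hasFDerivAt_apply_coo (h.diffAt hx), fderiv_eq_sum_pd]; rfl

lemma exists_hasFDerivAt_equiv (h : IsPull g' g ψ V' V) (hx : x ∈ V') :
    ∃ e : Coo m ≃L[ℝ] Coo m, HasFDerivAt ψ (e : Coo m →L[ℝ] Coo m) x := by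
  have hinj : Function.Injective (fderiv ℝ ψ x) := by
    intro v w hvw
    have : push (jac ψ x) v = push (jac ψ x) w := by
      funext c; rw [← h.fderiv_apply hx, ← h.fderiv_apply hx, hvw]
    ext c; exact congrFun (h.push_injective hx this) c
  refine ⟨(LinearEquiv.ofInjectiveEndo (fderiv ℝ ψ x : Coo m →ₗ[ℝ] Coo m)
    hinj).toContinuousLinearEquiv, ?_⟩
  convert! (h.diffAt hx).hasFDerivAt using 1

lemma exists_localInverse (h : IsPull g' g ψ V' V) (hx : x ∈ V') :
    ∃ (χ : Coo m → Coo m) (O : Set (Coo m)), IsOpen O ∧ ψ x ∈ O ∧ χ (ψ x) = x ∧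
      ContDiffOn ℝ ∞ χ O ∧ ∀ y ∈ O, χ y ∈ V' ∧ ψ (χ y) = y := by
  have hc : ∀ y ∈ V', ContDiffAt ℝ ∞ ψ y := fun y hy => h.smooth.contDiffAt (h.isOpen.mem_nhds hy)
  obtain ⟨e, he⟩ := h.exists_hasFDerivAt_equiv hx
  set Φ := (hc x hx).toOpenPartialHomeomorph ψ he (by simp) with hΦ
  have hcoe : (Φ : Coo m → Coo m) = ψ := rfl
  have hxs : x ∈ Φ.source := (hc x hx).mem_toOpenPartialHomeomorph_source he (by simp)
  refine ⟨Φ.symm, Φ.target ∩ Φ.symm ⁻¹' V', Φ.isOpen_inter_preimage_symm h.isOpen,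
    ⟨?_, ?_⟩, ?_, ?_, ?_⟩
  · rw [← hcoe]; exact Φ.map_source hxs
  · rw [Set.mem_preimage, ← hcoe, Φ.left_inv hxs]; exact hx
  · rw [← hcoe, Φ.left_inv hxs]
  · intro y hy
    obtain ⟨e', he'⟩ := h.exists_hasFDerivAt_equiv hy.2
    exact (Φ.contDiffAt_symm hy.1 he' (hc _ hy.2)).contDiffWithinAt
  · intro y hy
    exact ⟨hy.2, Φ.right_inv hy.1⟩

end IsPull

lemma push_eq_ap {l m : ℕ} (J : Fin l → Fin m → ℝ) (v : Fin l → ℝ) (c) :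
    push J v c = ap (fun _ : Unit => v) () fun a => J a c := rfl

lemma exists_orthonormal_frame_extending {k m : ℕ} {G : Matrix (Fin (k + m)) (Fin (k + m)) ℝ}
    (hG : G.PosDef) {t : Fin k → Fin (k + m) → ℝ}
    (ht : ∀ p q, (ap t p fun c => ap t q fun d => G c d) = if p = q then 1 else 0) :
    ∃ E : Fin (k + m) → Fin (k + m) → ℝ, (∀ p, E (Fin.castAdd m p) = t p) ∧
    ∀ a b, (ap E a fun c => ap E b fun d => G c d) = if a = b then 1 else 0 := by
  obtain ⟨F, hF⟩ := exists_orthonormal_frame hG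
  have hF1 a b : (1 : Matrix (Fin (k + m)) (Fin (k + m)) ℝ) a b
      = ap F a fun c => ap F b fun d => G c d := by rw [hF, Matrix.one_apply]
  obtain ⟨N, hN, hN'⟩ := exists_inverse_of_metric hF1 (by simp)
  have hNF : ∀ v, push F (push N v) = v := by
    intro v; funext c; simp only [push, sum_mul, mul_assoc]; rw [sum_comm]
    simp only [← mul_sum, hN]; simp
  have hin : ∀ v w : Fin (k + m) → ℝ, ∑ c, push F v c * ∑ d, push F w d * G c d
    = ∑ a, v a * w a := by
    intro v w; have : ∀ a b, ∑ c, F a c * ∑ d, F b d * G c d = if a = b then 1 else 0 := hF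
    simp only [push_eq_ap, sum_ap_mul, sum_mul_ap, this]; simp [ap]
  set B : Fin k → Fin (k + m) → ℝ := fun p => push N (t p) with hB
  have hBt p : push F (B p) = t p := hNF _
  have hBB p q : ∑ a, B p a * B q a = if p = q then 1 else 0 := by
        rw [← hin, hBt, hBt]; exact ht p q
  set v : Fin (k + m) → Coo (k + m) := Fin.addCases (fun p => WithLp.toLp 2 (B p)) (fun _ => 0)
    with hv
  have hvl p : v (Fin.castAdd m p) = WithLp.toLp 2 (B p) := by simp [hv]
  obtain ⟨b, hb⟩ := Orthonormal.exists_orthonormalBasis_extension_of_card_eq (𝕜 := ℝ)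
    (E := Coo (k + m)) (ι := Fin (k + m)) (by simp) (v := v) (s := Set.range (Fin.castAdd m)) (by
      rw [orthonormal_iff_ite]; rintro ⟨_, p, rfl⟩ ⟨_, q, rfl⟩
      have h1 : inner ℝ (v (Fin.castAdd m p)) (v (Fin.castAdd m q)) = if p = q then 1 else 0 := by
        rw [hvl, hvl, ← hBB, PiLp.inner_apply]; exact sum_ext fun _ => by simp [mul_comm]
      refine h1.trans ?_
      by_cases hαβ : p = q
      · subst hαβ; simp
      · rw [if_neg hαβ, if_neg fun h => hαβ (Fin.castAdd_injective k m (congrArg Subtype.val h))])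
  have hb' p : b (Fin.castAdd m p) = WithLp.toLp 2 (B p) := (hb _ ⟨p, rfl⟩).trans (hvl p)
  refine ⟨fun a => push F (b a), fun p => ?_, fun a c => ?_⟩
  · change push F (b (Fin.castAdd m p)) = t p
    rw [hb']; exact hBt p
  · have := hin (b a) (b c)
    refine this.trans ?_; have ho := orthonormal_iff_ite.1 b.orthonormal a c
    rw [← ho, PiLp.inner_apply]; exact sum_ext fun _ => by simp [mul_comm]

namespace CoordData

/-- A point at which ambient coordinates are normal, the coordinates of the submanifold are normal
for the induced metric, and the submanifold is tangent to the first coordinate directions. -/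
structure IsSpecialAt {k m : ℕ} (D : CoordData k (k + m)) (u : Coo k) : Prop where
  normal : IsNormalAt D.g (D.f u)
  normal_h : IsNormalAt D.h u
  tan : ∀ α, D.tan u α = amb (Fin.castAdd m α)

lemma Reg.exists_special {k m : ℕ} {D : CoordData k (k + m)} {U : Set (Coo k)}
    {V : Set (Coo (k + m))} {u0} (hD : D.Reg U V) (hu : u0 ∈ U) :
    ∃ (D' : CoordData k (k + m)) (φ : Coo k → Coo k) (ψ : Coo (k + m) → Coo (k + m))
      (U' : Set (Coo k)) (V' : Set (Coo (k + m))), Change D' D φ ψ U' U V' V ∧ (0 : Coo k) ∈ U' ∧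
        φ 0 = u0 ∧ D'.IsSpecialAt 0 := by
  obtain ⟨A, hA⟩ := exists_orthonormal_frame (hD.posDef_h hu)
  obtain ⟨h', φ, U1, hφ, hPh, h0, hφ0, hjφ, hnh⟩ := hD.reg_h.exists_normal hu hA
  obtain ⟨E, hEt, hE⟩ := exists_orthonormal_frame_extending
    (hD.metric.posDef _ (hD.maps _ hu)) (t := fun p c => ap A p fun q => D.tan u0 q c) (by
      intro p q; rw [← hA p q]; simp only [h_eq_ap]
      have : ∀ X : Fin (k + m) → ℝ, ∀ p, (ap (fun p c => ap A p fun q => D.tan u0 q c) p X)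
        = ap A p fun γ => ap (D.tan u0) γ X := by
        intro X p; simp only [ap]; exact sum_ap_mul A p (fun q c => D.tan u0 q c) X
      simp only [this]; congr 1; funext γ
      rw [ap_comm (D.tan u0) γ A q])
  obtain ⟨g', ψ, V', hψ, hPg, hv0, hψ0, hjψ, hng⟩ := hD.metric.exists_normal (hD.maps _ hu) hE
  obtain ⟨χ, O, hO, hO0, hχ0, hχ, hχO⟩ := hPg.exists_localInverse hv0; rw [hψ0] at hO0 hχ0
  set f' : Coo k → Coo (k + m) := fun u => χ (D.f (φ u)) with hf'
  set U' : Set (Coo k) := U1 ∩ (fun u => D.f (φ u)) ⁻¹' O with hU'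
  have hfφ : ContDiffOn ℝ ∞ (fun u => D.f (φ u)) U1 := hD.smooth.comp hφ.contDiffOn hPh.maps
  have hU'o : IsOpen U' := hfφ.continuousOn.isOpen_inter_preimage hPh.isOpen hO
  have hf's : ContDiffOn ℝ ∞ f' U' := hχ.comp (hfφ.mono Set.inter_subset_left) fun u hu => hu.2
  have hmaps : ∀ u ∈ U', f' u ∈ V' := fun u hu => (hχO _ hu.2).1
  have hcomm : ∀ u ∈ U', ψ (f' u) = D.f (φ u) := fun u hu => (hχO _ hu.2).2
  have hpush : ∀ u ∈ U', ∀ p, push (jac ψ (f' u)) (fun a => pd p (fun z => f' z a) u)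
    = fun c => ap (jac φ u) p fun q => D.tan (φ u) q c := by
    intro u hu p; funext c
    have hd : DifferentiableAt ℝ f' u :=
      (hf's.contDiffAt (hU'o.mem_nhds hu)).differentiableAt (by simp)
    have e1 : pd p (fun z => ψ (f' z) c) u
      = push (jac ψ (f' u)) (fun a => pd p (fun z => f' z a) u) c :=
      pd_comp ((Sm.coord hPg.smooth c).diffAt hPg.isOpen (hmaps u hu)) hd
    have e2 : pd p (fun z => D.f (φ z) c) u = ap (jac φ u) p fun q => D.tan (φ u) q c :=
      pd_comp ((Sm.coord hD.smooth c).diffAt hD.isOpen (hPh.maps u hu.1)) (hPh.diffAt hu.1)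
    rw [← e1, ← e2]; exact pd_congr hU'o hu fun z hz => by rw [hcomm z hz]
  have hreg : (⟨g', f'⟩ : CoordData k (k + m)).Reg U' V' := by
    refine ⟨hU'o, hf's, hmaps, hPg.reg', fun u hu => ?_⟩; rw [Fintype.linearIndependent_iff]
    intro c hc
    have hcc : push (jac φ u) c = 0 := by
      have him := Fintype.linearIndependent_iff.1 (hD.imm (φ u) (hPh.maps u hu.1)); funext q
      refine him _ ?_ q; funext e
      have h1 : ∑ p, c p * push (jac ψ (f' u)) (fun a => pd p (fun z => f' z a) u) e = 0 := by
        have h2 := fun a => congrFun hc a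
        simp only [Finset.sum_apply, Pi.smul_apply, smul_eq_mul, Pi.zero_apply] at h2
        simp only [push, mul_sum]; rw [sum_comm]; refine sum_eq_zero fun a _ => ?_
        have h3 : ∑ p, c p * pd p (fun z => f' z a) u = 0 := h2 a
        simp only [← mul_assoc, ← sum_mul, h3, zero_mul]
      simp only [fun p => congrFun (hpush u hu p) e, ap, mul_sum] at h1; rw [sum_comm] at h1
      simpa [push, Finset.sum_apply, sum_mul, mul_assoc] using h1
    exact congrFun (hPh.push_injective hu.1 (hcc.trans (by funext; simp [push])))
  have hch : Change (⟨g', f'⟩ : CoordData k (k + m)) D φ ψ U' U V' V :=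
    ⟨hreg, hD, hPg, hφ.contDiffOn, fun u hu => hPh.maps u hu.1, hcomm⟩
  have h0' : (0 : Coo k) ∈ U' := ⟨h0, by rw [Set.mem_preimage, hφ0]; exact hO0⟩
  have hf0 : f' 0 = 0 := by rw [hf']; simp only [hφ0]; exact hχ0
  have hheq : ∀ u ∈ U', CoordData.h ⟨g', f'⟩ u = h' u := by
    intro u hu; ext p q; rw [hch.h_eq hu, hPh.eq u hu.1]
  refine ⟨⟨g', f'⟩, φ, ψ, U', V', hch, h0', hφ0, ?_, ⟨?_, ?_⟩, ?_⟩
  · change IsNormalAt g' (f' 0); rwa [hf0]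
  · rw [hheq 0 h0', hnh.one]
  · intro c a b
    rw [← hnh.conn c a b]; simp only [christoffel, hheq 0 h0']
    have this d a b : pd d (fun z => CoordData.h ⟨g', f'⟩ z a b) 0 = pd d (fun z => h' z a b) 0 := pd_congr hU'o h0' fun z hz => by rw [hheq z hz]
    simp only [this]
  · intro p
    refine hPg.push_injective (hmaps 0 h0') ?_; rw [Change.push_amb]; have := hpush 0 h0' p
    refine this.trans ?_; funext c; have e := congrFun (hEt p) c
    simp only [hf0, funext hjψ, funext hjφ, hφ0]; rw [← e]; simp [ap, amb, Pi.single_apply]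

end CoordData

/-- The `α`-th tangential index. -/
def tg {k m : ℕ} (α : Fin k) : Fin (k + m) := Fin.castAdd m α

/-- The `j`-th normal index. -/
def nm {k m : ℕ} (j : Fin m) : Fin (k + m) := Fin.natAdd k j

local prefix:max "~" => tg
local prefix:max "&" => nm

section Indices
variable {k m : ℕ}

lemma sum_tg_nm (F : Fin (k + m) → ℝ) : ∑ a, F a = ∑ p, F ~p + ∑ j, F &j := Fin.sum_univ_add F

lemma kd_tg (a b) : kd (~a : Fin (k + m)) ~b = kd a b := by simp [kd, tg]

lemma kd_nm (i j) : kd (&i : Fin (k + m)) &j = kd i j := by simp [kd, nm]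

lemma kd_tg_nm (a : Fin k) (j : Fin m) : kd ~a &j = 0 := by
  have : (~a : Fin (k + m)) ≠ &j := by
    intro h; have := congrArg Fin.val h; simp [tg, nm] at this; omega
  simp [kd, this]

lemma kd_nm_tg (a : Fin k) (j : Fin m) : kd &j ~a = 0 := by rw [kd_comm, kd_tg_nm]

end Indices

namespace CoordData

lemma amb_apply {n : ℕ} (a b : Fin n) : amb a b = kd a b := by
  simp [amb, kd, Pi.single_apply, eq_comm]

section Components
variable {k n : ℕ} (D : CoordData k n) (u : Coo k)

/-- Components of the Weyl tensor along the map. -/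
def wc (a b c d : Fin n) : ℝ := weyl D.g (D.f u) ![a, b, c, d]

/-- Components of the covariant derivative of the Weyl tensor along the map. -/
def dwc (e a b c d : Fin n) : ℝ := cov D.g (weyl D.g) (D.f u) ![e, a, b, c, d]

/-- Components of the Schouten tensor along the map. -/
def pc (a b : Fin n) : ℝ := schouten D.g (D.f u) ![a, b]

/-- Components of the Cotton tensor along the map. -/
def cc (a b c : Fin n) : ℝ := cotton D.g (D.f u) ![a, b, c]

lemma W_eq_sum (v0 v1 v2 v3 : Fin n → ℝ) : D.W u v0 v1 v2 v3
    = ∑ a, v0 a * ∑ b, v1 b * ∑ c, v2 c * ∑ d, v3 d * D.wc u a b c d := evalTensor_four _ _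

lemma dW_eq_sum (v v0 v1 v2 v3 : Fin n → ℝ) : D.dW u v v0 v1 v2 v3
    = ∑ e, v e * ∑ a, v0 a * ∑ b, v1 b * ∑ c, v2 c * ∑ d, v3 d * D.dwc u e a b c d :=
  evalTensor_five _ _

lemma W_amb (a b c d : Fin n) : D.W u (amb a) (amb b) (amb c) (amb d) = D.wc u a b c d := by
  simp only [W_eq_sum, amb_apply, sum_kd_mul']

lemma dW_amb (e a b c d : Fin n) :
    D.dW u (amb e) (amb a) (amb b) (amb c) (amb d) = D.dwc u e a b c d := by
  simp only [dW_eq_sum, amb_apply, sum_kd_mul']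

lemma Sch_amb (a b : Fin n) : D.Sch u (amb a) (amb b) = D.pc u a b := by
  simp [Sch, evalTensor_two, amb_apply, sum_kd_mul', pc]

lemma Ric_amb (a b : Fin n) : D.Ric u (amb a) (amb b) = ricci D.g (D.f u) ![a, b] := by
  simp [Ric, evalTensor_two, amb_apply, sum_kd_mul']

lemma Bach_amb (a b : Fin n) : D.Bach u (amb a) (amb b) = bach D.g (D.f u) ![a, b] := by
  simp [Bach, evalTensor_two, amb_apply, sum_kd_mul']

lemma Cot_amb (a b c : Fin n) : D.Cot u (amb a) (amb b) (amb c) = D.cc u a b c := by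
  simp [Cot, evalTensor_three, amb_apply, sum_kd_mul', cc]

variable (v0 v1 v2 v3 : Fin n → ℝ)

lemma W_zero2 : D.W u v0 v1 0 v3 = 0 := by simp [W_eq_sum]

lemma W_zero3 : D.W u v0 v1 v2 0 = 0 := by simp [W_eq_sum]

lemma Sch_zero1 : D.Sch u v0 0 = 0 := by simp [Sch, evalTensor_two]

lemma Ric_zero1 : D.Ric u v0 0 = 0 := by simp [Ric, evalTensor_two]

lemma ddW_zero0 (v4 v5 : Fin n → ℝ) : D.ddW u 0 v1 v2 v3 v4 v5 = 0 := by simp [ddW, evalTensor_six]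

lemma wc_swap (a b c d) : D.wc u a b c d = -D.wc u b a c d := MReg.weyl_swap _ _ a b c d

lemma cc_swap (a b c) : D.cc u a b c = -D.cc u b a c := MReg.cotton_swap _ _ a b c

end Components

section Special
variable {k m : ℕ} {D : CoordData k (k + m)} {U : Set (Coo k)} {V : Set (Coo (k + m))} {u : Coo k}

local notation "Spec" => IsSpecialAt D u

namespace Reg

lemma wc_pair (hD : D.Reg U V) (hu : u ∈ U) (a b c d) : D.wc u a b c d = D.wc u c d a b :=
  hD.metric.weyl_pair (hD.maps u hu) a b c d

lemma wc_swap' (hD : D.Reg U V) (hu : u ∈ U) (a b c d) : D.wc u a b c d = -D.wc u a b d c :=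
  hD.metric.weyl_swap' (hD.maps u hu) a b c d

lemma wc_cyclic (hD : D.Reg U V) (hu : u ∈ U) (a b c d) :
    D.wc u a b c d + D.wc u b c a d + D.wc u c a b d = 0 :=
  hD.metric.weyl_cyclic (hD.maps u hu) a b c d

lemma pc_symm (hD : D.Reg U V) (hu : u ∈ U) (a b) : D.pc u a b = D.pc u b a :=
  hD.metric.schouten_symm (hD.maps u hu) a b

end Reg

namespace IsSpecialAt

lemma dwc_eq (hs : Spec) (e a b c d) :
    D.dwc u e a b c d = pd e (fun z => weyl D.g z ![a, b, c, d]) (D.f u) :=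
  hs.normal.cov_vecCons _ _ _

lemma dwc_swap (hs : Spec) (e a b c d) : D.dwc u e a b c d = -D.dwc u e b a c d := by
  rw [hs.dwc_eq, hs.dwc_eq]; exact MReg.pd_weyl_swap _ e a b c d

lemma dwc_pair (hs : Spec) (hD : D.Reg U V) (hu : u ∈ U) (e a b c d) :
    D.dwc u e a b c d = D.dwc u e c d a b := by
  rw [hs.dwc_eq, hs.dwc_eq]; exact hD.metric.pd_weyl_pair (hD.maps u hu) e a b c d

lemma dwc_swap' (hs : Spec) (hD : D.Reg U V) (hu : u ∈ U) (e a b c d) :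
    D.dwc u e a b c d = -D.dwc u e a b d c := by
  rw [hs.dwc_eq, hs.dwc_eq]; exact hD.metric.pd_weyl_swap' (hD.maps u hu) e a b c d

lemma dwc_bianchi (hs : Spec) (hD : D.Reg U V) (hu : u ∈ U) (a b c d e) :
    D.dwc u a b c d e + D.dwc u b c a d e + D.dwc u c a b d e
    = (kd c d * D.cc u a b e - kd c e * D.cc u a b d)
    + (kd a d * D.cc u b c e - kd a e * D.cc u b c d)
    + (kd b d * D.cc u c a e - kd b e * D.cc u c a d) := by
  have := hD.metric.weyl_bianchi (hD.maps u hu) a b c d e; simp only [hs.normal.kd_apply] at this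
  exact this

lemma tan_eq (hs : Spec) (a) : D.tan u a = amb ~a := hs.tan a

lemma tan_apply (hs : Spec) (p : Fin k) (a) : D.tan u p a = kd ~p a := by rw [hs.tan_eq, amb_apply]

lemma h_apply (hs : Spec) (a b) : D.h u a b = kd a b := hs.normal_h.kd_apply a b

lemma trT (hs : Spec) (F : Fin k → Fin k → ℝ) : D.trT u F = ∑ a, F a a := hs.normal_h.mtr F

lemma trA (hs : Spec) (F : Fin (k + m) → Fin (k + m) → ℝ) : D.trA u F = ∑ a, F a a :=
  hs.normal.mtr F

lemma trA_of_tg (hs : Spec) {F : Fin (k + m) → Fin (k + m) → ℝ}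
    (hF : ∀ a, F ~a ~a = 0) : D.trA u F = ∑ j, F &j &j := by
  rw [hs.trA, sum_tg_nm, sum_eq_zero fun a _ => hF a, zero_add]

lemma nor_apply (hs : Spec) (a b) : D.nor u a b = kd b a - ∑ p, kd ~p b * kd ~p a := by
  have h1 : ∀ p q, (D.h u)⁻¹ p q = kd p q := hs.normal_h.inv_apply
  simp only [nor, h1, hs.tan_apply, hs.normal.kd_apply, sum_kd_mul, mul_assoc, sum_kd_mul']; rfl

lemma nor_tg (hs : Spec) (a) : D.nor u ~a = 0 := by
  funext b; simp only [hs.nor_apply, kd_tg, sum_mul_kd, kd_comm b, sub_self, Pi.zero_apply]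

lemma nor_nm (hs : Spec) (j : Fin m) : D.nor u &j = amb &j := by
  funext b; simp [hs.nor_apply, kd_tg_nm, amb_apply, kd_comm b]

lemma L_tg (hs : Spec) (a b c) : D.L u a b ~c = 0 := by simp [L, hs.nor_tg]

lemma H_tg (hs : Spec) (c) : D.H u ~c = 0 := by simp [H, hs.trT, hs.L_tg]

lemma Lo_tg (hs : Spec) (a b c) : D.Lo u a b ~c = 0 := by simp [Lo, hs.L_tg, hs.H_tg]

lemma dH_tg (hs : Spec) (a c) : D.dH u a ~c = 0 := by simp [dH, hs.nor_tg]

lemma Dt_tg (hs : Spec) (a c) : D.Dt u a ~c = 0 := by simp [Dt, hs.nor_tg, hs.dH_tg, Sch_zero1]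

lemma dH_nm (hs : Spec) (a : Fin k) (j : Fin m) : D.dH u a &j = pd a (fun z => D.H z &j) u := by
  simp [dH, hs.nor_nm, hs.normal.conn, amb_apply, sum_mul_kd']

lemma Dt_nm (hs : Spec) (a j) : D.Dt u a &j = D.pc u ~a &j - pd a (fun z => D.H z &j) u := by
  rw [Dt, hs.dH_nm, hs.nor_nm, hs.tan_eq, Sch_amb]

lemma L_nm (hs : Spec) (a b : Fin k) (j : Fin m) :
    D.L u a b &j = pd a (fun z => D.tan z b &j) u := by
  simp [L, hs.nor_nm, hs.normal.conn, amb_apply, sum_mul_kd', hs.normal.kd_apply, sum_kd_mul]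

lemma L_eq_Lo_add (hs : Spec) (p b) (a) :
    D.L u p b a = D.Lo u p b a + kd p b * D.H u a := by rw [Lo, hs.h_apply]; ring

lemma L_symm (hs : Spec) (hD : D.Reg U V) (hu : u ∈ U) (a b) (j) : D.L u a b &j = D.L u b a &j := by
  rw [hs.L_nm, hs.L_nm]; exact pd_comm hD hu (Sm.coord hD.smooth &j) a b

lemma Lo_symm (hs : Spec) (hD : D.Reg U V) (hu : u ∈ U) (a b) (j) :
    D.Lo u a b &j = D.Lo u b a &j := by
  rw [Lo, Lo, hs.L_symm hD hu, hs.h_apply, hs.h_apply, kd_comm]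

lemma pd_comp_f (hs : Spec) (hD : D.Reg U V) (hu : u ∈ U) {F : Coo (k + m) → ℝ}
    (hF : Sm V F) (a) : pd a (fun z => F (D.f z)) u = pd ~a F (D.f u) := by
  rw [pd_comp (hF.diffAt hD.metric (hD.maps u hu)) (hD.diffAt hu)]
  have : ∀ c, pd a (fun z => D.f z c) u = kd ~a c := hs.tan_apply a; simp only [this, sum_kd_mul']

lemma pd_trT (hs : Spec) (hD : D.Reg U V) (hu : u ∈ U)
    {F : Coo k → Fin k → Fin k → ℝ} (hF : ∀ a b, Sm U fun z => F z a b) (c) :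
    pd c (fun z => D.trT z (F z)) u = ∑ p, pd c (fun z => F z p p) u :=
  hs.normal_h.pd_mtr hD.reg_h hu hF c

lemma pd_trA (hs : Spec) (hD : D.Reg U V) (hu : u ∈ U)
    {F : Coo k → Fin (k + m) → Fin (k + m) → ℝ} (hF : ∀ a b, Sm U fun z => F z a b) (c) :
    pd c (fun z => D.trA z (F z)) u = ∑ a, pd c (fun z => F z a a) u := by
  have hi a b : Sm U fun z => (D.g (D.f z))⁻¹ a b := hD.sm_comp (hD.metric.smooth_inv a b)
  have hd a b : Sm U fun z => (D.g (D.f z))⁻¹ a b * F z a b := (hi a b).mul (hF a b)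
  have h0 a b : pd c (fun z => (D.g (D.f z))⁻¹ a b) u = 0 := by
    rw [hs.pd_comp_f hD hu (F := fun x => (D.g x)⁻¹ a b) (hD.metric.smooth_inv a b),
      hs.normal.pd_inv hD.metric (hD.maps u hu)]
  simp only [CoordData.trA]; rw [pd_sum fun a _ => (Sm.sum fun b _ => hd a b).diffAt hD hu]
  refine sum_ext fun a => ?_; rw [pd_sum fun b _ => (hd a b).diffAt hD hu]
  have this b : pd c (fun z => (D.g (D.f z))⁻¹ a b * F z a b) u
    = kd a b * pd c (fun z => F z a b) u := by
    rw [pd_mul ((hi a b).diffAt hD hu) ((hF a b).diffAt hD hu), h0, hs.normal.inv_apply]; simp [kd]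
  simp only [this, sum_kd_mul']

lemma pd_trA_mul (hs : Spec) (hD : D.Reg U V) (hu : u ∈ U)
    {A B : Coo k → Fin (k + m) → ℝ} (hA : ∀ a, Sm U fun z => A z a) (hB : ∀ a, Sm U fun z => B z a)
    (hA0 : ∀ p, A u ~p = 0) (hB0 : ∀ p, B u ~p = 0) (c) :
    pd c (fun z => D.trA z fun a a' => A z a * B z a') u = ∑ j, (pd c (fun z => A z &j) u * B u &j
    + A u &j * pd c (fun z => B z &j) u) := by
  rw [hs.pd_trA hD hu fun a b => (hA a).mul (hB b)]
  simp only [fun a => pd_mul (a := c) ((hA a).diffAt hD hu) ((hB a).diffAt hD hu)]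
  rw [sum_tg_nm]; simp only [hA0, hB0, zero_mul, add_zero, sum_const_zero, zero_add]
  exact sum_ext fun _ => by ring

lemma pd_h (hs : Spec) (hD : D.Reg U V) (hu : u ∈ U) (a b c) :
    pd c (fun z => D.h z a b) u = 0 := hs.normal_h.pd_metric hD.reg_h hu c a b

lemma pd_tan_tg (hs : Spec) (hD : D.Reg U V) (hu : u ∈ U) (c p q) :
    pd c (fun z => D.tan z p ~q) u = 0 := by
  have hsym : ∀ c p q,
      pd c (fun z => D.tan z p ~q) u = pd p (fun z => D.tan z c ~q) u := fun c p q =>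
    pd_comm hD hu (Sm.coord hD.smooth ~q) c p
  have hanti c p q : pd c (fun z => D.tan z p ~q) u + pd c (fun z => D.tan z q ~p) u = 0 := by
    rw [← hs.pd_h hD hu p q c]
    have hg0 a b : pd c (fun z => D.g (D.f z) a b) u = 0 := by
      rw [hs.pd_comp_f hD hu (F := fun x => D.g x a b) (hD.metric.smooth a b),
        hs.normal.pd_metric hD.metric (hD.maps u hu)]
    have hd {F} (h : Sm U F) := h.diffAt hD hu; simp only [CoordData.h, of_apply]
    have hsm a b : Sm U fun z => D.g (D.f z) a b * D.tan z p a * D.tan z q b :=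
      ((hD.sm_g a b).mul (hD.sm_tan p a)).mul (hD.sm_tan q b)
    rw [pd_sum fun a _ => hd (Sm.sum fun b _ => hsm a b)]
    have this a : pd c (fun z => ∑ b, D.g (D.f z) a b * D.tan z p a * D.tan z q b) u
      = kd ~p a * pd c (fun z => D.tan z q a) u + kd ~q a * pd c (fun z => D.tan z p a) u := by
      rw [pd_sum fun b _ => hd (hsm a b)]
      have this b : pd c (fun z => D.g (D.f z) a b * D.tan z p a * D.tan z q b) u
        = kd a b * (kd ~p a * pd c (fun z => D.tan z q b) u
        + kd ~q b * pd c (fun z => D.tan z p a) u) := by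
        rw [pd_mul (hd ((hD.sm_g a b).mul (hD.sm_tan p a))) (hd (hD.sm_tan q b)),
          pd_mul (hd (hD.sm_g a b)) (hd (hD.sm_tan p a)), hg0, hs.normal.kd_apply, hs.tan_apply,
          hs.tan_apply]
        ring
      simp only [this, sum_kd_mul']
    simp only [this, sum_add, sum_kd_mul']; ring
  have h1 := hanti c p q; have h2 := hanti p q c; have h3 := hanti q c p
  linarith [hsym c p q, hsym p q c, hsym q c p]

lemma pd_tan (hs : Spec) (hD : D.Reg U V) (hu : u ∈ U) (c p : Fin k) :
    (fun a => pd c (fun z => D.tan z p a) u)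
    = fun a => ap (fun (_ : Unit) j => D.L u c p &j) () fun j => amb &j a := by
  funext a; simp only [ap, amb_apply]; refine Fin.addCases (fun b => ?_) (fun i => ?_) a
  · change pd c (fun z => D.tan z p ~b) u = ∑ j, D.L u c p &j * kd &j ~b
    simp [hs.pd_tan_tg hD hu, kd_nm_tg]
  · change pd c (fun z => D.tan z p &i) u = ∑ j, D.L u c p &j * kd &j &i
    simp [kd_nm, sum_mul_kd, hs.L_nm]

lemma pd_nor_apply (hs : Spec) (hD : D.Reg U V) (hu : u ∈ U) (t) (a b) :
    pd t (fun z => D.nor z a b) u = -∑ p, (pd t (fun z => D.tan z p b) u * kd ~p a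
    + kd ~p b * pd t (fun z => D.tan z p a) u) := by
  have hd {F} (h : Sm U F) := h.diffAt hD hu
  have hc q : Sm U fun z => ∑ c, D.g (D.f z) c a * D.tan z q c :=
    Sm.sum fun c _ => (hD.sm_g c a).mul (hD.sm_tan q c)
  have hg0 a b : pd t (fun z => D.g (D.f z) a b) u = 0 := by
    rw [hs.pd_comp_f hD hu (F := fun x => D.g x a b) (hD.metric.smooth a b),
      hs.normal.pd_metric hD.metric (hD.maps u hu)]
  have hpc q : pd t (fun z => ∑ c, D.g (D.f z) c a * D.tan z q c) u
    = pd t (fun z => D.tan z q a) u := by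
    rw [pd_sum fun c _ => hd ((hD.sm_g c a).mul (hD.sm_tan q c))]
    simp only [fun c => pd_mul (a := t) (hd (hD.sm_g c a)) (hd (hD.sm_tan q c)), hg0, mul_zero,
      add_zero, hs.normal.kd_apply, sum_kd_mul]
  have hvc q : ∑ c, D.g (D.f u) c a * D.tan u q c = kd ~q a := by
    simp only [hs.normal.kd_apply, sum_kd_mul, hs.tan_apply]
  have e z : D.nor z a b = (if b = a then 1 else 0) - D.trT z fun p q =>
      D.tan z p b * ∑ c, D.g (D.f z) c a * D.tan z q c := by
    simp only [nor, CoordData.trT]; congr 1; exact sum_ext2 fun _ _ => by ring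
  simp only [e]
  rw [pd_sub (by fun_prop) (hd (hD.sm_trT fun p q => (hD.sm_tan p b).mul (hc q))), pd_const,
    hs.pd_trT hD hu fun p q => (hD.sm_tan p b).mul (hc q), zero_sub]
  congr 1; refine sum_ext fun p => ?_
  rw [pd_mul (hd (hD.sm_tan p b)) (hd (hc p)), hpc, hvc, hs.tan_apply]; ring

lemma pd_nor (hs : Spec) (hD : D.Reg U V) (hu : u ∈ U) (c : Fin k) (j : Fin m) :
    (fun a => pd c (fun z => D.nor z &j a) u)
    = fun a => ap (fun (_ : Unit) p => -D.L u c p &j) () fun p => amb ~p a := by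
  funext b; rw [hs.pd_nor_apply hD hu]; simp [kd_tg_nm, ap, amb_apply, hs.L_nm, mul_comm]

lemma covAlong_eq (hs : Spec) (c) (v : Coo k → Fin (k + m) → ℝ) :
    covAlong D.g D.f c v u = fun a => pd c (fun z => v z a) u := by
  funext a; simp [covAlong, hs.normal.conn]

lemma pd_W (hs : Spec) (hD : D.Reg U V) (hu : u ∈ U) (t)
    {v0 v1 v2 v3 : Coo k → Fin (k + m) → ℝ} (h0 : ∀ a, Sm U fun z => v0 z a)
    (h1 : ∀ a, Sm U fun z => v1 z a) (h2 : ∀ a, Sm U fun z => v2 z a)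
    (h3 : ∀ a, Sm U fun z => v3 z a) : pd t (fun z => D.W z (v0 z) (v1 z) (v2 z) (v3 z)) u
    = D.dW u (amb ~t) (v0 u) (v1 u) (v2 u) (v3 u)
    + (D.W u (fun a => pd t (fun z => v0 z a) u) (v1 u) (v2 u) (v3 u)
    + D.W u (v0 u) (fun a => pd t (fun z => v1 z a) u) (v2 u) (v3 u)
    + D.W u (v0 u) (v1 u) (fun a => pd t (fun z => v2 z a) u) (v3 u)
    + D.W u (v0 u) (v1 u) (v2 u) (fun a => pd t (fun z => v3 z a) u)) := by
  have hd {F} (h : Sm U F) := h.diffAt hD hu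
  have key := pd_evalTensor (g := D.g) hD.metric (T := weyl D.g)
    (fun I => hD.metric.smooth_weyl I) (v := fun z => ![v0 z, v1 z, v2 z, v3 z]) (hD.maps u hu)
    (hD.diffAt hu) (fun j b => by
      fin_cases j
      exacts [hd (h0 b), hd (h1 b), hd (h2 b), hd (h3 b)]) t
  simp only [W, dW]; rw [key, Fin.sum_univ_four]
  have ht : (fun c => pd t (fun z => D.f z c) u) = amb ~t := hs.tan_eq t
  simp only [hs.covAlong_eq, ht]
  have e : ∀ w : Fin (k + m) → ℝ, update ![v0 u, v1 u, v2 u, v3 u] 0 w = ![w, v1 u, v2 u, v3 u] ∧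
    update ![v0 u, v1 u, v2 u, v3 u] 1 w = ![v0 u, w, v2 u, v3 u] ∧
    update ![v0 u, v1 u, v2 u, v3 u] 2 w = ![v0 u, v1 u, w, v3 u] ∧
    update ![v0 u, v1 u, v2 u, v3 u] 3 w = ![v0 u, v1 u, v2 u, w] := by
    intro w; refine ⟨?_, ?_, ?_, ?_⟩ <;> (funext i; fin_cases i <;> rfl)
  rw [(e _).1, (e _).2.1, (e _).2.2.1, (e _).2.2.2]; rfl

lemma pd_W_tan (hs : Spec) (hD : D.Reg U V) (hu : u ∈ U) (c a b d e) :
    pd c (fun z => D.W z (D.tan z a) (D.tan z b) (D.tan z d) (D.tan z e)) u = D.dwc u ~c ~a ~b ~d ~e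
    + (∑ j, D.L u c a &j * D.wc u &j ~b ~d ~e + ∑ j, D.L u c b &j * D.wc u ~a &j ~d ~e
    + ∑ j, D.L u c d &j * D.wc u ~a ~b &j ~e + ∑ j, D.L u c e &j * D.wc u ~a ~b ~d &j) := by
  rw [hs.pd_W hD hu c (hD.sm_tan a) (hD.sm_tan b) (hD.sm_tan d) (hD.sm_tan e)]
  simp only [hs.pd_tan hD hu, W_ap, hs.tan_eq, W_amb, dW_amb]; simp only [ap]

lemma pd_W_nor (hs : Spec) (hD : D.Reg U V) (hu : u ∈ U) (c a b e)
    (i) : pd c (fun z => D.W z (D.tan z a) (D.tan z b) (D.nor z &i) (D.tan z e)) u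
    = D.dwc u ~c ~a ~b &i ~e + (∑ j, D.L u c a &j * D.wc u &j ~b &i ~e
    + ∑ j, D.L u c b &j * D.wc u ~a &j &i ~e + ∑ d, -D.L u c d &i * D.wc u ~a ~b ~d ~e
    + ∑ j, D.L u c e &j * D.wc u ~a ~b &i &j) := by
  rw [hs.pd_W hD hu c (hD.sm_tan a) (hD.sm_tan b) (hD.sm_nor &i) (hD.sm_tan e)]
  simp only [hs.pd_tan hD hu, hs.pd_nor hD hu, W_ap, hs.tan_eq, hs.nor_nm, W_amb, dW_amb]
  simp only [ap]

lemma pd_L (hs : Spec) (hD : D.Reg U V) (hu : u ∈ U) (t p q) (j) :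
    pd t (fun z => D.L z p q &j) u = pd t (pd p fun z => D.tan z q &j) u
    + pd ~t (fun x => Γ D.g x &j ~p ~q) (D.f u) := by
  have hd {F} (h : Sm U F) := h.diffAt hD hu
  have hg0 a b : pd t (fun z => D.g (D.f z) a b) u = 0 := by
    rw [hs.pd_comp_f hD hu (F := fun x => D.g x a b) (hD.metric.smooth a b),
      hs.normal.pd_metric hD.metric (hD.maps u hu)]
  have hΓ : ∀ b d e, Sm U fun z => Γ D.g (D.f z) b d e := fun b d e =>
    hD.sm_comp (hD.metric.smooth_christoffel b d e)
  have hΓt : ∀ b d e, Sm U fun z => Γ D.g (D.f z) b d e * D.tan z p d * D.tan z q e :=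
    fun b d e => ((hΓ b d e).mul (hD.sm_tan p d)).mul (hD.sm_tan q e)
  set A : Coo k → Fin (k + m) → ℝ := fun z b => pd p (fun z => D.tan z q b) z
    + ∑ d, ∑ e, Γ D.g (D.f z) b d e * D.tan z p d * D.tan z q e with hAdef
  have hA b : Sm U fun z => A z b := ((hD.sm_tan q b).pd hD p).add
    (Sm.sum fun d _ => Sm.sum fun e _ => hΓt b d e)
  have hAu b : A u b = pd p (fun z => D.tan z q b) u := by simp [hAdef, hs.normal.conn]
  have hpA b : pd t (fun z => A z b) u = pd t (pd p fun z => D.tan z q b) u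
    + pd ~t (fun x => Γ D.g x b ~p ~q) (D.f u) := by
    rw [pd_add (hd ((hD.sm_tan q b).pd hD p)) (hd (Sm.sum fun d _ => Sm.sum fun e _ => hΓt b d e))]
    congr 1; rw [pd_sum fun d _ => hd (Sm.sum fun e _ => hΓt b d e)]
    have this d : pd t (fun z => ∑ e, Γ D.g (D.f z) b d e * D.tan z p d * D.tan z q e) u
      = kd ~p d * pd ~t (fun x => Γ D.g x b d ~q) (D.f u) := by
      rw [pd_sum fun e _ => hd (hΓt b d e)]
      have this e : pd t (fun z => Γ D.g (D.f z) b d e * D.tan z p d * D.tan z q e) u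
        = kd ~q e * (kd ~p d * pd ~t (fun x => Γ D.g x b d e) (D.f u)) := by
        rw [pd_mul (hd ((hΓ b d e).mul (hD.sm_tan p d))) (hd (hD.sm_tan q e)), pd_mul
          (hd (hΓ b d e)) (hd (hD.sm_tan p d)), hs.normal.conn, hs.pd_comp_f hD hu
          (F := fun x => Γ D.g x b d e) (hD.metric.smooth_christoffel b d e), hs.tan_apply,
          hs.tan_apply]
        ring
      simp only [this, sum_kd_mul']
    simp only [this, sum_kd_mul']
  have hL z : D.L z p q &j = ∑ b, ∑ c, D.g (D.f z) b c * A z b * D.nor z &j c := rfl; simp only [hL]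
  have hsm b c : Sm U fun z => D.g (D.f z) b c * A z b * D.nor z &j c :=
    ((hD.sm_g b c).mul (hA b)).mul (hD.sm_nor _ c)
  rw [pd_sum fun b _ => hd (Sm.sum fun c _ => hsm b c)]
  have this b : pd t (fun z => ∑ c, D.g (D.f z) b c * A z b * D.nor z &j c) u
    = A u b * pd t (fun z => D.nor z &j b) u + kd &j b * pd t (fun z => A z b) u := by
    rw [pd_sum fun c _ => hd (hsm b c)]
    have this c : pd t (fun z => D.g (D.f z) b c * A z b * D.nor z &j c) u
      = kd b c * (A u b * pd t (fun z => D.nor z &j c) u + kd &j c * pd t (fun z => A z b) u) := by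
      rw [pd_mul (hd ((hD.sm_g b c).mul (hA b))) (hd (hD.sm_nor _ c)),
        pd_mul (hd (hD.sm_g b c)) (hd (hA b)), hg0, hs.normal.kd_apply, hs.nor_nm, amb_apply]
      ring
    simp only [this, sum_kd_mul']
  simp only [this, sum_add, sum_kd_mul', hpA]; rw [add_eq_right, sum_tg_nm]
  have hn0 i : pd t (fun z => D.nor z &j &i) u = 0 := by rw [hs.pd_nor_apply hD hu]; simp [kd_tg_nm]
  simp [hn0, hAu, hs.pd_tan_tg hD hu]

lemma pd_Lo (hs : Spec) (hD : D.Reg U V) (hu : u ∈ U) (c a b) (j) : pd c (fun z => D.Lo z a b &j) u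
    = pd c (fun z => D.L z a b &j) u - pd c (fun z => D.H z &j) u * kd a b := by
  have hd {F} (h : Sm U F) := h.diffAt hD hu; simp only [Lo]
  rw [pd_sub (hd (hD.sm_L a b _)) (hd ((hD.sm_H _).mul (hD.sm_h a b))),
    pd_mul (hd (hD.sm_H _)) (hd (hD.sm_h a b)), hs.pd_h hD hu, hs.h_apply]
  ring

lemma codazzi (hs : Spec) (hD : D.Reg U V) (hu : u ∈ U) (c a b) (j) :
    pd c (fun z => D.Lo z a b &j) u = pd a (fun z => D.Lo z c b &j) u
    + D.wc u ~a ~c ~b &j + kd a b * D.Dt u c &j - kd c b * D.Dt u a &j := by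
  have hR : riemann D.g (D.f u) ![~a, ~c, ~b, &j] = pd ~c (fun x => Γ D.g x &j ~a ~b) (D.f u)
    - pd ~a (fun x => Γ D.g x &j ~c ~b) (D.f u) := by
    rw [hs.normal.riemann_eq_up]; exact hs.normal.riemannUp_eq _ _ _ _
  have hw : D.wc u ~a ~c ~b &j = riemann D.g (D.f u) ![~a, ~c, ~b, &j]
    - D.pc u ~c &j * kd a b + D.pc u ~a &j * kd c b := by
    simp [wc, weyl, hs.normal.kd_apply, kd_tg, kd_tg_nm, pc]
  rw [hs.pd_Lo hD hu, hs.pd_Lo hD hu, hs.pd_L hD hu, hs.pd_L hD hu, hs.Dt_nm, hs.Dt_nm, hw, hR,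
    pd_comm hD hu (hD.sm_tan b &j) c a]
  ring

lemma pd_Lo_symm (hs : Spec) (hD : D.Reg U V) (hu : u ∈ U) (c a b)
    (j) : pd c (fun z => D.Lo z a b &j) u = pd c (fun z => D.Lo z b a &j) u := by
  rw [hs.pd_Lo hD hu, hs.pd_Lo hD hu, hs.pd_L hD hu, hs.pd_L hD hu, kd_comm,
    pd_congr hD hu (F := pd a fun z => D.tan z b &j) (G := pd b fun z => D.tan z a &j)
      (fun z hz => pd_comm hD hz (Sm.coord hD.smooth &j) a b), pd_congr hD.metric (hD.maps u hu)
      (F := fun x => Γ D.g x &j ~a ~b) (G := fun x => Γ D.g x &j ~b ~a)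
      (fun z hz => hD.metric.christoffel_symm hz _ _ _)]

lemma sum_L (hs : Spec) (hk : k ≠ 0) (a) : ∑ p, D.L u p p a = k * D.H u a := by
  have : (k : ℝ) ≠ 0 := by exact_mod_cast hk
  rw [H, hs.trT]; field_simp

lemma sum_Lo (hs : Spec) (hk : k ≠ 0) (a) : ∑ p, D.Lo u p p a = 0 := by
  have := hs.sum_L hk a; simp only [hs.L_eq_Lo_add, sum_add, kd_self, one_mul, sum_const] at this
  linarith

lemma sum_pd_Lo (hs : Spec) (hD : D.Reg U V) (hu : u ∈ U) (hk : k ≠ 0) (c)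
    (j) : ∑ a, pd c (fun z => D.Lo z a a &j) u = 0 := by
  have hk' : (k : ℝ) ≠ 0 := by exact_mod_cast hk
  have h1 : pd c (fun z => D.H z &j) u = (1 / (k : ℝ)) * ∑ a, pd c (fun z => D.L z a a &j) u := by
    simp only [H]
    rw [pd_const_mul _ ((hD.sm_trT fun a b => hD.sm_L a b _).diffAt hD hu),
      hs.pd_trT hD hu fun a b => hD.sm_L a b _]
  simp only [hs.pd_Lo hD hu, kd_self, mul_one, sum_sub, sum_const, h1]; field_simp; ring

lemma Wtn_nm (hs : Spec) (a j) : D.Wtn u a &j = ∑ b, D.wc u ~a ~b &j ~b := by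
  simp only [Wtn, hs.trT, hs.tan_eq, hs.nor_nm, W_amb]

lemma Wtn_tg (hs : Spec) (a b) : D.Wtn u a ~b = 0 := by simp [Wtn, hs.trT, hs.nor_tg, W_zero2]

lemma div_Lo (hs : Spec) (hD : D.Reg U V) (hu : u ∈ U) (hk : k ≠ 0) (a)
    (j) : ∑ b, pd b (fun z => D.Lo z a b &j) u = -((k : ℝ) - 1) * D.Dt u a &j - D.Wtn u a &j := by
  simp only [fun b => hs.codazzi hD hu b a b j, sum_sub, sum_add,
    hs.sum_pd_Lo hD hu hk, sum_kd_mul', kd_self, one_mul, sum_const, hs.Wtn_nm, fun b => hD.wc_swap' hu ~a ~b ~b &j, sum_neg]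
  ring

end IsSpecialAt
end Special

/-- The conformal rescaling of the ambient metric. -/
def conf {k n : ℕ} (D : CoordData k n) (v : Coo n → ℝ) : CoordData k n := ⟨confMetric v D.g, D.f⟩

/-- The derivative of `v` in the normal directions. -/
def dn {k n : ℕ} (D : CoordData k n) (v : Coo n → ℝ) (u : Coo k) (a : Fin n) : ℝ :=
  ∑ b, D.nor u a b * pd b v (D.f u)

section General
variable {k n : ℕ} {D : CoordData k n} {U : Set (Coo k)} {V : Set (Coo n)} {u : Coo k}
  {v : Coo n → ℝ}

lemma Reg.conf (hD : D.Reg U V) (hv : Sm V v) : (D.conf v).Reg U V :=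
  ⟨hD, hD.smooth, hD.maps, hD.metric.conf hv, hD.imm⟩

lemma Change.conf {D' : CoordData k n} {φ : Coo k → Coo k} {ψ : Coo n → Coo n}
    {U' : Set (Coo k)} {V' : Set (Coo n)} (h : Change D' D φ ψ U' U V' V) (hv : Sm V v) :
    Change (D'.conf fun z => v (ψ z)) (D.conf v) φ ψ U' U V' V :=
  ⟨h.reg'.conf (hv.comp h.pull.smooth h.pull.maps), h.reg.conf hv, h.pull.conf hv, h.smooth,
    h.maps, h.comm⟩

lemma tan_conf (a) : (D.conf v).tan u a = D.tan u a := rfl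

lemma h_conf : (D.conf v).h = confMetric (fun z => v (D.f z)) D.h := by
  funext u; ext a b; rw [confMetric_apply]
  simp only [CoordData.h, of_apply, mul_sum, conf, confMetric_apply, mul_assoc]; rfl

lemma trT_conf (F : Fin k → Fin k → ℝ) : (D.conf v).trT u F = exp (-2 * v (D.f u)) * D.trT u F := by
  rw [trT_eq_mtr, h_conf, mtr_confMetric, trT_eq_mtr]

lemma trA_conf (F : Fin n → Fin n → ℝ) : (D.conf v).trA u F = exp (-2 * v (D.f u)) * D.trA u F := by
  rw [trA_eq_mtr, trA_eq_mtr]; exact mtr_confMetric F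

lemma nor_conf (a) : (D.conf v).nor u a = D.nor u a := by
  funext b; have h := exp_mul_exp_neg (v (D.f u))
  rw [Change.nor_eq_mtr, Change.nor_eq_mtr, h_conf, mtr_confMetric]; congr 1; rw [← mtr_const_mul]
  congr 1; funext p q; simp only [conf, confMetric_apply, mul_assoc, ← mul_sum]
  change exp (-2 * v (D.f u)) * (D.tan u p b * (exp (2 * v (D.f u)) *
    ∑ c, D.g (D.f u) c a * D.tan u q c)) = _
  linear_combination (D.tan u p b * ∑ c, D.g (D.f u) c a * D.tan u q c) * h

lemma Reg.W_conf (hD : D.Reg U V) (hv : Sm V v) (hu : u ∈ U) (hn : 3 ≤ n)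
    (v0 v1 v2 v3 : Fin n → ℝ) :
    (D.conf v).W u v0 v1 v2 v3 = exp (2 * v (D.f u)) * D.W u v0 v1 v2 v3 := by
  simp only [W]; rw [← evalTensor_smul]; congr 1; funext I
  exact weyl_conf hD.metric hv (hD.maps u hu) hn I

lemma Reg.L_conf (hD : D.Reg U V) (hv : Sm V v) (hu : u ∈ U) (p q) (a) :
    (D.conf v).L u p q a = exp (2 * v (D.f u)) * (D.L u p q a - D.h u p q * D.dn v u a) := by
  have hx := hD.maps u hu; set y : Fin k → ℝ := fun p => ∑ e, D.tan u p e * pd e v (D.f u) with hy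
  set G : Fin n → ℝ := fun b => ∑ d, (D.g (D.f u))⁻¹ b d * pd d v (D.f u) with hG
  have hΓ : ∀ b, ∑ d, ∑ e, Γ (confMetric v D.g) (D.f u) b d e * D.tan u p d * D.tan u q e
    = (∑ d, ∑ e, Γ D.g (D.f u) b d e * D.tan u p d * D.tan u q e)
    + D.tan u p b * y q + D.tan u q b * y p - D.h u p q * G b := by
    intro b
    have h1 : D.h u p q * G b = ∑ d, ∑ e, D.g (D.f u) d e * D.tan u p d * D.tan u q e * G b := by
      simp only [CoordData.h, of_apply, sum_mul]
    have h2 : D.tan u p b * y q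
      = ∑ d, ∑ e, kd b d * (D.tan u p d * (D.tan u q e * pd e v (D.f u))) := by
      simp only [← mul_sum, sum_kd_mul', hy]
    have h3 : D.tan u q b * y p
      = ∑ d, ∑ e, kd b e * (D.tan u q e * (D.tan u p d * pd d v (D.f u))) := by
      simp only [sum_kd_mul', hy, ← mul_sum]
    rw [h1, h2, h3, ← sum_add, ← sum_add, ← sum_sub]
    refine sum_ext fun d => ?_; rw [← sum_add, ← sum_add, ← sum_sub]
    refine sum_ext fun e => ?_; rw [christoffel_conf hD.metric hv hx]; ring
  have hGn : ∑ b, ∑ c, D.g (D.f u) b c * G b * D.nor u a c = D.dn v u a := by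
    rw [sum_comm]; refine sum_ext fun c => ?_
    have : ∑ b, D.g (D.f u) b c * G b = pd c v (D.f u) := by
      simp only [hG, mul_sum]; rw [sum_comm]; simp only [← mul_assoc, ← sum_mul]
      have h d : ∑ b, D.g (D.f u) b c * (D.g (D.f u))⁻¹ b d = if c = d then 1 else 0 := by
        rw [← hD.metric.mul_inv hx c d]; exact sum_ext fun b => by rw [hD.metric.symm hx]
      simp [h]
    rw [← sum_mul, this, mul_comm]
  have hL : (D.conf v).L u p q a = ∑ b, ∑ c, exp (2 * v (D.f u)) * D.g (D.f u) b c *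
      (pd p (fun z => D.tan z q b) u + ∑ d, ∑ e, Γ (confMetric v D.g) (D.f u) b d e *
        D.tan u p d * D.tan u q e) * D.nor u a c := by rw [← nor_conf (v := v)]; rfl
  rw [hL]; simp only [hΓ]; have hα := hD.inner_tan_nor hu p a; have hβ := hD.inner_tan_nor hu q a
  have e : ∀ b c, exp (2 * v (D.f u)) * D.g (D.f u) b c *
    (pd p (fun z => D.tan z q b) u + ((∑ d, ∑ e, Γ D.g (D.f u) b d e *
    D.tan u p d * D.tan u q e) + D.tan u p b * y q + D.tan u q b * y p - D.h u p q * G b))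
    * D.nor u a c = exp (2 * v (D.f u)) * (D.g (D.f u) b c * (pd p (fun z => D.tan z q b) u
    + ∑ d, ∑ e, Γ D.g (D.f u) b d e * D.tan u p d * D.tan u q e) * D.nor u a c)
    + exp (2 * v (D.f u)) * y q * (D.g (D.f u) b c * D.tan u p b * D.nor u a c)
    + exp (2 * v (D.f u)) * y p * (D.g (D.f u) b c * D.tan u q b * D.nor u a c)
    - exp (2 * v (D.f u)) * D.h u p q * (D.g (D.f u) b c * G b * D.nor u a c) := by intro b c; ring
  simp only [e, sum_add, sum_sub, ← mul_sum, hα, hβ, hGn]; rw [L]; ring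

lemma Reg.H_conf (hD : D.Reg U V) (hv : Sm V v) (hu : u ∈ U) (hk : k ≠ 0) (a) :
    (D.conf v).H u a = D.H u a - D.dn v u a := by
  have hk' : (k : ℝ) ≠ 0 := by exact_mod_cast hk
  have h := exp_mul_exp_neg (v (D.f u)); simp only [H, trT_conf, hD.L_conf hv hu]
  have e : mtr (D.h u) (fun p b => D.h u p b * D.dn v u a) = k * D.dn v u a :=
    (mtr_mul_const _ _ _).trans (by rw [hD.reg_h.mtr_metric hu])
  rw [trT_eq_mtr, trT_eq_mtr, mtr_const_mul, mtr_sub, e]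
  have hk2 : (1 / (k : ℝ)) * k = 1 := by field_simp
  linear_combination
    (1 / (k : ℝ)) * (mtr (D.h u) (fun p b => D.L u p b a) - k * D.dn v u a) * h - D.dn v u a * hk2

lemma Reg.Lo_conf (hD : D.Reg U V) (hv : Sm V v) (hu : u ∈ U) (hk : k ≠ 0) (p b)
    (a) : (D.conf v).Lo u p b a = exp (2 * v (D.f u)) * D.Lo u p b a := by
  rw [Lo, Lo, hD.L_conf hv hu, hD.H_conf hv hu hk, h_conf, confMetric_apply]; ring

end General

section Special
variable {k m : ℕ} {D : CoordData k (k + m)} {U : Set (Coo k)} {V : Set (Coo (k + m))} {u : Coo k}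
  {v : Coo (k + m) → ℝ}

local notation "Spec" => IsSpecialAt D u
local notation "D⋆" => conf D v
local notation "E2" => exp (-2 * v (D.f u))
local notation:max "dv" a:max => pd a v (D.f u)

namespace IsSpecialAt

lemma dn_tg (hs : Spec) (a) : D.dn v u ~a = 0 := by simp [dn, hs.nor_tg]

lemma dn_nm (hs : Spec) (j) : D.dn v u &j = dv &j := by
  simp only [dn, hs.nor_nm, amb_apply, sum_kd_mul']

lemma pd_dn (hs : Spec) (hD : D.Reg U V) (hv : Sm V v) (hu : u ∈ U) (p)
    (j) : pd p (fun z => D.dn v z &j) u = pd ~p (pd &j v) (D.f u) - ∑ q, D.L u p q &j * dv ~q := by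
  have hd {F} (h : Sm U F) := h.diffAt hD hu
  have hy := fun b => hD.sm_comp (hv.pd hD.metric b); simp only [dn]
  rw [pd_sum fun b _ => hd ((hD.sm_nor _ b).mul (hy b))]
  simp only [fun b => pd_mul (a := p) (hd (hD.sm_nor &j b)) (hd (hy b)),
    fun b => hs.pd_comp_f hD hu (hv.pd hD.metric b), hs.nor_nm, amb_apply,
    sum_add, sum_kd_mul', fun b => congrFun (hs.pd_nor hD hu p j) b, mul_ap]
  rw [sub_eq_add_neg, ← sum_neg]; congr 1; simp only [ap]; rw [sum_comm]
  simp only [neg_mul, sum_neg, ← mul_sum, sum_mul_kd']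

lemma H_conf_tg (hs : Spec) (hD : D.Reg U V) (hv : Sm V v) (hu : u ∈ U) (hk : k ≠ 0)
    (a) : D⋆.H u ~a = 0 := by rw [hD.H_conf hv hu hk, hs.H_tg, hs.dn_tg, sub_zero]

lemma H_conf_nm (hs : Spec) (hD : D.Reg U V) (hv : Sm V v) (hu : u ∈ U) (hk : k ≠ 0)
    (j) : D⋆.H u &j = D.H u &j - dv &j := by rw [hD.H_conf hv hu hk, hs.dn_nm]

lemma Sch_conf (hs : Spec) (hD : D.Reg U V) (hv : Sm V v) (hu : u ∈ U)
    (hn : 3 ≤ k + m) (a b) : D⋆.Sch u (amb a) (amb b) = D.pc u a b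
    - (pd a (pd b v) (D.f u) - dv a * dv b + 1 / 2 * gradSq v D.g (D.f u) * kd a b) := by
  rw [Sch_amb, ← hs.normal.confSchouten_eq]
  exact hs.normal.schouten_conf hD.metric hv (hD.maps u hu) hn a b

lemma Dt_conf (hs : Spec) (hD : D.Reg U V) (hv : Sm V v) (hu : u ∈ U) (hk : k ≠ 0)
    (hn : 3 ≤ k + m) (a j) : D⋆.Dt u a &j = D.Dt u a &j - ∑ q, D.Lo u a q &j * dv ~q := by
  have hx := hD.maps u hu
  have hdH : D⋆.dH u a &j = pd a (fun z => D.H z &j) u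
    - (pd ~a (pd &j v) (D.f u) - ∑ q, D.L u a q &j * dv ~q) - dv ~a * (D.H u &j - dv &j) := by
    have e1 : pd a (fun z => D⋆.H z &j) u = pd a (fun z => D.H z &j - D.dn v z &j) u :=
      pd_congr hD hu fun z hz => hD.H_conf hv hz hk _
    have hdn : Sm U fun z => D.dn v z &j := Sm.sum fun b _ => (hD.sm_nor _ b).mul
      (hD.sm_comp (hv.pd hD.metric b))
    rw [pd_sub ((hD.sm_H _).diffAt hD hu) (hdn.diffAt hD hu), hs.pd_dn hD hv hu] at e1
    have e2 : ∑ c, ∑ d, Γ (confMetric v D.g) (D.f u) c d &j * D.tan u a d *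
      D⋆.H u c = dv ~a * (D.H u &j - dv &j) := by
      simp only [hs.tan_apply, mul_right_comm _ (kd _ _), sum_mul_kd', hs.normal.christoffel_conf
        hD.metric hv hx, kd_tg_nm, zero_mul, sub_zero, add_mul, sum_add]
      simp only [mul_assoc, sum_kd_mul, hs.H_conf_tg hD hv hu hk, hs.H_conf_nm hD hv hu hk]; ring
    simp only [dH, nor_conf, hs.nor_nm, amb_apply, sum_mul_kd']; rw [e1]; exact congrArg₂ _ rfl e2
  rw [Dt, hdH, nor_conf, tan_conf, hs.nor_nm, hs.tan_eq, hs.Sch_conf hD hv hu hn, hs.Dt_nm,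
    kd_tg_nm]
  simp only [hs.L_eq_Lo_add, add_mul, sum_add, mul_assoc, sum_kd_mul']; ring

lemma Cot_conf (hs : Spec) (hD : D.Reg U V) (hv : Sm V v) (hu : u ∈ U)
    (hn : 3 ≤ k + m) (a b c) : D⋆.Cot u (amb a) (amb b) (amb c)
    = D.cc u a b c - ∑ d, D.wc u a b c d * dv d := by
  rw [Cot_amb]; exact hs.normal.cotton_conf hD.metric hv (hD.maps u hu) hn a b c

lemma cC_eq (hs : Spec) (a b c) : D.cC u (amb a) (amb b) (amb c)
    = D.cc u a b c - ∑ j, D.H u &j * D.wc u a b c &j := by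
  rw [cC, hs.trA_of_tg fun p => by rw [hs.H_tg, zero_mul], Cot_amb]
  simp only [hs.nor_nm, W_amb]

lemma cC_conf (hs : Spec) (hD : D.Reg U V) (hv : Sm V v) (hu : u ∈ U) (hk : k ≠ 0)
    (hn : 3 ≤ k + m) (a b c) : D⋆.cC u (amb a) (amb b) (amb c)
    = D.cC u (amb a) (amb b) (amb c) - ∑ s, D.wc u a b c ~s * dv ~s := by
  have h := exp_mul_exp_neg (v (D.f u))
  have e : D⋆.trA u (fun d d' => D⋆.H u d * D⋆.W u (amb a) (amb b) (amb c) (D⋆.nor u d'))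
    = ∑ j, (D.H u &j - dv &j) * D.wc u a b c &j := by
    rw [trA_conf, hs.trA_of_tg fun p => by rw [hs.H_conf_tg hD hv hu hk, zero_mul], mul_sum]
    refine sum_ext fun j => ?_
    rw [nor_conf, hs.nor_nm, hD.W_conf hv hu hn, W_amb, hs.H_conf_nm hD hv hu hk]
    linear_combination ((D.H u &j - dv &j) * D.wc u a b c &j) * h
  rw [cC, e, hs.cC_eq, hs.Cot_conf hD hv hu hn, sum_tg_nm]
  simp only [sub_mul, sum_sub, mul_comm (pd &_ _ _)]; ring

end IsSpecialAt
end Special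
end CoordData

/-! ### Divergence and Laplacian of a conformally related metric -/

section Divergence
variable {k : ℕ} {h : MetricField k} {U : Set (Coo k)} {u : Coo k}

lemma divergence_eq_sum (V : Coo k → Fin k → ℝ) : divergence h V u
    = mtr (h u) fun a b => pd a (fun z => V z b) u - ∑ c, Γ h u c a b * V u c := by
  simp only [divergence, cov_vecCons, univ_unique, sum_singleton, mtr]; rfl

lemma divergence_lin (hh : MReg h U) (hu : u ∈ U) {V V' : Coo k → Fin k → ℝ}
    (hV : ∀ a, Sm U fun z => V z a) (hV' : ∀ a, Sm U fun z => V' z a) (c c' : ℝ) :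
    divergence h (fun z a => c * V z a + c' * V' z a) u
    = c * divergence h V u + c' * divergence h V' u := by
  simp only [divergence_eq_sum]; rw [← mtr_const_mul, ← mtr_const_mul, ← mtr_add]
  congr 1; funext a b
  rw [pd_add (((Sm.const c).mul (hV b)).diffAt hh hu) (((Sm.const c').mul (hV' b)).diffAt hh hu),
    pd_const_mul c ((hV b).diffAt hh hu), pd_const_mul c' ((hV' b).diffAt hh hu)]
  simp only [mul_add, sum_add, mul_left_comm _ c, mul_left_comm _ c', ← mul_sum]; ring

lemma divergence_congr (hh : MReg h U) (hu : u ∈ U) {V V' : Coo k → Fin k → ℝ}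
    (he : ∀ z ∈ U, ∀ a, V z a = V' z a) : divergence h V u = divergence h V' u := by
  simp only [divergence_eq_sum]; congr 1; funext a b
  rw [pd_congr hh hu fun z hz => he z hz b]; simp only [he u hu]

lemma laplacian_lin (hh : MReg h U) (hu : u ∈ U) {F F' : Coo k → ℝ} (hF : Sm U F)
    (hF' : Sm U F') (c c' : ℝ) :
    laplacian h (fun z => c * F z + c' * F' z) u = c * laplacian h F u + c' * laplacian h F' u := by
  rw [laplacian, laplacian, laplacian, ← divergence_lin hh hu (fun a => hF.pd hh a)
    (fun a => hF'.pd hh a)]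
  refine divergence_congr hh hu fun z hz a => ?_
  rw [pd_add (((Sm.const c).mul hF).diffAt hh hz) (((Sm.const c').mul hF').diffAt hh
    hz), pd_const_mul c (hF.diffAt hh hz), pd_const_mul c' (hF'.diffAt hh hz)]

lemma IsNormalAt.divergence_eq (hn : IsNormalAt h u) (V : Coo k → Fin k → ℝ) :
    divergence h V u = ∑ a, pd a (fun z => V z a) u := by
  rw [divergence_eq_sum, hn.mtr]; simp [hn.conn]

lemma IsNormalAt.laplacian_eq (hn : IsNormalAt h u) (F : Coo k → ℝ) :
    laplacian h F u = ∑ a, pd a (pd a F) u := hn.divergence_eq _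

lemma IsNormalAt.divergence_conf (hn : IsNormalAt h u) (hh : MReg h U) (hu : u ∈ U)
    {σ : Coo k → ℝ} (hσ : Sm U σ) {V V' : Coo k → Fin k → ℝ} (hV : ∀ a, Sm U fun z => V z a)
    (he : ∀ z ∈ U, ∀ a, V' z a = exp (-2 * σ z) * V z a) :
    divergence (confMetric σ h) V' u = exp (-4 * σ u) *
    (divergence h V u + ((k : ℝ) - 4) * ∑ a, pd a σ u * V u a) := by
  have hE := exp_neg_four_mul (σ u); have hx : Sm U fun z => -2 * σ z := (Sm.const _).mul hσ
  have hp a b : pd a (fun z => V' z b) u = exp (-2 * σ u) *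
    (pd a (fun z => V z b) u - 2 * pd a σ u * V u b) := by
    rw [pd_congr hh hu fun z hz => he z hz b, pd_mul (hx.exp.diffAt hh hu) ((hV b).diffAt hh hu),
      pd_exp (hx.diffAt hh hu), pd_const_mul _ (hσ.diffAt hh hu)]
    ring
  rw [divergence_eq_sum, mtr_confMetric, hn.mtr, hn.divergence_eq]
  simp only [hp, he u hu, hn.christoffel_conf hh hσ hu, kd_self, one_mul]
  have e a : ∑ c, (kd c a * pd a σ u + kd c a * pd a σ u - pd c σ u) * (exp (-2 * σ u) * V u c)
    = exp (-2 * σ u) * (2 * (pd a σ u * V u a) - ∑ c, pd c σ u * V u c) := by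
    simp only [sub_mul, add_mul, mul_assoc, sum_sub, sum_add,
      sum_kd_mul, mul_left_comm _ (exp _), ← mul_sum]
    ring
  simp only [e, ← mul_sub, ← mul_sum, sum_sub, sum_const, mul_assoc, hE]; ring

lemma IsNormalAt.laplacian_conf (hn : IsNormalAt h u) (hh : MReg h U) (hu : u ∈ U)
    {σ : Coo k → ℝ} (hσ : Sm U σ) {F F' : Coo k → ℝ} (hF : Sm U F)
    (he : ∀ z ∈ U, F' z = exp (-2 * σ z) * F z) : laplacian (confMetric σ h) F' u = exp (-4 * σ u) *
    (laplacian h F u + ((k : ℝ) - 6) * (∑ a, pd a F u * pd a σ u) - 2 * F u * (∑ a, pd a (pd a σ) u)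
    - 2 * ((k : ℝ) - 4) * F u * ∑ a, pd a σ u * pd a σ u) := by
  have hx : Sm U fun z => -2 * σ z := (Sm.const _).mul hσ; have hσa := fun a => hσ.pd hh a
  have hFa := fun a => hF.pd hh a
  have hV a : Sm U fun z => pd a F z - 2 * F z * pd a σ z :=
    (hFa a).sub (((Sm.const 2).mul hF).mul (hσa a))
  rw [laplacian, hn.divergence_conf hh hu hσ (V := fun z a => pd a F z - 2 * F z * pd a σ z) hV
    fun z hz a => by
      rw [pd_congr hh hz he, pd_mul (hx.exp.diffAt hh hz) (hF.diffAt hh hz), pd_exp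
        (hx.diffAt hh hz), pd_const_mul _ (hσ.diffAt hh hz)]
      ring, hn.divergence_eq, hn.laplacian_eq]
  have e a : pd a (fun z => pd a F z - 2 * F z * pd a σ z) u
    = pd a (pd a F) u - 2 * (F u * pd a (pd a σ) u) - 2 * (pd a F u * pd a σ u) := by
    rw [pd_sub ((hFa a).diffAt hh hu) ((((Sm.const 2).mul hF).mul (hσa a)).diffAt hh hu), pd_mul
      (((Sm.const 2).mul hF).diffAt hh hu) ((hσa a).diffAt hh hu), pd_const_mul _ (hF.diffAt hh hu)]
    ring
  have e2 a : pd a σ u * (pd a F u - 2 * F u * pd a σ u)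
      = pd a F u * pd a σ u - 2 * (F u * (pd a σ u * pd a σ u)) := by ring
  simp only [e, e2, sum_sub, ← mul_sum]; ring

end Divergence

/-! ### Conformal weights -/

/-- `x'` arises from `x` by a rescaling of weight `w`. -/
def Wt (s w x' x : ℝ) : Prop := x' = exp (w * s) * x

lemma Wt.mul {s w w' x x' y y' : ℝ} (hx : Wt s w x' x) (hy : Wt s w' y' y) :
    Wt s (w + w') (x' * y') (x * y) := by rw [Wt, hx, hy, add_mul, Real.exp_add]; ring

lemma Wt.eq {s w w' x x' : ℝ} (hx : Wt s w x' x) (h : w = w') : x' = exp (w' * s) * x := by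
  rw [hx, h]

namespace CoordData
section Weights
variable {k n : ℕ} {D : CoordData k n} {U : Set (Coo k)} {V : Set (Coo n)} {u : Coo k}
  {v : Coo n → ℝ}

lemma wt_trT {w : ℝ} {F F' : Fin k → Fin k → ℝ} (h : ∀ a b, Wt (v (D.f u)) w (F' a b) (F a b)) :
    Wt (v (D.f u)) (-2 + w) ((D.conf v).trT u F') (D.trT u F) := by
  rw [Wt, trT_conf, show F' = fun a b => exp (w * v (D.f u)) * F a b from
    funext fun a => funext fun b => h a b, trT_eq_mtr, mtr_const_mul, trT_eq_mtr, add_mul,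
    Real.exp_add]
  ring

lemma wt_trA {w : ℝ} {F F' : Fin n → Fin n → ℝ} (h : ∀ a b, Wt (v (D.f u)) w (F' a b) (F a b)) :
    Wt (v (D.f u)) (-2 + w) ((D.conf v).trA u F') (D.trA u F) := by
  rw [Wt, trA_conf, show F' = fun a b => exp (w * v (D.f u)) * F a b from
    funext fun a => funext fun b => h a b, trA_eq_mtr, mtr_const_mul, trA_eq_mtr, add_mul,
    Real.exp_add]
  ring

/-- The standing hypotheses for a conformal change. -/
structure ConfHyp {k n : ℕ} (D : CoordData k n) (v : Coo n → ℝ) (U : Set (Coo k))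
    (V : Set (Coo n)) : Prop where
  reg : D.Reg U V
  smooth : Sm V v
  two_le : 2 ≤ k
  three_le : 3 ≤ n

namespace ConfHyp

local notation "D⋆" => conf D v
local notation "Hyp" => ConfHyp D v U V
local notation "E2" => exp (-2 * v (D.f u))
local notation "E4" => exp (-4 * v (D.f u))

lemma ne_zero (h : Hyp) : k ≠ 0 := by have := h.two_le; omega

lemma wt_W (h : Hyp) (hu : u ∈ U) (v0 v1 v2 v3 : Fin n → ℝ) :
    Wt (v (D.f u)) 2 (D⋆.W u v0 v1 v2 v3) (D.W u v0 v1 v2 v3) :=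
  h.reg.W_conf h.smooth hu h.three_le _ _ _ _

lemma wt_Lo (h : Hyp) (hu : u ∈ U) (p b) (a) : Wt (v (D.f u)) 2 (D⋆.Lo u p b a) (D.Lo u p b a) :=
    h.reg.Lo_conf h.smooth hu h.ne_zero p b a

lemma wt_Wtt (h : Hyp) (hu : u ∈ U) (a b) : Wt (v (D.f u)) (-2 + 2) (D⋆.Wtt u a b) (D.Wtt u a b) :=
    wt_trT fun _ _ => h.wt_W hu _ _ _ _

lemma wt_Wtn (h : Hyp) (hu : u ∈ U) (p a) :
    Wt (v (D.f u)) (-2 + 2) (D⋆.Wtn u p a) (D.Wtn u p a) := by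
  simp only [Wtn, nor_conf]; exact wt_trT fun _ _ => h.wt_W hu _ _ _ _

lemma wt_Wnn (h : Hyp) (hu : u ∈ U) (a b) :
    Wt (v (D.f u)) (-2 + 2) (D⋆.Wnn u a b) (D.Wnn u a b) := by
  simp only [Wnn, nor_conf]; exact wt_trT fun _ _ => h.wt_W hu _ _ _ _

lemma wt_Lo2 (h : Hyp) (hu : u ∈ U) (a b) :
    Wt (v (D.f u)) (-2 + (-2 + (2 + 2))) (D⋆.Lo2 u a b) (D.Lo2 u a b) :=
  wt_trT fun _ _ => wt_trA fun _ _ => (h.wt_Lo hu _ _ _).mul (h.wt_Lo hu _ _ _)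

lemma Wtr_conf (h : Hyp) (hu : u ∈ U) : D⋆.Wtr u = E2 * D.Wtr u :=
  (wt_trT fun _ _ => h.wt_Wtt hu _ _).eq (by norm_num)

lemma normLo_conf (h : Hyp) (hu : u ∈ U) : D⋆.normLo u = E2 * D.normLo u :=
  (wt_trT fun _ _ => wt_trT fun _ _ => wt_trA fun _ _ =>
    (h.wt_Lo hu _ _ _).mul (h.wt_Lo hu _ _ _)).eq (by norm_num)

lemma formLW_conf (h : Hyp) (hu : u ∈ U) (a) : D⋆.formLW u a = E2 * D.formLW u a := by
  simp only [formLW, nor_conf]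
  exact (wt_trT fun _ _ => wt_trT fun _ _ => wt_trA fun _ _ =>
    (h.wt_Lo hu _ _ _).mul (h.wt_W hu _ _ _ _)).eq (by norm_num)

lemma formLWtn_conf (h : Hyp) (hu : u ∈ U) (a) : D⋆.formLWtn u a = E2 * D.formLWtn u a :=
  (wt_trT fun _ _ => wt_trA fun _ _ => (h.wt_Lo hu _ _ _).mul (h.wt_Wtn hu _ _)).eq (by norm_num)

lemma sLLWttnn_conf (h : Hyp) (hu : u ∈ U) : D⋆.sLLWttnn u = E4 * D.sLLWttnn u := by
  simp only [sLLWttnn, nor_conf]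
  exact (wt_trT fun _ _ => wt_trT fun _ _ => wt_trT fun _ _ =>
    wt_trA fun _ _ => wt_trA fun _ _ => ((h.wt_Lo hu _ _ _).mul (h.wt_Lo hu _ _ _)).mul
    (h.wt_W hu _ _ _ _)).eq (by norm_num)

lemma sLLWtntn_conf (h : Hyp) (hu : u ∈ U) : D⋆.sLLWtntn u = E4 * D.sLLWtntn u := by
  simp only [sLLWtntn, nor_conf]
  exact (wt_trT fun _ _ => wt_trT fun _ _ => wt_trT fun _ _ =>
    wt_trA fun _ _ => wt_trA fun _ _ => ((h.wt_Lo hu _ _ _).mul (h.wt_Lo hu _ _ _)).mul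
    (h.wt_W hu _ _ _ _)).eq (by norm_num)

lemma sLo2W_conf (h : Hyp) (hu : u ∈ U) : D⋆.sLo2W u = E4 * D.sLo2W u :=
  (wt_trT fun _ _ => wt_trT fun _ _ => (h.wt_Lo2 hu _ _).mul (h.wt_Wtt hu _ _)).eq (by norm_num)

lemma sLLWtttt_conf (h : Hyp) (hu : u ∈ U) : D⋆.sLLWtttt u = E4 * D.sLLWtttt u :=
  (wt_trT fun _ _ => wt_trT fun _ _ => wt_trT fun _ _ => wt_trT fun _ _ =>
    wt_trA fun _ _ => ((h.wt_Lo hu _ _ _).mul (h.wt_Lo hu _ _ _)).mul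
    (h.wt_W hu _ _ _ _)).eq (by norm_num)

lemma sLLWnn_conf (h : Hyp) (hu : u ∈ U) : D⋆.sLLWnn u = E4 * D.sLLWnn u :=
  (wt_trT fun _ _ => wt_trT fun _ _ => wt_trA fun _ _ => wt_trA fun _ _ =>
    ((h.wt_Lo hu _ _ _).mul (h.wt_Lo hu _ _ _)).mul (h.wt_Wnn hu _ _)).eq (by norm_num)

lemma sWtnWtn_conf (h : Hyp) (hu : u ∈ U) : D⋆.sWtnWtn u = E4 * D.sWtnWtn u :=
  (wt_trT fun _ _ => wt_trA fun _ _ => (h.wt_Wtn hu _ _).mul (h.wt_Wtn hu _ _)).eq (by norm_num)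

lemma sWttnt_conf (h : Hyp) (hu : u ∈ U) : D⋆.sWttnt u = E4 * D.sWttnt u := by
  simp only [sWttnt, nor_conf]
  exact (wt_trT fun _ _ => wt_trT fun _ _ => wt_trA fun _ _ => wt_trT fun _ _ =>
    (h.wt_W hu _ _ _ _).mul (h.wt_W hu _ _ _ _)).eq (by norm_num)

lemma sWtttn_conf (h : Hyp) (hu : u ∈ U) : D⋆.sWtttn u = E4 * D.sWtttn u := by
  simp only [sWtttn, nor_conf]
  exact (wt_trT fun _ _ => wt_trT fun _ _ => wt_trT fun _ _ => wt_trA fun _ _ =>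
    (h.wt_W hu _ _ _ _).mul (h.wt_W hu _ _ _ _)).eq (by norm_num)

lemma sWttaa_conf (h : Hyp) (hu : u ∈ U) : D⋆.sWttaa u = E4 * D.sWttaa u :=
  (wt_trT fun _ _ => wt_trT fun _ _ => wt_trA fun _ _ => wt_trA fun _ _ =>
    (h.wt_W hu _ _ _ _).mul (h.wt_W hu _ _ _ _)).eq (by norm_num)

lemma sWtata_conf (h : Hyp) (hu : u ∈ U) : D⋆.sWtata u = E4 * D.sWtata u :=
  (wt_trT fun _ _ => wt_trA fun _ _ => wt_trT fun _ _ => wt_trA fun _ _ =>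
    (h.wt_W hu _ _ _ _).mul (h.wt_W hu _ _ _ _)).eq (by norm_num)

lemma sWaa_conf (h : Hyp) (hu : u ∈ U) :
    D⋆.sWaa u = E4 * D.sWaa u := (wt_trA fun _ _ => wt_trA fun _ _ =>
    (wt_trT fun _ _ => (h.wt_W hu _ _ _ _)).mul (wt_trT fun _ _ => (h.wt_W hu _ _ _ _))).eq (by norm_num)

end ConfHyp
end Weights

section Special
variable {k m : ℕ} {D : CoordData k (k + m)} {U : Set (Coo k)} {V : Set (Coo (k + m))} {u : Coo k}
  {v : Coo (k + m) → ℝ}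

local notation "Spec" => IsSpecialAt D u

namespace IsSpecialAt

/-! Contractions at a special point. -/

lemma formDL_eq (hs : Spec) (a) : D.formDL u a = ∑ b, ∑ j, D.Dt u b &j * D.Lo u a b &j := by
  rw [formDL, hs.trT]; exact sum_ext fun b => hs.trA_of_tg fun c => by rw [hs.Lo_tg, mul_zero]

lemma Lo2_eq (hs : Spec) (a b) : D.Lo2 u a b = ∑ c, ∑ j, D.Lo u c a &j * D.Lo u c b &j := by
  rw [Lo2, hs.trT]; exact sum_ext fun c => hs.trA_of_tg fun c => by rw [hs.Lo_tg, zero_mul]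

lemma normLo_eq (hs : Spec) : D.normLo u = ∑ a, ∑ b, ∑ j, D.Lo u a b &j * D.Lo u a b &j := by
  simp only [normLo, hs.trT]
  exact sum_ext2 fun a b => hs.trA_of_tg fun c => by rw [hs.Lo_tg, mul_zero]

lemma normD_eq (hs : Spec) : D.normD u = ∑ a, ∑ j, D.Dt u a &j * D.Dt u a &j := by
  rw [normD, hs.trT]; exact sum_ext fun a => hs.trA_of_tg fun c => by rw [hs.Dt_tg, mul_zero]

lemma normH_eq (hs : Spec) : D.normH u = ∑ j, D.H u &j * D.H u &j :=
  hs.trA_of_tg fun c => by rw [hs.H_tg, mul_zero]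

lemma formLW_eq (hs : Spec) (a) : D.formLW u a
    = ∑ b, ∑ c, ∑ j, D.Lo u b c &j * D.wc u ~a ~b &j ~c := by
  simp only [formLW, hs.trT]; refine sum_ext2 fun b c => ?_
  rw [hs.trA_of_tg fun c => by rw [hs.Lo_tg, zero_mul]]
  simp only [hs.tan_eq, hs.nor_nm, W_amb]

lemma formLWtn_eq (hs : Spec) (a) : D.formLWtn u a = ∑ b, ∑ j, D.Lo u a b &j * D.Wtn u b &j := by
  rw [formLWtn, hs.trT]; exact sum_ext fun b => hs.trA_of_tg fun c => by rw [hs.Lo_tg, zero_mul]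

lemma Wtt_eq (hs : Spec) (a b) : D.Wtt u a b = ∑ c, D.wc u ~a ~c ~b ~c := by
  simp only [Wtt, hs.trT, hs.tan_eq, W_amb]

lemma sDW_eq (hs : Spec) : D.sDW u = ∑ a, ∑ j, D.Dt u a &j * D.Wtn u a &j := by
  rw [sDW, hs.trT]; exact sum_ext fun b => hs.trA_of_tg fun c => by rw [hs.Dt_tg, zero_mul]

lemma sLC_eq (hs : Spec) : D.sLC u = ∑ a, ∑ b, ∑ j, D.Lo u a b &j *
    D.cC u (amb ~a) (amb &j) (amb ~b) := by
  simp only [sLC, hs.trT]; refine sum_ext2 fun b c => ?_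
  rw [hs.trA_of_tg fun c => by rw [hs.Lo_tg, zero_mul]]
  simp only [hs.tan_eq, hs.nor_nm]

lemma cC1_eq (hs : Spec) (a) : D.cC1 u a = ∑ b, D.cC u (amb ~b) (amb ~a) (amb ~b) := by
  simp only [cC1, hs.trT, hs.tan_eq]

lemma cP_eq (hs : Spec) (a b) : D.cP u a b = D.pc u ~a ~b
    + ∑ j, D.H u &j * D.Lo u a b &j + 1 / 2 * (∑ j, D.H u &j * D.H u &j) * kd a b := by
  rw [cP, hs.trA_of_tg fun c => by rw [hs.H_tg, zero_mul], hs.normH_eq, hs.h_apply, hs.tan_eq,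
    hs.tan_eq, Sch_amb]

/-! The divergences of `L̊²` and of `W_{αγβ}{}^γ`. -/

lemma div_Lo2 (hs : Spec) (hD : D.Reg U V) (hu : u ∈ U) (hk : k ≠ 0) (b) :
    ∑ p, pd p (fun z => D.Lo2 z p b) u = 1 / 2 * pd b D.normLo u - ((k : ℝ) - 2) * D.formDL u b
    - D.formLWtn u b - D.formLW u b := by
  have h1 p : pd p (fun z => D.Lo2 z p b) u
    = ∑ c, ∑ j, (pd p (fun z => D.Lo z c p &j) u * D.Lo u c b &j
    + D.Lo u c p &j * pd p (fun z => D.Lo z c b &j) u) := by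
    simp only [Lo2]
    rw [hs.pd_trT hD hu fun c c' => hD.sm_trA fun a a' => (hD.sm_Lo c p a).mul (hD.sm_Lo c' b a')]
    exact sum_ext fun c => hs.pd_trA_mul hD hu (hD.sm_Lo c p) (hD.sm_Lo c b)
      (hs.Lo_tg c p) (hs.Lo_tg c b) p
  have h2 : pd b D.normLo u = 2 * ∑ p, ∑ c, ∑ j,
    D.Lo u c p &j * pd b (fun z => D.Lo z c p &j) u := by
    refine (hs.pd_trT hD hu (F := fun z p p' => D.trT z fun b b' => D.trA z fun a a' =>
      D.Lo z p b a * D.Lo z p' b' a') (fun p p' => hD.sm_trT fun b b' => hD.sm_trA fun a a' =>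
        (hD.sm_Lo p b a).mul (hD.sm_Lo p' b' a')) b).trans ?_
    rw [sum_comm, mul_sum]; refine sum_ext fun p => ?_
    rw [hs.pd_trT hD hu (fun b b' => hD.sm_trA fun a a' =>
        (hD.sm_Lo p b a).mul (hD.sm_Lo p b' a')), mul_sum]
    refine sum_ext fun c => ?_
    rw [hs.pd_trA_mul hD hu (hD.sm_Lo p c) (hD.sm_Lo p c) (hs.Lo_tg p c) (hs.Lo_tg p c), mul_sum]
    exact sum_ext fun j => by ring
  have h3 : ∑ p, ∑ c, ∑ j, pd p (fun z => D.Lo z c p &j) u * D.Lo u c b &j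
    = -((k : ℝ) - 1) * D.formDL u b - D.formLWtn u b := by
    rw [sum_comm, hs.formDL_eq, hs.formLWtn_eq, mul_sum, ← sum_sub]
    refine sum_ext fun c => ?_; rw [sum_comm, mul_sum, ← sum_sub]
    refine sum_ext fun j => ?_; rw [← sum_mul, hs.div_Lo hD hu hk, hs.Lo_symm hD hu c b]; ring
  have h4 p c j : D.Lo u c p &j * pd p (fun z => D.Lo z c b &j) u
    = D.Lo u c p &j * pd b (fun z => D.Lo z c p &j) u - D.Lo u p c &j * D.wc u ~b ~p &j ~c
    + kd b c * (D.Dt u p &j * D.Lo u c p &j) - kd p c * (D.Lo u c p &j * D.Dt u b &j) := by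
    rw [hs.pd_Lo_symm hD hu p c b, hs.codazzi hD hu p b c j, hs.pd_Lo_symm hD hu b p c,
      hD.wc_swap' hu ~b ~p ~c &j, hs.Lo_symm hD hu p c]
    ring
  have h5 : ∑ p, ∑ c, ∑ j, kd p c * (D.Lo u c p &j * D.Dt u b &j) = 0 := by
    simp only [← mul_sum, sum_kd_mul']; rw [sum_comm]
    simp only [← sum_mul, hs.sum_Lo hk, zero_mul, sum_const_zero]
  have h6 : ∑ p, ∑ c, ∑ j, kd b c * (D.Dt u p &j * D.Lo u c p &j) = D.formDL u b := by
    simp only [← mul_sum, sum_kd_mul', hs.formDL_eq]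
  simp only [h1, sum_add, h3, h4, sum_sub, h5, h6, h2, ← hs.formLW_eq]; ring

lemma pd_Wtt (hs : Spec) (hD : D.Reg U V) (hu : u ∈ U) (e a b) : pd e (fun z => D.Wtt z a b) u
    = ∑ c, pd e (fun z => D.W z (D.tan z a) (D.tan z c) (D.tan z b) (D.tan z c)) u :=
    hs.pd_trT hD hu (fun c c' => hD.sm_W (hD.sm_tan a) (hD.sm_tan c) (hD.sm_tan b) (hD.sm_tan c')) e

lemma pd_Wtr (hs : Spec) (hD : D.Reg U V) (hu : u ∈ U) (e) :
    pd e D.Wtr u = ∑ a, ∑ c, D.dwc u ~e ~a ~c ~a ~c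
    + 4 * ∑ a, ∑ j, D.L u e a &j * D.Wtn u a &j := by
  have h1 : pd e (fun z => D.Wtr z) u = ∑ a, pd e (fun z => D.Wtt z a a) u :=
    hs.pd_trT hD hu (fun a a' => hD.sm_Wtt a a') e
  rw [show pd e D.Wtr u = pd e (fun z => D.Wtr z) u from rfl, h1]
  simp only [hs.pd_Wtt hD hu, hs.pd_W_tan hD hu, sum_add]
  have e1 : ∑ a, ∑ c, ∑ j, D.L u e a &j * D.wc u &j ~c ~a ~c
    = ∑ a, ∑ j, D.L u e a &j * D.Wtn u a &j := by
    refine sum_ext fun a => ?_; rw [sum_comm]; refine sum_ext fun j => ?_; rw [← mul_sum, hs.Wtn_nm]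
    simp only [hD.wc_pair hu &j]
  have e2 : ∑ a, ∑ c, ∑ j, D.L u e c &j * D.wc u ~a &j ~a ~c
    = ∑ a, ∑ c, ∑ j, D.L u e a &j * D.wc u &j ~c ~a ~c := by
    rw [sum_comm]; refine sum_ext3 fun a c j => ?_; rw [D.wc_swap, hD.wc_swap' hu, neg_neg]
  have e3 : ∑ a, ∑ c, ∑ j, D.L u e a &j * D.wc u ~a ~c &j ~c
    = ∑ a, ∑ c, ∑ j, D.L u e a &j * D.wc u &j ~c ~a ~c := by
    refine sum_ext3 fun a c j => ?_; rw [hD.wc_pair hu]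
  have e4 : ∑ a, ∑ c, ∑ j, D.L u e c &j * D.wc u ~a ~c ~a &j
    = ∑ a, ∑ c, ∑ j, D.L u e a &j * D.wc u &j ~c ~a ~c := by
    rw [← e2]; refine sum_ext3 fun a c j => ?_; rw [hD.wc_pair hu]
  rw [e2, e3, e4, e1]; ring

lemma sum_dwc (hs : Spec) (hD : D.Reg U V) (hu : u ∈ U) (b) : ∑ a, ∑ c, D.dwc u b ~a ~c ~a ~c
    = 2 * ∑ a, ∑ c, D.dwc u ~a ~a ~c b ~c + (2 * (k : ℝ) - 2) * ∑ a, D.cc u ~a b ~a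
    - 2 * ∑ a, kd ~a b * ∑ c, D.cc u ~c ~a ~c := by
  have hB a c : D.dwc u b ~a ~c ~a ~c = D.dwc u ~a ~a ~c b ~c + D.dwc u ~c ~c ~a b ~a
    + kd a c * D.cc u b ~a ~c + D.cc u ~a b ~a
    + kd ~a b * D.cc u ~a ~c ~c - kd ~c b * D.cc u ~a ~c ~a
    + D.cc u ~c b ~c - kd a c * D.cc u ~c b ~a := by
    have h := hs.dwc_bianchi hD hu b ~a ~c ~a ~c
    rw [hs.dwc_pair hD hu ~a ~c b, hs.dwc_swap' hD hu ~a ~a ~c ~c b, hs.dwc_pair hD hu ~c b ~a,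
      hs.dwc_swap ~c ~a ~c, D.cc_swap u b ~a, D.cc_swap u b ~a, kd_tg, kd_tg, kd_tg, kd_tg, kd_self,
      kd_self, kd_comm c a, kd_comm b ~a, kd_comm b ~c] at h
    rw [D.cc_swap u b ~a]; linear_combination h
  have e1 a : ∑ c, D.cc u ~a ~c ~c = -∑ c, D.cc u ~c ~a ~c := by
    rw [← sum_neg]; exact sum_ext fun c => D.cc_swap _ _ _ _
  have e2 : ∑ a, ∑ c, D.dwc u ~c ~c ~a b ~a = ∑ a, ∑ c, D.dwc u ~a ~a ~c b ~c := sum_comm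
  have e3 : ∑ a, ∑ c, kd ~c b * D.cc u ~a ~c ~a
      = ∑ a, kd ~a b * ∑ c, D.cc u ~c ~a ~c := by rw [sum_comm]; simp only [mul_sum]
  have e4 : ∑ a, D.cc u b ~a ~a = -∑ a, D.cc u ~a b ~a := by
    rw [← sum_neg]; exact sum_ext fun c => D.cc_swap _ _ _ _
  simp only [hB, sum_add, sum_sub, e2, e3, sum_kd_mul', e4, sum_const]
  simp only [← mul_sum, e1, mul_neg, sum_neg]; ring

lemma div_Wtt (hs : Spec) (hD : D.Reg U V) (hu : u ∈ U) (hk : k ≠ 0) (b) :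
    ∑ a, pd a (fun z => D.Wtt z a b) u = 1 / 2 * pd b D.Wtr u - ((k : ℝ) - 2) * D.cC1 u b
    - D.formLWtn u b - D.formLW u b := by
  have hB := hs.sum_dwc hD hu ~b; simp only [kd_tg, sum_kd_mul] at hB
  have hc : D.cC1 u b = ∑ a, D.cc u ~a ~b ~a - ∑ j, D.H u &j * D.Wtn u b &j := by
    simp only [hs.cC1_eq, hs.cC_eq, sum_sub, hs.Wtn_nm, mul_sum]; congr 1; rw [sum_comm]
    refine sum_ext2 fun j a => ?_; rw [D.wc_swap, hD.wc_swap' hu, neg_neg]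
  have hW j : ∑ c, D.wc u &j ~c ~b ~c = D.Wtn u b &j := by
    rw [hs.Wtn_nm]; exact sum_ext fun c => hD.wc_pair hu _ _ _ _
  have e1 : ∑ a, ∑ c, ∑ j, D.L u a a &j * D.wc u &j ~c ~b ~c
    = k * ∑ j, D.H u &j * D.Wtn u b &j := by
    have this a : ∑ c, ∑ j, D.L u a a &j * D.wc u &j ~c ~b ~c
        = ∑ j, D.L u a a &j * D.Wtn u b &j := by rw [sum_comm]; simp only [← mul_sum, hW]
    simp only [this]; rw [sum_comm, mul_sum]; refine sum_ext fun j => ?_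
    rw [← sum_mul, hs.sum_L hk]; ring
  have e2 : ∑ a, ∑ c, ∑ j, D.L u a c &j * D.wc u ~a &j ~b ~c
    = -D.formLW u b - ∑ j, D.H u &j * D.Wtn u b &j := by
    have this a c j : D.L u a c &j * D.wc u ~a &j ~b ~c = -(D.Lo u c a &j * D.wc u ~b ~c &j ~a)
      - kd a c * (D.H u &j * D.wc u ~b ~c &j ~a) := by
            rw [hs.L_eq_Lo_add, hs.Lo_symm hD hu, hD.wc_pair hu, hD.wc_swap' hu]; ring
    simp only [this, sum_sub, sum_neg, hs.formLW_eq]; rw [sum_comm]; congr 1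
    simp only [← mul_sum, sum_kd_mul']; rw [sum_comm]; simp only [← mul_sum, hs.Wtn_nm]
  have e3 : ∑ a, ∑ c, ∑ j, D.L u a b &j * D.wc u ~a ~c &j ~c
    = ∑ a, ∑ j, D.L u b a &j * D.Wtn u a &j := by
    refine sum_ext fun a => ?_; rw [sum_comm]; refine sum_ext fun j => ?_
    rw [← mul_sum, hs.Wtn_nm, hs.L_symm hD hu]
  have e4 : ∑ a, ∑ c, ∑ j, D.L u a c &j * D.wc u ~a ~c ~b &j = 0 := by
    have : ∑ a, ∑ c, ∑ j, D.L u a c &j * D.wc u ~a ~c ~b &j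
      = -∑ a, ∑ c, ∑ j, D.L u a c &j * D.wc u ~a ~c ~b &j := by
      conv_lhs => rw [sum_comm]
      simp only [← sum_neg]; refine sum_ext3 fun c a j => ?_; rw [hs.L_symm hD hu, D.wc_swap]; ring
    linarith
  have e5 : ∑ a, ∑ j, D.L u b a &j * D.Wtn u a &j
    = D.formLWtn u b + ∑ j, D.H u &j * D.Wtn u b &j := by
    simp only [hs.L_eq_Lo_add, add_mul, sum_add, hs.formLWtn_eq, mul_assoc, ← mul_sum, sum_kd_mul']
  simp only [hs.pd_Wtt hD hu, hs.pd_W_tan hD hu, sum_add, e1, e2, e3, e4,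
    hs.pd_Wtr hD hu, hB, hc, e5]
  ring

end IsSpecialAt
end Special

lemma sum_contract {ι κ lam : Type*} [Fintype ι] [Fintype κ] [Fintype lam]
    (X : ι → κ → ℝ) (Y : ι → lam → κ → ℝ) (y : lam → ℝ) :
    ∑ a, ∑ j, X a j * ∑ b, Y a b j * y b = ∑ b, (∑ a, ∑ j, X a j * Y a b j) * y b := by
  simp only [mul_sum, sum_mul]
  rw [Finset.sum_comm' (s := univ) (t := fun _ => univ) (t' := univ)
    (s' := fun _ => univ) (by simp)]
  rw [sum_comm, sum_ext fun a => sum_comm, sum_comm]; exact sum_ext3 fun _ _ _ => by ring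

lemma sum_sq_sub {ι κ : Type*} [Fintype ι] [Fintype κ] (a : ι → ℝ) (b : κ → ℝ) (x : ι → ℝ)
    (y H : κ → ℝ) (p : ι → ι → ℝ) (q : κ → ι → ℝ) (r : κ → κ → ℝ) (hr : ∀ i j, r i j = r j i) :
    (∑ s, x s * (2 * a s) + ∑ j, y j * (2 * b j))
    + (∑ c, (∑ s, p c s * (x c * x s) + ∑ j, q j c * (x c * y j))
    + ∑ j, (∑ s, q j s * (y j * x s) + ∑ i, r j i * (y j * y i)))
    + ∑ j, (H j - y j) * (2 * (b j + (∑ s, q j s * x s + ∑ i, r j i * y i)))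
    + ∑ i, ∑ j, (H i - y i) * (H j - y j) * r i j = 2 * ∑ j, H j * b j + ∑ i, ∑ j, H i * H j * r i j
    + 2 * ∑ s, (a s + ∑ j, H j * q j s) * x s + ∑ c, ∑ s, p c s * (x c * x s) := by
  have e1 : ∑ c, ∑ j, q j c * (x c * y j) = ∑ j, y j * ∑ s, q j s * x s := by
    rw [sum_comm]; simp only [mul_sum]; exact sum_ext2 fun _ _ => by ring
  have e2 : ∑ j, ∑ s, q j s * (y j * x s) = ∑ j, y j * ∑ s, q j s * x s := by
    simp only [mul_sum]; exact sum_ext2 fun _ _ => by ring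
  have e3 : ∑ s, (∑ j, H j * q j s) * x s = ∑ j, H j * ∑ s, q j s * x s := by
    simp only [mul_sum, sum_mul]; rw [sum_comm]; exact sum_ext2 fun _ _ => by ring
  have e4 : ∑ j, ∑ i, r j i * (y j * y i) = ∑ j, y j * ∑ i, r j i * y i := by
    simp only [mul_sum]; exact sum_ext2 fun _ _ => by ring
  have e5 : ∑ i, ∑ j, (H i - y i) * (H j - y j) * r i j = ∑ i, ∑ j, H i * H j * r i j
    - 2 * ∑ j, H j * ∑ i, r j i * y i + ∑ j, y j * ∑ i, r j i * y i := by
    have : ∑ i, ∑ j, y i * H j * r i j = ∑ j, H j * ∑ i, r j i * y i := by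
      rw [sum_comm]; simp only [mul_sum]; exact sum_ext2 fun _ _ => by rw [hr]; ring
    rw [two_mul]; nth_rw 1 [← this]; simp only [mul_sum, ← sum_sub, ← sum_add]
    exact sum_ext2 fun _ _ => by ring
  simp only [sum_add, add_mul, e1, e2, e3, e4, e5]
  simp only [mul_add, sub_mul, sum_add, sum_sub, mul_left_comm _ (2 : ℝ), ← mul_sum, mul_comm (a _)]
  ring

section Special
variable {k m : ℕ} {D : CoordData k (k + m)} {U : Set (Coo k)} {V : Set (Coo (k + m))} {u : Coo k}
  {v : Coo (k + m) → ℝ}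

local notation "Spec" => IsSpecialAt D u
local notation "D⋆" => conf D v
local notation "E2" => exp (-2 * v (D.f u))
local notation:max "dv" a:max => pd a v (D.f u)
local notation "E4" => exp (-4 * v (D.f u))
local notation "Hyp" => ConfHyp D v U V

namespace IsSpecialAt

lemma formDL_conf_aux (hs : Spec) (h : Hyp) (hu : u ∈ U) (a) : D⋆.formDL u a = E2 *
    (D.formDL u a - ∑ b, D.Lo2 u a b * dv ~b) := by
  have hpq := exp_mul_exp_neg (v (D.f u))
  have e : D⋆.formDL u a = E2 * ∑ b, ∑ j,
    (D.Dt u b &j - ∑ c, D.Lo u b c &j * dv ~c) * D.Lo u a b &j := by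
    rw [formDL, trT_conf, hs.trT]; congr 1; refine sum_ext fun b => ?_
    simp only [h.reg.Lo_conf h.smooth hu h.ne_zero]
    rw [trA_conf, hs.trA_of_tg fun c => by rw [hs.Lo_tg, mul_zero, mul_zero], mul_sum]
    refine sum_ext fun j => ?_; rw [hs.Dt_conf h.reg h.smooth hu h.ne_zero h.three_le]
    linear_combination ((D.Dt u b &j - ∑ c, D.Lo u b c &j * dv ~c) * D.Lo u a b &j) * hpq
  rw [e]; congr 1; simp only [sub_mul, sum_sub, hs.formDL_eq, hs.Lo2_eq]; congr 1
  rw [← sum_contract]; refine sum_ext2 fun b j => ?_; rw [hs.Lo_symm h.reg hu a b, mul_comm]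

lemma cC1_conf_aux (hs : Spec) (h : Hyp) (hu : u ∈ U) (a) : D⋆.cC1 u a = E2 *
    (D.cC1 u a - ∑ b, D.Wtt u a b * dv ~b) := by
  rw [cC1, trT_conf, hs.trT]; congr 1
  simp only [tan_conf, hs.tan_eq, hs.cC_conf h.reg h.smooth hu h.ne_zero h.three_le, hs.cC1_eq,
    sum_sub, hs.Wtt_eq, sum_mul]
  congr 1; rw [sum_comm]; refine sum_ext2 fun b c => ?_; rw [D.wc_swap, h.reg.wc_swap' hu, neg_neg]

end IsSpecialAt

/-- Transfer of the vanishing of a natural one-form from special points. -/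
lemma oneForm_eq_zero (E : CoordData k (k + m) → (Coo (k + m) → ℝ) → Coo k → Fin k → ℝ)
    (hE : ∀ {D' D : CoordData k (k + m)} {φ ψ U' U V' V v u},
    Change D' D φ ψ U' U V' V → ConfHyp D v U V → u ∈ U' → ∀ p,
    E D' (fun z => v (ψ z)) u p = ap (jac φ u) p fun b => E D v (φ u) b)
    (h0 : ∀ {D : CoordData k (k + m)} {U V v u}, ConfHyp D v U V → u ∈ U → D.IsSpecialAt u →
    ∀ p, E D v u p = 0) (h : Hyp) (hu : u ∈ U) (p) : E D v u p = 0 := by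
  obtain ⟨D', φ, ψ, U', V', hc, hu', rfl, hs⟩ := h.reg.exists_special hu
  refine hc.pull_h.ap_injective hu' (fun a => ?_) p; rw [← hE hc h hu' a]
  exact h0 ⟨hc.reg', h.smooth.comp hc.pull.smooth hc.pull.maps, h.two_le, h.three_le⟩ hu' hs a

lemma Change.pd_comp_f {D' : CoordData k (k + m)} {φ ψ U' V'} (hc : Change D' D φ ψ U' U V' V)
    (hv : Sm V v) (hu : u ∈ U') (b) : pd b (fun z => v (ψ (D'.f z))) u
    = ap (jac φ u) b fun c => pd c (fun z => v (D.f z)) (φ u) := by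
  rw [← hc.pd_comp hu (F := fun z => v (D.f z)) (hc.reg.sm_comp hv)]
  exact pd_congr hc.reg' hu fun z hz => by rw [hc.comm z hz]

namespace ConfHyp

lemma formDL_conf (h : Hyp) (hu : u ∈ U) (a) : D⋆.formDL u a = E2 * (D.formDL u a
    - D.trT u fun b b' => D.Lo2 u a b * pd b' (fun z => v (D.f z)) u) := by
  refine sub_eq_zero.1 (oneForm_eq_zero (fun D v u a => (D.conf v).formDL u a
    - exp (-2 * v (D.f u)) * (D.formDL u a
    - D.trT u fun b b' => D.Lo2 u a b * pd b' (fun z => v (D.f z)) u)) ?_ ?_ h hu a)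
  · intro D' D φ ψ U' U V' V v u hc h hu a
    rw [(hc.conf h.smooth).formDL_eq hu]
    simp only [hc.comm u hu, hc.formDL_eq hu, hc.Lo2_eq hu, hc.pd_comp_f h.smooth hu, trT_eq_mtr, ap_mul, mul_ap, mtr_ap,
      mtr_ap_right_ap, hc.trT_eq' hu, ap_sub]
    rw [← ap_sub, mul_ap]
  · intro D U V v u h hu hs a
    rw [hs.formDL_conf_aux h hu, hs.trT]; simp only [hs.pd_comp_f h.reg hu h.smooth, sub_self]

lemma cC1_conf (h : Hyp) (hu : u ∈ U) (a) : D⋆.cC1 u a = E2 * (D.cC1 u a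
    - D.trT u fun b b' => D.Wtt u a b * pd b' (fun z => v (D.f z)) u) := by
  refine sub_eq_zero.1 (oneForm_eq_zero (fun D v u a => (D.conf v).cC1 u a
    - exp (-2 * v (D.f u)) * (D.cC1 u a
    - D.trT u fun b b' => D.Wtt u a b * pd b' (fun z => v (D.f z)) u)) ?_ ?_ h hu a)
  · intro D' D φ ψ U' U V' V v u hc h hu a
    rw [(hc.conf h.smooth).cC1_eq hu]
    simp only [hc.comm u hu, hc.cC1_eq hu, hc.Wtt_eq hu, hc.pd_comp_f h.smooth hu, trT_eq_mtr, ap_mul, mul_ap, mtr_ap,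
      mtr_ap_right_ap, hc.trT_eq' hu, ap_sub]
    rw [← ap_sub, mul_ap]
  · intro D U V v u h hu hs a
    rw [hs.cC1_conf_aux h hu, hs.trT]; simp only [hs.pd_comp_f h.reg hu h.smooth, sub_self]

end ConfHyp

namespace IsSpecialAt

lemma div_contract (hs : Spec) (hD : D.Reg U V) (hu : u ∈ U)
    {A : Coo k → Fin k → Fin k → ℝ} (hA : ∀ p b, Sm U fun z => A z p b) {σ : Coo k → ℝ}
    (hσ : Sm U σ) : ∑ p, pd p (fun z => D.trT z fun b b' => A z p b * pd b' σ z) u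
    = ∑ b, (∑ p, pd p (fun z => A z p b) u) * pd b σ u + ∑ p, ∑ b, A u p b * pd p (pd b σ) u := by
  have hσa := fun a => hσ.pd hD a
  simp only [fun p => hs.pd_trT hD hu (F := fun z b b' => A z p b * pd b' σ z)
    (fun b b' => (hA p b).mul (hσa b')) p, fun p b => pd_mul (a := p)
    ((hA p b).diffAt hD hu) ((hσa b).diffAt hD hu), sum_add, sum_mul]
  rw [add_comm]; congr 1; rw [sum_comm]; exact sum_ext2 fun _ _ => by ring

lemma pd_pd_comp_f (hs : Spec) (hD : D.Reg U V) (hv : Sm V v) (hu : u ∈ U)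
    (p q) : pd p (pd q fun z => v (D.f z)) u = pd ~p (pd ~q v) (D.f u)
    + ∑ j, D.L u p q &j * dv &j := by
  have hy := fun b => hD.sm_comp (hv.pd hD.metric b); have hd {F} (h : Sm U F) := h.diffAt hD hu
  rw [pd_congr hD hu (G := fun z => ∑ c, D.tan z q c * pd c v (D.f z))
    (fun z hz => pd_comp (hv.diffAt hD.metric (hD.maps z hz)) (hD.diffAt hz)),
    pd_sum fun c _ => hd ((hD.sm_tan q c).mul (hy c))]
  simp only [fun c => pd_mul (a := p) (hd (hD.sm_tan q c)) (hd (hy c)), hs.tan_apply,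
    sum_add, sum_kd_mul', fun b => hs.pd_comp_f hD hu (hv.pd hD.metric b)]
  congr 1; rw [sum_tg_nm]
  simp only [hs.pd_tan_tg hD hu, mul_zero, sum_const_zero, zero_add, ← hs.L_nm]
  exact sum_ext fun _ => mul_comm _ _

variable (v) in
/-- The change of `𝒫` under a conformal rescaling, at a special point. -/
def Qc (D : CoordData k (k + m)) (u : Coo k) (α β : Fin k) : ℝ :=
  pd α (pd β fun z => v (D.f z)) u - pd ~α v (D.f u) * pd ~β v (D.f u)
    + 1 / 2 * (∑ γ : Fin k, pd ~γ v (D.f u) * pd ~γ v (D.f u)) * kd α β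

lemma cP_conf (hs : Spec) (h : Hyp) (hu : u ∈ U) (p b) :
    D⋆.cP u p b = D.cP u p b - Qc v D u p b := by
  have hpq := exp_mul_exp_neg (v (D.f u)); set H' : Fin m → ℝ := fun j => D.H u &j - dv &j with hH'
  have e1 : D⋆.trA u (fun a a' => D⋆.H u a * D⋆.Lo u p b a') = ∑ j, H' j * D.Lo u p b &j := by
    rw [trA_conf, hs.trA_of_tg fun c => by
      rw [hs.H_conf_tg h.reg h.smooth hu h.ne_zero, zero_mul], mul_sum]
    refine sum_ext fun j => ?_
    rw [hs.H_conf_nm h.reg h.smooth hu h.ne_zero, h.reg.Lo_conf h.smooth hu h.ne_zero]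
    linear_combination (H' j * D.Lo u p b &j) * hpq
  have e2 : D⋆.normH u = E2 * ∑ j, H' j * H' j := by
    rw [normH, trA_conf, hs.trA_of_tg fun c => by
      rw [hs.H_conf_tg h.reg h.smooth hu h.ne_zero, zero_mul]]
    simp only [hs.H_conf_nm h.reg h.smooth hu h.ne_zero, hH']
  have e3 : 1 / 2 * (E2 * ∑ j, H' j * H' j)
    * (exp (2 * v (D.f u)) * kd p b) = 1 / 2 * (∑ j, H' j * H' j) * kd p b := by
    linear_combination (1 / 2 * (∑ j, H' j * H' j) * kd p b) * hpq
  rw [cP, e1, e2, h_conf, confMetric_apply, hs.h_apply, e3, tan_conf, tan_conf, hs.tan_eq, hs.tan_eq,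
    hs.Sch_conf h.reg h.smooth hu h.three_le, hs.cP_eq, Qc, hs.pd_pd_comp_f h.reg h.smooth hu,
    hs.normal.gradSq_eq, sum_tg_nm, kd_tg]
  simp only [hs.L_eq_Lo_add, hH', sub_mul, mul_sub, add_mul, sum_sub, sum_add, mul_assoc, ← mul_sum]
  simp only [mul_comm (pd &_ _ _)]; ring

lemma cPtr_conf (hs : Spec) (h : Hyp) (hu : u ∈ U) :
    D⋆.cPtr u = E2 * (D.cPtr u - ∑ a, Qc v D u a a) := by
  rw [cPtr, trT_conf, hs.trT, cPtr, hs.trT]; simp only [hs.cP_conf h hu, sum_sub]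

lemma contract_cP_conf (hs : Spec) (h : Hyp) (hu : u ∈ U)
    {A A' : Fin k → Fin k → ℝ} (hA : ∀ a b, A' a b = A a b) :
    D⋆.trT u (fun a a' => D⋆.trT u fun b b' => A' a b * D⋆.cP u a' b')
    = E4 * (D.trT u (fun a a' => D.trT u fun b b' => A a b * D.cP u a' b')
    - ∑ a, ∑ b, A a b * Qc v D u a b) := by
  have hE := exp_neg_four_mul (v (D.f u))
  simp only [trT_conf, hs.trT, hs.cP_conf h hu, hA, mul_sub, sum_sub, ← mul_sum, hE]; ring

lemma sum_mul_Qc (A : Fin k → Fin k → ℝ) : ∑ a, ∑ b, A a b * Qc v D u a b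
    = ∑ a, ∑ b, A a b * pd a (pd b fun z => v (D.f z)) u - ∑ a, ∑ b, A a b * (dv ~a * dv ~b)
    + 1 / 2 * (∑ c, dv ~c * dv ~c) * ∑ a, A a a := by
  simp only [Qc, mul_add, mul_sub, sum_add, sum_sub]; congr 1
  simp only [mul_left_comm (A _ _), ← mul_sum, sum_mul_kd']

lemma sum_Qc : ∑ a, Qc v D u a a = ∑ a, pd a (pd a fun z => v (D.f z)) u
    + ((k : ℝ) / 2 - 1) * ∑ c, dv ~c * dv ~c := by
  simp only [Qc, sum_add, sum_sub, kd_self, sum_const]; ring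

lemma sDW_conf (hs : Spec) (h : Hyp) (hu : u ∈ U) : D⋆.sDW u = E4 *
    (D.sDW u - ∑ b, D.formLWtn u b * dv ~b) := by
  have hE := exp_neg_four_mul (v (D.f u))
  have e p : D⋆.trA u (fun a a' => D⋆.Dt u p a * D⋆.Wtn u p a')
    = E2 * ∑ j, (D.Dt u p &j * D.Wtn u p &j - D.Wtn u p &j * ∑ b, D.Lo u p b &j * dv ~b) := by
    have hW a : D⋆.Wtn u p a = D.Wtn u p a := by
      rw [(h.wt_Wtn hu p a).eq (w' := 0) (by norm_num)]; simp
    simp only [hW]; rw [trA_conf, hs.trA_of_tg fun c => by rw [hs.Wtn_tg, mul_zero]]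
    congr 1; refine sum_ext fun j => ?_
    rw [hs.Dt_conf h.reg h.smooth hu h.ne_zero h.three_le]; ring
  rw [sDW, trT_conf, hs.trT]; simp only [e, ← mul_sum, sum_sub, hs.sDW_eq, hE]
  rw [sum_contract, mul_assoc]; congr 3; refine sum_ext fun b => ?_; rw [hs.formLWtn_eq]; congr 1
  refine sum_ext2 fun p j => ?_; rw [hs.Lo_symm h.reg hu, mul_comm]

lemma normD_conf (hs : Spec) (h : Hyp) (hu : u ∈ U) : D⋆.normD u = E4 *
    (D.normD u - 2 * ∑ β, D.formDL u β * dv ~β + ∑ α, ∑ β, D.Lo2 u α β * (dv ~α * dv ~β)) := by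
  have hE := exp_neg_four_mul (v (D.f u)); set y : Fin k → ℝ := fun β => dv ~β with hy
  have hDt0 : ∀ α γ, D⋆.Dt u α ~γ = 0 := by intro α γ; simp [Dt, dH, nor_conf, hs.nor_tg, Sch_zero1]
  have e α : D⋆.trA u (fun a a' => D⋆.Dt u α a * D⋆.Dt u α a')
    = E2 * ∑ j, (D.Dt u α &j * D.Dt u α &j - 2 * (D.Dt u α &j * ∑ β, D.Lo u α β &j * y β)
    + (∑ β, D.Lo u α β &j * y β) * ∑ β, D.Lo u α β &j * y β) := by
    rw [trA_conf, hs.trA_of_tg fun γ => by rw [hDt0, mul_zero]]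
    congr 1; refine sum_ext fun j => ?_
    rw [hs.Dt_conf h.reg h.smooth hu h.ne_zero h.three_le]; ring
  rw [normD, trT_conf, hs.trT]; simp only [e, ← mul_sum, sum_sub, sum_add, hs.normD_eq, hE]
  have hY : ∑ β, (∑ α, ∑ j, D.Dt u α &j * D.Lo u α β &j) * y β = ∑ β, D.formDL u β * y β := by
    refine sum_ext fun β => ?_; rw [hs.formDL_eq]; congr 1; refine sum_ext2 fun α j => ?_
    rw [hs.Lo_symm h.reg hu]
  have hZ : ∑ β, (∑ α, ∑ j, (∑ γ, D.Lo u α γ &j * y γ) * D.Lo u α β &j) * y β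
    = ∑ α, ∑ β, D.Lo2 u α β * (y α * y β) := by
    rw [sum_comm (γ := Fin k)]; refine sum_ext fun β => ?_
    have this α : D.Lo2 u α β * (y α * y β) = (D.Lo2 u α β * y α) * y β := by ring
    simp only [this, ← sum_mul]; congr 1
    have e4 α : D.Lo2 u α β = ∑ γ, ∑ j, D.Lo u γ β &j * D.Lo u γ α &j := by
      rw [hs.Lo2_eq]; simp only [mul_comm]
    simp only [e4]; rw [← sum_contract]; exact sum_ext2 fun α j => mul_comm _ _
  rw [sum_contract, hY, sum_contract, hZ]; ring

lemma sLC_conf (hs : Spec) (h : Hyp) (hu : u ∈ U) : D⋆.sLC u = E4 *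
    (D.sLC u - ∑ b, D.formLW u b * dv ~b) := by
  have hE := exp_neg_four_mul (v (D.f u))
  have hpq := exp_mul_exp_neg (v (D.f u)); set y : Fin k → ℝ := fun b => dv ~b with hy
  have e p b : D⋆.trA u (fun a a' => D⋆.Lo u p b a * D⋆.cC u (D.tan u p) (D⋆.nor u a') (D.tan u b))
    = ∑ j, (D.Lo u p b &j * D.cC u (amb ~p) (amb &j) (amb ~b)
    - D.Lo u p b &j * ∑ d, D.wc u ~p &j ~b ~d * y d) := by
    simp only [h.reg.Lo_conf h.smooth hu h.ne_zero]
    rw [trA_conf, hs.trA_of_tg fun c => by rw [hs.Lo_tg, mul_zero, zero_mul], mul_sum]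
    refine sum_ext fun j => ?_
    rw [nor_conf, hs.nor_nm, hs.tan_eq, hs.tan_eq, hs.cC_conf h.reg h.smooth hu h.ne_zero
      h.three_le]
    linear_combination (D.Lo u p b &j * (D.cC u (amb ~p) (amb &j) (amb ~b)
      - ∑ d, D.wc u ~p &j ~b ~d * y d)) * hpq
  rw [sLC]; simp only [trT_conf, hs.trT, tan_conf, e, ← mul_sum, sum_sub, hs.sLC_eq, hE]
  rw [mul_assoc]; congr 3; simp only [sum_contract]; rw [sum_comm]; refine sum_ext fun d => ?_
  rw [← sum_mul, hs.formLW_eq]; congr 1; rw [sum_comm]; refine sum_ext3 fun b p j => ?_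
  rw [hs.Lo_symm h.reg hu, h.reg.wc_pair hu, D.wc_swap, h.reg.wc_swap' hu, neg_neg]

lemma cBtr_eq (hs : Spec) : D.cBtr u = ∑ a, (bach D.g (D.f u) ![~a, ~a]
    + ((k + m : ℕ) - 4 : ℝ) * (2 * ∑ j, D.H u &j * D.cc u &j ~a ~a)
    + ((k + m : ℕ) - 4 : ℝ) * ∑ i, ∑ j, D.H u &i * D.H u &j * D.wc u ~a &i ~a &j) := by
  rw [cBtr, hs.trT]; refine sum_ext fun a => ?_
  rw [cB, hs.trA_of_tg fun c => by rw [hs.H_tg, zero_mul], hs.trA_of_tg fun c => by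
    simp [hs.H_tg, hs.trA]]
  congr 1
  · simp only [hs.tan_eq, hs.nor_nm, Bach_amb, Cot_amb, ← two_mul, mul_left_comm _ (2 : ℝ),
      ← mul_sum]
  · congr 1
    refine sum_ext fun i => ?_; rw [hs.trA_of_tg fun c => by simp [hs.H_tg]]
    simp only [hs.tan_eq, hs.nor_nm, W_amb]

lemma cBtr_conf (hs : Spec) (h : Hyp) (hu : u ∈ U) : D⋆.cBtr u = E4 * (D.cBtr u
    - 2 * ((k + m : ℕ) - 4 : ℝ) * ∑ s, D.cC1 u s * dv ~s
    + ((k + m : ℕ) - 4 : ℝ) * ∑ a, ∑ s, D.Wtt u a s * (dv ~a * dv ~s)) := by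
  have hE := exp_neg_four_mul (v (D.f u))
  have hpq := exp_mul_exp_neg (v (D.f u)); set q := E2 with hq
  set y : Fin (k + m) → ℝ := fun s => dv s with hy; set N : ℝ := ((k + m : ℕ) - 4 : ℝ) with hN
  have hB : ∀ a, D⋆.Bach u (amb ~a) (amb ~a) = q *
    (bach D.g (D.f u) ![~a, ~a] + N * ∑ c, y c * (2 * D.cc u c ~a ~a)
    + N * ∑ c, ∑ d, D.wc u ~a c ~a d * (y c * y d)) := by
    intro a; rw [Bach_amb]
    refine (hs.normal.bach_conf h.reg.metric h.smooth (h.reg.maps u hu) h.three_le _ _).trans ?_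
    simp only [← two_mul]; rfl
  have hC : ∀ (a) j, D⋆.Cot u (amb &j) (amb ~a) (amb ~a)
    = D.cc u &j ~a ~a + ∑ d, D.wc u ~a &j ~a d * y d := by
    intro a j; rw [hs.Cot_conf h.reg h.smooth hu h.three_le, sub_eq_add_neg, ← sum_neg]
    congr 1; refine sum_ext fun d => ?_; rw [D.wc_swap]; ring
  have hcB : ∀ a, D⋆.cB u a a = q * (bach D.g (D.f u) ![~a, ~a]
    + N * ∑ c, y c * (2 * D.cc u c ~a ~a) + N * ∑ c, ∑ d, D.wc u ~a c ~a d * (y c * y d)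
    + N * ∑ j, (D.H u &j - y &j) * (2 * (D.cc u &j ~a ~a + ∑ d, D.wc u ~a &j ~a d * y d))
    + N * ∑ i, ∑ j, (D.H u &i - y &i) * (D.H u &j - y &j) * D.wc u ~a &i ~a &j) := by
    intro a
    simp only [cB, tan_conf, nor_conf, h.reg.W_conf h.smooth hu h.three_le, hs.tan_eq, hB, trA_conf]
    rw [hs.trA_of_tg fun t => by rw [hs.H_conf_tg h.reg h.smooth hu h.ne_zero, zero_mul],
      hs.trA_of_tg fun t => by simp [hs.H_conf_tg h.reg h.smooth hu h.ne_zero, hs.trA]]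
    have e i : D.trA u (fun b b' => D⋆.H u &i * D⋆.H u b *
      (exp (2 * v (D.f u)) * D.W u (amb ~a) (D.nor u &i) (amb ~a) (D.nor u b')))
      = exp (2 * v (D.f u)) * ∑ j, (D.H u &i - y &i) * (D.H u &j - y &j) * D.wc u ~a &i ~a &j := by
      rw [hs.trA_of_tg fun t => by simp [hs.H_conf_tg h.reg h.smooth hu h.ne_zero], mul_sum]
      simp only [hs.nor_nm, W_amb, hs.H_conf_nm h.reg h.smooth hu h.ne_zero]
      exact sum_ext fun j => by ring
    have hH : ∀ j, D⋆.H u &j = D.H u &j - y &j := hs.H_conf_nm h.reg h.smooth hu h.ne_zero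
    simp only [e]; simp only [hs.nor_nm, hC, hH, ← two_mul, ← mul_sum]
    linear_combination (q * N * ∑ i, ∑ j, (D.H u &i - y &i) * (D.H u &j - y &j) *
      D.wc u ~a &i ~a &j) * hpq
  have hS : ∀ a, D⋆.cB u a a = q * (bach D.g (D.f u) ![~a, ~a]
    + N * (2 * ∑ j, D.H u &j * D.cc u &j ~a ~a)
    + N * ∑ i, ∑ j, D.H u &i * D.H u &j * D.wc u ~a &i ~a &j + 2 * N * ∑ s, (D.cc u ~s ~a ~a
    + ∑ j, D.H u &j * D.wc u ~s ~a &j ~a) * y ~s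
    + N * ∑ t, ∑ s, D.wc u ~a ~t ~a ~s * (y ~t * y ~s)) := by
    intro a; rw [hcB]; congr 1
    have hw c d : D.wc u ~a c ~a d = D.wc u ~a d ~a c := h.reg.wc_pair hu _ _ _ _
    have hw' : ∀ (s) j, D.wc u ~s ~a &j ~a = D.wc u ~a &j ~a ~s := fun s j => by
      rw [hw, D.wc_swap, h.reg.wc_swap' hu, neg_neg]
    have key := sum_sq_sub (fun s => D.cc u ~s ~a ~a)
      (fun j => D.cc u &j ~a ~a) (fun s => y ~s) (fun j => y &j)
      (fun j => D.H u &j) (fun t s => D.wc u ~a ~t ~a ~s) (fun j s => D.wc u ~a &j ~a ~s)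
      (fun i j => D.wc u ~a &i ~a &j) fun i j => hw _ _
    simp only [sum_tg_nm, hw', hw ~_ &_]; linear_combination N * key
  rw [cBtr, trT_conf, hs.trT, ← hq, hE]; simp only [hS, ← mul_sum]; rw [mul_assoc]; congr 2
  have h1 : ∑ a, ∑ s, (D.cc u ~s ~a ~a + ∑ j, D.H u &j * D.wc u ~s ~a &j ~a) * y ~s
    = -∑ s, D.cC1 u s * y ~s := by
    rw [sum_comm, ← sum_neg]; refine sum_ext fun s => ?_
    rw [← sum_mul, hs.cC1_eq, neg_mul_eq_neg_mul, ← sum_neg]; congr 1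
    refine sum_ext fun a => ?_; rw [hs.cC_eq, D.cc_swap, neg_sub, sub_eq_neg_add]; congr 1
    refine sum_ext fun j => ?_; rw [D.wc_swap u ~a, h.reg.wc_swap' hu ~s ~a &j]
  have h2 : ∑ a, ∑ t, ∑ s, D.wc u ~a ~t ~a ~s * (y ~t * y ~s)
    = ∑ a, ∑ s, D.Wtt u a s * (y ~a * y ~s) := by
    rw [sum_comm]; refine sum_ext fun t => ?_; rw [sum_comm]; refine sum_ext fun s => ?_
    rw [← sum_mul, hs.Wtt_eq]; congr 1; refine sum_ext fun a => ?_
    rw [D.wc_swap, h.reg.wc_swap' hu, neg_neg]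
  simp only [sum_add, ← mul_sum, hs.cBtr_eq, ← hN, h1, h2]; ring

end IsSpecialAt
end Special

lemma Reg.twoIJ_eq {k n : ℕ} {D : CoordData k n} {U : Set (Coo k)} {V : Set (Coo n)} {u}
    (hD : D.Reg U V) (hu : u ∈ U) (hk : 2 ≤ k) : D.twoIJ u = -laplacian D.h D.normLo u
    + 2 * D.normLo u * D.cPtr u + 2 * ((k : ℝ) - 6) * (D.sLo2P u - divergence D.h D.formDL u
    - ((k : ℝ) - 3) * D.normD u - D.sDW u - D.sLC u) := by
  have hk' : (k : ℝ) - 1 ≠ 0 := by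
    have : (2 : ℝ) ≤ k := by exact_mod_cast hk
    linarith
  have e1 : laplacian D.h D.G u = 1 / (2 * ((k : ℝ) - 1)) * laplacian D.h D.normLo u
    + -(1 / (2 * ((k : ℝ) - 1))) * laplacian D.h D.Wtr u := by
    rw [← laplacian_lin hD.reg_h hu hD.sm_normLo hD.sm_Wtr]; congr 1; funext z; rw [G]; ring
  have e2 : divergence D.h (fun z p => D.cC1 z p - D.formDL z p) u
    = 1 * divergence D.h D.cC1 u + -1 * divergence D.h D.formDL u := by
    rw [← divergence_lin hD.reg_h hu hD.sm_cC1 hD.sm_formDL]; congr 1; funext z a; ring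
  rw [twoIJ, cI, cJ, e1, e2, G]; field_simp; ring

section Special
variable {k m : ℕ} {D : CoordData k (k + m)} {U : Set (Coo k)} {V : Set (Coo (k + m))} {u : Coo k}
  {v : Coo (k + m) → ℝ}

local notation "Spec" => IsSpecialAt D u
local notation "D⋆" => conf D v
local notation "E2" => exp (-2 * v (D.f u))
local notation:max "dv" a:max => pd a v (D.f u)
local notation "E4" => exp (-4 * v (D.f u))
local notation "Hyp" => ConfHyp D v U V

namespace IsSpecialAt

lemma K1_conf (hs : Spec) (h : Hyp) (hu : u ∈ U) : D⋆.K1 u = E4 * D.K1 u := by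
  rw [K1, h_conf, hs.normal_h.divergence_conf h.reg.reg_h hu (h.reg.sm_comp h.smooth)
    h.reg.sm_formLW (fun z hz a => h.formLW_conf hz a), hs.sLC_conf h hu, K1]
  simp only [hs.pd_comp_f h.reg hu h.smooth, mul_comm (pd ~_ _ _)]; ring

lemma K2_conf (hs : Spec) (h : Hyp) (hu : u ∈ U) : D⋆.K2 u = E4 * D.K2 u := by
  rw [K2, h_conf, hs.normal_h.divergence_conf h.reg.reg_h hu (h.reg.sm_comp h.smooth)
    h.reg.sm_formLWtn (fun z hz a => h.formLWtn_conf hz a), hs.sDW_conf h hu, K2]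
  simp only [hs.pd_comp_f h.reg hu h.smooth, mul_comm (pd ~_ _ _)]; ring

lemma divergence_conf_contract (hs : Spec) (h : Hyp) (hu : u ∈ U)
    {θ θ' : Coo k → Fin k → ℝ} {A : Coo k → Fin k → Fin k → ℝ} (hθ : ∀ a, Sm U fun z => θ z a)
    (hA : ∀ a b, Sm U fun z => A z a b) (he : ∀ z ∈ U, ∀ p, θ' z p = exp (-2 * v (D.f z)) * (θ z p
    - D.trT z fun q q' => A z p q * pd q' (fun z => v (D.f z)) z)) :
    divergence D⋆.h θ' u = E4 * (divergence D.h θ u - (∑ q, (∑ p, pd p (fun z => A z p q) u) * dv ~q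
    + ∑ p, ∑ q, A u p q * pd p (pd q fun z => v (D.f z)) u) + ((k : ℝ) - 4) * (∑ q, θ u q * dv ~q
    - ∑ p, ∑ q, A u p q * (dv ~p * dv ~q))) := by
  have hσ := h.reg.sm_comp h.smooth
  have hT p : Sm U fun z => D.trT z fun q q' => A z p q * pd q' (fun z => v (D.f z)) z := h.reg.sm_trT fun q q' => (hA p q).mul (hσ.pd h.reg q')
  rw [h_conf, hs.normal_h.divergence_conf h.reg.reg_h hu hσ (fun a => (hθ a).sub (hT a)) he,
    hs.normal_h.divergence_eq, hs.normal_h.divergence_eq]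
  simp only [fun a => pd_sub (a := a) ((hθ a).diffAt h.reg hu) ((hT a).diffAt h.reg hu), sum_sub,
    hs.div_contract h.reg hu hA hσ, hs.trT, hs.pd_comp_f h.reg hu h.smooth, mul_sub, mul_sum,
    mul_left_comm (pd _ _ _) (A _ _ _), mul_comm (pd _ _ _) (θ _ _)]

lemma twoIJ_conf (hs : Spec) (h : Hyp) (hu : u ∈ U) : D⋆.twoIJ u = E4 * D.twoIJ u := by
  have hE := exp_neg_four_mul (v (D.f u)); have hσ := h.reg.sm_comp h.smooth
  rw [(h.reg.conf h.smooth).twoIJ_eq hu h.two_le, h.reg.twoIJ_eq hu h.two_le, h.normLo_conf hu,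
    hs.cPtr_conf h hu, hs.normD_conf h hu, hs.sDW_conf h hu, hs.sLC_conf h hu,
    hs.divergence_conf_contract h hu h.reg.sm_formDL h.reg.sm_Lo2 (fun z hz a => h.formDL_conf hz
    a), h_conf, hs.normal_h.laplacian_conf h.reg.reg_h hu hσ h.reg.sm_normLo (fun z hz =>
    h.normLo_conf hz)]
  have e1 : D⋆.sLo2P u = _ := hs.contract_cP_conf h hu (A := D.Lo2 u)
    (fun p b => ((h.wt_Lo2 hu p b).eq (w' := 0) (by norm_num)).trans (by simp))
  have e2 : ∑ p, D.Lo2 u p p = D.normLo u := by simp only [hs.Lo2_eq, hs.normLo_eq]; rw [sum_comm]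
  have e3 : ∑ b, (∑ p, pd p (fun z => D.Lo2 z p b) u) * dv ~b = 1 / 2 * ∑ b, pd b D.normLo u * dv ~b
    - ((k : ℝ) - 2) * ∑ b, D.formDL u b * dv ~b
    - ∑ b, D.formLWtn u b * dv ~b - ∑ b, D.formLW u b * dv ~b := by
    simp only [hs.div_Lo2 h.reg hu h.ne_zero, sub_mul, sum_sub, mul_assoc, ← mul_sum]
  rw [e1, sum_mul_Qc, e2, e3, sum_Qc]; simp only [hs.pd_comp_f h.reg hu h.smooth, hE]
  change _ = _ * (-laplacian D.h D.normLo u + 2 * D.normLo u * D.cPtr u + 2 * ((k : ℝ) - 6) *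
    (D.trT u (fun p p' => D.trT u fun b b' => D.Lo2 u p b * D.cP u p' b')
    - divergence D.h D.formDL u - ((k : ℝ) - 3) * D.normD u - D.sDW u - D.sLC u))
  ring

lemma clearedJ_conf (hs : Spec) (h : Hyp) (hu : u ∈ U) : D⋆.clearedJ u = E4 * D.clearedJ u := by
  have hE := exp_neg_four_mul (v (D.f u)); have hσ := h.reg.sm_comp h.smooth
  rw [clearedJ, clearedJ, h.Wtr_conf hu, hs.cPtr_conf h hu, hs.cBtr_conf h hu, hs.sDW_conf h hu,
    hs.sLC_conf h hu, hs.divergence_conf_contract h hu h.reg.sm_cC1 h.reg.sm_Wtt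
    (fun z hz a => h.cC1_conf hz a), h_conf, hs.normal_h.laplacian_conf h.reg.reg_h hu hσ
    h.reg.sm_Wtr (fun z hz => h.Wtr_conf hz)]
  have e1 : D⋆.sWP u = _ := hs.contract_cP_conf h hu (A := D.Wtt u)
    (fun p b => ((h.wt_Wtt hu p b).eq (w' := 0) (by norm_num)).trans (by simp))
  have e2 : ∑ p, D.Wtt u p p = D.Wtr u := (hs.trT _).symm
  have e3 : ∑ b, (∑ p, pd p (fun z => D.Wtt z p b) u) * dv ~b = 1 / 2 * ∑ b, pd b D.Wtr u * dv ~b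
    - ((k : ℝ) - 2) * ∑ b, D.cC1 u b * dv ~b
    - ∑ b, D.formLWtn u b * dv ~b - ∑ b, D.formLW u b * dv ~b := by
    simp only [hs.div_Wtt h.reg hu h.ne_zero, sub_mul, sum_sub, mul_assoc, ← mul_sum]
  rw [e1, sum_mul_Qc, e2, e3, sum_Qc]; simp only [hs.pd_comp_f h.reg hu h.smooth, hE]
  have e4 : D.trT u (fun p p' => D.trT u fun b b' => D.Wtt u p b * D.cP u p' b') = D.sWP u := rfl
  rw [e4]; ring

end IsSpecialAt

namespace ConfHyp

lemma N1_conf (h : Hyp) (hu : u ∈ U) : D⋆.N1 u = E4 * D.N1 u := by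
  obtain ⟨D', φ, ψ, U', V', hc, hu', rfl, hs⟩ := h.reg.exists_special hu
  have h' : ConfHyp D' (fun z => v (ψ z)) U' V' :=
    ⟨hc.reg', h.smooth.comp hc.pull.smooth hc.pull.maps, h.two_le, h.three_le⟩
  rw [← (hc.conf h.smooth).N1_eq hu', ← hc.N1_eq hu', N1, N1, hs.twoIJ_conf h' hu',
    hs.K1_conf h' hu', hs.K2_conf h' hu', h'.sLLWttnn_conf hu', h'.sWtnWtn_conf hu',
    h'.sWtttn_conf hu', h'.sLo2W_conf hu', h'.sLLWtttt_conf hu', h'.sLLWnn_conf hu',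
    h'.sLLWtntn_conf hu', hc.comm 0 hu']
  ring

lemma N2_conf (h : Hyp) (hu : u ∈ U) : D⋆.N2 u = E4 * D.N2 u := by
  obtain ⟨D', φ, ψ, U', V', hc, hu', rfl, hs⟩ := h.reg.exists_special hu
  have h' : ConfHyp D' (fun z => v (ψ z)) U' V' :=
    ⟨hc.reg', h.smooth.comp hc.pull.smooth hc.pull.maps, h.two_le, h.three_le⟩
  rw [← (hc.conf h.smooth).N2_eq hu', ← hc.N2_eq hu', N2, N2, hs.clearedJ_conf h' hu', hs.K1_conf h'
    hu', hs.K2_conf h' hu', h'.sLLWttnn_conf hu', h'.sWtnWtn_conf hu', h'.sWttnt_conf hu',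
    h'.sWttaa_conf hu', h'.sWtata_conf hu', h'.sWaa_conf hu', h'.sLo2W_conf hu', h'.sLLWtttt_conf
    hu', h'.sLLWnn_conf hu', h'.sLLWtntn_conf hu', hc.comm 0 hu']
  ring

end ConfHyp
end Special

section Sums
variable {ι κ μ : Type*} [Fintype ι] [Fintype κ] [Fintype μ]

lemma sum_rot (F : ι → κ → μ → ℝ) : ∑ a, ∑ b, ∑ c, F a b c = ∑ b, ∑ c, ∑ a, F a b c := by
  rw [sum_comm]; exact sum_ext fun _ => sum_comm

end Sums

lemma sum_eq_zero_of_antisymm {ι : Type*} [Fintype ι] {F : ι → ι → ℝ} (h : ∀ a b, F a b = -F b a) :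
    ∑ a, ∑ b, F a b = 0 := by
  have : ∑ a, ∑ b, F a b = -∑ a, ∑ b, F a b := by
    conv_lhs => rw [sum_comm]
    simp only [← sum_neg]; exact sum_ext2 fun _ _ => h _ _
  linarith

section Special
variable {k m : ℕ} (D : CoordData k (k + m)) (u : Coo k)

/-! Contractions of the second fundamental form with `∇W`, with the Cotton tensor and with `W`, in
coordinates adapted to the immersion. -/

/-- `L̊^{βγα'} ∇^α W_{αβα'γ}`. -/
def LdivW : ℝ := ∑ α, ∑ β, ∑ γ, ∑ j, D.Lo u β γ &j * D.dwc u ~α ~α ~β &j ~γ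

/-- `L̊^{αβα'} ∇_α W_{βγα'}{}^γ`. -/
def LdWtn : ℝ := ∑ α, ∑ β, ∑ j, D.Lo u α β &j * ∑ γ : Fin k, D.dwc u ~α ~β ~γ &j ~γ

/-- `L̊^{αβα'} C_{αα'β}`. -/
def LCot : ℝ := ∑ α, ∑ β, ∑ j, D.Lo u α β &j * D.cc u ~α &j ~β

/-- `L̊^{αβα'} H^{β'} W_{β'αα'β}`. -/
def LHW : ℝ := ∑ α, ∑ β, ∑ j, D.Lo u α β &j * ∑ i, D.H u &i * D.wc u &i ~α &j ~β

variable {D u} {U : Set (Coo k)} {V : Set (Coo (k + m))}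

local notation "Spec" => IsSpecialAt D u

namespace IsSpecialAt

lemma sLLWttnn_eq (hs : Spec) : D.sLLWttnn u = ∑ c, ∑ a, ∑ b, ∑ i, ∑ j,
    D.Lo u c a &i * D.Lo u c b &j * D.wc u ~a ~b &i &j := by
  simp only [sLLWttnn, hs.trT, hs.trA, sum_tg_nm, hs.Lo_tg, zero_mul, mul_zero,
    sum_const_zero, zero_add, hs.tan_eq, hs.nor_nm, W_amb]

lemma sLLWtntn_eq (hs : Spec) : D.sLLWtntn u = ∑ c, ∑ a, ∑ b, ∑ i, ∑ j,
    D.Lo u c a &i * D.Lo u c b &j * D.wc u ~a &i ~b &j := by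
  simp only [sLLWtntn, hs.trT, hs.trA, sum_tg_nm, hs.Lo_tg, zero_mul, mul_zero,
    sum_const_zero, zero_add, hs.tan_eq, hs.nor_nm, W_amb]

lemma sLLWtttt_eq (hs : Spec) : D.sLLWtttt u = ∑ a, ∑ b, ∑ c, ∑ d, ∑ j,
    D.Lo u a c &j * D.Lo u b d &j * D.wc u ~a ~b ~c ~d := by
  simp only [sLLWtttt, hs.trT, hs.trA, sum_tg_nm, hs.Lo_tg, zero_mul,
    sum_const_zero, zero_add, hs.tan_eq, W_amb]

lemma sLLWnn_eq (hs : Spec) : D.sLLWnn u = ∑ a, ∑ b, ∑ i, ∑ j,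
    D.Lo u a b &i * D.Lo u a b &j * ∑ c, D.wc u &i ~c &j ~c := by
  simp only [sLLWnn, Wnn, hs.trT, hs.trA, sum_tg_nm, hs.Lo_tg, zero_mul, mul_zero,
    sum_const_zero, zero_add, hs.tan_eq, hs.nor_nm, W_amb]

lemma sHLW_eq (hs : Spec) : D.sHLW u = ∑ j, ∑ a, ∑ b, D.H u &j * D.Lo u a b &j * D.Wtt u a b := by
  simp only [sHLW, hs.trT, hs.trA, sum_tg_nm, hs.H_tg, zero_mul, sum_const_zero, zero_add]

lemma sLo2W_eq (hs : Spec) : D.sLo2W u = ∑ a, ∑ b,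
    (∑ c, ∑ j, D.Lo u c a &j * D.Lo u c b &j) * D.Wtt u a b := by
  simp only [sLo2W, hs.trT, hs.Lo2_eq]

lemma sWtnWtn_eq (hs : Spec) : D.sWtnWtn u = ∑ a, ∑ j, D.Wtn u a &j * D.Wtn u a &j := by
  simp only [sWtnWtn, hs.trT, hs.trA, sum_tg_nm, hs.Wtn_tg, zero_mul, sum_const_zero, zero_add]

lemma sWttnt_eq (hs : Spec) : D.sWttnt u = ∑ a, ∑ b, ∑ c, ∑ j,
    D.wc u ~a ~b &j ~c * D.wc u ~a ~b &j ~c := by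
  simp only [sWttnt, hs.trT, hs.trA, sum_tg_nm, hs.nor_tg, W_zero2, zero_mul,
    sum_const_zero, zero_add, hs.tan_eq, hs.nor_nm, W_amb]
  exact sum_ext2 fun _ _ => sum_comm

lemma sWtttn_eq_sWttnt (hs : Spec) (hD : D.Reg U V) (hu : u ∈ U) : D.sWtttn u = D.sWttnt u := by
  simp only [hs.sWttnt_eq, sWtttn, hs.trT, hs.trA, sum_tg_nm, hs.nor_tg, W_zero3, zero_mul,
    sum_const_zero, zero_add, hs.tan_eq, hs.nor_nm, W_amb,
    fun a b c j => hD.wc_swap' hu ~a ~b ~c &j, neg_mul_neg]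

lemma sLC_eq_sub (hs : Spec) (hD : D.Reg U V) (hu : u ∈ U) : D.sLC u = D.LCot u - D.LHW u := by
  simp only [hs.sLC_eq, hs.cC_eq, mul_sub, sum_sub, LCot, LHW]; rw [sub_right_inj, sum_comm]
  simp only [fun b a j => hs.Lo_symm hD hu b a j, fun b j a i => hD.wc_pair hu ~b &j ~a
    &i, fun a i b j => D.wc_swap u ~a &i ~b &j, fun a i b j => hD.wc_swap' hu &i ~a ~b &j, neg_neg]

lemma pd_formLW (hs : Spec) (hD : D.Reg U V) (hu : u ∈ U) (e p) :
    pd e (fun z => D.formLW z p) u = ∑ b, ∑ c, ∑ j,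
      (pd e (fun z => D.Lo z b c &j) u * D.wc u ~p ~b &j ~c + D.Lo u b c &j *
          pd e (fun z => D.W z (D.tan z p) (D.tan z b) (D.nor z &j) (D.tan z c)) u) := by
  have hW b c a : Sm U fun z => D.W z (D.tan z p) (D.tan z b) (D.nor z a) (D.tan z c) := hD.sm_W (hD.sm_tan p) (hD.sm_tan b) (hD.sm_nor a) (hD.sm_tan c)
  simp only [formLW]
  rw [hs.pd_trT hD hu fun b b' => hD.sm_trT fun c c' => hD.sm_trA fun a a' =>
    (hD.sm_Lo b c a).mul (hW b' c' a')]
  refine sum_ext fun b => ?_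
  rw [hs.pd_trT hD hu fun c c' => hD.sm_trA fun a a' => (hD.sm_Lo b c a).mul (hW b c' a')]
  refine sum_ext fun c => ?_
  rw [hs.pd_trA_mul hD hu (hD.sm_Lo b c) (hW b c) (hs.Lo_tg b c) fun d => by
    rw [hs.nor_tg, W_zero2]]
  simp only [hs.tan_eq, hs.nor_nm, W_amb]

lemma pd_Wtn (hs : Spec) (hD : D.Reg U V) (hu : u ∈ U) (e a) (j) : pd e (fun z => D.Wtn z a &j) u
    = ∑ c, pd e (fun z => D.W z (D.tan z a) (D.tan z c) (D.nor z &j) (D.tan z c)) u :=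
    hs.pd_trT hD hu (fun c c' => hD.sm_W (hD.sm_tan a) (hD.sm_tan c) (hD.sm_nor _) (hD.sm_tan c')) e

lemma pd_formLWtn (hs : Spec) (hD : D.Reg U V) (hu : u ∈ U) (e p) :
    pd e (fun z => D.formLWtn z p) u = ∑ b, ∑ j, (pd e (fun z => D.Lo z p b &j) u * D.Wtn u b &j
    + D.Lo u p b &j * pd e (fun z => D.Wtn z b &j) u) := by
  simp only [formLWtn]
  rw [hs.pd_trT hD hu fun b b' => hD.sm_trA fun a a' => (hD.sm_Lo p b a).mul (hD.sm_Wtn b' a')]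
  exact sum_ext fun b => hs.pd_trA_mul hD hu (hD.sm_Lo p b) (hD.sm_Wtn b)
    (hs.Lo_tg p b) (hs.Wtn_tg b) e

lemma div_formLW (hs : Spec) (hD : D.Reg U V) (hu : u ∈ U) (hk : k ≠ 0) :
    divergence D.h D.formLW u = 1 / 2 * D.sWttnt u + D.sDW u + D.LdivW u + ((k : ℝ) - 1) * D.LHW u
    - D.sLLWtntn u - D.sLLWtttt u - D.sLLWttnn u - D.sHLW u := by
  have e0 : ∑ a, ∑ b, ∑ c, ∑ j, pd a (fun z => D.Lo z b c &j) u
    * D.wc u ~a ~b &j ~c = 1 / 2 * D.sWttnt u + D.sDW u := by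
    have h1 a b c j : pd a (fun z => D.Lo z b c &j) u * D.wc u ~a ~b &j ~c
      = -(pd b (fun z => D.Lo z a c &j) u * D.wc u ~b ~a &j ~c)
      + D.wc u ~a ~b &j ~c * D.wc u ~a ~b &j ~c + kd b c * (D.Dt u a &j * D.wc u ~a ~b &j ~c)
      + kd a c * (D.Dt u b &j * D.wc u ~b ~a &j ~c) := by
      rw [hs.codazzi hD hu a b c j, D.wc_swap u ~b ~a, hD.wc_swap' hu _ _ _ &j, D.wc_swap u ~b ~a]
      ring
    have h2 : ∑ a, ∑ b, ∑ c, ∑ j, kd b c * (D.Dt u a &j * D.wc u ~a ~b &j ~c) = D.sDW u := by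
      simp only [← mul_sum, sum_kd_mul', hs.sDW_eq, hs.Wtn_nm]; refine sum_ext fun a => ?_
      rw [sum_comm]; simp only [mul_sum]
    have h3 := h2; rw [sum_comm] at h3
    have h4 := sum_comm (s := univ) (t := univ) (f := fun a b => ∑ c, ∑ j,
      pd a (fun z => D.Lo z b c &j) u * D.wc u ~a ~b &j ~c)
    have h5 : ∑ a, ∑ b, ∑ c, ∑ j, pd a (fun z => D.Lo z b c &j) u
      * D.wc u ~a ~b &j ~c = _ := sum_ext fun a => sum_ext3 fun b c j => h1 a b c j
    simp only [sum_add, sum_neg, h2, h3, ← hs.sWttnt_eq] at h5; rw [← h4] at h5; linarith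
  have eA : ∑ a, ∑ b, ∑ c, ∑ j, D.Lo u b c &j *
    ∑ i, D.L u a a &i * D.wc u &i ~b &j ~c = k * D.LHW u := by
    have : (k : ℝ) * D.LHW u = ∑ b, ∑ c, ∑ j, D.Lo u b c &j *
      ∑ i, (∑ a, D.L u a a &i) * D.wc u &i ~b &j ~c := by
      simp only [LHW, hs.sum_L hk, mul_assoc, ← mul_sum, mul_left_comm _ (k : ℝ)]
    rw [this, sum_comm]; refine sum_ext fun b => ?_; rw [sum_comm]; refine sum_ext fun c => ?_
    rw [sum_comm]; refine sum_ext fun j => ?_; rw [← mul_sum, sum_comm]; simp only [sum_mul]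
  have eB : ∑ a, ∑ b, ∑ c, ∑ j, D.Lo u b c &j *
    ∑ i, D.L u a b &i * D.wc u ~a &i &j ~c = -D.sLLWtntn u - D.LHW u := by
    have this a b c j i : D.L u a b &i * D.wc u ~a &i &j ~c = -(D.Lo u b a &i * D.wc u ~a &i ~c &j)
      - kd a b * (D.H u &i * D.wc u &i ~a &j ~c) := by
      rw [hs.L_eq_Lo_add, hs.Lo_symm hD hu, hD.wc_swap' hu, D.wc_swap u &i,
        hD.wc_swap' hu _ _ &j]; ring
    rw [sum_comm]; simp only [this, sum_sub, sum_neg, mul_sub, mul_neg]; refine congrArg₂ _ ?_ ?_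
    · rw [hs.sLLWtntn_eq, neg_inj]
      refine sum_ext3 fun b a c => ?_; rw [sum_comm]; simp only [mul_sum]
      exact sum_ext2 fun i j => by ring
    · simp only [← mul_sum, mul_left_comm _ (kd _ _), sum_kd_mul, LHW]
  have eC : ∑ a, ∑ b, ∑ c, ∑ j, D.Lo u b c &j * ∑ d, -D.L u a d &j * D.wc u ~a ~b ~d ~c
    = -D.sLLWtttt u - D.sHLW u := by
    have this a b c j d : -D.L u a d &j * D.wc u ~a ~b ~d ~c = -(D.Lo u a d &j * D.wc u ~a ~b ~d ~c)
      - kd a d * (D.H u &j * D.wc u ~b ~a ~c ~d) := by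
      rw [hs.L_eq_Lo_add, D.wc_swap u ~b, hD.wc_swap' hu _ _ ~c]; ring
    simp only [this, sum_sub, sum_neg, mul_sub, mul_neg, sum_kd_mul']; refine congrArg₂ _ ?_ ?_
    · rw [hs.sLLWtttt_eq, neg_inj]
      refine sum_ext2 fun a b => ?_; simp only [mul_sum]
      exact (sum_ext3 fun d c j => by ring).trans (sum_rot _).symm
    · rw [hs.sHLW_eq]
      refine (sum_rot _).trans ((sum_ext2 fun b c => ?_).trans (sum_rot _).symm); rw [sum_comm]
      refine sum_ext fun j => ?_; rw [hs.Wtt_eq, mul_sum]; exact sum_ext fun a => by ring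
  have eE : ∑ a, ∑ b, ∑ c, ∑ j, D.Lo u b c &j *
    ∑ i, D.L u a c &i * D.wc u ~a ~b &j &i = -D.sLLWttnn u := by
    have this a b c j i : D.Lo u b c &j * (D.L u a c &i * D.wc u ~a ~b &j &i)
      = -(D.Lo u c a &i * D.Lo u c b &j * D.wc u ~a ~b &i &j)
      - kd a c * (D.H u &i * (D.Lo u a b &j * D.wc u ~a ~b &i &j)) := by
      by_cases hαγ : a = c
      · subst hαγ
        rw [hs.L_eq_Lo_add, hs.Lo_symm hD hu b, hD.wc_swap' hu _ _ &i]; ring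
      · rw [hs.L_eq_Lo_add, hs.Lo_symm hD hu b, hs.Lo_symm hD hu a, hD.wc_swap' hu _ _ &i]
        simp only [kd, hαγ, if_false]; ring
    simp only [mul_sum, this, sum_sub, sum_neg]
    have h0 : ∑ a, ∑ b, ∑ c, ∑ j, ∑ i,
        kd a c * (D.H u &i * (D.Lo u a b &j * D.wc u ~a ~b &i &j)) = 0 := by
      simp only [← mul_sum, sum_kd_mul']; refine sum_eq_zero_of_antisymm fun a b => ?_
      simp only [hs.Lo_symm hD hu b a, D.wc_swap u ~b ~a, mul_neg, sum_neg, neg_neg]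
    rw [h0, sub_zero, neg_inj, hs.sLLWttnn_eq]
    exact (sum_ext3 fun _ _ _ => sum_comm).trans (sum_rot _).symm
  rw [hs.normal_h.divergence_eq]
  simp only [hs.pd_formLW hD hu, hs.pd_W_nor hD hu, mul_add, sum_add, e0, eA, eB, eC, eE]
  rw [LdivW]; ring

lemma div_formLWtn (hs : Spec) (hD : D.Reg U V) (hu : u ∈ U) (hk : k ≠ 0) :
    divergence D.h D.formLWtn u = -((k : ℝ) - 1) * D.sDW u - D.sWtnWtn u + D.LdWtn u + D.sLLWnn u
    - D.sLLWtntn u + 2 * D.sLLWttnn u - D.LHW u - D.sLo2W u - D.sHLW u := by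
  have e0 : ∑ a, ∑ b, ∑ j, pd a (fun z => D.Lo z a b &j) u * D.Wtn u b &j
    = -((k : ℝ) - 1) * D.sDW u - D.sWtnWtn u := by
    rw [sum_comm, hs.sDW_eq, hs.sWtnWtn_eq, mul_sum, ← sum_sub]; refine sum_ext fun b => ?_
    rw [sum_comm, mul_sum, ← sum_sub]; refine sum_ext fun j => ?_
    simp only [fun a => hs.pd_Lo_symm hD hu a a b j, ← sum_mul, hs.div_Lo hD hu hk]; ring
  have eA : ∑ a, ∑ b, ∑ j, D.Lo u a b &j * ∑ c,
    ∑ i, D.L u a b &i * D.wc u &i ~c &j ~c = D.sLLWnn u := by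
    have this a b j : D.Lo u a b &j * ∑ c, ∑ i, D.L u a b &i *
      D.wc u &i ~c &j ~c = ∑ i, D.Lo u a b &i * D.Lo u a b &j * ∑ c, D.wc u &i ~c &j ~c
      + kd a b * (D.Lo u a b &j * ∑ i, D.H u &i * ∑ c, D.wc u &i ~c &j ~c) := by
      rw [sum_comm]; simp only [← mul_sum, hs.L_eq_Lo_add, add_mul, sum_add, mul_add]
      simp only [mul_sum]; refine congrArg₂ _ ?_ ?_ <;> exact sum_ext2 fun i c => by ring
    have h0 : ∑ a, ∑ b, ∑ j, kd a b * (D.Lo u a b &j * ∑ i, D.H u &i * ∑ c,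
      D.wc u &i ~c &j ~c) = 0 := by
      simp only [← mul_sum, sum_kd_mul']; rw [sum_comm]
      simp only [← sum_mul, hs.sum_Lo hk, zero_mul, sum_const_zero]
    simp only [this, sum_add, h0, add_zero, hs.sLLWnn_eq]; exact sum_ext2 fun a b => sum_comm
  have eB : ∑ a, ∑ b, ∑ j, D.Lo u a b &j * ∑ c, ∑ i, D.L u a c &i * D.wc u ~b &i &j ~c
    = D.sLLWttnn u - D.sLLWtntn u - D.LHW u := by
    have this a b j c i : D.L u a c &i * D.wc u ~b &i &j ~c = D.Lo u a c &i * D.wc u ~c ~b &i &j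
      - D.Lo u a c &i * D.wc u ~c &i ~b &j - kd a c * (D.H u &i * D.wc u &i ~b &j ~c) := by
      have h := hD.wc_cyclic hu ~b &i ~c &j; rw [D.wc_swap u &i ~c] at h
      rw [hs.L_eq_Lo_add, D.wc_swap u &i, hD.wc_swap' hu _ _ &j]
      linear_combination -D.Lo u a c &i * h
    have hX : ∑ a, ∑ b, ∑ j, D.Lo u a b &j * ∑ i, D.H u &i * D.wc u &i ~b &j ~a = D.LHW u := by
      rw [sum_comm]; simp only [LHW, fun b a j => hs.Lo_symm hD hu b a j]
    simp only [this, sum_sub, mul_sub, ← mul_sum, sum_kd_mul', hX]; rw [sub_left_inj]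
    simp only [hs.sLLWttnn_eq, hs.sLLWtntn_eq, mul_sum]; refine congrArg₂ _ ?_ ?_ <;>
    · refine sum_ext fun a => ?_
      refine (sum_rot _).trans ((sum_rot _).trans (sum_ext2 fun c b => ?_)); rw [sum_comm]
      exact sum_ext2 fun i j => by ring
  have eC : ∑ a, ∑ b, ∑ j, D.Lo u a b &j * ∑ c, ∑ d, -D.L u a d &j * D.wc u ~b ~c ~d ~c
    = -D.sLo2W u - D.sHLW u := by
    have this a b j : D.Lo u a b &j * ∑ c, ∑ d, -D.L u a d &j * D.wc u ~b ~c ~d ~c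
      = -∑ d, D.Lo u a b &j * D.Lo u a d &j * D.Wtt u b d
      - D.H u &j * D.Lo u b a &j * D.Wtt u b a := by
      rw [sum_comm]
      simp only [← mul_sum, ← hs.Wtt_eq, hs.L_eq_Lo_add, add_mul, neg_add,
        sum_add, neg_mul, sum_neg, mul_assoc, sum_kd_mul', hs.Lo_symm hD hu b a]
      ring
    simp only [this, sum_sub, sum_neg, hs.sLo2W_eq, hs.sHLW_eq, sum_mul]; refine congrArg₂ _ ?_ ?_
    · rw [neg_inj]
      exact (sum_ext2 fun a b => sum_comm).trans (sum_rot _)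
    · rw [sum_comm]; exact (sum_rot _).symm
  have eE : ∑ a, ∑ b, ∑ j, D.Lo u a b &j * ∑ c,
    ∑ i, D.L u a c &i * D.wc u ~b ~c &j &i = D.sLLWttnn u := by
    have h0 : ∑ a, ∑ b, ∑ j, D.Lo u a b &j * ∑ i, D.H u &i * D.wc u ~b ~a &j &i = 0 :=
      sum_eq_zero_of_antisymm fun a b => by
        simp only [hs.Lo_symm hD hu b a, D.wc_swap u ~b ~a, mul_neg, sum_neg, neg_neg]
    simp only [hs.L_eq_Lo_add, add_mul, sum_add, mul_add, mul_assoc,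
      ← mul_sum, sum_kd_mul', h0, add_zero, hs.sLLWttnn_eq]
    simp only [mul_sum]; exact sum_ext2 fun a b => sum_comm
  rw [hs.normal_h.divergence_eq]
  simp only [hs.pd_formLWtn hD hu, hs.pd_Wtn hD hu, hs.pd_W_nor hD hu, mul_add,
    sum_add, e0, eA, eB, eC, eE, LdWtn]
  ring

lemma LdivW_add_LdWtn (hs : Spec) (hD : D.Reg U V) (hu : u ∈ U) (hk : k ≠ 0) :
    D.LdivW u + D.LdWtn u + ((k : ℝ) - 2) * D.LCot u = D.sLdW u := by
  have hB a b c j : D.Lo u b c &j * D.dwc u &j ~b ~a ~c ~a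
    = D.Lo u c b &j * D.dwc u ~a ~a ~c &j ~b + D.Lo u b c &j * D.dwc u ~b ~c ~a &j ~a
    - kd a c * (D.Lo u b c &j * D.cc u ~b &j ~a) + D.Lo u b c &j * D.cc u ~b &j ~c
    + kd b c * (D.Lo u b c &j * D.cc u ~a &j ~a) - kd b a * (D.Lo u b c &j * D.cc u ~a &j ~c) := by
    have h := hs.dwc_bianchi hD hu &j ~b ~a ~c ~a
    rw [hs.dwc_pair hD hu ~b ~a, hs.dwc_swap' hD hu ~b _ _ ~a, hs.dwc_pair hD hu
      ~a &j, hs.dwc_swap ~a ~c, D.cc_swap u &j, D.cc_swap u &j] at h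
    simp only [kd_tg, kd_nm_tg, kd_self] at h; rw [hs.Lo_symm hD hu c b]
    linear_combination D.Lo u b c &j * h
  have hL : D.sLdW u = ∑ b, ∑ c, ∑ j, ∑ a, D.Lo u b c &j * D.dwc u &j ~b ~a ~c ~a := by
    simp only [sLdW, hs.trT, hs.trA, sum_tg_nm, hs.Lo_tg, zero_mul, sum_const_zero, zero_add,
      hs.tan_eq, hs.nor_nm, dW_amb, mul_sum]
  have h1 : ∑ b, ∑ c, ∑ j, ∑ a, D.Lo u c b &j * D.dwc u ~a ~a ~c &j ~b = D.LdivW u := by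
    rw [sum_comm, LdivW]; exact (sum_ext2 fun _ _ => sum_comm).trans (sum_rot _).symm
  have h2 : ∑ b, ∑ c, ∑ j, ∑ a, kd b c * (D.Lo u b c &j * D.cc u ~a &j ~a) = 0 := by
    simp only [← mul_sum, sum_kd_mul']; rw [sum_comm]
    simp only [← sum_mul, hs.sum_Lo hk, zero_mul, sum_const_zero]
  rw [hL]; simp only [hB, sum_add, sum_sub, h1, h2]
  simp only [sum_kd_mul, sum_kd_mul', ← mul_sum, LdWtn, LCot, sum_const, mul_left_comm _ (k : ℝ)]
  ring

lemma cPtr_eq (hs : Spec) (hk : k ≠ 0) : D.cPtr u = ∑ a, D.pc u ~a ~a + k / 2 * D.normH u := by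
  rw [cPtr, hs.trT]; simp only [hs.cP_eq, kd_self, sum_add, sum_const, hs.normH_eq]
  rw [sum_comm]; simp only [← mul_sum, hs.sum_Lo hk, mul_zero, sum_const_zero]; ring

lemma sum_mul_cP (hs : Spec) (A : Fin k → Fin k → ℝ) : ∑ a, ∑ b, A a b * D.cP u a b
    = ∑ a, ∑ b, A a b * D.pc u ~a ~b
    + ∑ j, ∑ a, ∑ b, D.H u &j * D.Lo u a b &j * A a b + 1 / 2 * D.normH u * ∑ a, A a a := by
  have this a b : A a b * D.cP u a b = A a b * D.pc u ~a ~b + ∑ j, D.H u &j * D.Lo u a b &j * A a b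
    + kd a b * (1 / 2 * D.normH u * A a b) := by rw [hs.cP_eq, ← hs.normH_eq, ← sum_mul]; ring
  simp only [this, sum_add, sum_kd_mul', ← mul_sum]
  rw [sum_rot fun j a b => D.H u &j * D.Lo u a b &j * A a b]

lemma ricci_eq (hs : Spec) (hn : 3 ≤ k + m) (a b) :
    ricci D.g (D.f u) ![a, b] = ((k + m : ℕ) - 2 : ℝ) * D.pc u a b
    + 1 / (2 * ((k + m : ℕ) - 1 : ℝ)) * scalarCurv D.g (D.f u) * kd a b := by
  rw [MReg.ricci_eq_schouten hn, hs.normal.kd_apply]; rfl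

lemma sum_mul_Ric (hs : Spec) (hn : 3 ≤ k + m) (A : Fin k → Fin k → ℝ) :
    ∑ a, ∑ b, A a b * D.Ric u (D.tan u a) (D.tan u b)
    = ((k + m : ℕ) - 2 : ℝ) * ∑ a, ∑ b, A a b * D.pc u ~a ~b
    + 1 / (2 * ((k + m : ℕ) - 1 : ℝ)) * scalarCurv D.g (D.f u) * ∑ a, A a a := by
  simp only [hs.tan_eq, Ric_amb, hs.ricci_eq hn, kd_tg, mul_add, sum_add,
    mul_sum, mul_left_comm (A _ _)]
  simp only [← mul_sum, mul_comm (A _ _) (kd _ _), sum_kd_mul']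

lemma sRicN_eq (hs : Spec) (hn : 3 ≤ k + m) :
    D.sRicN u = scalarCurv D.g (D.f u) - ((k + m : ℕ) - 2 : ℝ) * ∑ p, D.pc u ~p ~p
    - k * (1 / (2 * ((k + m : ℕ) - 1 : ℝ)) * scalarCurv D.g (D.f u)) := by
  have h1 : scalarCurv D.g (D.f u) = ∑ a, ricci D.g (D.f u) ![a, a] :=
    hs.normal.mtr fun a b => ricci D.g (D.f u) ![a, b]
  have h2 : ∑ p, ricci D.g (D.f u) ![~p, ~p] = ((k + m : ℕ) - 2 : ℝ) * ∑ p, D.pc u ~p ~p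
    + k * (1 / (2 * ((k + m : ℕ) - 1 : ℝ)) * scalarCurv D.g (D.f u)) := by
    simp only [hs.ricci_eq hn, kd_self, sum_add, sum_const, mul_one, mul_sum]
  rw [sum_tg_nm, h2] at h1; rw [sRicN, hs.trA_of_tg fun c => by rw [hs.nor_tg, Ric_zero1]]
  simp only [hs.nor_nm, Ric_amb]; linarith

lemma sum_Lo2 (hs : Spec) : ∑ a, D.Lo2 u a a = D.normLo u := by
  simp only [hs.Lo2_eq, hs.normLo_eq]; exact sum_comm

lemma sHLo3_eq (hs : Spec) (hD : D.Reg U V) (hu : u ∈ U) : D.sHLo3 u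
    = ∑ j, ∑ a, ∑ b, D.H u &j * D.Lo u a b &j * D.Lo2 u a b := by
  simp only [sHLo3, trLo3, hs.trT, hs.trA, sum_tg_nm, hs.Lo_tg, hs.H_tg, zero_mul,
    sum_const_zero, zero_add, hs.Lo2_eq, mul_sum]
  refine sum_ext fun j => ?_; rw [sum_rot, sum_rot]
  refine sum_ext3 fun c a b => sum_ext fun i => ?_; rw [hs.Lo_symm hD hu a b i]; ring

lemma N1_eq (hs : Spec) (hD : D.Reg U V) (hu : u ∈ U) (hk : k = 4) (hm : 1 ≤ m) :
    D.N1 u = -(1 / 2) * laplacian D.h D.normLo u + 2 * divergence D.h D.formDL u + D.J1CHO u := by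
  have hk0 : k ≠ 0 := by omega
  have hn : 3 ≤ k + m := by omega
  have hk' : (k : ℝ) = 4 := by exact_mod_cast hk
  have hm' : (1 : ℝ) ≤ m := by exact_mod_cast hm
  have hB := hs.LdivW_add_LdWtn hD hu hk0
  have h1 : D.sLo2P u = _ := (by simp only [sLo2P, hs.trT] :
    D.sLo2P u = ∑ a, ∑ b, D.Lo2 u a b * D.cP u a b).trans (hs.sum_mul_cP _)
  have h2 : D.sLo2Ric u = _ := (by simp only [sLo2Ric, hs.trT] : D.sLo2Ric u
    = ∑ a, ∑ b, D.Lo2 u a b * D.Ric u (D.tan u a) (D.tan u b)).trans (hs.sum_mul_Ric hn _)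
  rw [hs.sum_Lo2] at h1 h2; rw [← hs.sHLo3_eq hD hu] at h1
  rw [N1, hD.twoIJ_eq hu (by omega), K1, K2, hs.div_formLW hD hu hk0, hs.div_formLWtn hD hu hk0,
    hs.sLC_eq_sub hD hu, hs.sWtttn_eq_sWttnt hD hu, J1CHO, ← hB, h1, h2, hs.sRicN_eq hn,
    hs.cPtr_eq hk0]
  have e1 : ((k + m : ℕ) : ℝ) - 1 ≠ 0 := by push_cast; rw [hk']; linarith
  have e2 : ((k + m : ℕ) : ℝ) - 2 ≠ 0 := by push_cast; rw [hk']; linarith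
  rw [hk']; field_simp; ring

end IsSpecialAt
end Special
end CoordData

section Symmetries
variable {n : ℕ} {g : MetricField n} {V : Set (Coo n)} {x : Coo n}

lemma MReg.cov_perm (hg : MReg g V) (hx : x ∈ V) {r : ℕ} {T : TensorField n r}
    (hT : ∀ I, Sm V fun z => T z I) (σ : Equiv.Perm (Fin r)) {c : ℝ}
    (h : ∀ z ∈ V, ∀ I, T z (I ∘ σ) = c * T z I) (a) (K : Fin r → Fin n) :
    cov g T x (Matrix.vecCons a (K ∘ σ)) = c * cov g T x (Matrix.vecCons a K) := by
  rw [cov_vecCons, cov_vecCons, pd_congr hg hx fun z hz => h z hz K,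
    pd_const_mul _ ((hT K).diffAt hg hx), mul_sub, mul_sum]
  congr 1; refine Fintype.sum_equiv σ _ _ fun j => ?_; rw [mul_sum]; refine sum_ext fun b => ?_
  rw [show update (K ∘ σ) j b = update K (σ j) b ∘ σ by
    rw [Function.update_comp_equiv, Equiv.symm_apply_apply], h x hx, Function.comp_apply]
  ring

lemma MReg.cov_weyl_swap (hg : MReg g V) (hx : x ∈ V) (e a b c d) :
    cov g (weyl g) x ![e, a, b, c, d] = -cov g (weyl g) x ![e, b, a, c, d] := by
  have h := hg.cov_perm hx hg.smooth_weyl (Equiv.swap 0 1) (c := -1) (fun z hz I => by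
    rw [show I ∘ Equiv.swap (0 : Fin 4) 1 = ![I 1, I 0, I 2, I 3] by funext i; fin_cases i <;> rfl,
      MReg.weyl_swap, neg_one_mul]
    congr 2; funext i; fin_cases i <;> rfl) e ![b, a, c, d]
  rw [neg_one_mul] at h; rw [← h]; congr 1; funext i; fin_cases i <;> rfl

lemma MReg.cov_weyl_pair (hg : MReg g V) (hx : x ∈ V) (e a b c d) :
    cov g (weyl g) x ![e, a, b, c, d] = cov g (weyl g) x ![e, c, d, a, b] := by
  have h := hg.cov_perm hx hg.smooth_weyl (Equiv.swap 0 2 * Equiv.swap 1 3) (c := 1)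
    (fun z hz I => by
      rw [show I ∘ (Equiv.swap (0 : Fin 4) 2 * Equiv.swap 1 3 : Equiv.Perm _)
        = ![I 2, I 3, I 0, I 1] by funext i; fin_cases i <;> rfl, hg.weyl_pair hz, one_mul]
      congr 1; funext i; fin_cases i <;> rfl) e ![c, d, a, b]
  rw [one_mul] at h; rw [← h]; congr 1; funext i; fin_cases i <;> rfl

end Symmetries

namespace CoordData
section Special
variable {k m : ℕ} (D : CoordData k (k + m)) (u : Coo k)

/-- Components of `∇∇W` along the map. -/
def ddwc (e f a b c d : Fin (k + m)) : ℝ := cov D.g (cov D.g (weyl D.g)) (D.f u) ![e, f, a, b, c, d]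

/-- Components of `∇C` along the map. -/
def dcc (e a b c : Fin (k + m)) : ℝ := cov D.g (cotton D.g) (D.f u) ![e, a, b, c]

/-- The tangential trace `W_{cγd}{}^γ`. -/
def wtr (c d : Fin (k + m)) : ℝ := ∑ γ : Fin k, D.wc u c ~γ d ~γ

variable {D u} {U : Set (Coo k)} {V : Set (Coo (k + m))}

local notation "Spec" => IsSpecialAt D u

namespace IsSpecialAt

lemma ddwc_eq (hs : Spec) (e f a b c d) : D.ddwc u e f a b c d
    = pd e (fun z => cov D.g (weyl D.g) z ![f, a, b, c, d]) (D.f u) := hs.normal.cov_vecCons _ _ _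

lemma dcc_eq (hs : Spec) (e a b c) : D.dcc u e a b c
    = pd e (fun z => cotton D.g z ![a, b, c]) (D.f u) := hs.normal.cov_vecCons _ _ _

lemma ddwc_swap (hs : Spec) (hD : D.Reg U V) (hu : u ∈ U) (e f a b c d) :
    D.ddwc u e f a b c d = -D.ddwc u e f b a c d := by
  rw [hs.ddwc_eq, hs.ddwc_eq, ← pd_neg]
  exact pd_congr hD.metric (hD.maps u hu) fun z hz => hD.metric.cov_weyl_swap hz f a b c d

lemma ddwc_pair (hs : Spec) (hD : D.Reg U V) (hu : u ∈ U) (e f a b c d) :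
    D.ddwc u e f a b c d = D.ddwc u e f c d a b := by
  rw [hs.ddwc_eq, hs.ddwc_eq]
  exact pd_congr hD.metric (hD.maps u hu) fun z hz => hD.metric.cov_weyl_pair hz f a b c d

lemma ddwc_div (hs : Spec) (hD : D.Reg U V) (hu : u ∈ U) (hn : 3 ≤ k + m) (e a b d) :
    ∑ c, D.ddwc u e c a b c d = ((k + m : ℕ) - 3 : ℝ) * D.dcc u e a b d := by
  have hp := hD.maps u hu; simp only [hs.ddwc_eq, hs.dcc_eq]
  rw [← pd_const_mul _ ((hD.metric.smooth_cotton _).diffAt hD.metric hp),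
    ← pd_congr hD.metric hp (fun z hz => hD.metric.div_weyl hz hn a b d),
    hs.normal.pd_mtr hD.metric hp fun c f => hD.metric.smooth_cov hD.metric.smooth_weyl _]

lemma ddwc_bianchi (hs : Spec) (hD : D.Reg U V) (hu : u ∈ U) (f a b c d e) :
    D.ddwc u f a b c d e + D.ddwc u f b c a d e + D.ddwc u f c a b d e
    = (kd c d * D.dcc u f a b e - kd c e * D.dcc u f a b d)
    + (kd a d * D.dcc u f b c e - kd a e * D.dcc u f b c d)
    + (kd b d * D.dcc u f c a e - kd b e * D.dcc u f c a d) := by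
  have hp := hD.maps u hu
  have hd : ∀ {F : Coo (k + m) → ℝ}, Sm V F → DifferentiableAt ℝ F (D.f u) := fun h =>
    h.diffAt hD.metric hp
  have hW := hD.metric.smooth_cov hD.metric.smooth_weyl
  have hgC := fun a b I => (hD.metric.smooth a b).mul (hD.metric.smooth_cotton I)
  have hgp a b I : pd f (fun z => D.g z a b * cotton D.g z I) (D.f u)
    = kd a b * pd f (fun z => cotton D.g z I) (D.f u) := by
    rw [pd_mul (hd (hD.metric.smooth a b)) (hd (hD.metric.smooth_cotton I)),
      hs.normal.pd_metric hD.metric hp, hs.normal.kd_apply]; ring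
  simp only [hs.ddwc_eq, hs.dcc_eq]
  rw [← pd_add (hd (hW _)) (hd (hW _)), ← pd_add (hd ((hW _).add (hW _))) (hd (hW _)), pd_congr
    hD.metric hp fun z hz => hD.metric.weyl_bianchi hz a b c d e, pd_add (hd (((hgC _ _ _).sub
    (hgC _ _ _)).add ((hgC _ _ _).sub (hgC _ _ _)))) (hd ((hgC _ _ _).sub (hgC _ _ _))), pd_add
    (hd ((hgC _ _ _).sub (hgC _ _ _))) (hd ((hgC _ _ _).sub (hgC _ _ _))), pd_sub (hd (hgC _ _ _))
    (hd (hgC _ _ _)), pd_sub (hd (hgC _ _ _)) (hd (hgC _ _ _)), pd_sub (hd (hgC _ _ _))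
    (hd (hgC _ _ _))]
  simp only [hgp]

lemma dcc_swap (hs : Spec) (e a b c) : D.dcc u e a b c = -D.dcc u e b a c := by
  rw [hs.dcc_eq, hs.dcc_eq, ← pd_neg]; congr 1; funext z; exact MReg.cotton_swap _ _ _ _ _

lemma ddwc_comm (hs : Spec) (hD : D.Reg U V) (hu : u ∈ U) (e f a b c d) :
    D.ddwc u e f a b c d - D.ddwc u f e a b c d
    = ∑ x, riemann D.g (D.f u) ![e, f, a, x] * D.wc u x b c d
    + ∑ x, riemann D.g (D.f u) ![e, f, b, x] * D.wc u a x c d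
    + ∑ x, riemann D.g (D.f u) ![e, f, c, x] * D.wc u a b x d
    + ∑ x, riemann D.g (D.f u) ![e, f, d, x] * D.wc u a b c x := by
  have e1 w : update ![a, b, c, d] 0 w = ![w, b, c, d] ∧ update ![a, b, c, d] 1 w = ![a, w, c, d] ∧
    update ![a, b, c, d] 2 w = ![a, b, w, d] ∧ update ![a, b, c, d] 3 w = ![a, b, c, w] := by
        refine ⟨?_, ?_, ?_, ?_⟩ <;> (funext i; fin_cases i <;> rfl)
  rw [ddwc, ddwc, hs.normal.ricci_identity hD.metric (hD.maps u hu) hD.metric.smooth_weyl,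
    Fin.sum_univ_four]
  simp only [(e1 _).1, (e1 _).2.1, (e1 _).2.2.1, (e1 _).2.2.2, hs.normal.riemann_eq_up]; rfl

lemma riemann_eq (hs : Spec) (a b c d) : riemann D.g (D.f u) ![a, b, c, d]
    = D.wc u a b c d + kd b d * D.pc u a c + kd a c * D.pc u b d - kd b c * D.pc u a d
    - kd a d * D.pc u b c := by simp only [wc, weyl, hs.normal.kd_apply, pc, cons_val]; ring

lemma sum_wc_trace (hs : Spec) (hD : D.Reg U V) (hu : u ∈ U) (hn : 3 ≤ k + m) (a b) :
    ∑ e, D.wc u e a e b = 0 := by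
  have := hs.normal.weyl_trace hD.metric (hD.maps u hu) hn a b; rw [← this]
  exact sum_ext fun e => by
    show D.wc u e a e b = D.wc u a e b e
    rw [D.wc_swap, hD.wc_swap' hu, neg_neg]

lemma box_weyl (hs : Spec) (hD : D.Reg U V) (hu : u ∈ U) (hn : 3 ≤ k + m) :
    ∑ a, ∑ b, ∑ e, D.ddwc u e e ~a ~b ~a ~b = 2 * ∑ a, ∑ b, ∑ e,
    (D.ddwc u e ~a e ~b ~a ~b - D.ddwc u ~a e e ~b ~a ~b)
    - 2 * ((k + m : ℕ) - 2 : ℝ) * ∑ a, ∑ b, D.dcc u ~a ~b ~a ~b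
    - (2 * (k : ℝ) - 2) * ∑ a, ∑ e, D.dcc u e e ~a ~a := by
  have hB : ∀ (a b) e, D.ddwc u e e ~a ~b ~a ~b
    = D.ddwc u e ~a e ~b ~a ~b + D.ddwc u e ~b e ~a ~b ~a
    + kd a b * D.dcc u e e ~a ~b - D.dcc u e e ~a ~a + kd e ~a * D.dcc u e ~a ~b ~b
    + kd e ~b * D.dcc u e ~b ~a ~a - D.dcc u e e ~b ~b + kd a b * D.dcc u e e ~b ~a := by
    intro a b e; have h := hs.ddwc_bianchi hD hu e e ~a ~b ~a ~b
    rw [hs.ddwc_swap hD hu e ~a ~b, hs.ddwc_pair hD hu e ~b e ~a,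
      hs.ddwc_swap hD hu e ~b ~a, hs.ddwc_pair hD hu e ~b ~b ~a,
      hs.dcc_swap e ~b e, hs.dcc_swap e ~b e, hs.dcc_swap e ~a ~b ~a] at h
    simp only [kd_tg, kd_self, kd_comm b a] at h; linear_combination h
  have h1 : ∑ a, ∑ b, ∑ e, D.ddwc u ~a e e ~b ~a ~b = -((k + m : ℕ) - 3 : ℝ) *
    ∑ a, ∑ b, D.dcc u ~a ~b ~a ~b := by
    simp only [hs.ddwc_pair hD hu _ _ _ ~_ ~_, hs.ddwc_div hD hu hn,
      fun a b => hs.dcc_swap ~a ~a ~b ~b, mul_sum]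
    exact sum_ext2 fun _ _ => by ring
  have h2 : ∑ a, ∑ b, ∑ e, D.ddwc u e ~b e ~a ~b ~a
    = ∑ a, ∑ b, ∑ e, D.ddwc u e ~a e ~b ~a ~b := sum_comm
  have h3 : ∑ a, ∑ b, D.dcc u ~a ~a ~b ~b = -∑ a, ∑ b, D.dcc u ~a ~b ~a ~b := by
    simp only [← sum_neg]; exact sum_ext2 fun a b => hs.dcc_swap _ _ _ _
  have h4 : ∑ a, ∑ b, D.dcc u ~b ~b ~a ~a = ∑ a, ∑ b, D.dcc u ~a ~a ~b ~b := sum_comm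
  simp only [hB, sum_add, sum_sub, h1, h2]
  simp only [← mul_sum, sum_kd_mul, sum_kd_mul', h3, h4, sum_const]; ring

lemma wtr_comm (hD : D.Reg U V) (hu : u ∈ U) (c d) : D.wtr u c d = D.wtr u d c :=
  sum_ext fun _ => hD.wc_pair hu _ _ _ _

lemma sum_comm_weyl (hs : Spec) (hD : D.Reg U V) (hu : u ∈ U) (hn : 3 ≤ k + m) :
    ∑ p, ∑ q, ∑ e, (D.ddwc u e ~p e ~q ~p ~q - D.ddwc u ~p e e ~q ~p ~q)
    = -(D.sWttaa u - D.sWtata u + D.sWaa u)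
    + ((k + m : ℕ) - 2 : ℝ) * ∑ p, ∑ x, D.pc u ~p x * D.wtr u x ~p
    + (∑ e, D.pc u e e) * D.Wtr u - ((k : ℝ) - 1) * ∑ e, ∑ x, D.pc u e x * D.wtr u e x := by
  have z1 a b c : D.wc u a b c c = 0 := by linarith [hD.wc_swap' hu a b c c]
  have z2 a b c : D.wc u a a b c = 0 := by linarith [D.wc_swap u a a b c]
  have w1 c d : ∑ t, D.wc u c ~t ~t d = -D.wtr u c d := by
    rw [wtr, ← sum_neg]; exact sum_ext fun t => hD.wc_swap' hu _ _ _ _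
  have t1 : ∑ p, ∑ q, ∑ e, ∑ x, riemann D.g (D.f u) ![e, ~p, e, x] *
    D.wc u x ~q ~p ~q = ((k + m : ℕ) - 2 : ℝ) * ∑ p, ∑ x, D.pc u ~p x * D.wtr u x ~p
    + (∑ e, D.pc u e e) * D.Wtr u := by
    have h1 : ∀ (p) x, ∑ e, riemann D.g (D.f u) ![e, ~p, e, x]
        = ((k + m : ℕ) - 2 : ℝ) * D.pc u ~p x + kd ~p x * ∑ e, D.pc u e e := fun p x => by
      simp only [hs.riemann_eq, sum_add, sum_sub, hs.sum_wc_trace hD hu hn, kd_self, sum_kd_mul,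
        sum_kd_mul', ← mul_sum, one_mul, sum_const]
      ring
    have h2 p : ∑ q, ∑ e, ∑ x, riemann D.g (D.f u) ![e, ~p, e, x] *
      D.wc u x ~q ~p ~q = ∑ x, (((k + m : ℕ) - 2 : ℝ) * (D.pc u ~p x * D.wtr u x ~p)
      + kd ~p x * ((∑ e, D.pc u e e) * D.wtr u x ~p)) := by
      rw [sum_rot, sum_rot]; refine sum_ext fun x => ?_
      simp only [← sum_mul, ← mul_sum, h1, wtr]; ring
    simp only [h2, sum_add, sum_kd_mul', ← mul_sum, Wtr, hs.trT, hs.Wtt_eq, wtr]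
  have t2 : ∑ p, ∑ q, ∑ e, ∑ x, riemann D.g (D.f u) ![e, ~p, ~q, x] *
    D.wc u e x ~p ~q = ∑ p, ∑ q, ∑ e, ∑ x, D.wc u e ~p ~q x * D.wc u e x ~p ~q
    - 2 * ∑ p, ∑ x, D.pc u ~p x * D.wtr u x ~p := by
    have h1 : ∑ p, ∑ q, ∑ e, D.pc u e ~q * D.wc u e ~p ~p ~q
      = -∑ p, ∑ x, D.pc u ~p x * D.wtr u x ~p := by
      rw [sum_rot, ← sum_neg]; refine sum_ext fun q => ?_
      simp only [← mul_sum, w1, mul_neg, sum_neg, hD.pc_symm hu ~q]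
    have h2 : ∑ p, ∑ q, ∑ x, D.pc u ~p x * D.wc u ~q x ~p ~q
      = -∑ p, ∑ x, D.pc u ~p x * D.wtr u x ~p := by
      rw [← sum_neg]; refine sum_ext fun p => ?_; rw [sum_comm]
      simp only [← mul_sum, fun q x => D.wc_swap u ~q x ~p ~q, sum_neg, mul_neg, wtr]
    simp only [hs.riemann_eq, sum_add, sum_sub, add_mul, sub_mul, mul_assoc, ← mul_sum, kd_tg,
      sum_kd_mul, sum_kd_mul', h1, h2, z1, z2, mul_zero, sum_const_zero]
    ring
  have t3 : ∑ p, ∑ q, ∑ e, ∑ x, riemann D.g (D.f u) ![e, ~p, ~p, x] *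
    D.wc u e ~q x ~q = -D.sWaa u + 2 * ∑ p, ∑ x, D.pc u ~p x * D.wtr u x ~p
    - k * ∑ e, ∑ x, D.pc u e x * D.wtr u e x := by
    have h1 p : ∑ q, ∑ e, ∑ x, riemann D.g (D.f u) ![e, ~p, ~p, x] *
      D.wc u e ~q x ~q = ∑ e, ∑ x, riemann D.g (D.f u) ![e, ~p, ~p, x] * D.wtr u e x := by
      rw [sum_rot]; simp only [← mul_sum, wtr]
    have h2 : ∑ p, ∑ e, ∑ x, D.wc u e ~p ~p x * D.wtr u e x = -D.sWaa u := by
      rw [sum_rot]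
      simp only [← sum_mul, w1, sWaa, hs.trA, hs.trT, hs.tan_eq, W_amb, neg_mul, sum_neg, wtr]
    have h3 : ∑ e, D.wtr u e e = 0 := by
      simp only [wtr]; rw [sum_comm]; simp only [hs.sum_wc_trace hD hu hn, sum_const_zero]
    simp only [h1]
    simp only [hs.riemann_eq, sum_add, sum_sub, add_mul, sub_mul, mul_assoc, ← mul_sum, kd_self,
      sum_kd_mul, sum_kd_mul', h2, h3, sum_const, mul_zero, hD.pc_symm hu _ ~_, wtr_comm hD hu ~_]
    ring
  have t4 : ∑ p, ∑ q, ∑ e, ∑ x, riemann D.g (D.f u) ![e, ~p, ~q, x] *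
    D.wc u e ~q ~p x = ∑ p, ∑ q, ∑ e, ∑ x, D.wc u e ~p ~q x * D.wc u e ~q ~p x
    + ∑ e, ∑ x, D.pc u e x * D.wtr u e x := by
    have h1 : ∑ p, ∑ e, ∑ x, D.pc u e x * D.wc u e ~p ~p x
      = -∑ e, ∑ x, D.pc u e x * D.wtr u e x := by
      rw [sum_rot]; simp only [← mul_sum, w1, mul_neg, sum_neg]
    simp only [hs.riemann_eq, sum_add, sum_sub, add_mul, sub_mul, mul_assoc, ← mul_sum, kd_tg,
      sum_kd_mul, sum_kd_mul', h1, z1, z2, mul_zero, fun e a b => hD.wc_swap' hu e a b e, sum_neg,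
      hs.sum_wc_trace hD hu hn, neg_zero, sum_const_zero]
    ring
  have t5 : ∑ p, ∑ q, ∑ e, ∑ x, D.wc u e ~p ~q x * D.wc u e x ~p ~q
    + ∑ p, ∑ q, ∑ e, ∑ x, D.wc u e ~p ~q x * D.wc u e ~q ~p x = D.sWtata u - D.sWttaa u := by
    have h1 : D.sWtata u = ∑ p, ∑ q, ∑ e, ∑ x, D.wc u ~p e ~q x * D.wc u ~p e ~q x := by
      simp only [sWtata, hs.trA, hs.trT, hs.tan_eq, W_amb]; exact sum_ext fun _ => sum_comm
    have h2 : D.sWttaa u = ∑ p, ∑ q, ∑ e, ∑ x, D.wc u ~p ~q e x * D.wc u ~p ~q e x := by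
      simp only [sWttaa, hs.trA, hs.trT, hs.tan_eq, W_amb]
    have h3 : ∑ p, ∑ q, ∑ e, ∑ x, (D.wc u e ~p ~q x *
      D.wc u e x ~p ~q + D.wc u e ~p ~q x * D.wc u e ~q ~p x - D.wc u ~p e ~q x * D.wc u ~p e ~q x
      + D.wc u ~p ~q e x * D.wc u ~p ~q e x) = 0 := by
      refine sum_eq_zero_of_antisymm fun p q => ?_; simp only [← sum_neg]
      refine sum_ext2 fun e x => ?_; have hc := hD.wc_cyclic hu ~p e ~q x
      rw [hD.wc_pair hu e x, hD.wc_pair hu e x, D.wc_swap u ~q ~p, D.wc_swap u ~q e,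
        D.wc_swap u ~p e]
      rw [D.wc_swap u ~p e, D.wc_swap u ~q ~p] at hc
      linear_combination -(D.wc u e ~q ~p x - D.wc u e ~p ~q x + 2 * D.wc u ~p ~q e x) * hc
    simp only [sum_add, sum_sub, ← h1, ← h2] at h3; linarith
  simp only [hs.ddwc_comm hD hu, sum_add, t1, t2, t3, t4]; linear_combination t5

lemma sum_bach (hs : Spec) (hD : D.Reg U V) (hu : u ∈ U) : ∑ p, bach D.g (D.f u) ![~p, ~p]
    = ∑ p, ∑ e, D.dcc u e e ~p ~p + ∑ e, ∑ x, D.pc u e x * D.wtr u e x := by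
  have hi : ∀ a b, (D.g (D.f u))⁻¹ a b = kd a b := hs.normal.inv_apply
  have h1 p : bach D.g (D.f u) ![~p, ~p] = ∑ e, D.dcc u e e ~p ~p
    + ∑ e, ∑ x, D.pc u e x * D.wc u ~p e ~p x := by
    simp only [bach, hi, mul_assoc, ← mul_sum, sum_kd_mul', cons_val]
    simp only [dcc, wc, pc, mul_comm]
  simp only [h1, sum_add]; rw [sum_rot fun (p : Fin k) e x => D.pc u e x * D.wc u ~p e ~p x]
  simp only [← mul_sum, wtr, fun e x (p) => D.wc_swap u ~p e ~p x,
    fun e x (p) => hD.wc_swap' hu e ~p ~p x, neg_neg]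

lemma sum_ddwc (hs : Spec) (hD : D.Reg U V) (hu : u ∈ U) (hn : 3 ≤ k + m) :
    ∑ a, ∑ b, ∑ e, D.ddwc u e e ~a ~b ~a ~b
    = -2 * ((k + m : ℕ) - 2 : ℝ) * ∑ a, ∑ b, D.dcc u ~a ~b ~a ~b
    - 2 * (D.sWttaa u - D.sWtata u + D.sWaa u)
    + 2 * ((k + m : ℕ) - 2 : ℝ) * ∑ a, ∑ x, D.pc u ~a x * D.wtr u x ~a
    + 2 * (∑ e, D.pc u e e) * D.Wtr u - (2 * (k : ℝ) - 2) * ∑ a, bach D.g (D.f u) ![~a, ~a] := by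
  rw [hs.box_weyl hD hu hn, hs.sum_comm_weyl hD hu hn, hs.sum_bach hD hu]; ring

end IsSpecialAt
end Special

section General
variable {k n : ℕ} (D : CoordData k n) (u : Coo k)

/-- `∇_γ W_{αβ}{}^{αβ}`, with the covariant derivative of the ambient tensor. -/
def formdW (γ : Fin k) : ℝ := D.trT u fun a b => D.trT u fun c d =>
  D.dW u (D.tan u γ) (D.tan u a) (D.tan u c) (D.tan u b) (D.tan u d)

/-- `H^{α'} W_{αβα'}{}^β`. -/
def formHW (α : Fin k) : ℝ := D.trA u fun a a' => D.H u a * D.Wtn u α a'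

variable {D u} {U : Set (Coo k)} {V : Set (Coo n)}

lemma Reg.sm_formdW (hD : D.Reg U V) (c) : Sm U fun z => D.formdW z c :=
  hD.sm_trT fun a a' => hD.sm_trT fun b b' => hD.sm_dW (hD.sm_tan c) (hD.sm_tan a) (hD.sm_tan b)
    (hD.sm_tan a') (hD.sm_tan b')

lemma Reg.sm_formHW (hD : D.Reg U V) (p) : Sm U fun z => D.formHW z p :=
  hD.sm_trA fun a a' => (hD.sm_H a).mul (hD.sm_Wtn p a')

lemma Reg.W_swap_swap (hD : D.Reg U V) (hu : u ∈ U) (v0 v1 v2 v3 : Fin n → ℝ) :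
    D.W u v0 v1 v2 v3 = D.W u v1 v0 v3 v2 := by
  simp only [W_eq_sum, mul_sum]; rw [sum_comm]; refine sum_ext2 fun b a => ?_; rw [sum_comm]
  refine sum_ext2 fun d c => ?_
  rw [D.wc_swap, show D.wc u b a c d = -D.wc u b a d c from
    hD.metric.weyl_swap' (hD.maps u hu) _ _ _ _]; ring

variable {D' : CoordData k n} {φ : Coo k → Coo k} {ψ : Coo n → Coo n} {U' : Set (Coo k)}
  {V' : Set (Coo n)}

lemma Change.formdW_eq (h : Change D' D φ ψ U' U V' V) (hu : u ∈ U') (c) :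
    D'.formdW u c = ap (jac φ u) c fun c' => D.formdW (φ u) c' := by
  simp only [formdW, h.dW_eq hu, h.push_tan hu, dW_ap,
    trT_eq_mtr, ap_mul, mul_ap, mtr_ap, mtr_ap_right_ap, h.trT_eq' hu]

lemma Change.formHW_eq (h : Change D' D φ ψ U' U V' V) (hu : u ∈ U') (a) :
    D'.formHW u a = ap (jac φ u) a fun a' => D.formHW (φ u) a' := by
  simp only [formHW, h.Wtn_eq hu, h.H_eq hu, trA_eq_mtr, ap_mul, mul_ap, mtr_ap, mtr_ap_right_ap,
    h.trA_eq' hu]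

end General

section Special
variable {k m : ℕ} {D : CoordData k (k + m)} {u : Coo k} {U : Set (Coo k)} {V : Set (Coo (k + m))}

local notation "Spec" => IsSpecialAt D u

namespace IsSpecialAt

lemma formHW_eq (hs : Spec) (a) : D.formHW u a = ∑ j, D.H u &j * D.Wtn u a &j :=
  hs.trA_of_tg fun c => by rw [hs.H_tg, zero_mul]

lemma formdW_eq (hs : Spec) (c) : D.formdW u c = ∑ a, ∑ b, D.dwc u ~c ~a ~b ~a ~b := by
  simp only [formdW, hs.trT, hs.tan_eq, dW_amb]

lemma pd_Wtr_eq (hs : Spec) (hD : D.Reg U V) (hu : u ∈ U) (c) :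
    pd c D.Wtr u = D.formdW u c + 4 * D.formLWtn u c + 4 * D.formHW u c := by
  rw [hs.pd_Wtr hD hu, hs.formdW_eq, hs.formLWtn_eq, hs.formHW_eq]
  simp only [hs.L_eq_Lo_add, add_mul, sum_add, mul_assoc, ← mul_sum, sum_kd_mul']; ring

lemma pd_evalTensor_tan (hs : Spec) (hD : D.Reg U V) (hu : u ∈ U) {r : ℕ}
    {T : TensorField (k + m) r} (hT : ∀ I, Sm V fun x => T x I) (s : Fin r → Fin k) (t) :
    pd t (fun z => ev (T (D.f z)) fun j => D.tan z (s j)) u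
    = cov D.g T (D.f u) (Matrix.vecCons ~t fun j => tg (s j)) + ∑ j, ∑ i, D.L u t (s j) &i *
    T (D.f u) (update (fun j => tg (s j)) j &i) := by
  rw [pd_evalTensor (g := D.g) hD.metric hT (hD.maps u hu) (hD.diffAt hu)
    (fun j b => (hD.sm_tan (s j) b).diffAt hD hu)]
  have ht : (fun c => pd t (fun z => D.f z c) u) = amb ~t := hs.tan_eq t; congr 1
  · rw [← evalTensor_single (cov D.g T (D.f u)), ht]
    congr 1; funext j; refine Fin.cases rfl (fun j => ?_) j
    simp only [Fin.cons_succ, hs.tan_eq]; rfl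
  · refine sum_ext fun j => ?_
    simp only [hs.covAlong_eq, hs.pd_tan hD hu, evalTensor_update_ap]; refine sum_ext fun i => ?_
    rw [← evalTensor_single (T (D.f u))]; refine congrArg (_ * ev _ ·) (funext fun l => ?_)
    by_cases hl : l = j
    · subst hl; simp [amb]
    · simp [hl, hs.tan_eq, amb]

end IsSpecialAt

lemma Reg.pd_Wtr (hD : D.Reg U V) (hu : u ∈ U) (c) :
    pd c D.Wtr u = D.formdW u c + 4 * D.formLWtn u c + 4 * D.formHW u c := by
  obtain ⟨D', φ, ψ, U', V', h, h0, rfl, hs⟩ := hD.exists_special hu; rw [← sub_eq_zero]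
  refine h.pull_h.ap_injective h0 (F := fun c => pd c D.Wtr (φ 0)
    - (D.formdW (φ 0) c + 4 * D.formLWtn (φ 0) c + 4 * D.formHW (φ 0) c)) (fun a => ?_) c
  have := hs.pd_Wtr_eq h.reg' h0 a
  rw [h.formdW_eq h0, h.formLWtn_eq h0, h.formHW_eq h0, pd_congr h.reg' h0
    fun z hz => h.Wtr_eq hz, h.pd_comp h0 hD.sm_Wtr] at this
  simp only [ap] at this ⊢
  simp only [mul_sub, mul_add, sum_sub, sum_add, this, mul_left_comm _ (4 : ℝ), ← mul_sum, sub_self]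

lemma Reg.lapWtr_eq (hD : D.Reg U V) (hu : u ∈ U) : laplacian D.h D.Wtr u
    = divergence D.h D.formdW u + 4 * divergence D.h D.formLWtn u
    + 4 * divergence D.h D.formHW u := by
  have h1 := divergence_lin hD.reg_h hu hD.sm_formLWtn hD.sm_formHW 4 4
  have h2 := divergence_lin hD.reg_h hu hD.sm_formdW (V' := fun z a => 4 * D.formLWtn z a
    + 4 * D.formHW z a) (fun a => ((Sm.const 4).mul (hD.sm_formLWtn a)).add
    ((Sm.const 4).mul (hD.sm_formHW a))) 1 1
  rw [h1] at h2
  rw [laplacian, divergence_congr hD.reg_h hu fun z hz a => (hD.pd_Wtr hz a).trans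
    (show _ = 1 * D.formdW z a + 1 * (4 * D.formLWtn z a + 4 * D.formHW z a) by ring), h2]
  ring

section Divergences
variable (D u)

/-- `H^{α'} C_{αα'}{}^α`. -/
def HCot : ℝ := ∑ j, D.H u &j * ∑ α : Fin k, D.cc u ~α &j ~α

/-- `H^{α'} H^{β'} W_{α'γβ'}{}^γ`. -/
def HHW : ℝ := ∑ i, ∑ j, D.H u &i * D.H u &j * D.wtr u &i &j

end Divergences

namespace IsSpecialAt

lemma pd_dW_tan (hs : Spec) (hD : D.Reg U V) (hu : u ∈ U) (t l p q s ζ : Fin k) :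
    pd t (fun z => D.dW z (D.tan z l) (D.tan z p) (D.tan z q) (D.tan z s) (D.tan z ζ)) u
    = D.ddwc u ~t ~l ~p ~q ~s ~ζ + (∑ i, D.L u t l &i * D.dwc u &i ~p ~q ~s ~ζ
    + ∑ i, D.L u t p &i * D.dwc u ~l &i ~q ~s ~ζ + ∑ i, D.L u t q &i * D.dwc u ~l ~p &i ~s ~ζ
    + ∑ i, D.L u t s &i * D.dwc u ~l ~p ~q &i ~ζ + ∑ i, D.L u t ζ &i * D.dwc u ~l ~p ~q ~s &i) := by
  have h := hs.pd_evalTensor_tan hD hu (hD.metric.smooth_cov hD.metric.smooth_weyl)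
    ![l, p, q, s, ζ] t
  rw [Fin.sum_univ_five] at h
  have e1 z : (fun j => D.tan z (![l, p, q, s, ζ] j))
    = ![D.tan z l, D.tan z p, D.tan z q, D.tan z s, D.tan z ζ] := by funext j; fin_cases j <;> rfl
  have e2 : (fun j => (tg (![l, p, q, s, ζ] j) : Fin (k + m)))
      = ![~l, ~p, ~q, ~s, ~ζ] := by funext j; fin_cases j <;> rfl
  have e3 : ∀ w : Fin (k + m), ∀ a b c d e : Fin (k + m),
    update ![a, b, c, d, e] 0 w = ![w, b, c, d, e] ∧
    update ![a, b, c, d, e] 1 w = ![a, w, c, d, e] ∧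
    update ![a, b, c, d, e] 2 w = ![a, b, w, d, e] ∧
    update ![a, b, c, d, e] 3 w = ![a, b, c, w, e] ∧
    update ![a, b, c, d, e] 4 w = ![a, b, c, d, w] := by
    intros; refine ⟨?_, ?_, ?_, ?_, ?_⟩ <;> (funext i; fin_cases i <;> rfl)
  simp only [e1, e2, (e3 _ _ _ _ _ _).1, (e3 _ _ _ _ _ _).2.1, (e3 _ _ _ _ _ _).2.2.1,
    (e3 _ _ _ _ _ _).2.2.2.1, (e3 _ _ _ _ _ _).2.2.2.2] at h
  exact h

lemma pd_Cot_tan (hs : Spec) (hD : D.Reg U V) (hu : u ∈ U) (t p q d : Fin k) :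
    pd t (fun z => D.Cot z (D.tan z p) (D.tan z q) (D.tan z d)) u = D.dcc u ~t ~p ~q ~d
    + (∑ i, D.L u t p &i * D.cc u &i ~q ~d + ∑ i, D.L u t q &i * D.cc u ~p &i ~d
    + ∑ i, D.L u t d &i * D.cc u ~p ~q &i) := by
  have h := hs.pd_evalTensor_tan hD hu hD.metric.smooth_cotton ![p, q, d] t
  rw [Fin.sum_univ_three] at h
  have e1 z : (fun j => D.tan z (![p, q, d] j)) = ![D.tan z p, D.tan z q, D.tan z d] := by funext j; fin_cases j <;> rfl
  have e2 : (fun j => (tg (![p, q, d] j) : Fin (k + m))) = ![~p, ~q, ~d] := by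
    funext j; fin_cases j <;> rfl
  have e3 : ∀ w a b c : Fin (k + m), update ![a, b, c] 0 w = ![w, b, c] ∧
    update ![a, b, c] 1 w = ![a, w, c] ∧ update ![a, b, c] 2 w = ![a, b, w] := by
    intros; refine ⟨?_, ?_, ?_⟩ <;> (funext i; fin_cases i <;> rfl)
  simp only [e1, e2, (e3 _ _ _ _).1, (e3 _ _ _ _).2.1, (e3 _ _ _ _).2.2] at h; exact h

lemma sHdW_eq (hs : Spec) : D.sHdW u = ∑ i, D.H u &i * ∑ a, ∑ b, D.dwc u &i ~a ~b ~a ~b := by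
  simp only [sHdW, hs.trT, hs.trA, sum_tg_nm, hs.H_tg, zero_mul, sum_const_zero, zero_add,
    hs.tan_eq, hs.nor_nm, dW_amb]

lemma sHdW_eq_add (hs : Spec) (hD : D.Reg U V) (hu : u ∈ U) : D.sHdW u
    = 2 * ∑ i, D.H u &i * ∑ a, ∑ b, D.dwc u ~a ~a ~b &i ~b + (2 * (k : ℝ) - 2) * D.HCot u := by
  simp only [hs.sHdW_eq, hs.sum_dwc hD hu, kd_tg_nm, zero_mul, sum_const_zero, mul_zero,
    sub_zero, mul_add, sum_add, mul_left_comm (D.H u _), ← mul_sum, HCot]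

lemma div_formdW (hs : Spec) (hD : D.Reg U V) (hu : u ∈ U) (hk : k ≠ 0) :
    divergence D.h D.formdW u = ∑ a, ∑ b, ∑ c, D.ddwc u ~c ~c ~a ~b ~a ~b
    + ((k : ℝ) + 2) * D.sHdW u + 4 * D.LdWtn u - (4 * (k : ℝ) - 4) * D.HCot u := by
  have h1 c : pd c (fun z => D.formdW z c) u = ∑ a, ∑ b, pd c (fun z =>
      D.dW z (D.tan z c) (D.tan z a) (D.tan z b) (D.tan z a) (D.tan z b)) u := by
    have hs5 := fun a b a' b' => hD.sm_dW (hD.sm_tan c) (hD.sm_tan a) (hD.sm_tan b) (hD.sm_tan a')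
      (hD.sm_tan b')
    refine (hs.pd_trT hD hu (fun a a' => hD.sm_trT fun b b' => hs5 a b a' b') c).trans ?_
    exact sum_ext fun a => hs.pd_trT hD hu (fun b b' => hs5 a b a b') c
  have e0 : ∑ c, ∑ a, ∑ b, ∑ i, D.L u c c &i * D.dwc u &i ~a ~b ~a ~b = k * D.sHdW u := by
    have this c : ∑ a, ∑ b, ∑ i, D.L u c c &i * D.dwc u &i ~a ~b ~a ~b = ∑ i, D.L u c c &i *
      ∑ a, ∑ b, D.dwc u &i ~a ~b ~a ~b := by
      simp only [mul_sum]; exact (sum_rot _).trans (sum_rot _)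
    simp only [this]; rw [sum_comm]
    simp only [← sum_mul, hs.sum_L hk, mul_assoc, ← mul_sum, hs.sHdW_eq]
  have e1 : ∑ c, ∑ a, ∑ b, ∑ i, D.L u c a &i * D.dwc u ~c ~a ~b &i ~b
    = D.LdWtn u + ∑ i, D.H u &i * ∑ a, ∑ b, D.dwc u ~a ~a ~b &i ~b := by
    have this c a : ∑ b, ∑ i, D.L u c a &i * D.dwc u ~c ~a ~b &i ~b
      = ∑ j, D.Lo u c a &j * ∑ b, D.dwc u ~c ~a ~b &j ~b
      + kd c a * ∑ i, D.H u &i * ∑ b, D.dwc u ~c ~a ~b &i ~b := by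
      rw [sum_comm]; simp only [← mul_sum, hs.L_eq_Lo_add, add_mul, sum_add, mul_assoc]
    simp only [this, sum_add, sum_kd_mul', LdWtn]; congr 1; rw [sum_comm]; simp only [← mul_sum]
  have e2 : ∑ c, ∑ a, ∑ b, ∑ i, D.L u c b &i * D.dwc u ~c ~a ~b ~a &i
    = ∑ c, ∑ a, ∑ b, ∑ i, D.L u c a &i * D.dwc u ~c ~a ~b &i ~b := by
    refine sum_ext fun c => ?_; rw [sum_comm]; refine sum_ext3 fun b a i => ?_
    rw [hs.dwc_swap, hs.dwc_swap' hD hu, neg_neg]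
  rw [hs.normal_h.divergence_eq]; simp only [h1, hs.pd_dW_tan hD hu, sum_add, e0]
  simp only [hs.dwc_pair hD hu _ &_ ~_, hs.dwc_pair hD hu _ ~_ &_ ~_ ~_, e1, e2]
  rw [sum_rot fun (c a b : Fin k) => D.ddwc u ~c ~c ~a ~b ~a ~b]
  linear_combination -2 * hs.sHdW_eq_add hD hu

end IsSpecialAt

lemma ddW_amb (e f a b c d) :
    D.ddW u (amb e) (amb f) (amb a) (amb b) (amb c) (amb d) = D.ddwc u e f a b c d := by
  rw [ddwc, ← evalTensor_single (cov D.g (cov D.g (weyl D.g)) (D.f u)), ddW]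
  congr 1; funext j; fin_cases j <;> rfl

namespace IsSpecialAt

lemma Wtr_eq (hs : Spec) : D.Wtr u = ∑ a, D.Wtt u a a := hs.trT _

lemma sWdH_eq (hs : Spec) : D.sWdH u = ∑ a, ∑ j, D.Wtn u a &j * D.dH u a &j := by
  simp only [sWdH, hs.trT, hs.trA, sum_tg_nm, hs.Wtn_tg, zero_mul, sum_const_zero, zero_add]

lemma div_formHW (hs : Spec) (hD : D.Reg U V) (hu : u ∈ U) (hk : k ≠ 0) :
    divergence D.h D.formHW u = D.sWdH u + 1 / 2 * D.sHdW u - ((k : ℝ) - 1) * D.HCot u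
    + ((k : ℝ) - 1) * D.HHW u - D.LHW u - D.sHLW u - D.normH u * D.Wtr u := by
  have h1 a : pd a (fun z => D.formHW z a) u = ∑ j, (pd a (fun z => D.H z &j) u *
    D.Wtn u a &j + D.H u &j * pd a (fun z => D.Wtn z a &j) u) :=
    hs.pd_trA_mul hD hu hD.sm_H (hD.sm_Wtn a) hs.H_tg (hs.Wtn_tg a) a
  have e0 : ∑ a, ∑ j, pd a (fun z => D.H z &j) u * D.Wtn u a &j = D.sWdH u := by
    simp only [hs.sWdH_eq, hs.dH_nm, mul_comm]
  have eA : ∑ a, ∑ j, D.H u &j * ∑ c, ∑ i, D.L u a a &i * D.wc u &i ~c &j ~c = k * D.HHW u := by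
    have this a j : D.H u &j * ∑ c, ∑ i, D.L u a a &i *
      D.wc u &i ~c &j ~c = ∑ i, D.L u a a &i * (D.H u &j * D.wtr u &i &j) := by
      rw [sum_comm]; rw [mul_sum]; exact sum_ext fun i => by rw [← mul_sum, wtr]; ring
    simp only [this]; rw [sum_rot, sum_comm]
    simp only [← sum_mul, hs.sum_L hk, HHW, mul_assoc, ← mul_sum]
  have eB : ∑ a, ∑ j, D.H u &j * ∑ c,
    ∑ i, D.L u a c &i * D.wc u ~a &i &j ~c = -D.LHW u - D.HHW u := by
    have this a j c i : D.H u &j * (D.L u a c &i * D.wc u ~a &i &j ~c)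
      = -(D.Lo u c a &i * (D.H u &j * D.wc u &j ~c &i ~a))
      - kd a c * (D.H u &i * D.H u &j * D.wc u &i ~a &j ~c) := by
      rw [hs.L_eq_Lo_add, hs.Lo_symm hD hu, D.wc_swap u ~a, hD.wc_pair hu &j]; ring
    simp only [mul_sum, this, sum_sub, sum_neg]; refine congrArg₂ _ (congrArg _ ?_) ?_
    · simp only [LHW, mul_sum]
      exact (sum_ext fun a => sum_rot _).trans sum_comm
    · simp only [← mul_sum, sum_kd_mul']
      simp only [HHW, wtr, mul_sum]; exact (sum_rot _).trans sum_comm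
  have eC : ∑ a, ∑ j, D.H u &j * ∑ c, ∑ d, -D.L u a d &j * D.wc u ~a ~c ~d ~c
    = -D.sHLW u - D.normH u * D.Wtr u := by
    have this a j : D.H u &j * ∑ c, ∑ d, -D.L u a d &j * D.wc u ~a ~c ~d ~c
      = -∑ d, D.H u &j * D.Lo u a d &j * D.Wtt u a d - D.H u &j * D.H u &j * D.Wtt u a a := by
      rw [sum_comm]
      simp only [← mul_sum, ← hs.Wtt_eq, hs.L_eq_Lo_add, add_mul, neg_add,
        sum_add, neg_mul, sum_neg, mul_assoc, sum_kd_mul']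
      ring
    simp only [this, sum_sub, sum_neg, hs.sHLW_eq, hs.Wtr_eq, hs.normH_eq, ← sum_mul, ← mul_sum]
    rw [sum_comm]
  have eE : ∑ a, ∑ j, D.H u &j * ∑ c, ∑ i, D.L u a c &i * D.wc u ~a ~c &j &i = 0 := by
    simp only [mul_sum]; rw [sum_comm]
    refine sum_eq_zero fun j _ => sum_eq_zero_of_antisymm fun a c => ?_
    simp only [hs.L_symm hD hu c a, D.wc_swap u ~c ~a, mul_neg, sum_neg, neg_neg]
  have eY : ∑ a, ∑ j, D.H u &j * ∑ b, D.dwc u ~a ~a ~b &j ~b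
    = 1 / 2 * D.sHdW u - ((k : ℝ) - 1) * D.HCot u := by
    rw [hs.sHdW_eq_add hD hu, sum_comm]; simp only [← mul_sum]; ring
  rw [hs.normal_h.divergence_eq]
  simp only [h1, hs.pd_Wtn hD hu, hs.pd_W_nor hD hu, mul_add, sum_add, e0, eA, eB, eC, eE, eY]; ring

lemma div_cC1 (hs : Spec) (hD : D.Reg U V) (hu : u ∈ U) (hk : k ≠ 0) :
    divergence D.h D.cC1 u = ∑ p, ∑ b, D.dcc u ~p ~b ~p ~b
    - D.LCot u + ((k : ℝ) - 1) * D.HCot u - divergence D.h D.formHW u := by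
  have h1 p : pd p (fun z => D.cC1 z p) u
    = ∑ b, pd p (fun z => D.Cot z (D.tan z b) (D.tan z p) (D.tan z b)) u
    - pd p (fun z => D.formHW z p) u := by
    have hC := fun b b' => hD.sm_Cot (hD.sm_tan b) (hD.sm_tan p) (hD.sm_tan b')
    have hW := fun b b' a => hD.sm_W (hD.sm_tan b) (hD.sm_tan p) (hD.sm_tan b') (hD.sm_nor a)
    have hA := fun b b' => hD.sm_trA fun a a' => (hD.sm_H a).mul (hW b b' a')
    rw [show pd p (fun z => D.formHW z p) u = _ from
      hs.pd_trA_mul hD hu hD.sm_H (hD.sm_Wtn p) hs.H_tg (hs.Wtn_tg p) p]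
    refine (hs.pd_trT hD hu (fun b b' => (hC b b').sub (hA b b')) p).trans ?_
    simp only [pd_sub ((hC _ _).diffAt hD hu) ((hA _ _).diffAt hD hu), sum_sub]; rw [sub_right_inj]
    simp only [fun b => hs.pd_trA_mul hD hu hD.sm_H (hW b b) hs.H_tg (fun c => by
      rw [hs.nor_tg, W_zero3]) p, hs.pd_Wtn hD hu, hs.Wtn_nm, mul_sum]
    rw [sum_comm]; simp only [← sum_add]; refine sum_ext2 fun j b => ?_
    rw [pd_congr hD hu fun z hz => hD.W_swap_swap hz (D.tan z b) (D.tan z p)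
      (D.tan z b) (D.nor z &j), hD.W_swap_swap hu]
    simp only [hs.tan_eq, hs.nor_nm, W_amb]
  have e1 : ∑ p, ∑ b, ∑ i, D.L u p b &i * D.cc u &i ~p ~b = -D.LCot u - D.HCot u := by
    have this p b i : D.L u p b &i * D.cc u &i ~p ~b = -(D.Lo u p b &i * D.cc u ~p &i ~b)
      - kd p b * (D.H u &i * D.cc u ~p &i ~b) := by rw [hs.L_eq_Lo_add, D.cc_swap]; ring
    have hH : D.HCot u = ∑ p, ∑ i, D.H u &i * D.cc u ~p &i ~p := by
      simp only [HCot, mul_sum]; exact sum_comm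
    simp only [this, sum_sub, sum_neg, ← mul_sum, sum_kd_mul', LCot, hH]
  have e2 : ∑ p, ∑ b, ∑ i, D.L u p p &i * D.cc u ~b &i ~b = k * D.HCot u := by
    have this p : ∑ b, ∑ i, D.L u p p &i * D.cc u ~b &i ~b
      = ∑ i, D.L u p p &i * ∑ b, D.cc u ~b &i ~b := by rw [sum_comm]; simp only [← mul_sum]
    simp only [this]; rw [sum_comm]; simp only [← sum_mul, hs.sum_L hk, HCot, mul_assoc, ← mul_sum]
  have e3 : ∑ p, ∑ b, ∑ i, D.L u p b &i * D.cc u ~b ~p &i = 0 :=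
    sum_eq_zero_of_antisymm fun p b => by
      simp only [hs.L_symm hD hu b p, D.cc_swap u ~b ~p, mul_neg, sum_neg]
  rw [hs.normal_h.divergence_eq, hs.normal_h.divergence_eq]
  simp only [h1, hs.pd_Cot_tan hD hu, sum_add, sum_sub, e1, e2, e3]; ring

lemma N2_eq (hs : Spec) (hD : D.Reg U V) (hu : u ∈ U) (hk : k = 4) (hm : 1 ≤ m) :
    D.N2 u = (3 * ((k + m : ℕ) : ℝ) - 10) / 6 * laplacian D.h D.Wtr u
    - 4 * (((k + m : ℕ) : ℝ) - 5) / 3 * divergence D.h D.cC1 u + D.J2CHO u := by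
  have hk0 : k ≠ 0 := by omega
  have hn : 3 ≤ k + m := by omega
  have hk' : (k : ℝ) = 4 := by exact_mod_cast hk
  have hm' : (1 : ℝ) ≤ m := by exact_mod_cast hm
  have hB := hs.LdivW_add_LdWtn hD hu hk0; have hbox := hs.sum_ddwc hD hu hn
  have hJ : ∑ e, D.pc u e e = 1 / (2 * ((k + m : ℕ) - 1 : ℝ)) * scalarCurv D.g (D.f u) := by
    have := hD.metric.mtr_schouten (hD.maps u hu) hn; rw [hs.normal.mtr] at this; exact this
  have hdd : ∑ a, ∑ b, ∑ e, D.ddwc u e e ~a ~b ~a ~b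
    = ∑ a, ∑ b, ∑ c, D.ddwc u ~c ~c ~a ~b ~a ~b + D.sddW u := by
    have h0 : D.sddW u = ∑ j, ∑ a, ∑ b, D.ddwc u &j &j ~a ~b ~a ~b := by
      simp only [sddW, hs.trT, hs.trA, sum_tg_nm, hs.nor_tg, ddW_zero0, sum_const_zero,
        zero_add, hs.tan_eq, hs.nor_nm, ddW_amb]
    simp only [sum_tg_nm, sum_add, h0]; rw [sum_rot fun j (a b) => D.ddwc u &j &j ~a ~b ~a ~b]
  have hP : ∑ a, ∑ x, D.pc u ~a x * D.wtr u x ~a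
    = ∑ a, ∑ b, D.Wtt u a b * D.pc u ~a ~b + D.sDW u + D.sWdH u := by
    simp only [sum_tg_nm, sum_add, add_assoc, hs.sDW_eq, hs.sWdH_eq, ← sum_add]
    refine sum_ext fun a => congrArg₂ _ (sum_ext fun b => ?_) (sum_ext fun j => ?_)
    · rw [wtr_comm hD hu, mul_comm, hs.Wtt_eq, wtr]
    · rw [wtr_comm hD hu, wtr, ← hs.Wtn_nm, hs.Dt_nm, hs.dH_nm]; ring
  have hBt : D.cBtr u = ∑ a, bach D.g (D.f u) ![~a, ~a]
    - 2 * ((k + m : ℕ) - 4 : ℝ) * D.HCot u + ((k + m : ℕ) - 4 : ℝ) * D.HHW u := by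
    have h1 : D.HCot u = -∑ a, ∑ j, D.H u &j * D.cc u &j ~a ~a := by
      simp only [HCot, mul_sum]; rw [sum_comm]; simp only [← sum_neg]
      exact sum_ext2 fun a j => by rw [D.cc_swap]; ring
    have h2 : D.HHW u = ∑ a, ∑ i, ∑ j, D.H u &i * D.H u &j * D.wc u ~a &i ~a &j := by
      simp only [HHW, wtr, mul_sum]; refine (sum_ext3 fun i j a => ?_).trans (sum_rot _).symm
      rw [D.wc_swap, hD.wc_swap' hu, neg_neg]
    rw [hs.cBtr_eq, h1, h2]; simp only [sum_add, ← mul_sum]; ring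
  have h1 : D.sWP u = _ := (by simp only [sWP, hs.trT] :
    D.sWP u = ∑ a, ∑ b, D.Wtt u a b * D.cP u a b).trans (hs.sum_mul_cP _)
  have h2 : D.sRicW u = _ := (by simp only [sRicW, hs.trT, mul_comm] : D.sRicW u
    = ∑ a, ∑ b, D.Wtt u a b * D.Ric u (D.tan u a) (D.tan u b)).trans (hs.sum_mul_Ric hn _)
  rw [← hs.Wtr_eq] at h1 h2; rw [← hs.sHLW_eq] at h1; have hlap := hD.lapWtr_eq hu
  have hC := hs.div_cC1 hD hu hk0; rw [hs.div_formHW hD hu hk0] at hC hlap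
  rw [hs.div_formdW hD hu hk0, hs.div_formLWtn hD hu hk0] at hlap; rw [hdd, hP, hJ] at hbox
  rw [N2, clearedJ, K1, K2, hs.div_formLW hD hu hk0, hs.div_formLWtn hD hu hk0,
    hs.sLC_eq_sub hD hu, J2CHO, ← hB, h1, hs.cPtr_eq hk0, hBt]
  have e1 : ((k + m : ℕ) : ℝ) - 1 ≠ 0 := by push_cast; rw [hk']; linarith
  have e2 : ((k + m : ℕ) : ℝ) - 2 ≠ 0 := by push_cast; rw [hk']; linarith
  have hR := hs.sRicN_eq hn; simp only [hk'] at hbox hC hlap hR h2 ⊢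
  generalize ((k + m : ℕ) : ℝ) = n at hbox hC hlap hR h2 e1 e2 ⊢
  have hS : -((n - 4) / (n - 1) * scalarCurv D.g (D.f u) * D.Wtr u)
    + (n - 4) / (n - 2) * D.sRicN u * D.Wtr u + 4 * (n - 5) / (3 * (n - 2)) * D.sRicW u
    = -(n - 4) * D.Wtr u * ∑ a, D.pc u ~a ~a
    + 4 * (n - 5) / 3 * ∑ a, ∑ b, D.Wtt u a b * D.pc u ~a ~b
    - 2 / 3 * (1 / (2 * (n - 1)) * scalarCurv D.g (D.f u)) * D.Wtr u := by
    rw [hR, h2]; field_simp; ring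
  linear_combination -1 / 3 * hlap - 1 / 3 * hbox - 2 * (n - 2) / 3 * hC - hS

end IsSpecialAt
end Special
end CoordData

section Charts
variable {k n : ℕ} {X Y : Type*} [TopologicalSpace X] [ChartedSpace (Coo n) X]
  [IsManifold (𝓡 n) ∞ X] [TopologicalSpace Y] [ChartedSpace (Coo k) Y] [IsManifold (𝓡 k) ∞ Y]
  {g : RiemMetric n X} {i : Y → X}

local notation "cX" => extChartAt (𝓡 n)
local notation "cY" => extChartAt (𝓡 k)

lemma mdifferentiableAt_chart_symm {x0 : X} {z}
    (hz : z ∈ (cX x0).target) : MDifferentiableAt (𝓡 n) (𝓡 n) (cX x0).symm z :=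
  (contMDiffOn_extChartAt_symm (n := ∞) x0).contMDiffAt ((isOpen_extChartAt_target x0).mem_nhds
    hz) |>.mdifferentiableAt (by simp)

lemma mfderiv_eq_comp {l : ℕ} {F : Coo l → X} {u : Coo l} (x0 : X)
    (hF : MDifferentiableAt (𝓡 l) (𝓡 n) F u) (hx : F u ∈ (cX x0).source)
    (v : Coo l) : (mfderiv (𝓡 l) (𝓡 n) F u v : Coo n)
    = mfderiv (𝓡 n) (𝓡 n) (cX x0).symm (cX x0 (F u)) (fderiv ℝ (fun z => cX x0 (F z)) u v) := by
  have h1 : MDifferentiableAt (𝓡 l) (𝓡 n) (fun z => cX x0 (F z)) u :=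
    (mdifferentiableAt_extChartAt (by simpa using hx)).comp u hF
  have h2 := mdifferentiableAt_chart_symm ((cX x0).map_source hx)
  have h3 : F =ᶠ[nhds u] (cX x0).symm ∘ fun z => cX x0 (F z) := by
    filter_upwards [hF.continuousAt.preimage_mem_nhds
      ((isOpen_extChartAt_source (I := 𝓡 n) x0).mem_nhds hx)] with z hz
    exact ((cX x0).left_inv hz).symm
  have h4 := ((h2.hasMFDerivAt.comp u h1.hasMFDerivAt).congr_of_eventuallyEq h3).mfderiv
  rw [mfderiv_eq_fderiv] at h4; exact congrArg (fun A : Coo l →L[ℝ] Coo n => A v) h4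

lemma fderiv_single_eq {l m : ℕ} {ψ : Coo l → Coo m} {u : Coo l} (h : DifferentiableAt ℝ ψ u)
    (a : Fin l) : fderiv ℝ ψ u (single a 1) = ∑ c, jac ψ u a c • single c (1 : ℝ) := by
  ext c; rw [← (EuclideanSpace.basisFun (Fin m) ℝ).sum_repr (fderiv ℝ ψ u _)]
  simp [jac, pd, hasFDerivAt_apply_coo h]

lemma inner_mfderiv {l : ℕ} {F : Coo l → X} {u : Coo l} (g : RiemMetric n X) (x0 : X)
    (hF : MDifferentiableAt (𝓡 l) (𝓡 n) F u) (hx : F u ∈ (cX x0).source)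
    (a b : Fin l) : g.inner (F u) (mfderiv (𝓡 l) (𝓡 n) F u (single a (1 : ℝ)))
        (mfderiv (𝓡 l) (𝓡 n) F u (single b (1 : ℝ)))
      = ap (jac (fun z => cX x0 (F z)) u) a fun c => ap (jac (fun z => cX x0 (F z)) u) b fun d =>
          coordMetric g x0 (cX x0 (F u)) c d := by
  have h1 : DifferentiableAt ℝ (fun z => cX x0 (F z)) u := mdifferentiableAt_iff_differentiableAt.1
      ((mdifferentiableAt_extChartAt (by simpa using hx)).comp u hF)
  set y := cX x0 (F u) with hy; have hyF : (cX x0).symm y = F u := (cX x0).left_inv hx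
  let G : X → Coo n →L[ℝ] Coo n →L[ℝ] ℝ := fun x => g.inner x
  let A : Coo n →L[ℝ] Coo n := mfderiv (𝓡 n) (𝓡 n) (cX x0).symm y
  have e a : (mfderiv (𝓡 l) (𝓡 n) F u (single a (1 : ℝ)) : Coo n)
    = ∑ c, jac (fun z => cX x0 (F z)) u a c • A (single c 1) := by
    rw [mfderiv_eq_comp x0 hF hx, fderiv_single_eq h1]
    exact (map_sum A _ _).trans (sum_congr rfl fun c _ => map_smul A _ _)
  change G (F u) (mfderiv (𝓡 l) (𝓡 n) F u (single a (1 : ℝ)) : Coo n)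
    (mfderiv (𝓡 l) (𝓡 n) F u (single b (1 : ℝ)) : Coo n) = ap _ a fun c => ap _ b
    fun d => G ((cX x0).symm y) (A (single c 1)) (A (single d 1))
  rw [hyF, e a, e b]
  simp only [map_sum, map_smul, ContinuousLinearMap.sum_apply, ContinuousLinearMap.smul_apply,
    smul_eq_mul, ap, mul_sum]
  rw [sum_comm]; exact sum_congr rfl fun _ _ => sum_congr rfl fun _ _ => mul_left_comm _ _ _

lemma smooth_coordMetric (g : RiemMetric n X) (x0 : X) (a b) :
    Sm (cX x0).target fun z => coordMetric g x0 z a b := by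
  have ho : IsOpen (cX x0).target := isOpen_extChartAt_target x0
  have hs := contMDiffOn_extChartAt_symm (I := 𝓡 n) (n := ∞) x0
  have hv a : ContMDiffOn (𝓡 n) (𝓡 n).tangent ∞ (fun z => (⟨(cX x0).symm z,
    mfderiv (𝓡 n) (𝓡 n) (cX x0).symm z (single a (1 : ℝ))⟩ :
    TangentBundle (𝓡 n) X)) (cX x0).target := by
    have h1 := hs.contMDiffOn_tangentMapWithin (m := ∞) (by simp) ho.uniqueMDiffOn
    have h2 : ContMDiffOn (𝓡 n) (𝓡 n).tangent ∞ (fun z => (⟨z, single a 1⟩ :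
      TangentBundle (𝓡 n) (Coo n))) (cX x0).target :=
      fun z _ => contMDiffWithinAt_vectorSpace_iff_contDiffWithinAt.2 contDiffWithinAt_const
    refine (h1.comp h2 fun z hz => hz).congr fun z hz => ?_
    simp only [Function.comp, tangentMapWithin, mfderivWithin_of_isOpen ho hz]
  have h3 : ContMDiffOn (𝓡 n) ((𝓡 n).prod 𝓘(ℝ)) ∞ (fun z => Bundle.TotalSpace.mk' ℝ
    (E := Bundle.Trivial X ℝ) ((cX x0).symm z) (coordMetric g x0 z a b))
    (cX x0).target := ContMDiffOn.clm_bundle_apply₂ (F₁ := Coo n) (F₂ := Coo n)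
    (g.contMDiff.comp_contMDiffOn hs) (hv a) (hv b)
  intro z hz; have h4 := h3 z hz; simp only [Bundle.contMDiffWithinAt_totalSpace] at h4
  exact h4.2.contDiffWithinAt

lemma injective_mfderiv_chart_symm {x0 : X} {z}
    (hz : z ∈ (cX x0).target) : Function.Injective (mfderiv (𝓡 n) (𝓡 n) (cX x0).symm z) := by
  have := isInvertible_mfderivWithin_extChartAt_symm (I := 𝓡 n) hz
  rw [ModelWithCorners.range_eq_univ, mfderivWithin_univ] at this; exact this.injective

lemma sum_smul_single {m : ℕ} (v : Fin m → ℝ) : WithLp.toLp 2 v = ∑ c, v c • single c (1 : ℝ) := by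
  ext c; simp [Pi.single_apply]

lemma reg_coordMetric (g : RiemMetric n X) (x0 : X) : MReg (coordMetric g x0) (cX x0).target where
  isOpen := isOpen_extChartAt_target x0
  smooth := smooth_coordMetric g x0
  posDef z hz := by
    let G : Coo n →L[ℝ] Coo n →L[ℝ] ℝ := g.inner ((cX x0).symm z)
    let A : Coo n →L[ℝ] Coo n := mfderiv (𝓡 n) (𝓡 n) (cX x0).symm z
    refine Matrix.PosDef.of_dotProduct_mulVec_pos ?_ fun v hv => ?_
    · ext a b
      exact g.symm _ _ _
    · have e : star v ⬝ᵥ (coordMetric g x0 z).mulVec v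
          = G (A (WithLp.toLp 2 v)) (A (WithLp.toLp 2 v)) := by
        rw [sum_smul_single]
        simp only [map_sum, map_smul, ContinuousLinearMap.sum_apply, ContinuousLinearMap.smul_apply,
          smul_eq_mul, dotProduct, Matrix.mulVec, mul_sum, star_trivial]
        rw [sum_comm]; refine sum_congr rfl fun c _ => sum_congr rfl fun d _ => ?_
        have : coordMetric g x0 z d c = G (A (single d 1)) (A (single c 1)) := rfl; rw [this]; ring
      rw [e]; refine g.pos _ _ fun h0 => hv ?_
      have : WithLp.toLp 2 v = 0 := injective_mfderiv_chart_symm hz (h0.trans (map_zero A).symm)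
      simpa using this

/-- The metric and the map in the preferred charts at `x0` and `y0`. -/
def coordsAt (g : RiemMetric n X) (i : Y → X) (y0 : Y) (x0 : X) : CoordData k n where
  g := coordMetric g x0
  f u := cX x0 (i ((cY y0).symm u))

variable (k n) in
/-- The part of the chart at `y0` that is mapped into the chart at `x0`. -/
def dom (i : Y → X) (y0 : Y) (x0 : X) : Set (Coo k) := (cY y0).target ∩
  (fun u => i ((cY y0).symm u)) ⁻¹' (cX x0).source

/-- The transition map from the chart at `y1` to the chart at `y0`. -/
def trans (y0 y1 : Y) (u : Coo k) : Coo k := cY y0 ((cY y1).symm u)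

variable (k n) in
/-- The points where the charts at `y0`, `y1` of `Y` and `x0`, `x1` of `X` are all defined, in the
chart at `y1`. -/
def overlap (i : Y → X) (y0 y1 : Y) (x0 x1 : X) : Set (Coo k) :=
  (cY y1).target ∩ (cY y1).symm ⁻¹' ((cY y0).source ∩
    i ⁻¹' ((cX x1).source ∩ (cX x0).source))

/-- An immersion. -/
structure IsImm (k n : ℕ) {X Y : Type*} [TopologicalSpace X] [ChartedSpace (Coo n) X]
    [TopologicalSpace Y] [ChartedSpace (Coo k) Y] (i : Y → X) : Prop where
  smooth : ContMDiff (𝓡 k) (𝓡 n) ∞ i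
  inj : ∀ y : Y, Function.Injective (mfderiv (𝓡 k) (𝓡 n) i y)

namespace IsImm
variable {y0 y1 : Y} {x0 x1 : X} {u : Coo k}

lemma smooth_symm (hi : IsImm k n i) (y0 : Y) :
    ContMDiffOn (𝓡 k) (𝓡 n) ∞ (fun u => i ((cY y0).symm u))
    (cY y0).target := hi.smooth.comp_contMDiffOn (contMDiffOn_extChartAt_symm y0)

lemma isOpen_dom (hi : IsImm k n i) (y0 : Y) (x0 : X) : IsOpen (dom k n i y0 x0) :=
  (hi.smooth_symm y0).continuousOn.isOpen_inter_preimage (isOpen_extChartAt_target y0)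
    (isOpen_extChartAt_source x0)

lemma mdiffAt (hi : IsImm k n i) (hu : u ∈ (cY y0).target) :
    MDifferentiableAt (𝓡 k) (𝓡 n) (fun u => i ((cY y0).symm u)) u :=
  ((hi.smooth_symm y0).contMDiffAt ((isOpen_extChartAt_target y0).mem_nhds hu)).mdifferentiableAt
    (by simp)

lemma reg (hi : IsImm k n i) (g : RiemMetric n X) (y0 : Y) (x0 : X) :
    (coordsAt g i y0 x0).Reg (dom k n i y0 x0) (cX x0).target where
  isOpen := hi.isOpen_dom y0 x0
  smooth := ((contMDiffOn_extChartAt (x := x0)).comp ((hi.smooth_symm y0).mono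
    Set.inter_subset_left) fun u hu => by simpa using hu.2).contDiffOn
  maps u hu := (cX x0).map_source hu.2
  metric := reg_coordMetric g x0
  imm u hu := by
    rw [Fintype.linearIndependent_iff]; intro c hc
    have hd : DifferentiableAt ℝ (coordsAt g i y0 x0).f u := mdifferentiableAt_iff_differentiableAt.1
      ((mdifferentiableAt_extChartAt (by simpa using hu.2)).comp u (hi.mdiffAt hu.1))
    have h0 : fderiv ℝ (coordsAt g i y0 x0).f u (WithLp.toLp 2 c) = 0 := by
      rw [sum_smul_single c, map_sum, ← WithLp.toLp_zero, ← hc, WithLp.toLp_sum]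
      refine sum_congr rfl fun a _ => ?_; rw [map_smul, fderiv_single_eq hd, ← sum_smul_single]; rfl
    have h1 := mfderiv_eq_comp x0 (hi.mdiffAt hu.1) hu.2 (WithLp.toLp 2 c)
    have h2 := mdifferentiableAt_chart_symm hu.1
    have h3 := mfderiv_comp u (hi.smooth.mdifferentiable (by simp) _) h2
    have h4 : mfderiv (𝓡 k) (𝓡 n) i _ (mfderiv (𝓡 k) (𝓡 k) (cY y0).symm u (WithLp.toLp 2 c)) = 0 :=
      (congrArg (fun A : Coo k →L[ℝ] Coo n => A (WithLp.toLp 2 c)) h3).symm.trans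
      (h1.trans ((congrArg _ h0).trans (map_zero _)))
    have h5 := injective_mfderiv_chart_symm hu.1 ((hi.inj _ (h4.trans (map_zero _).symm)).trans
      (map_zero _).symm)
    exact fun a => congrFun (congrArg WithLp.ofLp h5) a

lemma areaDensity_eq (hi : IsImm k n i) (g : RiemMetric n X) (hu : u ∈ dom k n i y0 x0) :
    areaDensity g i y0 u = √((coordsAt g i y0 x0).h u).det := by
  rw [areaDensity]; congr 2; ext a b; rw [CoordData.h_eq_ap]
  exact inner_mfderiv g x0 (hi.mdiffAt hu.1) hu.2 a b

lemma change (hi : IsImm k n i) (g : RiemMetric n X) (y0 y1 : Y) (x0 x1 : X) :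
    CoordData.Change (coordsAt g i y1 x1) (coordsAt g i y0 x0) (trans y0 y1)
    (fun z => cX x0 ((cX x1).symm z)) (overlap k n i y0 y1 x0 x1) (dom k n i y0 x0)
    ((cX x1).target ∩ (cX x1).symm ⁻¹' (cX x0).source) (cX x0).target := by
  have hV : IsOpen ((cX x1).target ∩ (cX x1).symm ⁻¹' (cX x0).source) :=
    (continuousOn_extChartAt_symm x1).isOpen_inter_preimage (isOpen_extChartAt_target x1)
    (isOpen_extChartAt_source x0)
  have hr : (coordsAt g i y1 x1).Reg (overlap k n i y0 y1 x0 x1) ((cX x1).target ∩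
    (cX x1).symm ⁻¹' (cX x0).source) := by
    refine (hi.reg g y1 x1).mono (fun u hu => ⟨hu.1, hu.2.2.1⟩) ?_ Set.inter_subset_left hV
      fun u hu => ⟨(cX x1).map_source hu.2.2.1, ?_⟩
    · exact (continuousOn_extChartAt_symm y1).isOpen_inter_preimage (isOpen_extChartAt_target y1)
        ((isOpen_extChartAt_source y0).inter (((isOpen_extChartAt_source x1).inter
          (isOpen_extChartAt_source x0)).preimage hi.smooth.continuous))
    · rw [Set.mem_preimage, coordsAt, (cX x1).left_inv hu.2.2.1]
      exact hu.2.2.2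
  refine ⟨hr, hi.reg g y0 x0, ⟨hr.metric, reg_coordMetric g x0, ?_, ?_, ?_⟩, ?_, ?_, ?_⟩
  · exact ((contMDiffOn_extChartAt (x := x0)).comp ((contMDiffOn_extChartAt_symm x1).mono
      Set.inter_subset_left) fun u hu => by simpa using hu.2).contDiffOn
  · exact fun z hz => (cX x0).map_source hz.2
  · exact fun z hz a b => inner_mfderiv g x0 (mdifferentiableAt_chart_symm hz.1) hz.2 a b
  · exact ((contMDiffOn_extChartAt (x := y0)).comp ((contMDiffOn_extChartAt_symm y1).mono
      Set.inter_subset_left) fun u hu => by simpa using hu.2.1).contDiffOn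
  · intro u hu
    refine ⟨(cY y0).map_source hu.2.1, ?_⟩; rw [Set.mem_preimage, trans, (cY y0).left_inv hu.2.1]
    exact hu.2.2.2
  · intro u hu
    simp only [coordsAt, trans]; rw [(cX x1).left_inv hu.2.2.1, (cY y0).left_inv hu.2.1]

end IsImm
end Charts

section Jacobi
variable {m : ℕ} {x : Coo m}

lemma pd_det {ι : Type*} [Fintype ι] [DecidableEq ι] {A : Coo m → Matrix ι ι ℝ}
    (hA : ∀ i j, DifferentiableAt ℝ (fun z => A z i j) x) (a) : pd a (fun z => (A z).det) x
    = ∑ j, ∑ i, (A x).adjugate j i * pd a (fun z => A z i j) x := by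
  have hp : ∀ σ : Equiv.Perm ι, pd a (fun z => ∏ i, A z (σ i) i) x
    = ∑ j, (∏ i ∈ univ.erase j, A x (σ i) i) * pd a (fun z => A z (σ j) j) x := by
    intro σ; rw [pd, fderiv_finsetProd fun i _ => hA (σ i) i]; simp [pd]
  have hd : ∀ σ : Equiv.Perm ι, DifferentiableAt ℝ (fun z => ∏ i, A z (σ i) i) x := fun σ =>
    (HasFDerivAt.finsetProd fun i _ => (hA (σ i) i).hasFDerivAt).differentiableAt
  simp only [Matrix.det_apply']; rw [pd_sum fun σ _ => (hd σ).const_mul _]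
  simp only [pd_const_mul _ (hd _), hp, mul_sum]; rw [sum_comm]; refine sum_congr rfl fun j _ => ?_
  have : ∑ i, (A x).adjugate j i * pd a (fun z => A z i j) x
    = ((A x).updateCol j fun i => pd a (fun z => A z i j) x).det := by
    rw [← Matrix.cramer_apply, Matrix.cramer_eq_adjugate_mulVec]; rfl
  rw [this, Matrix.det_apply']; refine sum_congr rfl fun σ _ => ?_
  rw [← Finset.mul_prod_erase _ _ (mem_univ j), Matrix.updateCol_self, mul_comm (∏ i ∈ _, _)]
  refine congrArg _ (congrArg _ (Finset.prod_congr rfl fun i hi => ?_))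
  rw [Matrix.updateCol_ne (Finset.ne_of_mem_erase hi)]

namespace MReg
variable {h : MetricField m} {U : Set (Coo m)}

lemma smooth_sqrt_det (hh : MReg h U) : Sm U fun z => √(h z).det :=
  (Sm.det hh.smooth).sqrt fun z hz => hh.det_ne hz

lemma pd_sqrt_det (hh : MReg h U) (hx : x ∈ U) (c) :
    pd c (fun z => √(h z).det) x = √(h x).det * ∑ a, Γ h x a c a := by
  have hdp := (hh.posDef x hx).det_pos
  have h1 : pd c (fun z => (h z).det) x = (h x).det * (2 * ∑ a, Γ h x a c a) := by
    have hi i j : (h x).adjugate j i = (h x).det * (h x)⁻¹ j i := by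
      rw [Matrix.inv_def, Matrix.smul_apply, Ring.inverse_eq_inv', smul_eq_mul,
        mul_inv_cancel_left₀ hdp.ne']
    rw [pd_det fun i j => (hh.smooth i j).diffAt hh hx]
    simp only [hi, mul_assoc, ← mul_sum, hh.pd_metric hx, sum_add, mul_add]
    rw [← mul_add, two_mul]; refine congrArg _ ?_; refine congrArg₂ _ ?_ ?_
    · calc _ = ∑ i, ∑ d, Γ h x d c i * ∑ j, h x d j * (h x)⁻¹ j i := by
            simp only [mul_sum]; rw [sum_comm]; refine sum_congr rfl fun i _ => ?_; rw [sum_comm]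
            exact sum_congr rfl fun _ _ => sum_congr rfl fun _ _ => by ring
        _ = _ := by simp [hh.mul_inv hx]
    · calc _ = ∑ j, ∑ d, Γ h x d c j * ∑ i, (h x)⁻¹ j i * h x i d := by
            simp only [mul_sum]; refine sum_congr rfl fun i _ => ?_; rw [sum_comm]
            exact sum_congr rfl fun _ _ => sum_congr rfl fun _ _ => by ring
        _ = _ := by simp [hh.inv_mul hx]
  have h2 : pd c (fun z => √(h z).det) x = (2 * √(h x).det)⁻¹ * pd c (fun z => (h z).det) x := by
    have hd := (Sm.det hh.smooth).diffAt hh hx; rw [pd, (hd.hasFDerivAt.sqrt hdp.ne').fderiv]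
    simp [pd]
  rw [h2, h1]; have h3 := Real.sq_sqrt hdp.le; have h4 := (Real.sqrt_pos.2 hdp).ne'; field_simp
  rw [h3]

lemma sqrt_det_mul_divergence (hh : MReg h U) (hx : x ∈ U) {V : Coo m → Fin m → ℝ}
    (hV : ∀ a, Sm U fun z => V z a) : √(h x).det * divergence h V x
    = ∑ a, pd a (fun z => √(h z).det * ∑ b, (h z)⁻¹ a b * V z b) x := by
  set v : Coo m → Fin m → ℝ := fun z a => ∑ b, (h z)⁻¹ a b * V z b with hv
  have hvs a : Sm U fun z => v z a := Sm.sum fun b _ => (hh.smooth_inv a b).mul (hV b)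
  have hVv : ∀ z ∈ U, ∀ b, V z b = ∑ c, h z b c * v z c := by
    intro z hz b; simp only [hv, mul_sum]; rw [sum_comm]
    simp only [← mul_assoc, ← sum_mul, hh.mul_inv hz]; simp
  have h1 a b : pd a (fun z => V z b) x - ∑ c, Γ h x c a b * V x c
    = ∑ c, h x b c * (pd a (fun z => v z c) x + ∑ d, Γ h x c a d * v x d) := by
    rw [pd_congr hh hx fun z hz => hVv z hz b,
      pd_sum fun c _ => ((hh.smooth b c).mul (hvs c)).diffAt hh hx]
    simp only [pd_mul ((hh.smooth b _).diffAt hh hx) ((hvs _).diffAt hh hx),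
      hh.pd_metric hx, hVv x hx, sum_add, add_mul, mul_add, sum_mul, mul_sum, mul_assoc]
    have e1 : ∑ c, ∑ d, v x c * (Γ h x d a b * h x d c)
      = ∑ c, ∑ d, Γ h x c a b * (h x c d * v x d) := by
      rw [sum_comm]; exact sum_congr rfl fun _ _ => sum_congr rfl fun _ _ => by ring
    have e2 : ∑ c, ∑ d, v x c * (Γ h x d a c * h x b d)
      = ∑ c, ∑ d, h x b c * (Γ h x c a d * v x d) := by
      rw [sum_comm]; exact sum_congr rfl fun _ _ => sum_congr rfl fun _ _ => by ring
    rw [e1, e2]; ring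
  have h2 : divergence h V x = ∑ a, (pd a (fun z => v z a) x + (∑ d, Γ h x d a d) * v x a) := by
    rw [divergence_eq_sum]; simp only [h1, mtr, mul_sum]
    have : ∀ a b c (E : ℝ), (h x)⁻¹ a b * (h x b c * E) = (h x)⁻¹ a b * h x b c * E :=
      fun _ _ _ _ => (mul_assoc _ _ _).symm
    simp only [this, sum_comm (γ := Fin m) (f := fun b c => (h x)⁻¹ _ b * h x b c * _),
      ← sum_mul, hh.inv_mul hx]
    simp only [ite_mul, one_mul, zero_mul, sum_ite_eq, mem_univ, if_true, sum_add, sum_mul]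
    refine congrArg _ ?_; rw [sum_comm]
    exact sum_congr rfl fun _ _ => sum_congr rfl fun _ _ => by rw [hh.christoffel_symm hx]
  rw [h2, mul_sum]; refine sum_congr rfl fun a _ => ?_
  rw [pd_mul (hh.smooth_sqrt_det.diffAt hh hx) ((hvs a).diffAt hh hx), hh.pd_sqrt_det hx]; ring

end MReg

lemma divergence_sum {ι : Type*} {h : MetricField m} {U : Set (Coo m)} (hh : MReg h U)
    (hx : x ∈ U) {s : Finset ι} {V : ι → Coo m → Fin m → ℝ} (hV : ∀ j a, Sm U fun z => V j z a) :
    divergence h (fun z a => ∑ j ∈ s, V j z a) x = ∑ j ∈ s, divergence h (V j) x := by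
  simp only [divergence_eq_sum, mtr]; rw [sum_comm (s := s)]; refine sum_congr rfl fun a _ => ?_
  rw [sum_comm (s := s)]; refine sum_congr rfl fun b _ => ?_
  rw [pd_sum fun j _ => (hV j b).diffAt hh hx, ← mul_sum, Finset.sum_sub_distrib]
  simp only [mul_sum]; rw [sum_comm (s := s)]

lemma divergence_zero {h : MetricField m} : divergence h (fun _ _ => 0) x = 0 := by
  simp [divergence_eq_sum, pd_const, mtr]

lemma MReg.smooth_divergence {h : MetricField m} {U : Set (Coo m)} (hh : MReg h U)
    {V : Coo m → Fin m → ℝ} (hV : ∀ a, Sm U fun z => V z a) : Sm U (divergence h V) :=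
  Sm.sum fun a _ => Sm.sum fun b _ => (hh.smooth_inv a b).mul (hh.smooth_cov (fun _ => hV _) _)

end Jacobi

section Integrals

open MeasureTheory

variable {m : ℕ} {T K : Set (Coo m)} {F : Coo m → ℝ}

lemma integrableOn_of_compact (hT : IsOpen T) (hF : ContinuousOn F T) (hK : IsCompact K)
    (hKT : K ⊆ T) (h0 : ∀ u ∈ T, u ∉ K → F u = 0) : IntegrableOn F T :=
  ((hF.mono hKT).integrableOn_compact hK).of_forall_sdiff_eq_zero hT.measurableSet
    fun u hu => h0 u hu.1 hu.2

lemma integral_pd_eq_zero (hT : IsOpen T) (hF : Sm T F) (hK : IsCompact K) (hKT : K ⊆ T)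
    (h0 : ∀ u ∈ T, u ∉ K → F u = 0) (a) : ∫ u in T, pd a F u = 0 := by
  set G := T.indicator F with hG
  have hFG : ∀ u ∈ T, G =ᶠ[nhds u] F := fun u hu => by
    filter_upwards [hT.mem_nhds hu] with z hz using Set.indicator_of_mem hz F
  have hG0 : ∀ u ∉ K, G u = 0 := fun u hu => by
    by_cases hT' : u ∈ T
    · rw [hG, Set.indicator_of_mem hT', h0 u hT' hu]
    · exact Set.indicator_of_notMem hT' F
  have hc : ContDiff ℝ 1 G := contDiff_iff_contDiffAt.2 fun u => by
    by_cases hu : u ∈ K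
    · exact ((hF.contDiffAt hT (hKT hu)).of_le (by simp)).congr_of_eventuallyEq (hFG u (hKT hu))
    · refine (contDiffAt_const (c := (0 : ℝ))).congr_of_eventuallyEq ?_
      filter_upwards [hK.isClosed.isOpen_compl.mem_nhds hu] with z hz using hG0 z hz
  have hs : HasCompactSupport G := HasCompactSupport.intro hK hG0
  have hi1 : Integrable G := hc.continuous.integrable_of_hasCompactSupport hs
  have hi2 : Integrable fun u => fderiv ℝ G u (single a 1) :=
    ((hc.continuous_fderiv (by simp)).clm_apply continuous_const).integrable_of_hasCompactSupport
      (hs.fderiv_apply ℝ _)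
  have h1 := integral_mul_fderiv_eq_neg_fderiv_mul_of_integrable (f := fun _ => (1 : ℝ))
    (g := G) (v := single a 1) (μ := volume) (by simp) (by simpa using hi2)
    (by simpa using hi1) (fun _ _ => differentiableAt_const _)
    (fun u _ => hc.differentiable (by simp) u)
  simp only [one_mul, fderiv_fun_const, Pi.zero_apply, ContinuousLinearMap.zero_apply, zero_mul,
    integral_zero, neg_zero] at h1
  rw [setIntegral_congr_fun hT.measurableSet fun u hu => pd_congr_ev (a := a) (hFG u hu).symm]
  refine (setIntegral_eq_integral_of_forall_compl_eq_zero fun u hu => ?_).trans h1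
  · rw [pd]
    have : G =ᶠ[nhds u] fun _ => 0 := by
      filter_upwards [hK.isClosed.isOpen_compl.mem_nhds fun h => hu (hKT h)] with z hz using hG0 z hz
    rw [this.fderiv_eq]; simp

end Integrals

section Forms

open MeasureTheory

variable {k n : ℕ} {X Y : Type*} [TopologicalSpace X] [ChartedSpace (Coo n) X]
  [IsManifold (𝓡 n) ∞ X] [TopologicalSpace Y] [ChartedSpace (Coo k) Y] [IsManifold (𝓡 k) ∞ Y]
  {g : RiemMetric n X} {i : Y → X} {y0 y1 : Y} {x0 x1 : X} {u : Coo k} {a : Fin k}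

local notation "cX" => extChartAt (𝓡 n)
local notation "cY" => extChartAt (𝓡 k)

variable (n) in
/-- A smooth function on `Y`, given in charts. -/
structure IsScalar (i : Y → X) (S : Y → X → Coo k → ℝ) : Prop where
  smooth : ∀ y x, Sm (dom k n i y x) (S y x)
  nat : ∀ {y0 y1 x0 x1 u}, u ∈ overlap k n i y0 y1 x0 x1 → S y1 x1 u = S y0 x0 (trans y0 y1 u)

variable (n) in
/-- A smooth one-form on `Y`, given in charts. -/
structure IsForm (i : Y → X) (θ : Y → X → Coo k → Fin k → ℝ) : Prop where
  smooth : ∀ y x a, Sm (dom k n i y x) fun u => θ y x u a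
  nat : ∀ {y0 y1 x0 x1 u}, u ∈ overlap k n i y0 y1 x0 x1 → ∀ a,
    θ y1 x1 u a = ap (jac (trans y0 y1) u) a fun b => θ y0 x0 (trans y0 y1 u) b

/-- The function on `Y` given by a family of functions in charts. -/
def onY (i : Y → X) (S : Y → X → Coo k → ℝ) (y : Y) : ℝ := S y (i y) (cY y y)

lemma IsScalar.onY_eq {S : Y → X → Coo k → ℝ} (hS : IsScalar n i S)
    (hu : u ∈ dom k n i y0 x0) : onY i S ((cY y0).symm u) = S y0 x0 u := by
  set y := (cY y0).symm u with hy; have h1 : (cY y).symm (cY y y) = y := extChartAt_to_inv y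
  have h2 : trans y0 y (cY y y) = u := by rw [trans, h1, hy, (cY y0).right_inv hu.1]
  rw [onY, hS.nat (y0 := y0) (x0 := x0) ⟨mem_extChartAt_target y, ?_⟩, h2]
  rw [Set.mem_preimage, h1]; exact ⟨(cY y0).map_target hu.1, mem_extChartAt_source _, hu.2⟩

lemma mem_dom (hu : u ∈ (cY y0).target) : u ∈ dom k n i y0 (i ((cY y0).symm u)) :=
  ⟨hu, mem_extChartAt_source (I := 𝓡 n) (i ((cY y0).symm u))⟩

lemma mem_dom_self (y : Y) : cY y y ∈ dom k n i y (i y) := by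
  have := mem_dom (n := n) (i := i) (mem_extChartAt_target (I := 𝓡 k) y)
  rwa [extChartAt_to_inv] at this

lemma IsImm.sm_target (hi : IsImm k n i) {F : Coo k → ℝ} (hF : ∀ x0, Sm (dom k n i y0 x0) F) :
    Sm (cY y0).target F := fun u hu =>
  ((hF _).contDiffAt (hi.isOpen_dom y0 _) (mem_dom hu)).contDiffWithinAt

lemma IsImm.sm_onY (hi : IsImm k n i) {S : Y → X → Coo k → ℝ} (hS : IsScalar n i S)
    (y0 : Y) : Sm (cY y0).target fun u => onY i S ((cY y0).symm u) :=
  hi.sm_target fun x0 => (hS.smooth y0 x0).congr fun _ hu => hS.onY_eq hu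

lemma IsImm.sm_areaDensity (hi : IsImm k n i) (g : RiemMetric n X) (y0 : Y) :
    Sm (cY y0).target (areaDensity g i y0) :=
  hi.sm_target fun x0 => (hi.reg g y0 x0).reg_h.smooth_sqrt_det.congr fun _ hu =>
    hi.areaDensity_eq g hu

lemma IsForm.div {θ : Y → X → Coo k → Fin k → ℝ} (hθ : IsForm n i θ) (hi : IsImm k n i)
    (g : RiemMetric n X) : IsScalar n i fun y x => divergence (coordsAt g i y x).h (θ y x) where
  smooth y x := (hi.reg g y x).reg_h.smooth_divergence (hθ.smooth y x)
  nat {y0 y1 x0 x1 _} hu := (hi.change g y0 y1 x0 x1).divergence_eq hu (hθ.smooth y0 x0)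
    fun _ hz => hθ.nat hz

lemma IsForm.smul {θ : Y → X → Coo k → Fin k → ℝ} (hθ : IsForm n i θ) {ρ : Y → ℝ}
    (hρ : ContMDiff (𝓡 k) 𝓘(ℝ) ∞ ρ) : IsForm n i fun y x u a => ρ ((cY y).symm u) * θ y x u a where
  smooth y x a := Sm.mul (((hρ.comp_contMDiffOn (contMDiffOn_extChartAt_symm y)).contDiffOn).mono
    Set.inter_subset_left) (hθ.smooth y x a)
  nat {y0 y1 x0 x1 u} hu a := by
    rw [hθ.nat hu, trans, (cY y0).left_inv hu.2.1]; simp only [ap, mul_sum, mul_left_comm]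

lemma IsForm.eq_of_mem {θ : Y → X → Coo k → Fin k → ℝ} (hθ : IsForm n i θ)
    (h0 : u ∈ dom k n i y0 x0) (h1 : u ∈ dom k n i y0 x1) : θ y0 x1 u a = θ y0 x0 u a := by
  have h : ∀ z ∈ (cY y0).target, trans y0 y0 z = z := fun z hz => (cY y0).right_inv hz
  have hj b : jac (trans y0 y0) u a b = if a = b then 1 else 0 :=
    (pd_congr (isOpen_extChartAt_target y0) h0.1 fun z hz => by rw [h z hz]).trans (by
      change fderiv ℝ (EuclideanSpace.proj (𝕜 := ℝ) b) u _ = _; rw [ContinuousLinearMap.fderiv]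
      simp [eq_comm])
  rw [hθ.nat (y0 := y0) (x0 := x0) ⟨h0.1, (cY y0).map_target h0.1, h1.2, h0.2⟩, h u h0.1]
  simp [ap, hj]

lemma det_fderiv {ψ : Coo k → Coo k} (h : DifferentiableAt ℝ ψ u) :
    (fderiv ℝ ψ u).det = (Matrix.of (jac ψ u)).det := by
  rw [ContinuousLinearMap.det, ← LinearMap.det_toMatrix (EuclideanSpace.basisFun (Fin k) ℝ).toBasis,
    ← Matrix.det_transpose]
  congr 1; ext a b; simp [LinearMap.toMatrix_apply, jac, pd, hasFDerivAt_apply_coo h]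

lemma IsImm.areaDensity_trans (hi : IsImm k n i) (g : RiemMetric n X) (hu : u ∈ (cY y1).target)
    (h0 : (cY y1).symm u ∈ (cY y0).source) :
    HasFDerivAt (trans y0 y1) (fderiv ℝ (trans y0 y1) u) u ∧ areaDensity g i y1 u
    = |(fderiv ℝ (trans y0 y1) u).det| * areaDensity g i y0 (trans y0 y1 u) := by
  set x := i ((cY y1).symm u)
  have hm : u ∈ overlap k n i y0 y1 x x :=
    ⟨hu, h0, mem_extChartAt_source (I := 𝓡 n) x, mem_extChartAt_source (I := 𝓡 n) x⟩
  have hc := hi.change g y0 y1 x x; have hd : DifferentiableAt ℝ (trans y0 y1) u := hc.diffAt hm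
  refine ⟨hd.hasFDerivAt, ?_⟩
  have hh : (coordsAt g i y1 x).h u = Matrix.of (jac (trans y0 y1) u) *
    (coordsAt g i y0 x).h (trans y0 y1 u) * (Matrix.of (jac (trans y0 y1) u)).transpose := by
    ext a b; rw [← ap_ap_eq_matrix]; exact hc.h_eq hm a b
  rw [hi.areaDensity_eq g (x0 := x) (mem_dom hu), hi.areaDensity_eq g (hc.maps u hm), hh, det_fderiv hd,
    Matrix.det_mul, Matrix.det_mul, Matrix.det_transpose, mul_right_comm, ← sq,
    Real.sqrt_mul (sq_nonneg _), Real.sqrt_sq_eq_abs]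

lemma IsImm.integral_chart (hi : IsImm k n i) (g : RiemMetric n X) {G : Y → ℝ}
    (hG : ∀ y, y ∉ (cY y0).source ∩ (cY y1).source → G y = 0) :
    ∫ u in (cY y0).target, G ((cY y0).symm u) * areaDensity g i y0 u = ∫ u in (cY y1).target,
    G ((cY y1).symm u) * areaDensity g i y1 u := by
  have ho : ∀ y0 y1 : Y, MeasurableSet ((cY y1).target ∩
      (cY y1).symm ⁻¹' (cY y0).source) := fun y0 y1 =>
    ((continuousOn_extChartAt_symm y1).isOpen_inter_preimage (isOpen_extChartAt_target y1)
      (isOpen_extChartAt_source y0)).measurableSet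
  have himg : trans y0 y1 '' ((cY y1).target ∩ (cY y1).symm ⁻¹' (cY y0).source) = (cY y0).target ∩
    (cY y0).symm ⁻¹' (cY y1).source := by
    ext v; constructor
    · rintro ⟨u, hu, rfl⟩
      refine ⟨(cY y0).map_source hu.2, ?_⟩; rw [Set.mem_preimage, trans, (cY y0).left_inv hu.2]
      exact (cY y1).map_target hu.1
    · intro hv
      refine ⟨trans y1 y0 v, ⟨(cY y1).map_source hv.2, ?_⟩, ?_⟩
      · rw [Set.mem_preimage, trans, (cY y1).left_inv hv.2]
        exact (cY y0).map_target hv.1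
      · rw [trans, trans, (cY y1).left_inv hv.2, (cY y0).right_inv hv.1]
  have hinj : Set.InjOn (trans y0 y1) ((cY y1).target ∩ (cY y1).symm ⁻¹' (cY y0).source) := by
    intro u hu v hv h; exact (cY y1).symm.injOn hu.1 hv.1 ((cY y0).injOn hu.2 hv.2 h)
  have hr : ∀ y0 y1 : Y, (∀ y, y ∉ (cY y1).source → G y = 0) →
      ∫ u in (cY y0).target, G ((cY y0).symm u) * areaDensity g i y0 u
        = ∫ u in (cY y0).target ∩ (cY y0).symm ⁻¹' (cY y1).source,
          G ((cY y0).symm u) * areaDensity g i y0 u := fun y0 y1 h =>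
    setIntegral_eq_of_subset_of_forall_sdiff_eq_zero (isOpen_extChartAt_target y0).measurableSet
      Set.inter_subset_left fun u hu => by rw [h _ fun h => hu.2 ⟨hu.1, h⟩, zero_mul]
  rw [hr y0 y1 fun y h => hG y fun h' => h h'.2, hr y1 y0 fun y h => hG y fun h' => h h'.1, ← himg,
    integral_image_eq_integral_abs_det_fderiv_smul volume (ho y0 y1) (fun u hu =>
    (hi.areaDensity_trans g hu.1 hu.2).1.hasFDerivWithinAt) hinj]
  refine setIntegral_congr_fun (ho y0 y1) fun u hu => ?_
  simp only [(hi.areaDensity_trans g hu.1 hu.2).2, smul_eq_mul]; rw [trans, (cY y0).left_inv hu.2]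
  ring

variable [T2Space Y] [CompactSpace Y]

lemma IsImm.integrableOn_chart (hi : IsImm k n i) (g : RiemMetric n X) {G : Y → ℝ}
    (hG : ContinuousOn (fun u => G ((cY y0).symm u)) (cY y0).target)
    {K : Set Y} (hK : IsClosed K) (hKs : K ⊆ (cY y0).source) (h0 : ∀ y ∉ K, G y = 0) :
    IntegrableOn (fun u => G ((cY y0).symm u) * areaDensity g i y0 u) (cY y0).target := by
  refine integrableOn_of_compact (K := cY y0 '' K) (isOpen_extChartAt_target y0)
    (hG.mul (hi.sm_areaDensity g y0).continuousOn)
    (hK.isCompact.image_of_continuousOn ((continuousOn_extChartAt y0).mono hKs)) ?_ ?_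
  · rintro _ ⟨y, hy, rfl⟩
    exact (cY y0).map_source (hKs hy)
  · intro u hu hn
    rw [h0 _ fun h => hn ⟨_, h, (cY y0).right_inv hu⟩, zero_mul]

lemma IsImm.div_eq_zero (hi : IsImm k n i) (g : RiemMetric n X) {θ : Y → X → Coo k → Fin k → ℝ}
    {K : Set Y} (hK : IsClosed K) {y : Y} (hy : y ∉ K)
    (h0 : ∀ u ∈ dom k n i y (i y), (cY y).symm u ∉ K → ∀ a, θ y (i y) u a = 0) :
    onY i (fun y x => divergence (coordsAt g i y x).h (θ y x)) y = 0 := by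
  have ho := ((continuousOn_extChartAt_symm (I := 𝓡 k) y).isOpen_inter_preimage
    (isOpen_extChartAt_target y) hK.isOpen_compl).inter (hi.isOpen_dom y (i y))
  have hr := (hi.reg g y (i y)).reg_h.mono Set.inter_subset_right ho
  have hm : cY y y ∈ ((cY y).target ∩ (cY y).symm ⁻¹' Kᶜ) ∩ dom k n i y (i y) := by
    refine ⟨⟨mem_extChartAt_target y, ?_⟩, mem_dom_self y⟩
    rwa [Set.mem_preimage, extChartAt_to_inv]
  exact (divergence_congr hr hm fun z hz a => h0 z hz.2 hz.1.2 a).trans divergence_zero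

lemma IsImm.integral_div_chart (hi : IsImm k n i) (g : RiemMetric n X)
    {θ : Y → X → Coo k → Fin k → ℝ} (hθ : IsForm n i θ) {K : Set Y} (hK : IsClosed K)
    (hKs : K ⊆ (cY y0).source)
    (h0 : ∀ x, ∀ u ∈ dom k n i y0 x, (cY y0).symm u ∉ K → ∀ a, θ y0 x u a = 0) :
    ∫ u in (cY y0).target, onY i (fun y x => divergence (coordsAt g i y x).h (θ y x))
    ((cY y0).symm u) * areaDensity g i y0 u = 0 := by
  have ho : IsOpen (cY y0).target := isOpen_extChartAt_target y0
  set v : Fin k → Coo k → ℝ := fun a u => areaDensity g i y0 u *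
    ∑ b, ((coordsAt g i y0 (i ((cY y0).symm u))).h u)⁻¹ a b * θ y0 (i ((cY y0).symm u)) u b with hv
  have hvx x : ∀ u ∈ dom k n i y0 x, ∀ a, v a u = √((coordsAt g i y0 x).h u).det *
    ∑ b, ((coordsAt g i y0 x).h u)⁻¹ a b * θ y0 x u b := by
    intro u hu a
    have : (coordsAt g i y0 (i ((cY y0).symm u))).h u = (coordsAt g i y0 x).h u := by
      ext a b; rw [CoordData.h_eq_ap, CoordData.h_eq_ap]
      exact (inner_mfderiv g _ (hi.mdiffAt hu.1) (mem_dom hu.1).2 a b).symm.trans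
        (inner_mfderiv g x (hi.mdiffAt hu.1) hu.2 a b)
    simp only [hv, hi.areaDensity_eq g hu, this, hθ.eq_of_mem hu (mem_dom hu.1)]
  have hvs a : Sm (cY y0).target (v a) := hi.sm_target fun x =>
    ((hi.reg g y0 x).reg_h.smooth_sqrt_det.mul (Sm.sum fun b _ =>
      ((hi.reg g y0 x).reg_h.smooth_inv a b).mul (hθ.smooth y0 x b))).congr fun u hu => hvx x u hu a
  have hd : ∀ u ∈ (cY y0).target, onY i (fun y x => divergence (coordsAt g i y x).h (θ y x))
    ((cY y0).symm u) * areaDensity g i y0 u = ∑ a, pd a (v a) u := by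
    intro u hu; have hm := mem_dom (n := n) (i := i) hu
    rw [(hθ.div hi g).onY_eq hm, hi.areaDensity_eq g hm, mul_comm,
      (hi.reg g y0 _).reg_h.sqrt_det_mul_divergence hm (hθ.smooth y0 _)]
    exact sum_congr rfl fun a _ => pd_congr (hi.isOpen_dom _ _) hm fun z hz => (hvx _ z hz a).symm
  have hKc : IsCompact (cY y0 '' K) :=
    hK.isCompact.image_of_continuousOn ((continuousOn_extChartAt y0).mono hKs)
  have hKt : cY y0 '' K ⊆ (cY y0).target := by
    rintro _ ⟨y, hy, rfl⟩; exact (cY y0).map_source (hKs hy)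
  have hv0 a : ∀ u ∈ (cY y0).target, u ∉ cY y0 '' K → v a u = 0 := fun u hu hn => by
    have := h0 _ u (mem_dom hu) fun h => hn ⟨_, h, (cY y0).right_inv hu⟩
    simp only [hv, this, mul_zero, sum_const_zero]
  rw [setIntegral_congr_fun ho.measurableSet hd, integral_finset_sum _ fun a _ => ?_]
  · exact sum_eq_zero fun a _ => integral_pd_eq_zero ho (hvs a) hKc hKt (hv0 a) a
  · refine integrableOn_of_compact ho ((hvs a).pd ho a).continuousOn hKc hKt fun u hu hn => ?_
    rw [pd_congr (ho.inter hKc.isClosed.isOpen_compl) ⟨hu, hn⟩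
      fun z hz => hv0 a z hz.1 hz.2, pd_const]

variable {ρ : SmoothPartitionOfUnity Y (𝓡 k) Y Set.univ}

lemma finite_support (ρ : SmoothPartitionOfUnity Y (𝓡 k) Y Set.univ) :
    {y0 | (Function.support (ρ y0)).Nonempty}.Finite := ρ.locallyFinite.finite_nonempty_of_compact

lemma areaIntegral_eq_sum (g : RiemMetric n X) (F : Y → ℝ) : areaIntegral ρ g i F
    = ∑ y0 ∈ (finite_support ρ).toFinset, ∫ u in (cY y0).target,
    (ρ y0 * F) ((cY y0).symm u) * areaDensity g i y0 u := by
  refine finsum_eq_sum_of_support_subset _ fun y0 h => ?_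
  simp only [Set.Finite.coe_toFinset, Set.mem_setOf_eq, Function.support_nonempty_iff]; intro h0
  simp [h0] at h

lemma sum_eq_one (y : Y) : ∑ y0 ∈ (finite_support ρ).toFinset, ρ y0 y = 1 := by
  rw [← ρ.sum_eq_one (Set.mem_univ y)]
  refine (finsum_eq_sum_of_support_subset _ fun y0 h => ?_).symm
  simp only [Set.Finite.coe_toFinset, Set.mem_setOf_eq]; exact ⟨y, h⟩

lemma continuousOn_symm (y0 y1 : Y) :
    ContinuousOn (fun u => ρ y1 ((cY y0).symm u)) (cY y0).target :=
  (ρ y1).contMDiff.continuous.comp_continuousOn (continuousOn_extChartAt_symm y0)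

lemma tsupport_subset (hρ : ρ.IsSubordinate fun y => (chartAt (Coo k) y).source) (y0 : Y) :
    tsupport (ρ y0) ⊆ (cY y0).source := by simpa using hρ y0

lemma IsImm.integrable_scalar (hi : IsImm k n i) (g : RiemMetric n X)
    (hρ : ρ.IsSubordinate fun y => (chartAt (Coo k) y).source)
    {S : Y → X → Coo k → ℝ} (hS : IsScalar n i S) (y0 : Y) :
    IntegrableOn (fun u => (ρ y0 * onY i S) ((cY y0).symm u) * areaDensity g i y0 u)
      (cY y0).target :=
  hi.integrableOn_chart g ((continuousOn_symm y0 y0).mul (hi.sm_onY hS y0).continuousOn)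
    (isClosed_tsupport _) (tsupport_subset hρ y0) fun y hy => by
      rw [Pi.mul_apply, image_eq_zero_of_notMem_tsupport hy, zero_mul]

/-- The divergence theorem on a compact manifold. -/
lemma IsImm.areaIntegral_div (hi : IsImm k n i) (g : RiemMetric n X)
    (hρ : ρ.IsSubordinate fun y => (chartAt (Coo k) y).source)
    {θ : Y → X → Coo k → Fin k → ℝ} (hθ : IsForm n i θ) :
    areaIntegral ρ g i (onY i fun y x => divergence (coordsAt g i y x).h (θ y x)) = 0 := by
  set s := (finite_support ρ).toFinset with hs
  set f : Y → Y → ℝ := fun y1 => onY i fun y x => divergence (coordsAt g i y x).h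
    fun u a => ρ y1 ((cY y).symm u) * θ y x u a with hf
  have hθ' y1 : IsForm n i fun y x u a => ρ y1 ((cY y).symm u) * θ y x u a := hθ.smul (ρ y1).contMDiff
  have hm : ∀ y : Y, cY y y ∈ dom k n i y (i y) := mem_dom_self
  have hsum : (onY i fun y x => divergence (coordsAt g i y x).h (θ y x)) = ∑ y1 ∈ s, f y1 := by
    funext y; rw [Finset.sum_apply, hf]; simp only [onY]
    rw [← divergence_sum (hi.reg g y (i y)).reg_h (hm y) fun y1 => (hθ' y1).smooth y (i y)]
    refine divergence_congr (hi.reg g y (i y)).reg_h (hm y) fun z _ a => ?_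
    rw [← sum_mul, sum_eq_one, one_mul]
  have hf0 y1 : ∀ y ∉ tsupport (ρ y1), f y1 y = 0 := fun y hy =>
    hi.div_eq_zero g (isClosed_tsupport _) hy fun u _ hu a => by
      rw [image_eq_zero_of_notMem_tsupport hu, zero_mul]
  have hcont y0 y1 : ContinuousOn (fun u => (ρ y0 * f y1) ((cY y1).symm u)) (cY y1).target := (continuousOn_symm y1 y0).mul (hi.sm_onY ((hθ' y1).div hi g) y1).continuousOn
  rw [areaIntegral_eq_sum, hsum]
  calc _ = ∑ y0 ∈ s, ∑ y1 ∈ s, ∫ u in (cY y0).target,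
        (ρ y0 * f y1) ((cY y0).symm u) * areaDensity g i y0 u := by
        refine sum_congr rfl fun y0 _ => ?_
        rw [← integral_finset_sum _ fun y1 _ => hi.integrable_scalar g hρ ((hθ' y1).div hi g) y0]
        simp only [Pi.mul_apply, Finset.sum_apply, mul_sum, sum_mul]; rfl
    _ = ∑ y0 ∈ s, ∑ y1 ∈ s, ∫ u in (cY y1).target,
        (ρ y0 * f y1) ((cY y1).symm u) * areaDensity g i y1 u := by
        refine sum_congr rfl fun y0 _ => sum_congr rfl fun y1 _ =>
          hi.integral_chart g fun y hy => ?_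
        rw [Pi.mul_apply]
        by_cases h : y ∈ tsupport (ρ y0)
        · rw [hf0 y1 y fun h' => hy ⟨tsupport_subset hρ _ h, tsupport_subset hρ _ h'⟩, mul_zero]
        · rw [image_eq_zero_of_notMem_tsupport h, zero_mul]
    _ = ∑ y1 ∈ s, ∫ u in (cY y1).target, f y1 ((cY y1).symm u) * areaDensity g i y1 u := by
        rw [sum_comm]; refine sum_congr rfl fun y1 _ => ?_
        rw [← integral_finset_sum _ fun y0 _ => hi.integrableOn_chart g (hcont y0 y1)
          (isClosed_tsupport _) (tsupport_subset hρ y1) fun y hy => by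
            rw [Pi.mul_apply, hf0 y1 y hy, mul_zero]]
        simp only [Pi.mul_apply, ← sum_mul, sum_eq_one, one_mul, hs]
    _ = 0 := sum_eq_zero fun y1 _ => hi.integral_div_chart g (hθ' y1) (isClosed_tsupport _)
        (tsupport_subset hρ y1) fun x u _ hn a => by
          rw [image_eq_zero_of_notMem_tsupport hn, zero_mul]

end Forms

namespace CoordData
variable {k n m : ℕ} {U : Set (Coo k)} {u : Coo k}

lemma Reg.N1_eq {V : Set (Coo (k + m))} {D : CoordData k (k + m)} (hD : D.Reg U V) (hu : u ∈ U)
    (hk : k = 4) (hm : 1 ≤ m) : D.N1 u = -(1 / 2) * laplacian D.h D.normLo u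
    + 2 * divergence D.h D.formDL u + D.J1CHO u := by
  obtain ⟨D', φ, ψ, U', V', h, h0, rfl, hs⟩ := hD.exists_special hu
  rw [← h.N1_eq h0, ← h.lapNormLo_eq h0, ← h.divDL_eq h0, ← h.J1CHO_eq h0, hs.N1_eq h.reg' h0 hk hm]

lemma Reg.N2_eq {V : Set (Coo (k + m))} {D : CoordData k (k + m)} (hD : D.Reg U V) (hu : u ∈ U)
    (hk : k = 4) (hm : 1 ≤ m) : D.N2 u = (3 * ((k + m : ℕ) : ℝ) - 10) / 6 * laplacian D.h D.Wtr u
    - 4 * (((k + m : ℕ) : ℝ) - 5) / 3 * divergence D.h D.cC1 u + D.J2CHO u := by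
  obtain ⟨D', φ, ψ, U', V', h, h0, rfl, hs⟩ := hD.exists_special hu
  rw [← h.N2_eq h0, ← h.lapWtr_eq h0, ← h.divC_eq h0, ← h.J2CHO_eq h0, hs.N2_eq h.reg' h0 hk hm]

end CoordData

section Invariance

open MeasureTheory

variable {k n : ℕ} {X Y : Type*} [TopologicalSpace X] [ChartedSpace (Coo n) X]
  [IsManifold (𝓡 n) ∞ X] [TopologicalSpace Y] [ChartedSpace (Coo k) Y] [IsManifold (𝓡 k) ∞ Y]
  {g ghat : RiemMetric n X} {i : Y → X} {Υ : X → ℝ}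

local notation "cX" => extChartAt (𝓡 n)
local notation "cY" => extChartAt (𝓡 k)

lemma IsConformalRescaling.coordsAt_eq (hg : IsConformalRescaling g Υ ghat) (y0 : Y) (x0 : X) :
    coordsAt ghat i y0 x0 = (coordsAt (k := k) g i y0 x0).conf fun z => Υ ((cX x0).symm z) := by
  rw [coordsAt, CoordData.conf]; congr 1; funext z; ext a b; exact hg _ _ _

lemma IsConformalRescaling.onManifold_eq (hg : IsConformalRescaling g Υ ghat)
    (hΥ : ContMDiff (𝓡 n) 𝓘(ℝ) ∞ Υ) (hi : IsImm k n i) (hk : 2 ≤ k) (hn : 3 ≤ n)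
    {S : CoordData k n → Coo k → ℝ} (hS : ∀ {D v U V u}, D.ConfHyp v U V → u ∈ U →
      S (D.conf v) u = exp (-4 * v (D.f u)) * S D u) (y : Y) :
    onManifold S ghat i y = exp (-4 * Υ (i y)) * onManifold S g i y := by
  have h : coords ghat i y = (coords (k := k) g i y).conf fun z => Υ ((cX (i y)).symm z) :=
    hg.coordsAt_eq y (i y)
  rw [onManifold, onManifold, h, hS (D := coords g i y) ⟨hi.reg g y (i y), ?_, hk, hn⟩
    (mem_dom_self y)]
  · have : (coords (k := k) g i y).f (cY y y) = cX (i y) (i y) := by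
      simp [coords, writtenInExtChartAt]
    rw [this, extChartAt_to_inv]
  · exact (hΥ.comp_contMDiffOn (contMDiffOn_extChartAt_symm (i y))).contDiffOn

lemma IsConformalRescaling.areaDensity_eq (hg : IsConformalRescaling g Υ ghat) (hk : k = 4)
    (y0 : Y) (u) : areaDensity ghat i y0 u
    = exp (4 * Υ (i ((cY y0).symm u))) * areaDensity g i y0 u := by
  rw [areaDensity, areaDensity]; simp only [hg _ _ _]
  have e : ∀ (c : ℝ) (A : Fin k → Fin k → ℝ), (Matrix.of fun a b => c * A a b) = c • Matrix.of A :=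
    fun _ _ => rfl
  have hk' : (k : ℝ) = 4 := by exact_mod_cast hk
  rw [e, Matrix.det_smul, Fintype.card_fin, Real.sqrt_mul (by positivity), ← Real.exp_nat_mul,
    hk', ← Real.exp_half]
  ring_nf

lemma areaIntegral_conf (hg : IsConformalRescaling g Υ ghat) (hk : k = 4)
    {ρ : SmoothPartitionOfUnity Y (𝓡 k) Y Set.univ} {F F' : Y → ℝ}
    (hF : ∀ y, F' y = exp (-4 * Υ (i y)) * F y) :
    areaIntegral ρ ghat i F' = areaIntegral ρ g i F := by
  rw [areaIntegral, areaIntegral]; refine finsum_congr fun y0 => ?_; congr 1; funext u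
  rw [hF, hg.areaDensity_eq hk, neg_mul, Real.exp_neg]; field_simp

lemma IsImm.areaIntegral_add_div [T2Space Y] [CompactSpace Y] (hi : IsImm k n i)
    (g : RiemMetric n X) {ρ : SmoothPartitionOfUnity Y (𝓡 k) Y Set.univ}
    (hρ : ρ.IsSubordinate fun y => (chartAt (Coo k) y).source)
    {F J N : CoordData k n → Coo k → ℝ} {θ : CoordData k n → Coo k → Fin k → ℝ} {c c' : ℝ}
    (sF : ∀ {D U V}, D.Reg U V → Sm U (F D)) (sJ : ∀ {D U V}, D.Reg U V → Sm U (J D))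
    (sθ : ∀ {D U V}, D.Reg U V → ∀ a, Sm U fun z => θ D z a)
    (nF : ∀ {D' D φ ψ U' U V' V u}, CoordData.Change D' D φ ψ U' U V' V → u ∈ U' →
      F D' u = F D (φ u))
    (nJ : ∀ {D' D φ ψ U' U V' V u}, CoordData.Change D' D φ ψ U' U V' V → u ∈ U' →
      J D' u = J D (φ u))
    (nθ : ∀ {D' D φ ψ U' U V' V u}, CoordData.Change D' D φ ψ U' U V' V → u ∈ U' → ∀ a,
      θ D' u a = ap (jac φ u) a fun b => θ D (φ u) b)
    (hN : ∀ {D U V u}, D.Reg U V → u ∈ U →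
      N D u = c * laplacian D.h (F D) u + c' * divergence D.h (θ D) u + J D u) :
    areaIntegral ρ g i (onManifold J g i) = areaIntegral ρ g i (onManifold N g i) := by
  have hω : IsForm n i fun y x u a => c * pd a (F (coordsAt g i y x)) u
    + c' * θ (coordsAt g i y x) u a := by
    refine ⟨fun y x a => ((Sm.const c).mul ((sF (hi.reg g y x)).pd (hi.isOpen_dom y x) a)).add
      ((Sm.const c').mul (sθ (hi.reg g y x) a)), fun {y0 y1 x0 x1 u} hu a => ?_⟩
    have hc := hi.change g y0 y1 x0 x1
    rw [nθ hc hu, pd_congr hc.reg' hu fun z hz => nF hc hz, hc.pd_comp hu (sF hc.reg)]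
    simp only [ap, mul_sum, ← sum_add]; exact sum_congr rfl fun _ _ => by ring
  have hJ : IsScalar n i fun y x => J (coordsAt g i y x) :=
    ⟨fun y x => sJ (hi.reg g y x), fun hu => nJ (hi.change g _ _ _ _) hu⟩
  have hNJ : onManifold N g i = (onY i fun y x => divergence (coordsAt g i y x).h
    fun u a => c * pd a (F (coordsAt g i y x)) u + c' * θ (coordsAt g i y x) u a)
    + onManifold J g i := by
    funext y; have hr := hi.reg g y (i y)
    refine (hN hr (mem_dom_self y)).trans (congrArg (· + J (coordsAt g i y (i y)) (cY y y)) ?_)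
    exact (divergence_lin hr.reg_h (mem_dom_self y) (fun a => (sF hr).pd hr a) (sθ hr) c c').symm
  have h0 := hi.areaIntegral_div g hρ hω; rw [areaIntegral_eq_sum] at h0
  rw [areaIntegral_eq_sum, areaIntegral_eq_sum, hNJ, ← zero_add (Finset.sum _ _), ← h0,
    ← Finset.sum_add_distrib]
  refine sum_congr rfl fun y0 _ => ?_; have hJi := hi.integrable_scalar g hρ hJ y0
  change IntegrableOn (fun u => (ρ y0 * onManifold J g i) _ * _) _ _ at hJi
  rw [← integral_add (hi.integrable_scalar g hρ (hω.div hi g) y0) hJi]; congr 1; funext u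
  simp only [Pi.mul_apply, Pi.add_apply]; ring

end Invariance
end ConfSub
end

theorem mainTheorem12 {k n : ℕ} (hk : 2 ≤ k) (hkn : k < n)
    {X Y : Type*}
    [TopologicalSpace X] [ChartedSpace (ConfSub.Coo n) X] [IsManifold (𝓡 n) ∞ X]
    [TopologicalSpace Y] [ChartedSpace (ConfSub.Coo k) Y] [IsManifold (𝓡 k) ∞ Y]
    (g : ConfSub.RiemMetric n X) (i : Y → X) (hi : ContMDiff (𝓡 k) (𝓡 n) ∞ i)
    (himm : ∀ y : Y, Function.Injective (mfderiv (𝓡 k) (𝓡 n) i y)) :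
    -- conformal invariance of weight `-4` of `𝒩₁`, and of `𝒩₂` if `k ∉ {3, 6}`
    (∀ (Υ : X → ℝ) (ghat : ConfSub.RiemMetric n X), ContMDiff (𝓡 n) 𝓘(ℝ, ℝ) ∞ Υ →
      ConfSub.IsConformalRescaling g Υ ghat → ∀ y : Y, ConfSub.scalarN1 (k := k) ghat i y
            = Real.exp (-4 * Υ (i y)) * ConfSub.scalarN1 (k := k) g i y ∧
        (k ≠ 3 → k ≠ 6 → ConfSub.scalarN2 (k := k) ghat i y
            = Real.exp (-4 * Υ (i y)) * ConfSub.scalarN2 (k := k) g i y)) ∧ (k = 4 →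
      -- for `k = 4` they agree with `𝒥₁`, `𝒥₂` up to tangential divergences
      (∀ y : Y, ConfSub.scalarN1 (k := k) g i y
            = -(1 / 2) * ConfSub.lapNormLo (k := k) g i y + 2 * ConfSub.divDL (k := k) g i y
              + ConfSub.scalarJ1 (k := k) g i y ∧ ConfSub.scalarN2 (k := k) g i y
            = (3 * (n : ℝ) - 10) / 6 * ConfSub.lapWtr (k := k) g i y
              - 4 * ((n : ℝ) - 5) / 3 * ConfSub.divC (k := k) g i y
              + ConfSub.scalarJ2 (k := k) g i y) ∧
      -- hence `∫ 𝒥₁` and `∫ 𝒥₂` are conformally invariant if `Y` is compact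
      (T2Space Y → CompactSpace Y →
        ∀ (Υ : X → ℝ) (ghat : ConfSub.RiemMetric n X), ContMDiff (𝓡 n) 𝓘(ℝ, ℝ) ∞ Υ →
        ConfSub.IsConformalRescaling g Υ ghat → ∀ ρ : SmoothPartitionOfUnity Y (𝓡 k) Y Set.univ,
          ρ.IsSubordinate (fun y => (chartAt (ConfSub.Coo k) y).source) →
          ConfSub.areaIntegral ρ ghat i (ConfSub.scalarJ1 (k := k) ghat i)
              = ConfSub.areaIntegral ρ g i (ConfSub.scalarJ1 (k := k) g i) ∧
          ConfSub.areaIntegral ρ ghat i (ConfSub.scalarJ2 (k := k) ghat i)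
              = ConfSub.areaIntegral ρ g i (ConfSub.scalarJ2 (k := k) g i))) := by
  obtain ⟨m, rfl⟩ := Nat.exists_eq_add_of_lt hkn
  have hi' : ConfSub.IsImm k (k + (m + 1)) i := ⟨hi, himm⟩
  have h1 : ∀ (Υ : X → ℝ) (ghat : ConfSub.RiemMetric (k + (m + 1)) X),
      ContMDiff (𝓡 (k + (m + 1))) 𝓘(ℝ, ℝ) ∞ Υ → ConfSub.IsConformalRescaling g Υ ghat →
      ∀ y : Y, ConfSub.scalarN1 (k := k) ghat i y
            = Real.exp (-4 * Υ (i y)) * ConfSub.scalarN1 (k := k) g i y ∧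
        (k ≠ 3 → k ≠ 6 → ConfSub.scalarN2 (k := k) ghat i y
            = Real.exp (-4 * Υ (i y)) * ConfSub.scalarN2 (k := k) g i y) :=
    fun Υ ghat hΥ hg y => ⟨hg.onManifold_eq hΥ hi' hk (by omega) (fun h hu => h.N1_conf hu) y,
      fun _ _ => hg.onManifold_eq hΥ hi' hk (by omega) (fun h hu => h.N2_conf hu) y⟩
  refine ⟨h1, fun h4 => ⟨fun y => ⟨(hi'.reg g y (i y)).N1_eq (ConfSub.mem_dom_self y) h4 (by omega),
    (hi'.reg g y (i y)).N2_eq (ConfSub.mem_dom_self y) h4 (by omega)⟩, ?_⟩⟩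
  intro _ _ Υ ghat hΥ hg ρ hρ
  have e1 : ∀ g : ConfSub.RiemMetric (k + (m + 1)) X,
      ConfSub.areaIntegral ρ g i (ConfSub.scalarJ1 (k := k) g i)
        = ConfSub.areaIntegral ρ g i (ConfSub.scalarN1 (k := k) g i) := fun g =>
    hi'.areaIntegral_add_div g hρ (F := ConfSub.CoordData.normLo) (θ := ConfSub.CoordData.formDL)
      (fun h => h.sm_normLo) (fun h => h.sm_J1CHO) (fun h => h.sm_formDL) (fun h => h.normLo_eq)
      (fun h => h.J1CHO_eq) (fun h => h.formDL_eq) (fun h hu => h.N1_eq hu h4 (by omega))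
  have e2 : ∀ g : ConfSub.RiemMetric (k + (m + 1)) X,
      ConfSub.areaIntegral ρ g i (ConfSub.scalarJ2 (k := k) g i)
        = ConfSub.areaIntegral ρ g i (ConfSub.scalarN2 (k := k) g i) := fun g =>
    hi'.areaIntegral_add_div g hρ (F := ConfSub.CoordData.Wtr) (θ := ConfSub.CoordData.cC1)
      (fun h => h.sm_Wtr) (fun h => h.sm_J2CHO) (fun h => h.sm_cC1) (fun h => h.Wtr_eq)
      (fun h => h.J2CHO_eq) (fun h => h.cC1_eq)
      (fun h hu => (h.N2_eq hu h4 (by omega)).trans (by rw [sub_eq_add_neg, ← neg_mul]))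
  rw [e1, e1, e2, e2]
  exact ⟨ConfSub.areaIntegral_conf hg h4 fun y => (h1 Υ ghat hΥ hg y).1,
    ConfSub.areaIntegral_conf hg h4 fun y => (h1 Υ ghat hΥ hg y).2 (by omega) (by omega)⟩
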